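/- Let $n\ge 1$ and $\gamma\in(0,\infty)\setminus\mathbb N$. Write $[\gamma]=\gamma-\lfloor\gamma\rfloor$, $m=1-2[\gamma]$, $k=\lfloor\gamma\rfloor+1$; let $(x,y)$ be the coordinates of $\mathbb R^{n+1}_+=\mathbb R^n\times(0,\infty)$, $\overline\Delta=\sum_i\partial_{x_i}^2$, $T=\partial_y^2+my^{-1}\partial_y$, $\Delta_m=\overline\Delta+T$ and $L_{2k}=\Delta_m^k$. Let $C^\infty_{\rm even}$ be the space of functions smooth on $\overline{\mathbb R^{n+1}_+}$ whose Taylor series in $y$ at $y=0$ contain only even powers, and let $\mathcal C^{2\gamma}=C^\infty_{\rm even}+y^{2[\gamma]}C^\infty_{\rm even}$. With $\iota^*U=\lim_{y\to0^+}U(\cdot,y)$, define on $\mathcal C^{2\gamma}$, recursively for $0\le j\le\lfloor\gamma\rfloor$, $$B_{2j}=(-1)^j\iota^*T^j-\sum_{\ell=1}^j\binom j\ell\frac{\Gamma(1+j-[\gamma])\,\Gamma(1+2j-2\ell-\gamma)}{\Gamma(1+j-\ell-[\gamma])\,\Gamma(1+2j-\ell-\gamma)}\overline\Delta^\ell B_{2j-2\ell},$$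 $$B_{2[\gamma]+2j}=(-1)^{j+1}\iota^*y^m\partial_yT^j-\sum_{\ell=1}^j\binom j\ell\frac{\Gamma(1+j+[\gamma])\,\Gamma(1+2j-2\ell-\lfloor\gamma\rfloor+[\gamma])}{\Gamma(1+j-\ell+[\gamma])\,\Gamma(1+2j-\ell-\lfloor\gamma\rfloor+[\gamma])}\overline\Delta^\ell B_{2[\gamma]+2j-2\ell}.$$ Say that a function $U$ on $\mathbb R^{n+1}_+$ is of moderate growth if there are $C,N$ with $\|U(\cdot,y)\|_{L^2(\mathbb R^n)}\le C(1+y)^N$ for all $y>0$. For $\sigma>0$ and $f$ on $\mathbb R^n$, let $\mathcal P(\frac n2+\sigma)f$ denote the unique smooth function $P$ on $\mathbb R^{n+1}_+$ with $$y^2\partial_y^2P-(n-1)y\,\partial_yP+y^2\overline\Delta P+\Bigl(\tfrac{n^2}4-\sigma^2\Bigr)P=0,\qquad \lim_{y\to0^+}y^{-\frac{n-2\sigma}2}P(\cdot,y)=f,$$ such that $y^{-\frac{n-2\sigma}2}P$ is of moderate growth (the first equation is $\Delta_{g_+}P+(\frac{n^2}4-\sigma^2)P=0$ for the hyperbolic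 metric $g_+=y^{-2}(dx^2+dy^2)$). Theorem. Let $f^{(2j)}\in C^\infty(\mathbb R^n)\cap H^{\gamma-2j}(\mathbb R^n)$ for $0\le j\le\lfloor\gamma/2\rfloor$, and $\phi^{(2j)}\in C^\infty(\mathbb R^n)\cap H^{\lfloor\gamma\rfloor-[\gamma]-2j}(\mathbb R^n)$ for $0\le j\le\lfloor\gamma\rfloor-\lfloor\gamma/2\rfloor-1$, be real-valued. Then $\mathcal P(\frac n2+\gamma-2j)f^{(2j)}$ and $\mathcal P(\frac n2+\lfloor\gamma\rfloor-[\gamma]-2j)\phi^{(2j)}$ exist (and are unique) for these $j$, and there is exactly one $V\in\mathcal C^{2\gamma}$ of moderate growth with $$L_{2k}V=0\ \text{ in }\mathbb R^{n+1}_+,\qquad B_{2j}(V)=f^{(2j)}\ \Bigl(0\le j\le\lfloor\tfrac\gamma2\rfloor\Bigr),\qquad B_{2[\gamma]+2j}(V)=\phi^{(2j)}\ \Bigl(0\le j\le\lfloor\gamma\rfloor-\lfloor\tfrac\gamma2\rfloor-1\Bigr).$$ It is $$V=\sum_{j=0}^{\lfloor\gamma/2\rfloor}(-1)^j2^{-2j}\frac{\Gamma(1-[\gamma])}{j!\,\Gamma(1+j-[\gamma])}F^{(2j)}+\sum_{j=0}^{\lfloor\gamma\rfloor-\lfloor\gamma/2\rfloor-1}(-1)^{j+1}2^{-2j-1}\frac{\Gamma([\gamma])}{j!\,\Gamma(1+j+[\gamma])}\Phi^{(2j)},$$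 where $F^{(2j)}=y^{-\frac{n-2\gamma}2}\mathcal P(\frac n2+\gamma-2j)f^{(2j)}$ and $\Phi^{(2j)}=y^{-\frac{n-2\gamma}2}\mathcal P(\frac n2+\lfloor\gamma\rfloor-[\gamma]-2j)\phi^{(2j)}$. -/

import Mathlib

open Filter Topology MeasureTheory Set
open scoped ContDiff

noncomputable section

/-- The boundary `ℝⁿ` with its Euclidean norm. -/
abbrev Bdry (n : ℕ) : Type := EuclideanSpace ℝ (Fin n)

/-- Coordinates `(x, y)`. The upper half space is the set `0 < y`; every condition below on a
function `U : HalfCoord n → ℝ` only involves its values at points with `0 < y`. -/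
abbrev HalfCoord (n : ℕ) : Type := Bdry n × ℝ

/-- The partial derivative `∂_y`. -/
def partialY {n : ℕ} (U : HalfCoord n → ℝ) : HalfCoord n → ℝ :=
  fun p => deriv (fun y => U (p.1, y)) p.2

/-- The tangential Laplacian `∑ i, ∂²/∂x_i²`. -/
def tangentialLaplacian {n : ℕ} (U : HalfCoord n → ℝ) : HalfCoord n → ℝ :=
  fun p => Laplacian.laplacian (fun x : Bdry n => U (x, p.2)) p.1

/-- `T = ∂_y² + m y⁻¹ ∂_y`. -/
def normalOp {n : ℕ} (m : ℝ) (U : HalfCoord n → ℝ) : HalfCoord n → ℝ :=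
  fun p => partialY (partialY U) p + m * p.2⁻¹ * partialY U p

/-- The weighted Laplacian `Δ_m = Δ + m y⁻¹ ∂_y` of the upper half space, where `Δ` is the
Euclidean Laplacian in all of the variables `(x, y)`. -/
def weightedLaplacian {n : ℕ} (m : ℝ) (U : HalfCoord n → ℝ) : HalfCoord n → ℝ :=
  fun p => tangentialLaplacian U p + partialY (partialY U) p + m * p.2⁻¹ * partialY U p

/-- The weight `m = 1 - 2[γ]`, where `[γ]` is the fractional part of `γ`. -/
def weightExp (γ : ℝ) : ℝ := 1 - 2 * Int.fract γ

/-- The weighted poly-Laplacian `L_{2k} = Δ_m ^ k`, with `k = ⌊γ⌋ + 1` and `m = 1 - 2[γ]`. -/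
def polyLaplacian {n : ℕ} (γ : ℝ) (U : HalfCoord n → ℝ) : HalfCoord n → ℝ :=
  (weightedLaplacian (weightExp γ))^[⌊γ⌋₊ + 1] U

/-- The Laplace-Beltrami operator of the hyperbolic metric `y⁻² (dx² + dy²)`, in coordinates:
`y² ∂_y² - (n - 1) y ∂_y + y² ∑ i, ∂²/∂x_i²`. -/
def hyperbolicLaplacian {n : ℕ} (U : HalfCoord n → ℝ) : HalfCoord n → ℝ :=
  fun p => p.2 ^ 2 * partialY (partialY U) p - ((n : ℝ) - 1) * p.2 * partialY U p
    + p.2 ^ 2 * tangentialLaplacian U p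

/-- `C^∞_even` of the closed upper half space: functions smooth up to the boundary all of whose
odd Taylor coefficients in `y` at `y = 0` vanish. -/
def IsSmoothEven {n : ℕ} (F : HalfCoord n → ℝ) : Prop :=
  ContDiffOn ℝ ∞ F (univ ×ˢ Ici (0 : ℝ)) ∧
    ∀ (x : Bdry n) (i : ℕ), Odd i →
      iteratedDerivWithin i (fun y : ℝ => F (x, y)) (Ici 0) 0 = 0

/-- The space `C^{2γ} = C^∞_even + y^{2[γ]} C^∞_even`, as functions on the upper half space. -/
def MemC2γ {n : ℕ} (γ : ℝ) (U : HalfCoord n → ℝ) : Prop :=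
  ∃ F G : HalfCoord n → ℝ, IsSmoothEven F ∧ IsSmoothEven G ∧
    ∀ (x : Bdry n) (y : ℝ), 0 < y → U (x, y) = F (x, y) + y ^ (2 * Int.fract γ) * G (x, y)

/-- The Sobolev space `H^s(ℝⁿ)` for `s ≥ 0`, as a condition on real-valued functions. -/
def MemHs {n : ℕ} (s : ℝ) (f : Bdry n → ℝ) : Prop :=
  ∃ hf : MemLp (fun x => (f x : ℂ)) 2 (volume : Measure (Bdry n)),
    TemperedDistribution.MemSobolev s 2
      ((hf.toLp : Lp ℂ 2 (volume : Measure (Bdry n))) : TemperedDistribution (Bdry n) ℂ)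

/-- Moderate growth: every slice `U(·, y)`, `y > 0`, is in `L²(ℝⁿ)`, with a norm that is bounded
by a polynomial in `y`. -/
def ModerateGrowth {n : ℕ} (U : HalfCoord n → ℝ) : Prop :=
  ∃ (C : ℝ) (N : ℕ), ∀ y : ℝ, 0 < y →
    MemLp (fun x : Bdry n => U (x, y)) 2 volume ∧
      eLpNorm (fun x : Bdry n => U (x, y)) 2 volume ≤ ENNReal.ofReal (C * (1 + y) ^ N)

/-- The boundary operators `B_{2j}^{2γ}`. The restriction `ι^*` to the boundary is the limit
`y → 0⁺`, which exists for the functions in `C^{2γ}`. The summation index `ℓ` of the recursive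
definition, `1 ≤ ℓ ≤ j`, is `i + 1` for `i : Fin j`. -/
def evenBdryOp {n : ℕ} (γ : ℝ) (U : HalfCoord n → ℝ) (j : ℕ) : Bdry n → ℝ :=
  fun x =>
    (-1) ^ j * limUnder (𝓝[>] (0 : ℝ)) (fun y => (normalOp (weightExp γ))^[j] U (x, y))
    - ∑ i : Fin j,
        (j.choose (i.1 + 1) : ℝ)
          * ((Real.Gamma (1 + j - Int.fract γ)
                * Real.Gamma (1 + 2 * (j : ℝ) - 2 * ((i.1 : ℝ) + 1) - γ))
            / (Real.Gamma (1 + j - ((i.1 : ℝ) + 1) - Int.fract γ)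
                * Real.Gamma (1 + 2 * (j : ℝ) - ((i.1 : ℝ) + 1) - γ)))
          * (Laplacian.laplacian)^[i.1 + 1] (evenBdryOp γ U (j - (i.1 + 1))) x
termination_by j
decreasing_by omega

/-- The boundary operators `B_{2[γ]+2j}^{2γ}`, with the same conventions. -/
def oddBdryOp {n : ℕ} (γ : ℝ) (U : HalfCoord n → ℝ) (j : ℕ) : Bdry n → ℝ :=
  fun x =>
    (-1) ^ (j + 1) * limUnder (𝓝[>] (0 : ℝ))
        (fun y => y ^ weightExp γ * partialY ((normalOp (weightExp γ))^[j] U) (x, y))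
    - ∑ i : Fin j,
        (j.choose (i.1 + 1) : ℝ)
          * ((Real.Gamma (1 + j + Int.fract γ)
                * Real.Gamma (1 + 2 * (j : ℝ) - 2 * ((i.1 : ℝ) + 1) - ⌊γ⌋₊ + Int.fract γ))
            / (Real.Gamma (1 + j - ((i.1 : ℝ) + 1) + Int.fract γ)
                * Real.Gamma (1 + 2 * (j : ℝ) - ((i.1 : ℝ) + 1) - ⌊γ⌋₊ + Int.fract γ)))
          * (Laplacian.laplacian)^[i.1 + 1] (oddBdryOp γ U (j - (i.1 + 1))) x
termination_by j
decreasing_by omega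

/-- `P` solves the Poisson problem of the hyperbolic space with spectral parameter `n/2 + σ` and
data `f`: it is smooth, `Δ_{g₊} P + (n²/4 - σ²) P = 0`, and `y^{-(n-2σ)/2} P(·, y) → f` as
`y → 0⁺`; moreover `y^{-(n-2σ)/2} P` is of moderate growth. -/
structure IsPoissonSolution {n : ℕ} (σ : ℝ) (f : Bdry n → ℝ) (P : HalfCoord n → ℝ) : Prop where
  smooth : ContDiffOn ℝ ∞ P (univ ×ˢ Ioi (0 : ℝ))
  eqn : ∀ (x : Bdry n) (y : ℝ), 0 < y →
    hyperbolicLaplacian P (x, y) + ((n : ℝ) ^ 2 / 4 - σ ^ 2) * P (x, y) = 0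
  boundary : ∀ x : Bdry n,
    Tendsto (fun y : ℝ => y ^ (-(((n : ℝ) - 2 * σ) / 2)) * P (x, y)) (𝓝[>] 0) (𝓝 (f x))
  growth : ModerateGrowth (fun p : HalfCoord n => p.2 ^ (-(((n : ℝ) - 2 * σ) / 2)) * P p)

/-- `P` is the hyperbolic Poisson extension of `f` with parameter `n/2 + σ`: the unique solution
of the Poisson problem. -/
def IsPoissonExtension {n : ℕ} (σ : ℝ) (f : Bdry n → ℝ) (P : HalfCoord n → ℝ) : Prop :=
  IsPoissonSolution σ f P ∧
    ∀ P' : HalfCoord n → ℝ, IsPoissonSolution σ f P' →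
      ∀ (x : Bdry n) (y : ℝ), 0 < y → P' (x, y) = P (x, y)

/-- `V` is a solution, in `C^{2γ}` and of moderate growth, of the Dirichlet problem
`L_{2k} V = 0`, `B_{2j}^{2γ} V = f j` for `0 ≤ j ≤ ⌊γ/2⌋`, and `B_{2[γ]+2j}^{2γ} V = φ j` for
`0 ≤ j ≤ ⌊γ⌋ - ⌊γ/2⌋ - 1`. -/
structure IsDirichletSolution {n : ℕ} (γ : ℝ) (f φ : ℕ → Bdry n → ℝ)
    (V : HalfCoord n → ℝ) : Prop where
  mem : MemC2γ γ V
  growth : ModerateGrowth V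
  eqn : ∀ (x : Bdry n) (y : ℝ), 0 < y → polyLaplacian γ V (x, y) = 0
  even_data : ∀ j : ℕ, j ≤ ⌊γ / 2⌋₊ → evenBdryOp γ V j = f j
  odd_data : ∀ j : ℕ, j < ⌊γ⌋₊ - ⌊γ / 2⌋₊ → oddBdryOp γ V j = φ j

end

noncomputable section

open Function (iterate_succ_apply')
open Laplacian (laplacian)
open scoped FourierTransform SchwartzMap

section

/-- The open upper half space. -/
def upperHalf (n : ℕ) : Set (HalfCoord n) := univ ×ˢ Ioi (0 : ℝ)

/-- Functions that are smooth on the open upper half space. -/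
def SmoothHalf {n : ℕ} (U : HalfCoord n → ℝ) : Prop := ContDiffOn ℝ ∞ U (upperHalf n)

variable {n : ℕ}

theorem isOpen_upperHalf : IsOpen (upperHalf n) := isOpen_univ.prod isOpen_Ioi

theorem mem_upperHalf {p : HalfCoord n} : p ∈ upperHalf n ↔ 0 < p.2 := by
  simp [upperHalf]

namespace SmoothHalf

variable {U V : HalfCoord n → ℝ}

theorem contDiffAt (hU : SmoothHalf U) {p : HalfCoord n} (hp : p ∈ upperHalf n) :
    ContDiffAt ℝ ∞ U p := ContDiffOn.contDiffAt hU (isOpen_upperHalf.mem_nhds hp)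

theorem differentiableAt (hU : SmoothHalf U) {p : HalfCoord n} (hp : p ∈ upperHalf n) :
    DifferentiableAt ℝ U p := (hU.contDiffAt hp).differentiableAt (by simp)

theorem add (hU : SmoothHalf U) (hV : SmoothHalf V) : SmoothHalf (U + V) :=
  ContDiffOn.add hU hV

theorem mul_right (hU : SmoothHalf U) {h : ℝ → ℝ} (hh : ContDiffOn ℝ ∞ h (Ioi 0)) :
    SmoothHalf (fun p => h p.2 * U p) :=
  ContDiffOn.mul (hh.comp contDiff_snd.contDiffOn (fun _ hp => hp.2)) hU

theorem const_mul (hU : SmoothHalf U) (c : ℝ) : SmoothHalf (fun p => c * U p) :=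
  contDiffOn_const.mul hU

theorem congr (hU : SmoothHalf U) (h : EqOn V U (upperHalf n)) : SmoothHalf V :=
  ContDiffOn.congr hU h

theorem fderiv_apply (hU : SmoothHalf U) (v : HalfCoord n) :
    SmoothHalf (fun p => fderiv ℝ U p v) :=
  ContDiffOn.clm_apply (hU.fderiv_of_isOpen isOpen_upperHalf (by simp)) contDiffOn_const

theorem fderiv_comm (hU : SmoothHalf U) {p : HalfCoord n} (hp : p ∈ upperHalf n)
    (v w : HalfCoord n) :
    fderiv ℝ (fun q => fderiv ℝ U q v) p w = fderiv ℝ (fun q => fderiv ℝ U q w) p v := by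
  have hd : DifferentiableAt ℝ (fderiv ℝ U) p :=
    ((hU.fderiv_of_isOpen isOpen_upperHalf (m := ∞) (by simp)).contDiffAt
      (isOpen_upperHalf.mem_nhds hp)).differentiableAt (by simp)
  rw [fderiv_clm_apply hd (differentiableAt_const _), fderiv_clm_apply hd (differentiableAt_const _)]
  simpa using (((hU.contDiffAt hp).isSymmSndFDerivAt (by simp; norm_cast)).eq w v)

theorem hasDerivAt (hU : SmoothHalf U) {p : HalfCoord n} (hp : p ∈ upperHalf n) :
    HasDerivAt (fun y => U (p.1, y)) (fderiv ℝ U p (0, 1)) p.2 := by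
  have h1 : HasFDerivAt U (fderiv ℝ U p) (p.1, p.2) := (hU.differentiableAt hp).hasFDerivAt
  have h2 : HasDerivAt (fun y : ℝ => (p.1, y)) ((0 : Bdry n), (1 : ℝ)) p.2 :=
    (hasDerivAt_const _ _).prodMk (hasDerivAt_id _)
  exact h1.comp_hasDerivAt p.2 h2

theorem partialY_eq (hU : SmoothHalf U) {p : HalfCoord n} (hp : p ∈ upperHalf n) :
    _root_.partialY U p = fderiv ℝ U p (0, 1) := (hU.hasDerivAt hp).deriv

theorem hasDerivAt_partialY (hU : SmoothHalf U) {p : HalfCoord n} (hp : p ∈ upperHalf n) :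
    HasDerivAt (fun y => U (p.1, y)) (_root_.partialY U p) p.2 := by
  rw [hU.partialY_eq hp]; exact hU.hasDerivAt hp

theorem partialY (hU : SmoothHalf U) : SmoothHalf (partialY U) :=
  (hU.fderiv_apply (0, 1)).congr fun _ hp => hU.partialY_eq hp

theorem slice_hasFDerivAt (hU : SmoothHalf U) {x : Bdry n} {y : ℝ} (hy : 0 < y) :
    HasFDerivAt (fun x => U (x, y))
      ((fderiv ℝ U (x, y)).comp (ContinuousLinearMap.inl ℝ (Bdry n) ℝ)) x := by
  have h1 : HasFDerivAt U (fderiv ℝ U (x, y)) (x, y) :=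
    (hU.differentiableAt (mem_upperHalf.2 hy)).hasFDerivAt
  exact h1.comp x (hasFDerivAt_prodMk_left x y)

theorem slice_contDiff (hU : SmoothHalf U) {y : ℝ} (hy : 0 < y) :
    ContDiff ℝ ∞ (fun x => U (x, y)) := by
  rw [← contDiffOn_univ]
  exact ContDiffOn.comp hU (contDiff_prodMk_left y).contDiffOn (fun x _ => mem_upperHalf.2 hy)

theorem tangentialLaplacian_eq (hU : SmoothHalf U) {p : HalfCoord n} (hp : p ∈ upperHalf n) :
    _root_.tangentialLaplacian U p = ∑ i : Fin n,
      fderiv ℝ (fun q => fderiv ℝ U q (EuclideanSpace.basisFun (Fin n) ℝ i, 0)) p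
        (EuclideanSpace.basisFun (Fin n) ℝ i, 0) := by
  have hy : 0 < p.2 := mem_upperHalf.1 hp
  unfold _root_.tangentialLaplacian
  rw [InnerProductSpace.laplacian_eq_iteratedFDeriv_orthonormalBasis _
    (EuclideanSpace.basisFun (Fin n) ℝ)]
  refine Finset.sum_congr rfl fun i _ => ?_
  set e := EuclideanSpace.basisFun (Fin n) ℝ i
  rw [iteratedFDeriv_two_apply]
  have hd : DifferentiableAt ℝ (fderiv ℝ (fun x => U (x, p.2))) p.1 :=
    (((hU.slice_contDiff hy).fderiv_right (m := 1) (by norm_cast)).differentiable (by simp)) _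
  have h1 := fderiv_clm_apply hd (differentiableAt_const e)
  have h2 : (fun x => fderiv ℝ (fun x => U (x, p.2)) x e)
      = fun x => fderiv ℝ U (x, p.2) (e, 0) := by
    funext x
    rw [(hU.slice_hasFDerivAt hy).fderiv]; simp
  rw [h2] at h1
  have h3 := congrArg (fun L => L e) h1
  simp only [fderiv_fun_const, Pi.zero_apply, ContinuousLinearMap.comp_zero, zero_add,
    ContinuousLinearMap.flip_apply] at h3
  change (fderiv ℝ (fderiv ℝ (fun x => U (x, p.2))) p.1) e e = _
  rw [← h3]
  rw [((hU.fderiv_apply (e, 0)).slice_hasFDerivAt (x := p.1) hy).fderiv]; simp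

theorem tangentialLaplacian (hU : SmoothHalf U) : SmoothHalf (tangentialLaplacian U) := by
  refine SmoothHalf.congr ?_ fun p hp => hU.tangentialLaplacian_eq hp
  exact ContDiffOn.sum fun i _ => (hU.fderiv_apply _).fderiv_apply _

end SmoothHalf

theorem partialY_congr {U V : HalfCoord n → ℝ} (h : EqOn U V (upperHalf n)) :
    EqOn (partialY U) (partialY V) (upperHalf n) := by
  intro p hp
  refine EventuallyEq.deriv_eq ?_
  filter_upwards [lt_mem_nhds (mem_upperHalf.1 hp)] with y hy
  exact h (mem_upperHalf.2 hy)

theorem partialY_eqOn {U U' : HalfCoord n → ℝ}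
    (h : ∀ p ∈ upperHalf n, HasDerivAt (fun y => U (p.1, y)) (U' p) p.2) :
    EqOn (partialY U) U' (upperHalf n) := fun p hp => (h p hp).deriv

/-- Operators in the tangential variables: they are local, additive on smooth functions, and
commute with `∂_y` and with multiplication by functions of `y`. -/
structure TangentialOp (Z : (HalfCoord n → ℝ) → HalfCoord n → ℝ) : Prop where
  smooth : ∀ {U}, SmoothHalf U → SmoothHalf (Z U)
  congr : ∀ {U V}, EqOn U V (upperHalf n) → EqOn (Z U) (Z V) (upperHalf n)
  add : ∀ {U V}, SmoothHalf U → SmoothHalf V → EqOn (Z (U + V)) (Z U + Z V) (upperHalf n)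
  mul : ∀ {U} (h : ℝ → ℝ), SmoothHalf U →
    EqOn (Z fun p => h p.2 * U p) (fun p => h p.2 * Z U p) (upperHalf n)
  comm : ∀ {U}, SmoothHalf U → EqOn (Z (partialY U)) (partialY (Z U)) (upperHalf n)

theorem tangentialOp_lap :
    TangentialOp (tangentialLaplacian : (HalfCoord n → ℝ) → HalfCoord n → ℝ) where
  smooth hU := hU.tangentialLaplacian
  congr {U V} h p hp := by
    have : (fun x => U (x, p.2)) = fun x => V (x, p.2) :=
      funext fun x => h (mem_upperHalf.2 (mem_upperHalf.1 hp))
    simp only [tangentialLaplacian, this]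
  add {U V} hU hV p hp := by
    have hy := mem_upperHalf.1 hp
    exact ((hU.slice_contDiff hy).contDiffAt.of_le (by norm_cast)).laplacian_add
      ((hV.slice_contDiff hy).contDiffAt.of_le (by norm_cast))
  mul {U} h hU p hp := by
    have hy := mem_upperHalf.1 hp
    exact InnerProductSpace.laplacian_smul (h p.2)
      ((hU.slice_contDiff hy).contDiffAt.of_le (by norm_cast))
  comm {U} hU p hp := by
    rw [hU.partialY.tangentialLaplacian_eq hp, hU.tangentialLaplacian.partialY_eq hp]
    have h1 : fderiv ℝ (tangentialLaplacian U) p = fderiv ℝ (fun p => ∑ i : Fin n,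
      fderiv ℝ (fun q => fderiv ℝ U q (EuclideanSpace.basisFun (Fin n) ℝ i, 0)) p
        (EuclideanSpace.basisFun (Fin n) ℝ i, 0)) p := by
      refine EventuallyEq.fderiv_eq ?_
      filter_upwards [isOpen_upperHalf.mem_nhds hp] with q hq
      exact hU.tangentialLaplacian_eq hq
    rw [h1, fderiv_fun_sum fun i _ =>
      (((hU.fderiv_apply _).fderiv_apply _).differentiableAt hp), sum_apply]
    refine Finset.sum_congr rfl fun i _ => ?_
    set e := EuclideanSpace.basisFun (Fin n) ℝ i
    rw [(hU.fderiv_apply (e, 0)).fderiv_comm hp (e, 0) (0, 1)]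
    have h2 : ∀ q ∈ upperHalf n, fderiv ℝ (partialY U) q (e, 0)
        = fderiv ℝ (fun q => fderiv ℝ U q (e, 0)) q (0, 1) := fun q hq => by
      rw [hU.fderiv_comm hq (e, 0) (0, 1)]
      congr 1
      refine EventuallyEq.fderiv_eq ?_
      filter_upwards [isOpen_upperHalf.mem_nhds hq] with r hr
      exact hU.partialY_eq hr
    congr 1
    refine EventuallyEq.fderiv_eq ?_
    filter_upwards [isOpen_upperHalf.mem_nhds hp] with q hq
    exact h2 q hq

theorem tangentialOp_smul (c : ℝ) :
    TangentialOp (fun (U : HalfCoord n → ℝ) p => c * U p) where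
  smooth hU := hU.const_mul c
  congr h p hp := by simp only [h hp]
  add _ _ p _ := by simp [mul_add]
  mul h _ p _ := by ring
  comm hU p hp := ((hU.hasDerivAt_partialY hp).const_mul c).deriv.symm

/-- `Z + ∂_y² + a y⁻¹ ∂_y`. -/
def genLaplacian (Z : (HalfCoord n → ℝ) → HalfCoord n → ℝ) (a : ℝ) (U : HalfCoord n → ℝ) :
    HalfCoord n → ℝ :=
  fun p => Z U p + partialY (partialY U) p + a * p.2⁻¹ * partialY U p

theorem weightedLaplacian_eq_gen (a : ℝ) :
    (weightedLaplacian a : (HalfCoord n → ℝ) → HalfCoord n → ℝ)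
      = genLaplacian tangentialLaplacian a := rfl

namespace TangentialOp

variable {Z : (HalfCoord n → ℝ) → HalfCoord n → ℝ} {U V W : HalfCoord n → ℝ}

theorem gen_smooth (hZ : TangentialOp Z) (a : ℝ) (hU : SmoothHalf U) :
    SmoothHalf (genLaplacian Z a U) := by
  refine SmoothHalf.add (SmoothHalf.add (hZ.smooth hU) hU.partialY.partialY) ?_
  exact hU.partialY.mul_right (contDiffOn_const.mul (contDiffOn_id.inv fun y hy => hy.ne'))

theorem gen_congr (hZ : TangentialOp Z) (a : ℝ) (h : EqOn U V (upperHalf n)) :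
    EqOn (genLaplacian Z a U) (genLaplacian Z a V) (upperHalf n) := fun p hp => by
  simp only [genLaplacian, hZ.congr h hp, partialY_congr h hp,
    partialY_congr (partialY_congr h) hp]

theorem gen_add (hZ : TangentialOp Z) (a : ℝ) (hU : SmoothHalf U) (hV : SmoothHalf V) :
    EqOn (genLaplacian Z a (U + V)) (genLaplacian Z a U + genLaplacian Z a V)
      (upperHalf n) := fun p hp => by
  have h1 : EqOn (partialY (U + V)) (partialY U + partialY V) (upperHalf n) :=
    partialY_eqOn fun p hp => (hU.hasDerivAt_partialY hp).add (hV.hasDerivAt_partialY hp)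
  have h2 : EqOn (partialY (partialY U + partialY V))
      (partialY (partialY U) + partialY (partialY V)) (upperHalf n) :=
    partialY_eqOn fun p hp =>
      (hU.partialY.hasDerivAt_partialY hp).add (hV.partialY.hasDerivAt_partialY hp)
  simp only [genLaplacian, hZ.add hU hV hp, h1 hp, partialY_congr h1 hp, h2 hp, Pi.add_apply]
  ring

theorem gen_const_mul (hZ : TangentialOp Z) (a c : ℝ) (hU : SmoothHalf U) :
    EqOn (genLaplacian Z a (fun p => c * U p)) (fun p => c * genLaplacian Z a U p)
      (upperHalf n) := fun p hp => by
  have h1 : EqOn (partialY (fun p => c * U p)) (fun p => c * partialY U p) (upperHalf n) :=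
    partialY_eqOn fun p hp => (hU.hasDerivAt_partialY hp).const_mul c
  have h2 : EqOn (partialY (fun p => c * partialY U p))
      (fun p => c * partialY (partialY U) p) (upperHalf n) :=
    partialY_eqOn fun p hp => (hU.partialY.hasDerivAt_partialY hp).const_mul c
  simp only [genLaplacian, hZ.mul (fun _ => c) hU hp, h1 hp, partialY_congr h1 hp, h2 hp]
  ring

theorem iter_smooth (hZ : TangentialOp Z) (a : ℝ) (k : ℕ) (hU : SmoothHalf U) :
    SmoothHalf ((genLaplacian Z a)^[k] U) := by
  induction k with
  | zero => exact hU
  | succ k ih => rw [iterate_succ_apply']; exact hZ.gen_smooth a ih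

theorem iter_congr (hZ : TangentialOp Z) (a : ℝ) (k : ℕ) (h : EqOn U V (upperHalf n)) :
    EqOn ((genLaplacian Z a)^[k] U) ((genLaplacian Z a)^[k] V) (upperHalf n) := by
  induction k with
  | zero => exact h
  | succ k ih => simp only [iterate_succ_apply']; exact hZ.gen_congr a ih

theorem iter_add (hZ : TangentialOp Z) (a : ℝ) (k : ℕ) (hU : SmoothHalf U) (hV : SmoothHalf V) :
    EqOn ((genLaplacian Z a)^[k] (U + V))
      ((genLaplacian Z a)^[k] U + (genLaplacian Z a)^[k] V) (upperHalf n) := by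
  induction k with
  | zero => exact fun _ _ => rfl
  | succ k ih =>
    simp only [iterate_succ_apply']
    exact (hZ.gen_congr a ih).trans (hZ.gen_add a (hZ.iter_smooth a k hU) (hZ.iter_smooth a k hV))

theorem iter_const_mul (hZ : TangentialOp Z) (a c : ℝ) (k : ℕ) (hU : SmoothHalf U) :
    EqOn ((genLaplacian Z a)^[k] (fun p => c * U p))
      (fun p => c * (genLaplacian Z a)^[k] U p) (upperHalf n) := by
  induction k with
  | zero => exact fun _ _ => rfl
  | succ k ih =>
    simp only [iterate_succ_apply']
    exact (hZ.gen_congr a ih).trans (hZ.gen_const_mul a c (hZ.iter_smooth a k hU))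

theorem iter_sum (hZ : TangentialOp Z) (a : ℝ) (k : ℕ) {ι : Type*} (s : Finset ι)
    (c : ι → ℝ) {f : ι → HalfCoord n → ℝ} (hf : ∀ i ∈ s, SmoothHalf (f i)) :
    SmoothHalf (fun p => ∑ i ∈ s, c i * f i p) ∧
    EqOn ((genLaplacian Z a)^[k] (fun p => ∑ i ∈ s, c i * f i p))
      (fun p => ∑ i ∈ s, c i * (genLaplacian Z a)^[k] (f i) p) (upperHalf n) := by
  classical
  have h0 : SmoothHalf (fun _ : HalfCoord n => (0 : ℝ)) := contDiffOn_const
  induction s using Finset.induction_on with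
  | empty =>
    refine ⟨by simpa using h0, ?_⟩
    have := hZ.iter_const_mul a 0 k h0
    simpa using this
  | insert i s hi ih =>
    obtain ⟨h1, h2⟩ := ih fun j hj => hf j (Finset.mem_insert_of_mem hj)
    have h3 := (hf i (Finset.mem_insert_self i s))
    simp only [Finset.sum_insert hi]
    refine ⟨(h3.const_mul (c i)).add h1, ?_⟩
    refine (hZ.iter_add a k (h3.const_mul (c i)) h1).trans fun p hp => ?_
    simp only [Pi.add_apply, h2 hp, hZ.iter_const_mul a (c i) k h3 hp]

end TangentialOp
end

section

variable {n : ℕ} {Z : (HalfCoord n → ℝ) → HalfCoord n → ℝ} {U V W : HalfCoord n → ℝ}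

theorem partialY_mul_eqOn (hU : SmoothHalf U) {h h' : ℝ → ℝ}
    (hh : ∀ y, 0 < y → HasDerivAt h (h' y) y) :
    EqOn (partialY fun p => h p.2 * U p) (fun p => h' p.2 * U p + h p.2 * partialY U p)
      (upperHalf n) :=
  partialY_eqOn fun p hp =>
    (hh p.2 (mem_upperHalf.1 hp)).mul (hU.hasDerivAt_partialY hp)

theorem contDiffOn_inv_Ioi : ContDiffOn ℝ ∞ (fun y : ℝ => y⁻¹) (Ioi 0) :=
  contDiffOn_id.inv fun _ hy => (mem_Ioi.1 hy).ne'

theorem contDiffOn_rpow_Ioi (s : ℝ) : ContDiffOn ℝ ∞ (fun y : ℝ => y ^ s) (Ioi 0) :=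
  contDiffOn_id.rpow_const_of_ne fun _ hy => (mem_Ioi.1 hy).ne'

/-- The expansion of `Z + ∂_y² + a y⁻¹ ∂_y` on a product `h(y) U`. -/
theorem TangentialOp.gen_mul (hZ : TangentialOp Z) (a : ℝ) (hU : SmoothHalf U) {h h' h'' : ℝ → ℝ}
    (hh : ∀ y, 0 < y → HasDerivAt h (h' y) y) (hh' : ∀ y, 0 < y → HasDerivAt h' (h'' y) y) :
    EqOn (genLaplacian Z a fun p => h p.2 * U p)
      (fun p => h p.2 * Z U p + (h'' p.2 * U p + 2 * h' p.2 * partialY U p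
        + h p.2 * partialY (partialY U) p)
        + a * p.2⁻¹ * (h' p.2 * U p + h p.2 * partialY U p)) (upperHalf n) := fun p hp => by
  have h1 := partialY_mul_eqOn hU hh
  have h2 : EqOn (partialY fun p => h' p.2 * U p + h p.2 * partialY U p)
      (fun p => h'' p.2 * U p + 2 * h' p.2 * partialY U p
        + h p.2 * partialY (partialY U) p) (upperHalf n) := partialY_eqOn fun p hp => by
    have hy := mem_upperHalf.1 hp
    have := ((hh' p.2 hy).mul (hU.hasDerivAt_partialY hp)).add
      ((hh p.2 hy).mul (hU.partialY.hasDerivAt_partialY hp))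
    exact this.congr_deriv (by ring)
  simp only [genLaplacian, hZ.mul h hU hp, h1 hp, partialY_congr h1 hp, h2 hp]

namespace TangentialOp

theorem eq_of_ker {a : ℝ}
    (hk : ∀ p ∈ upperHalf n, genLaplacian Z a W p = 0) :
    EqOn (Z W) (fun p => -(partialY (partialY W) p + a * (p.2⁻¹ * partialY W p)))
      (upperHalf n) := fun p hp => by
  have := hk p hp
  simp only [genLaplacian] at this ⊢
  linarith

theorem partialY_eq_of_ker (hZ : TangentialOp Z) {a : ℝ} (hW : SmoothHalf W)
    (hk : ∀ p ∈ upperHalf n, genLaplacian Z a W p = 0) :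
    EqOn (Z (partialY W)) (fun p => -(partialY (partialY (partialY W)) p
      + a * (-(p.2 ^ 2)⁻¹ * partialY W p + p.2⁻¹ * partialY (partialY W) p)))
      (upperHalf n) := by
  refine (hZ.comm hW).trans ((partialY_congr (eq_of_ker hk)).trans
    (partialY_eqOn fun p hp => ?_))
  have h0 := mem_upperHalf.1 hp
  exact ((hW.partialY.partialY.hasDerivAt_partialY hp).add
    (((hasDerivAt_inv h0.ne').mul (hW.partialY.hasDerivAt_partialY hp)).const_mul a)).neg

theorem lower (hZ : TangentialOp Z) {a : ℝ} (hW : SmoothHalf W)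
    (hk : ∀ p ∈ upperHalf n, genLaplacian Z a W p = 0) :
    ∀ p ∈ upperHalf n, genLaplacian Z (a + 2) (fun p => p.2⁻¹ * partialY W p) p = 0 := by
  intro p hp
  have h0 := mem_upperHalf.1 hp
  have hd : ∀ y : ℝ, 0 < y → HasDerivAt (fun y : ℝ => -(y ^ 2)⁻¹) (2 * (y ^ 3)⁻¹) y := by
    intro y hy
    have := ((hasDerivAt_pow 2 y).inv (by positivity)).neg
    exact this.congr_deriv (by simp; field_simp)
  rw [hZ.gen_mul (a + 2) hW.partialY (fun y hy => hasDerivAt_inv hy.ne') hd hp]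
  simp only [hZ.partialY_eq_of_ker hW hk hp]
  field_simp
  ring

theorem raise (hZ : TangentialOp Z) {a : ℝ} (hW : SmoothHalf W)
    (hk : ∀ p ∈ upperHalf n, genLaplacian Z a W p = 0) :
    ∀ p ∈ upperHalf n,
      genLaplacian Z (a - 2) (fun p => p.2 * partialY W p + (a - 1) * W p) p = 0 := by
  intro p hp
  have h0 := mem_upperHalf.1 hp
  have h1 := hZ.gen_add (a - 2) (hW.partialY.mul_right (h := fun y => y) contDiffOn_id)
    (hW.const_mul (a - 1)) hp
  have h2 := hZ.gen_mul (a - 2) hW.partialY (fun y _ => hasDerivAt_id' y)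
    (fun y _ => hasDerivAt_const y 1) hp
  have h3 := hZ.gen_const_mul (a - 2) (a - 1) hW hp
  simp only [Pi.add_apply] at h1
  rw [h2, h3] at h1
  refine Eq.trans h1 ?_
  simp only [hZ.partialY_eq_of_ker hW hk hp, genLaplacian, eq_of_ker hk hp]
  field_simp
  ring

/-- If `W` solves `(Z + ∂_y² + (m - 2 (N - 2 j)) y⁻¹ ∂_y) W = 0`, where `m = 1 - 2 μ`, then
`y ^ (2 j) W` is annihilated by the `(N + 1)`-st power of `Z + ∂_y² + m y⁻¹ ∂_y`. -/
theorem iter_pow_mul_eq_zero (hZ : TangentialOp Z) {μ : ℝ} (h0 : 0 < μ) (h1 : μ < 1) (N : ℕ) :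
    ∀ (j : ℕ) (W : HalfCoord n → ℝ), j ≤ N → SmoothHalf W →
      (∀ p ∈ upperHalf n, genLaplacian Z (1 - 2 * μ - 2 * ((N : ℝ) - 2 * j)) W p = 0) →
      ∀ p ∈ upperHalf n,
        (genLaplacian Z (1 - 2 * μ))^[N + 1] (fun p => p.2 ^ (2 * j) * W p) p = 0 := by
  induction N with
  | zero =>
    intro j W hj hW hk p hp
    obtain rfl : j = 0 := by omega
    simpa using hk p hp
  | succ N ih =>
    intro j W hj hW hk p hp
    have hσ : μ + (N + 1) - 2 * j ≠ 0 := by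
      intro h
      have h2 : μ = ((2 * j - (N + 1) : ℤ) : ℝ) := by push_cast; linarith
      rw [h2] at h0 h1
      have h3 : (0 : ℤ) < 2 * j - (N + 1) := by exact_mod_cast h0
      have h4 : (2 * j - (N + 1) : ℤ) < 1 := by exact_mod_cast h1
      omega
    set a : ℝ := 1 - 2 * μ - 2 * (((N + 1 : ℕ) : ℝ) - 2 * j) with ha
    set σ : ℝ := μ + (N + 1) - 2 * j with hσd
    set b : ℝ := 2 * j * (2 * j - 2 * μ) / (2 * σ) with hb
    set Wm : HalfCoord n → ℝ := fun p => p.2⁻¹ * partialY W p with hWm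
    set Wp : HalfCoord n → ℝ := fun p => p.2 * partialY W p + (a - 1) * W p with hWp
    have sm : SmoothHalf Wm := hW.partialY.mul_right contDiffOn_inv_Ioi
    have sp : SmoothHalf Wp :=
      (hW.partialY.mul_right (h := fun y => y) contDiffOn_id).add (hW.const_mul (a - 1))
    have km := hZ.lower hW hk
    have kp := hZ.raise hW hk
    set A : HalfCoord n → ℝ := fun p => p.2 ^ (2 * j) * Wm p with hA
    set B : HalfCoord n → ℝ := fun p => p.2 ^ (2 * (j - 1)) * Wp p with hB
    have sA : SmoothHalf A := sm.mul_right (h := fun y => y ^ (2 * j)) (contDiffOn_id.pow _)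
    have sB : SmoothHalf B := sp.mul_right (h := fun y => y ^ (2 * (j - 1))) (contDiffOn_id.pow _)
    have key : EqOn (genLaplacian Z (1 - 2 * μ) fun p => p.2 ^ (2 * j) * W p)
        ((fun p => (2 * (N + 1) + b) * A p) + fun p => (-b) * B p) (upperHalf n) := by
      intro p hp
      have hy := mem_upperHalf.1 hp
      have hd1 : ∀ y : ℝ, 0 < y → HasDerivAt (fun y : ℝ => y ^ (2 * j))
          (((2 * j : ℕ) : ℝ) * y ^ (2 * j - 1)) y := fun y _ => hasDerivAt_pow _ y
      have hd2 : ∀ y : ℝ, 0 < y → HasDerivAt (fun y : ℝ => ((2 * j : ℕ) : ℝ) * y ^ (2 * j - 1))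
          (((2 * j : ℕ) : ℝ) * (((2 * j - 1 : ℕ) : ℝ) * y ^ (2 * j - 1 - 1))) y :=
        fun y _ => (hasDerivAt_pow _ y).const_mul _
      rw [hZ.gen_mul (1 - 2 * μ) hW hd1 hd2 hp]
      simp only [eq_of_ker hk hp, hA, hB, hWm, hWp, Pi.add_apply]
      have hbσ : b * σ = j * (2 * j - 2 * μ) := by rw [hb]; field_simp
      have haσ : a - 1 = -(2 * σ) := by rw [ha, hσd]; push_cast; ring
      rcases j with _ | j
      · simp only [ha, hb]; push_cast; simp; field_simp; ring
      · have e1 : 2 * (j + 1) - 1 = 2 * j + 1 := by omega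
        have e2 : 2 * (j + 1) - 1 - 1 = 2 * j := by omega
        have e3 : 2 * (j + 1 - 1) = 2 * j := by omega
        have e4 : 2 * (j + 1) = 2 * j + 2 := by omega
        simp only [e1, e3, haσ]
        simp only [e4, pow_add, pow_one]
        have : -b * (p.2 ^ (2 * j) * (p.2 * partialY W p + -(2 * σ) * W p))
          = p.2 ^ (2 * j) * (-b * p.2 * partialY W p + 2 * (b * σ) * W p) := by ring
        rw [this, hbσ, ha]
        push_cast
        field_simp
        ring
    rw [Function.iterate_succ_apply, hZ.iter_congr _ _ key hp,
      hZ.iter_add _ _ (sA.const_mul _) (sB.const_mul _) hp]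
    simp only [Pi.add_apply]
    rw [hZ.iter_const_mul _ _ _ sA hp, hZ.iter_const_mul _ _ _ sB hp]
    have tA : (2 * (N + 1) + b) * (genLaplacian Z (1 - 2 * μ))^[N + 1] A p = 0 := by
      rcases Nat.lt_or_ge N j with hlt | hle
      · have hj' : (j : ℝ) = N + 1 := by exact_mod_cast (by omega : j = N + 1)
        have : 2 * ((N : ℝ) + 1) + b = 0 := by
          rw [hb]
          have : σ = μ - (N + 1) := by rw [hσd, hj']; ring
          have h3 : μ - ((N : ℝ) + 1) ≠ 0 := this ▸ hσ
          rw [this, hj']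
          field_simp
          ring
        rw [this, zero_mul]
      · rw [ih j Wm hle sm (fun q hq => ?_) p hp, mul_zero]
        have e : 1 - 2 * μ - 2 * ((N : ℝ) - 2 * j) = a + 2 := by rw [ha]; push_cast; ring
        rw [e]; exact km q hq
    have tB : -b * (genLaplacian Z (1 - 2 * μ))^[N + 1] B p = 0 := by
      rcases Nat.eq_zero_or_pos j with h0 | hpos
      · have : b = 0 := by rw [hb, h0]; simp
        rw [this]; simp
      · rw [ih (j - 1) Wp (by omega) sp (fun q hq => ?_) p hp, mul_zero]
        have e : 1 - 2 * μ - 2 * ((N : ℝ) - 2 * ((j - 1 : ℕ) : ℝ)) = a - 2 := by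
          rw [ha, Nat.cast_sub hpos]; push_cast; ring
        rw [e]; exact kp q hq
    simp only [tA, tB, add_zero]

/-- Multiplication by `y ^ (2 σ)` carries the kernel for the weight `1 + 2 σ` to the kernel for
the weight `1 - 2 σ`; here in the opposite direction. -/
theorem ker_rpow_mul (hZ : TangentialOp Z) {σ : ℝ} (hW : SmoothHalf W)
    (hk : ∀ p ∈ upperHalf n, genLaplacian Z (1 - 2 * σ) W p = 0) :
    ∀ p ∈ upperHalf n, genLaplacian Z (1 + 2 * σ) (fun p => p.2 ^ (-(2 * σ)) * W p) p = 0 := by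
  intro p hp
  have hy := mem_upperHalf.1 hp
  have hd1 : ∀ y : ℝ, 0 < y → HasDerivAt (fun y : ℝ => y ^ (-(2 * σ)))
      (-(2 * σ) * y ^ (-(2 * σ) - 1)) y := fun y hy => Real.hasDerivAt_rpow_const (Or.inl hy.ne')
  have hd2 : ∀ y : ℝ, 0 < y → HasDerivAt (fun y : ℝ => -(2 * σ) * y ^ (-(2 * σ) - 1))
      (-(2 * σ) * ((-(2 * σ) - 1) * y ^ (-(2 * σ) - 1 - 1))) y :=
    fun y hy => (Real.hasDerivAt_rpow_const (Or.inl hy.ne')).const_mul _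
  rw [hZ.gen_mul (1 + 2 * σ) hW hd1 hd2 hp]
  simp only [eq_of_ker hk hp, Real.rpow_sub_one hy.ne']
  field_simp
  ring

end TangentialOp
end

section

/-- The first `l` derivatives of `f` satisfy `f^{(i)} = O(y ^ (r - i))` as `y → 0⁺`. -/
def DerivBound : ℕ → ℝ → (ℝ → ℝ) → Prop
  | 0, r, f => f =O[𝓝[>] (0 : ℝ)] fun y => y ^ r
  | l + 1, r, f => (f =O[𝓝[>] (0 : ℝ)] fun y => y ^ r) ∧
      (∀ᶠ y in 𝓝[>] (0 : ℝ), DifferentiableAt ℝ f y) ∧ DerivBound l (r - 1) (deriv f)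

/-- All derivatives of `f` satisfy `f^{(l)} = O(y ^ (r - l))` as `y → 0⁺`. -/
def SymbolBound (r : ℝ) (f : ℝ → ℝ) : Prop := ∀ l, DerivBound l r f

theorem eventuallyEq_deriv_right {f g : ℝ → ℝ} (h : f =ᶠ[𝓝[>] 0] g) :
    deriv f =ᶠ[𝓝[>] 0] deriv g := by
  have h1 := eventually_eventually_nhdsWithin.2 h
  filter_upwards [h1, self_mem_nhdsWithin] with y hy hy0
  rw [IsOpen.nhdsWithin_eq isOpen_Ioi hy0] at hy
  exact EventuallyEq.deriv_eq hy

theorem isBigO_rpow_mono {r s : ℝ} (h : s ≤ r) :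
    (fun y : ℝ => y ^ r) =O[𝓝[>] (0 : ℝ)] fun y => y ^ s := by
  refine Asymptotics.IsBigO.of_bound 1 ?_
  filter_upwards [Ioo_mem_nhdsGT (zero_lt_one' ℝ)] with y hy
  rw [one_mul, Real.norm_of_nonneg (Real.rpow_nonneg hy.1.le _),
    Real.norm_of_nonneg (Real.rpow_nonneg hy.1.le _)]
  exact Real.rpow_le_rpow_of_exponent_ge hy.1 hy.2.le h

theorem tendsto_rpow_zero_right {r : ℝ} (h : 0 < r) :
    Tendsto (fun y : ℝ => y ^ r) (𝓝[>] 0) (𝓝 0) := by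
  have := (Real.continuousAt_rpow_const 0 r (Or.inr h.le)).tendsto
  rw [Real.zero_rpow h.ne'] at this
  exact this.mono_left nhdsWithin_le_nhds

namespace DerivBound

variable {l : ℕ} {r s : ℝ} {f g : ℝ → ℝ}

theorem congr (h : DerivBound l r f) (hfg : f =ᶠ[𝓝[>] 0] g) : DerivBound l r g := by
  induction l generalizing r f g with
  | zero => exact Asymptotics.IsBigO.congr' h hfg EventuallyEq.rfl
  | succ l ih =>
    refine ⟨h.1.congr' hfg EventuallyEq.rfl, ?_, ih h.2.2 (eventuallyEq_deriv_right hfg)⟩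
    have h1 := eventually_eventually_nhdsWithin.2 hfg
    filter_upwards [h1, self_mem_nhdsWithin, h.2.1] with y hy hy0 hd
    rw [IsOpen.nhdsWithin_eq isOpen_Ioi hy0] at hy
    exact hd.congr_of_eventuallyEq (EventuallyEq.symm hy)

theorem mono (h : DerivBound l r f) (hs : s ≤ r) : DerivBound l s f := by
  induction l generalizing r s f with
  | zero => exact Asymptotics.IsBigO.trans h (isBigO_rpow_mono hs)
  | succ l ih => exact ⟨h.1.trans (isBigO_rpow_mono hs), h.2.1, ih h.2.2 (by linarith)⟩

theorem of_succ (h : DerivBound (l + 1) r f) : DerivBound l r f := by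
  induction l generalizing r f with
  | zero => exact h.1
  | succ l ih => exact ⟨h.1, h.2.1, ih h.2.2⟩

theorem add (hf : DerivBound l r f) (hg : DerivBound l r g) :
    DerivBound l r (fun y => f y + g y) := by
  induction l generalizing r f g with
  | zero => exact Asymptotics.IsBigO.add hf hg
  | succ l ih =>
    refine ⟨hf.1.add hg.1, ?_, (ih hf.2.2 hg.2.2).congr ?_⟩
    · filter_upwards [hf.2.1, hg.2.1] with y h1 h2 using h1.add h2
    · filter_upwards [hf.2.1, hg.2.1] with y h1 h2
      exact (h1.hasDerivAt.add h2.hasDerivAt).deriv.symm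

theorem mul (hf : DerivBound l r f) (hg : DerivBound l s g) :
    DerivBound l (r + s) (fun y => f y * g y) := by
  have key : ∀ {r s : ℝ} {f g : ℝ → ℝ}, (f =O[𝓝[>] (0 : ℝ)] fun y => y ^ r) →
      (g =O[𝓝[>] (0 : ℝ)] fun y => y ^ s) →
      (fun y => f y * g y) =O[𝓝[>] (0 : ℝ)] fun y => y ^ (r + s) := by
    intro r s f g h1 h2
    refine (h1.mul h2).congr' EventuallyEq.rfl ?_
    filter_upwards [self_mem_nhdsWithin] with y hy using (Real.rpow_add hy _ _).symm
  induction l generalizing r s f g with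
  | zero => exact key hf hg
  | succ l ih =>
    refine ⟨key hf.1 hg.1, ?_, ?_⟩
    · filter_upwards [hf.2.1, hg.2.1] with y h1 h2 using h1.mul h2
    · have h1 := ih hf.2.2 hg.of_succ
      have h2 := ih hf.of_succ hg.2.2
      rw [show r - 1 + s = r + s - 1 by ring] at h1
      rw [show r + (s - 1) = r + s - 1 by ring] at h2
      refine (h1.add h2).congr ?_
      filter_upwards [hf.2.1, hg.2.1] with y h1 h2
      exact (h1.hasDerivAt.mul h2.hasDerivAt).deriv.symm

theorem zero_fun : DerivBound l r (fun _ => 0) := by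
  induction l generalizing r with
  | zero => exact Asymptotics.isBigO_zero _ _
  | succ l ih => exact ⟨Asymptotics.isBigO_zero _ _, .of_forall fun _ => by simp, by
      have : deriv (fun _ : ℝ => (0 : ℝ)) = fun _ => 0 := by funext; simp
      rw [this]; exact ih⟩

theorem const (c : ℝ) : DerivBound l 0 (fun _ => c) := by
  have h0 : (fun _ : ℝ => c) =O[𝓝[>] (0 : ℝ)] fun y => y ^ (0 : ℝ) := by
    simpa using Asymptotics.isBigO_const_const c (one_ne_zero (α := ℝ)) (𝓝[>] (0 : ℝ))
  cases l with
  | zero => exact h0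
  | succ l =>
    refine ⟨h0, .of_forall fun _ => by simp, ?_⟩
    have : deriv (fun _ : ℝ => c) = fun _ => 0 := by funext; simp
    rw [this]; exact zero_fun

theorem const_mul (c : ℝ) (hf : DerivBound l r f) : DerivBound l r (fun y => c * f y) := by
  simpa using (const (l := l) c).mul hf

theorem rpow (s : ℝ) : DerivBound l s (fun y => y ^ s) := by
  induction l generalizing s with
  | zero => exact Asymptotics.isBigO_refl _ _
  | succ l ih =>
    refine ⟨Asymptotics.isBigO_refl _ _, ?_, ((ih (s - 1)).const_mul s).congr ?_⟩
    · filter_upwards [self_mem_nhdsWithin] with y hy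
      exact (Real.hasDerivAt_rpow_const (Or.inl (ne_of_gt hy))).differentiableAt
    · filter_upwards [self_mem_nhdsWithin] with y hy
      exact (Real.hasDerivAt_rpow_const (Or.inl (ne_of_gt hy))).deriv.symm

end DerivBound

namespace SymbolBound

variable {r s : ℝ} {f g : ℝ → ℝ}

theorem isBigO (h : SymbolBound r f) : f =O[𝓝[>] (0 : ℝ)] fun y => y ^ r := h 0

theorem congr (h : SymbolBound r f) (hfg : f =ᶠ[𝓝[>] 0] g) : SymbolBound r g :=
  fun l => (h l).congr hfg

theorem mono (h : SymbolBound r f) (hs : s ≤ r) : SymbolBound s f := fun l => (h l).mono hs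

theorem add (hf : SymbolBound r f) (hg : SymbolBound r g) : SymbolBound r (fun y => f y + g y) :=
  fun l => (hf l).add (hg l)

theorem mul (hf : SymbolBound r f) (hg : SymbolBound s g) :
    SymbolBound (r + s) (fun y => f y * g y) := fun l => (hf l).mul (hg l)

theorem const_mul (c : ℝ) (hf : SymbolBound r f) : SymbolBound r (fun y => c * f y) :=
  fun l => (hf l).const_mul c

theorem sub (hf : SymbolBound r f) (hg : SymbolBound r g) : SymbolBound r (fun y => f y - g y) := by
  have := hf.add (hg.const_mul (-1))
  simpa [sub_eq_add_neg] using this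

theorem rpow (s : ℝ) : SymbolBound s (fun y => y ^ s) := fun _ => DerivBound.rpow s

theorem zero_fun : SymbolBound r (fun _ => 0) := fun _ => DerivBound.zero_fun

theorem differentiableAt (h : SymbolBound r f) :
    ∀ᶠ y in 𝓝[>] (0 : ℝ), DifferentiableAt ℝ f y := (h 1).2.1

theorem deriv (h : SymbolBound r f) : SymbolBound (r - 1) (deriv f) := fun l => (h (l + 1)).2.2

theorem sum {ι : Type*} (t : Finset ι) {f : ι → ℝ → ℝ} (h : ∀ i ∈ t, SymbolBound r (f i)) :
    SymbolBound r (fun y => ∑ i ∈ t, f i y) := by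
  classical
  induction t using Finset.induction_on with
  | empty => simpa using zero_fun
  | insert i t hi ih =>
    simp only [Finset.sum_insert hi]
    exact (h i (Finset.mem_insert_self i t)).add
      (ih fun j hj => h j (Finset.mem_insert_of_mem hj))

theorem tendsto (h : SymbolBound r f) (hr : 0 < r) : Tendsto f (𝓝[>] 0) (𝓝 0) :=
  h.isBigO.trans_tendsto (tendsto_rpow_zero_right hr)

end SymbolBound

/-- The one-variable operator `∂_y² + m y⁻¹ ∂_y`. -/
def besselOp (m : ℝ) (f : ℝ → ℝ) : ℝ → ℝ := fun y => deriv (deriv f) y + m * y⁻¹ * deriv f y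

theorem SymbolBound.inv : SymbolBound (-1) (fun y : ℝ => y⁻¹) :=
  (SymbolBound.rpow (-1)).congr (by
    filter_upwards [self_mem_nhdsWithin] with y hy
    exact Real.rpow_neg_one y)

theorem SymbolBound.besselOp {r : ℝ} {f : ℝ → ℝ} (m : ℝ) (h : SymbolBound r f) :
    SymbolBound (r - 2) (besselOp m f) := by
  have h1 := h.deriv.deriv
  have h2 := (SymbolBound.inv.const_mul m).mul h.deriv
  rw [show r - 1 - 1 = r - 2 by ring] at h1
  rw [show -1 + (r - 1) = r - 2 by ring] at h2
  exact h1.add h2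

theorem besselOp_add {r s : ℝ} {f g : ℝ → ℝ} (m : ℝ) (hf : SymbolBound r f)
    (hg : SymbolBound s g) :
    besselOp m (fun y => f y + g y) =ᶠ[𝓝[>] 0] fun y => besselOp m f y + besselOp m g y := by
  have h1 : deriv (fun y => f y + g y) =ᶠ[𝓝[>] 0] fun y => deriv f y + deriv g y := by
    filter_upwards [hf.differentiableAt, hg.differentiableAt] with y h1 h2
    exact (h1.hasDerivAt.add h2.hasDerivAt).deriv
  have h2 : deriv (fun y => deriv f y + deriv g y) =ᶠ[𝓝[>] 0]
      fun y => deriv (deriv f) y + deriv (deriv g) y := by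
    filter_upwards [hf.deriv.differentiableAt, hg.deriv.differentiableAt] with y h1 h2
    exact (h1.hasDerivAt.add h2.hasDerivAt).deriv
  filter_upwards [h1, (eventuallyEq_deriv_right h1).trans h2] with y h3 h4
  simp only [besselOp, h3, h4]; ring

theorem besselOp_const_mul {r : ℝ} {f : ℝ → ℝ} (m c : ℝ) (hf : SymbolBound r f) :
    besselOp m (fun y => c * f y) =ᶠ[𝓝[>] 0] fun y => c * besselOp m f y := by
  have h1 : deriv (fun y => c * f y) =ᶠ[𝓝[>] 0] fun y => c * deriv f y := by
    filter_upwards [hf.differentiableAt] with y h1 using (h1.hasDerivAt.const_mul c).deriv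
  have h2 : deriv (fun y => c * deriv f y) =ᶠ[𝓝[>] 0] fun y => c * deriv (deriv f) y := by
    filter_upwards [hf.deriv.differentiableAt] with y h1 using (h1.hasDerivAt.const_mul c).deriv
  filter_upwards [h1, (eventuallyEq_deriv_right h1).trans h2] with y h3 h4
  simp only [besselOp, h3, h4]; ring

theorem besselOp_rpow (μ s : ℝ) {y : ℝ} (hy : 0 < y) :
    besselOp (1 - 2 * μ) (fun y => y ^ s) y = s * (s - 2 * μ) * y ^ (s - 2) := by
  have h1 : ∀ y : ℝ, 0 < y → deriv (fun y : ℝ => y ^ s) y = s * y ^ (s - 1) := fun y hy =>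
    (Real.hasDerivAt_rpow_const (Or.inl hy.ne')).deriv
  have h2 : deriv (deriv fun y : ℝ => y ^ s) y = s * ((s - 1) * y ^ (s - 1 - 1)) := by
    have : deriv (fun y : ℝ => y ^ s) =ᶠ[𝓝 y] fun y => s * y ^ (s - 1) := by
      filter_upwards [lt_mem_nhds hy] with z hz using h1 z hz
    rw [this.deriv_eq]
    exact ((Real.hasDerivAt_rpow_const (Or.inl hy.ne')).const_mul s).deriv
  simp only [besselOp, h1 y hy, h2]
  rw [show s - 2 = s - 1 - 1 by ring]
  rw [Real.rpow_sub_one hy.ne' (s - 1)]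
  field_simp
  ring

/-- `∑_{i < J} (v_i y^{2i} + w_i y^{2μ + 2i})`. -/
def expSum (μ : ℝ) (v w : ℕ → ℝ) (J : ℕ) (y : ℝ) : ℝ :=
  ∑ i ∈ Finset.range J, (v i * y ^ (2 * (i : ℝ)) + w i * y ^ (2 * μ + 2 * (i : ℝ)))

/-- `f = ∑_{i < J} (v_i y^{2i} + w_i y^{2μ + 2i}) + O(y^{2J})`, and this may be differentiated. -/
def HasExp (μ : ℝ) (J : ℕ) (f : ℝ → ℝ) (v w : ℕ → ℝ) : Prop :=
  SymbolBound (2 * (J : ℝ)) fun y => f y - expSum μ v w J y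

theorem symbolBound_expSum {μ : ℝ} (hμ : 0 < μ) (v w : ℕ → ℝ) (J : ℕ) :
    SymbolBound 0 (expSum μ v w J) := by
  refine SymbolBound.sum _ fun i _ => SymbolBound.add ?_ ?_
  · exact ((SymbolBound.rpow _).const_mul _).mono (by positivity)
  · exact ((SymbolBound.rpow _).const_mul _).mono (by positivity)

theorem besselOp_expSum {μ : ℝ} (hμ : 0 < μ) (v w : ℕ → ℝ) (J : ℕ) :
    besselOp (1 - 2 * μ) (expSum μ v w (J + 1)) =ᶠ[𝓝[>] 0]
      expSum μ (fun i => 2 * (i + 1) * (2 * (i + 1) - 2 * μ) * v (i + 1))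
        (fun i => (2 * μ + 2 * (i + 1)) * (2 * (i + 1)) * w (i + 1)) J := by
  have key : ∀ J, besselOp (1 - 2 * μ) (expSum μ v w J) =ᶠ[𝓝[>] 0] fun y =>
      ∑ i ∈ Finset.range J, (v i * (2 * (i : ℝ) * (2 * i - 2 * μ) * y ^ (2 * (i : ℝ) - 2))
        + w i * ((2 * μ + 2 * i) * (2 * μ + 2 * i - 2 * μ) * y ^ (2 * μ + 2 * (i : ℝ) - 2))) := by
    intro J
    induction J with
    | zero =>
      have : expSum μ v w 0 = fun _ => 0 := by funext y; simp [expSum]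
      rw [this]
      filter_upwards with y
      simp [besselOp]
    | succ J ih =>
      have h1 : expSum μ v w (J + 1) = fun y => expSum μ v w J y
          + (v J * y ^ (2 * (J : ℝ)) + w J * y ^ (2 * μ + 2 * (J : ℝ))) := by
        funext y; simp [expSum, Finset.sum_range_succ]
      rw [h1]
      have s1 := symbolBound_expSum hμ v w J
      have s2 : SymbolBound 0 fun y : ℝ => v J * y ^ (2 * (J : ℝ)) :=
        ((SymbolBound.rpow _).const_mul _).mono (by positivity)
      have s3 : SymbolBound 0 fun y : ℝ => w J * y ^ (2 * μ + 2 * (J : ℝ)) :=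
        ((SymbolBound.rpow _).const_mul _).mono (by positivity)
      filter_upwards [besselOp_add (1 - 2 * μ) s1 (s2.add s3), besselOp_add (1 - 2 * μ) s2 s3,
        besselOp_const_mul (1 - 2 * μ) (v J) (SymbolBound.rpow (2 * (J : ℝ))),
        besselOp_const_mul (1 - 2 * μ) (w J) (SymbolBound.rpow (2 * μ + 2 * (J : ℝ))), ih,
        self_mem_nhdsWithin] with y e1 e2 e3 e4 e5 hy
      rw [e1, e2, e3, e4, e5, besselOp_rpow _ _ hy, besselOp_rpow _ _ hy, Finset.sum_range_succ]
  filter_upwards [key (J + 1)] with y hy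
  rw [hy, Finset.sum_range_succ']
  simp only [expSum, Nat.cast_zero, Nat.cast_add, Nat.cast_one]
  rw [show (v 0 * (2 * (0 : ℝ) * (2 * 0 - 2 * μ) * y ^ (2 * (0 : ℝ) - 2))
        + w 0 * ((2 * μ + 2 * 0) * (2 * μ + 2 * 0 - 2 * μ) * y ^ (2 * μ + 2 * (0 : ℝ) - 2))) = 0 by
      ring, add_zero]
  refine Finset.sum_congr rfl fun i _ => ?_
  rw [show 2 * ((i : ℝ) + 1) - 2 = 2 * i by ring,
    show 2 * μ + 2 * ((i : ℝ) + 1) - 2 = 2 * μ + 2 * i by ring]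
  ring

namespace HasExp

variable {μ : ℝ} {J : ℕ} {f : ℝ → ℝ} {v w : ℕ → ℝ}

theorem besselOp (hμ : 0 < μ) (h : HasExp μ (J + 1) f v w) :
    HasExp μ J (besselOp (1 - 2 * μ) f)
      (fun i => 2 * (i + 1) * (2 * (i + 1) - 2 * μ) * v (i + 1))
      (fun i => (2 * μ + 2 * (i + 1)) * (2 * (i + 1)) * w (i + 1)) := by
  have h1 := SymbolBound.besselOp (1 - 2 * μ) h
  have h2 := besselOp_add (1 - 2 * μ) h (symbolBound_expSum hμ v w (J + 1))
  have h3 : 2 * ((J + 1 : ℕ) : ℝ) - 2 = 2 * J := by push_cast; ring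
  rw [h3] at h1
  refine h1.congr ?_
  filter_upwards [h2, besselOp_expSum hμ v w J] with y e1 e2
  simp only [sub_add_cancel] at e1
  rw [← e2, e1]; ring

theorem besselOp_iterate (hμ : 0 < μ) (j : ℕ) :
    ∀ {J : ℕ} {f : ℝ → ℝ} {v w : ℕ → ℝ}, HasExp μ (J + j) f v w →
    HasExp μ J ((_root_.besselOp (1 - 2 * μ))^[j] f)
      (fun i => (∏ l ∈ Finset.range j, 2 * ((i : ℝ) + l + 1) * (2 * ((i : ℝ) + l + 1) - 2 * μ))
        * v (i + j))
      (fun i => (∏ l ∈ Finset.range j, (2 * μ + 2 * ((i : ℝ) + l + 1)) * (2 * ((i : ℝ) + l + 1)))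
        * w (i + j)) := by
  induction j with
  | zero => intro J f v w h; simpa using h
  | succ j ih =>
    intro J f v w h
    have h1 := ih (J := J) (HasExp.besselOp hμ (J := J + j) h)
    rw [Function.iterate_succ_apply]
    convert h1 using 2 with i i
    · rw [Finset.prod_range_succ, mul_assoc, ← add_assoc]; push_cast; ring
    · rw [Finset.prod_range_succ, mul_assoc, ← add_assoc]; push_cast; ring

theorem tendsto (hμ : 0 < μ) (h : HasExp μ (J + 1) f v w) : Tendsto f (𝓝[>] 0) (𝓝 (v 0)) := by
  have h1 : Tendsto (fun y => f y - expSum μ v w (J + 1) y) (𝓝[>] 0) (𝓝 0) :=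
    SymbolBound.tendsto h (by positivity)
  have h2 : Tendsto (expSum μ v w (J + 1)) (𝓝[>] 0) (𝓝 (v 0)) := by
    have h3 : expSum μ v w (J + 1) = fun y => (∑ i ∈ Finset.range J,
        (v (i + 1) * y ^ (2 * ((i : ℝ) + 1)) + w (i + 1) * y ^ (2 * μ + 2 * ((i : ℝ) + 1))))
        + (v 0 + w 0 * y ^ (2 * μ)) := by
      funext y; simp [expSum, Finset.sum_range_succ']
    rw [h3]
    have h4 : Tendsto (fun y : ℝ => ∑ i ∈ Finset.range J,
        (v (i + 1) * y ^ (2 * ((i : ℝ) + 1)) + w (i + 1) * y ^ (2 * μ + 2 * ((i : ℝ) + 1))))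
        (𝓝[>] 0) (𝓝 (∑ i ∈ Finset.range J, (v (i + 1) * 0 + w (i + 1) * 0))) :=
      tendsto_finsetSum _ fun i _ => ((tendsto_rpow_zero_right (by positivity)).const_mul _).add
        ((tendsto_rpow_zero_right (by positivity)).const_mul _)
    have h5 := h4.add (((tendsto_rpow_zero_right (by positivity : 0 < 2 * μ)).const_mul
      (w 0)).const_add (v 0))
    simpa using h5
  simpa using h1.add h2

theorem tendsto_deriv (hμ : 0 < μ) (hμ1 : μ < 1) (h : HasExp μ (J + 1) f v w) :
    Tendsto (fun y => y ^ (1 - 2 * μ) * deriv f y) (𝓝[>] 0) (𝓝 (2 * μ * w 0)) := by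
  have e : ∀ y : ℝ, expSum μ v w (J + 1) y = (∑ i ∈ Finset.range J,
        (v (i + 1) * y ^ (2 * ((i : ℝ) + 1)) + w (i + 1) * y ^ (2 * μ + 2 * ((i : ℝ) + 1))))
        + (v 0 + w 0 * y ^ (2 * μ)) := fun y => by simp [expSum, Finset.sum_range_succ']
  have s0 : SymbolBound 2 fun y : ℝ => ∑ i ∈ Finset.range J,
        (v (i + 1) * y ^ (2 * ((i : ℝ) + 1)) + w (i + 1) * y ^ (2 * μ + 2 * ((i : ℝ) + 1))) := by
    refine SymbolBound.sum _ fun i _ => SymbolBound.add ?_ ?_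
    · exact ((SymbolBound.rpow _).const_mul _).mono (by nlinarith [(Nat.cast_nonneg i : (0:ℝ) ≤ i)])
    · exact ((SymbolBound.rpow _).const_mul _).mono (by nlinarith [(Nat.cast_nonneg i : (0:ℝ) ≤ i)])
  have s1 : SymbolBound 2 fun y => f y - (v 0 + w 0 * y ^ (2 * μ)) := by
    have h2 := (SymbolBound.mono h (s := 2) (by push_cast; nlinarith [(Nat.cast_nonneg J : (0:ℝ) ≤ J)])).add s0
    refine h2.congr (.of_forall fun y => ?_)
    simp only [e]; ring
  have s2 := (SymbolBound.rpow (1 - 2 * μ)).mul s1.deriv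
  have t := (s2.tendsto (by linarith)).add_const (2 * μ * w 0)
  rw [zero_add] at t
  refine t.congr' ?_
  filter_upwards [s1.differentiableAt, self_mem_nhdsWithin] with y hd hy
  have hy : 0 < y := hy
  have d0 : HasDerivAt (fun y : ℝ => v 0 + w 0 * y ^ (2 * μ))
      (w 0 * (2 * μ * y ^ (2 * μ - 1))) y :=
    ((Real.hasDerivAt_rpow_const (Or.inl hy.ne')).const_mul _).const_add _
  have d1 := hd.hasDerivAt.add d0
  have d2 : HasDerivAt f (deriv (fun y => f y - (v 0 + w 0 * y ^ (2 * μ))) y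
      + w 0 * (2 * μ * y ^ (2 * μ - 1))) y := by
    refine d1.congr_of_eventuallyEq (.of_forall fun y => ?_)
    simp
  rw [d2.deriv, mul_add]
  congr 1
  have : y ^ (1 - 2 * μ) * y ^ (2 * μ - 1) = 1 := by
    rw [← Real.rpow_add hy]; simp
  linear_combination (-(2 * μ * w 0)) * this

end HasExp

theorem besselOp_iterate_eq_normalOp {n : ℕ} (m : ℝ) (U : HalfCoord n → ℝ) (x : Bdry n) (j : ℕ) :
    (fun y => (normalOp m)^[j] U (x, y)) = (besselOp m)^[j] fun y => U (x, y) := by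
  induction j with
  | zero => rfl
  | succ j ih =>
    simp only [iterate_succ_apply']
    rw [← ih]; rfl

/-- The factors relating the limits in the boundary operators to expansion coefficients. -/
def evenFactor (μ : ℝ) (j : ℕ) : ℝ :=
  ∏ l ∈ Finset.range j, 2 * ((l : ℝ) + 1) * (2 * ((l : ℝ) + 1) - 2 * μ)

/-- See `evenFactor`. -/
def oddFactor (μ : ℝ) (j : ℕ) : ℝ :=
  2 * μ * ∏ l ∈ Finset.range j, (2 * μ + 2 * ((l : ℝ) + 1)) * (2 * ((l : ℝ) + 1))

theorem HasExp.tendsto_normalOp {n : ℕ} {μ : ℝ} (hμ : 0 < μ) {j J : ℕ} {U : HalfCoord n → ℝ}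
    {x : Bdry n} {v w : ℕ → ℝ} (h : HasExp μ (J + 1 + j) (fun y => U (x, y)) v w) :
    Tendsto (fun y => (normalOp (1 - 2 * μ))^[j] U (x, y)) (𝓝[>] 0) (𝓝 (evenFactor μ j * v j)) := by
  rw [besselOp_iterate_eq_normalOp]
  simpa [evenFactor] using (HasExp.besselOp_iterate hμ j h).tendsto hμ

theorem HasExp.tendsto_partialY_normalOp {n : ℕ} {μ : ℝ} (hμ : 0 < μ) (hμ1 : μ < 1) {j J : ℕ}
    {U : HalfCoord n → ℝ} {x : Bdry n} {v w : ℕ → ℝ}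
    (h : HasExp μ (J + 1 + j) (fun y => U (x, y)) v w) :
    Tendsto (fun y => y ^ (1 - 2 * μ) * partialY ((normalOp (1 - 2 * μ))^[j] U) (x, y)) (𝓝[>] 0)
      (𝓝 (oddFactor μ j * w j)) := by
  have := (HasExp.besselOp_iterate hμ j h).tendsto_deriv hμ hμ1
  rw [← besselOp_iterate_eq_normalOp] at this
  simpa [oddFactor, mul_assoc, partialY] using this

theorem evenFactor_ne_zero {μ : ℝ} (hμ1 : μ < 1) (j : ℕ) : evenFactor μ j ≠ 0 := by
  refine Finset.prod_ne_zero_iff.2 fun l _ => mul_ne_zero (by positivity) ?_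
  have : (0 : ℝ) ≤ l := Nat.cast_nonneg l
  linarith

theorem oddFactor_ne_zero {μ : ℝ} (hμ : 0 < μ) (j : ℕ) : oddFactor μ j ≠ 0 := by
  refine mul_ne_zero (by positivity) (Finset.prod_ne_zero_iff.2 fun l _ => ?_)
  positivity

end

section

variable {n : ℕ}

/-- The closed upper half space. -/
def closedHalf (n : ℕ) : Set (HalfCoord n) := univ ×ˢ Ici (0 : ℝ)

theorem uniqueDiffOn_closedHalf : UniqueDiffOn ℝ (closedHalf n) :=
  uniqueDiffOn_univ.prod (uniqueDiffOn_Ici 0)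

theorem hasDerivWithinAt_slice {F : HalfCoord n → ℝ} (hF : ContDiffOn ℝ ∞ F (closedHalf n))
    (x : Bdry n) {y : ℝ} (hy : 0 ≤ y) :
    HasDerivWithinAt (fun y => F (x, y)) (fderivWithin ℝ F (closedHalf n) (x, y) (0, 1))
      (Ici 0) y := by
  have h1 : HasFDerivWithinAt F (fderivWithin ℝ F (closedHalf n) (x, y)) (closedHalf n) (x, y) :=
    (hF.differentiableOn (by simp) (x, y) ⟨mem_univ _, hy⟩).hasFDerivWithinAt
  have h2 : HasDerivWithinAt (fun y : ℝ => (x, y)) ((0 : Bdry n), (1 : ℝ)) (Ici 0) y :=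
    ((hasDerivAt_const _ _).prodMk (hasDerivAt_id _)).hasDerivWithinAt
  exact h1.comp_hasDerivWithinAt y h2 fun z hz => ⟨mem_univ _, hz⟩

theorem contDiffOn_partialWithin {F : HalfCoord n → ℝ} (hF : ContDiffOn ℝ ∞ F (closedHalf n)) :
    ContDiffOn ℝ ∞ (fun p : HalfCoord n => fderivWithin ℝ F (closedHalf n) p (0, 1))
      (closedHalf n) :=
  (hF.fderivWithin uniqueDiffOn_closedHalf (by simp)).clm_apply contDiffOn_const

/-- Taylor's theorem at the boundary, uniformly on compact sets. -/
theorem exists_bound_of_iteratedDerivWithin_eq_zero {K : Set (Bdry n)} (hK : IsCompact K) (r : ℕ) :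
    ∀ {F : HalfCoord n → ℝ}, ContDiffOn ℝ ∞ F (closedHalf n) →
      (∀ x ∈ K, ∀ k < r, iteratedDerivWithin k (fun y => F (x, y)) (Ici 0) 0 = 0) →
      ∃ C : ℝ, ∀ x ∈ K, ∀ y ∈ Icc (0 : ℝ) 1, |F (x, y)| ≤ C * y ^ r := by
  induction r with
  | zero =>
    intro F hF _
    obtain ⟨C, hC⟩ := (hK.prod (isCompact_Icc (a := (0 : ℝ)) (b := 1))).exists_bound_of_continuousOn
      (hF.continuousOn.mono fun p hp => ⟨mem_univ _, hp.2.1⟩)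
    exact ⟨C, fun x hx y hy => by simpa using hC (x, y) ⟨hx, hy⟩⟩
  | succ r ih =>
    intro F hF h0
    obtain ⟨C, hC⟩ := ih (contDiffOn_partialWithin hF) (fun x hx k hk => by
      have h1 := h0 x hx (k + 1) (by omega)
      rw [iteratedDerivWithin_succ'] at h1
      refine Eq.trans ?_ h1
      refine iteratedDerivWithin_congr (fun y hy => ?_) self_mem_Ici
      exact ((hasDerivWithinAt_slice hF x hy).derivWithin ((uniqueDiffOn_Ici 0) y hy)).symm)
    refine ⟨C, fun x hx y hy => ?_⟩
    have h2 : F (x, 0) = 0 := by simpa using h0 x hx 0 (by omega)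
    have hC0 : 0 ≤ C := by
      have := (abs_nonneg _).trans (hC x hx 1 ⟨zero_le_one, le_rfl⟩)
      simpa using this
    have h3 := Convex.norm_image_sub_le_of_norm_hasDerivWithin_le (s := Icc 0 y) (x := 0) (y := y)
      (f := fun y => F (x, y)) (C := C * y ^ r)
      (fun z hz => (hasDerivWithinAt_slice hF x hz.1).mono Icc_subset_Ici_self)
      (fun z hz => (hC x hx z ⟨hz.1, hz.2.trans hy.2⟩).trans
        (mul_le_mul_of_nonneg_left (pow_le_pow_left₀ hz.1 hz.2 r) hC0))
      (convex_Icc 0 y) ⟨le_rfl, hy.1⟩ ⟨hy.1, le_rfl⟩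
    simp only [h2, sub_zero, Real.norm_eq_abs, abs_of_nonneg hy.1] at h3
    rw [pow_succ, ← mul_assoc]; exact h3

theorem derivBound_of_contDiffOn (l : ℕ) : ∀ (r : ℕ) {f : ℝ → ℝ}, ContDiffOn ℝ ∞ f (Ici 0) →
    (∀ k < r, iteratedDerivWithin k f (Ici 0) 0 = 0) → DerivBound l (r : ℝ) f := by
  have key : ∀ (r : ℕ) {f : ℝ → ℝ}, ContDiffOn ℝ ∞ f (Ici 0) →
      (∀ k < r, iteratedDerivWithin k f (Ici 0) 0 = 0) →
      f =O[𝓝[>] (0 : ℝ)] fun y => y ^ (r : ℝ) := by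
    intro r f hf h0
    obtain ⟨C, hC⟩ := exists_bound_of_iteratedDerivWithin_eq_zero (n := 0) (K := {0})
      isCompact_singleton r (F := fun p => f p.2)
      (hf.comp contDiff_snd.contDiffOn fun p hp => hp.2) fun x _ k hk => h0 k hk
    refine Asymptotics.IsBigO.of_bound C ?_
    filter_upwards [Ioo_mem_nhdsGT (zero_lt_one' ℝ)] with y hy
    have := hC 0 rfl y ⟨hy.1.le, hy.2.le⟩
    rw [Real.rpow_natCast, Real.norm_eq_abs, Real.norm_of_nonneg (pow_nonneg hy.1.le r)]
    exact this
  induction l with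
  | zero => exact fun r f hf h0 => key r hf h0
  | succ l ih =>
    intro r f hf h0
    have hd : ∀ y, 0 < y → DifferentiableAt ℝ f y := fun y hy =>
      (hf.contDiffAt (Ici_mem_nhds hy)).differentiableAt (by simp)
    have he : deriv f =ᶠ[𝓝[>] 0] derivWithin f (Ici 0) := by
      filter_upwards [self_mem_nhdsWithin] with y hy
      exact (derivWithin_of_mem_nhds (Ici_mem_nhds hy)).symm
    have hf' : ContDiffOn ℝ ∞ (derivWithin f (Ici 0)) (Ici 0) :=
      hf.derivWithin (uniqueDiffOn_Ici 0) (by simp)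
    refine ⟨key r hf h0, ?_, DerivBound.congr ?_ he.symm⟩
    · filter_upwards [self_mem_nhdsWithin] with y hy using hd y hy
    · rcases r with _ | r
      · exact (ih 0 hf' (by simp)).mono (by simp)
      · have := ih r hf' fun k hk => by
          have := h0 (k + 1) (by omega)
          rwa [iteratedDerivWithin_succ'] at this
        exact this.mono (by push_cast; linarith)

theorem symbolBound_of_contDiffOn {r : ℕ} {f : ℝ → ℝ} (hf : ContDiffOn ℝ ∞ f (Ici 0))
    (h0 : ∀ k < r, iteratedDerivWithin k f (Ici 0) 0 = 0) : SymbolBound (r : ℝ) f :=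
  fun l => derivBound_of_contDiffOn l r hf h0

/-- `f = ∑_{i < J} v_i y^{2i} + O(y^{2J})`, and this may be differentiated. -/
def EvenExp (J : ℕ) (f : ℝ → ℝ) (v : ℕ → ℝ) : Prop :=
  SymbolBound (2 * (J : ℝ)) fun y => f y - ∑ i ∈ Finset.range J, v i * y ^ (2 * (i : ℝ))

theorem evenExp_of_contDiffOn {f : ℝ → ℝ} (hf : ContDiffOn ℝ ∞ f (Ici 0))
    (h0 : ∀ k, Odd k → iteratedDerivWithin k f (Ici 0) 0 = 0) (J : ℕ) :
    EvenExp J f fun i => iteratedDerivWithin (2 * i) f (Ici 0) 0 / ((2 * i).factorial : ℝ) := by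
  set c : ℕ → ℝ := fun i => iteratedDerivWithin (2 * i) f (Ici 0) 0 / ((2 * i).factorial : ℝ)
  have hterm : ∀ i, ContDiff ℝ ∞ fun y : ℝ => c i * y ^ (2 * i) := fun i => by fun_prop
  have hs : ContDiff ℝ ∞ fun y : ℝ => ∑ i ∈ Finset.range J, c i * y ^ (2 * i) :=
    ContDiff.sum fun i _ => hterm i
  have h1 : SymbolBound ((2 * J : ℕ) : ℝ)
      fun y => f y - ∑ i ∈ Finset.range J, c i * y ^ (2 * i) := by
    refine symbolBound_of_contDiffOn (hf.sub hs.contDiffOn) fun k hk => ?_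
    have hm : (0 : ℝ) ∈ Ici (0 : ℝ) := mem_Ici.2 le_rfl
    have e1 : iteratedDerivWithin k (fun y => f y - ∑ i ∈ Finset.range J, c i * y ^ (2 * i)) (Ici 0) 0
        = _ := iteratedDerivWithin_sub hm (uniqueDiffOn_Ici 0)
      ((hf 0 hm).of_le (m := (k : WithTop ℕ∞)) (by exact_mod_cast le_top))
      ((hs.contDiffOn 0 hm).of_le (m := (k : WithTop ℕ∞)) (by exact_mod_cast le_top))
    rw [e1, iteratedDerivWithin_eq_iteratedDeriv (uniqueDiffOn_Ici 0)
      (hs.contDiffAt.of_le (by exact_mod_cast le_top)) hm,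
      iteratedDeriv_fun_sum fun i _ => (hterm i).contDiffAt.of_le (by exact_mod_cast le_top)]
    have e2 : ∀ i, iteratedDeriv k (fun y : ℝ => c i * y ^ (2 * i)) 0
        = if k = 2 * i then c i * ((2 * i).factorial : ℝ) else 0 := fun i => by
      rw [iteratedDeriv_const_mul_field, iteratedDeriv_fun_pow_zero]
      split_ifs <;> simp_all
    simp only [e2]
    rcases Nat.even_or_odd' k with ⟨i, hi | hi⟩
    · rw [Finset.sum_eq_single i (fun j _ hj => if_neg (by omega))
        (fun h => absurd (Finset.mem_range.2 (by omega)) h), if_pos hi, hi]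
      simp only [c]
      field_simp
      ring
    · rw [h0 k ⟨i, hi⟩, Finset.sum_eq_zero fun j _ => if_neg (by omega), sub_zero]
  rw [EvenExp, show 2 * (J : ℝ) = ((2 * J : ℕ) : ℝ) by push_cast; ring]
  refine h1.congr ?_
  filter_upwards [self_mem_nhdsWithin] with y hy
  congr 1
  refine Finset.sum_congr rfl fun i _ => ?_
  rw [← Real.rpow_natCast]; push_cast; rfl

namespace EvenExp

variable {J : ℕ} {f g : ℝ → ℝ} {v w : ℕ → ℝ}

theorem of_add {l : ℕ} (h : EvenExp (J + l) f v) : EvenExp J f v := by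
  have h1 : SymbolBound (2 * (J : ℝ)) fun y : ℝ =>
      ∑ i ∈ Finset.range l, v (J + i) * y ^ (2 * ((J + i : ℕ) : ℝ)) :=
    SymbolBound.sum _ fun i _ => ((SymbolBound.rpow _).const_mul _).mono (by push_cast; nlinarith [(Nat.cast_nonneg i : (0:ℝ) ≤ i)])
  refine ((SymbolBound.mono h (by push_cast; nlinarith [(Nat.cast_nonneg l : (0:ℝ) ≤ l)])).add h1).congr
    (.of_forall fun y => ?_)
  simp only [Finset.sum_range_add]; ring

theorem shift (h : ∀ J, EvenExp J f v) (l J : ℕ) :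
    EvenExp J (fun y => y ^ (2 * (l : ℝ)) * f y) fun j => if l ≤ j then v (j - l) else 0 := by
  refine of_add (l := l) ?_
  have h1 := (SymbolBound.rpow (2 * (l : ℝ))).mul (h J)
  rw [EvenExp, show 2 * ((J + l : ℕ) : ℝ) = 2 * (l : ℝ) + 2 * J by push_cast; ring]
  refine h1.congr ?_
  filter_upwards [self_mem_nhdsWithin] with y hy
  have hy : 0 < y := hy
  rw [mul_sub, add_comm J l, Finset.sum_range_add, Finset.sum_eq_zero (s := Finset.range l)
    (fun i hi => by rw [if_neg (by simpa using hi), zero_mul]), zero_add, Finset.mul_sum]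
  congr 1
  refine Finset.sum_congr rfl fun i _ => ?_
  rw [if_pos (by omega), Nat.add_sub_cancel_left]
  push_cast
  rw [mul_add, Real.rpow_add hy]; ring

theorem hasExp {μ : ℝ} (hμ : 0 < μ) (hf : EvenExp J f v) (hg : EvenExp J g w) {U : ℝ → ℝ}
    (hU : ∀ y, 0 < y → U y = f y + y ^ (2 * μ) * g y) : HasExp μ J U v w := by
  have h1 := ((SymbolBound.rpow (2 * μ)).mul hg).mono (s := 2 * (J : ℝ)) (by linarith)
  refine (SymbolBound.add hf h1).congr ?_
  filter_upwards [self_mem_nhdsWithin] with y hy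
  have hy : 0 < y := hy
  rw [hU y hy, expSum, Finset.sum_add_distrib, mul_sub, Finset.mul_sum]
  have : ∑ i ∈ Finset.range J, y ^ (2 * μ) * (w i * y ^ (2 * (i : ℝ)))
      = ∑ i ∈ Finset.range J, w i * y ^ (2 * μ + 2 * (i : ℝ)) :=
    Finset.sum_congr rfl fun i _ => by rw [Real.rpow_add hy]; ring
  rw [this]; ring

end EvenExp

theorem HasExp.sum {μ : ℝ} {J : ℕ} {ι : Type*} (s : Finset ι) (c : ι → ℝ) {f : ι → ℝ → ℝ}
    {v w : ι → ℕ → ℝ} (h : ∀ i ∈ s, HasExp μ J (f i) (v i) (w i)) :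
    HasExp μ J (fun y => ∑ i ∈ s, c i * f i y) (fun j => ∑ i ∈ s, c i * v i j)
      (fun j => ∑ i ∈ s, c i * w i j) := by
  refine (SymbolBound.sum s fun i hi => SymbolBound.const_mul (c i) (h i hi)).congr
    (.of_forall fun y => ?_)
  simp only [expSum, mul_sub, Finset.sum_sub_distrib, Finset.mul_sum, Finset.sum_mul, mul_add]
  congr 1
  rw [Finset.sum_comm]
  refine Finset.sum_congr rfl fun j _ => ?_
  rw [← Finset.sum_add_distrib]
  exact Finset.sum_congr rfl fun i _ => by ring

theorem IsSmoothEven.evenExp {F : HalfCoord n → ℝ} (hF : IsSmoothEven F) (x : Bdry n) (J : ℕ) :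
    EvenExp J (fun y => F (x, y)) fun i =>
      iteratedDerivWithin (2 * i) (fun y => F (x, y)) (Ici 0) 0 / ((2 * i).factorial : ℝ) :=
  evenExp_of_contDiffOn (hF.1.comp (contDiff_prodMk_right x).contDiffOn
    fun _ hy => ⟨mem_univ _, hy⟩) (fun k hk => hF.2 x k hk) J

/-- A smooth function that is even in `y` on a whole line satisfies the evenness condition. -/
theorem iteratedDerivWithin_eq_zero_of_even {f : ℝ → ℝ} (hf : ContDiff ℝ ∞ f)
    (he : ∀ y, f (-y) = f y) {i : ℕ} (hi : Odd i) : iteratedDerivWithin i f (Ici 0) 0 = 0 := by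
  rw [iteratedDerivWithin_eq_iteratedDeriv (uniqueDiffOn_Ici 0)
    (hf.contDiffAt.of_le (by exact_mod_cast le_top)) (mem_Ici.2 le_rfl)]
  have h1 := iteratedDeriv_comp_neg i f 0
  simp only [he, neg_zero, hi.neg_one_pow, neg_smul, one_smul] at h1
  linarith

theorem isSmoothEven_of_even {F : HalfCoord n → ℝ} (hF : ContDiff ℝ ∞ F)
    (he : ∀ x y, F (x, -y) = F (x, y)) : IsSmoothEven F :=
  ⟨hF.contDiffOn, fun x _ hi => iteratedDerivWithin_eq_zero_of_even
    (hF.comp (contDiff_prodMk_right x)) (he x) hi⟩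

end

section

/-- The integrand of `besselInt`. -/
def besselKer (σ u s : ℝ) : ℝ := Real.exp (-s - u / s) * s ^ (σ - 1)

/-- `∫_0^∞ e^{-s-u/s} s^{σ-1} ds`, a modified Bessel function of the second kind in disguise. -/
def besselInt (σ u : ℝ) : ℝ := ∫ s in Ioi (0 : ℝ), besselKer σ u s

theorem besselKer_nonneg (σ u : ℝ) {s : ℝ} (hs : 0 < s) : 0 ≤ besselKer σ u s :=
  mul_nonneg (Real.exp_nonneg _) (Real.rpow_nonneg hs.le _)

theorem continuousOn_besselKer (σ u : ℝ) : ContinuousOn (besselKer σ u) (Ioi 0) := by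
  refine ContinuousOn.mul (Real.continuous_exp.comp_continuousOn ?_) ?_
  · exact continuousOn_id.neg.sub (continuousOn_const.div continuousOn_id fun s hs => ne_of_gt hs)
  · exact continuousOn_id.rpow_const fun s hs => Or.inl (ne_of_gt hs)

theorem integrableOn_besselKer (σ : ℝ) {u : ℝ} (hu : 0 < u) :
    IntegrableOn (besselKer σ u) (Ioi 0) := by
  obtain ⟨M, hM⟩ := exists_nat_gt (-σ)
  have h1 := (Real.GammaIntegral_convergent (s := σ + M) (by linarith)).const_mul
    ((M.factorial : ℝ) / u ^ M)
  refine Integrable.mono' h1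
    ((continuousOn_besselKer σ u).aestronglyMeasurable measurableSet_Ioi) ?_
  filter_upwards [ae_restrict_mem measurableSet_Ioi] with s hs
  have hs : 0 < s := hs
  rw [Real.norm_of_nonneg (besselKer_nonneg σ u hs)]
  have h2 := Real.pow_div_factorial_le_exp _ (div_pos hu hs).le M
  have h3 : Real.exp (-(u / s)) ≤ (M.factorial : ℝ) / u ^ M * s ^ M := by
    rw [Real.exp_neg, inv_le_comm₀ (Real.exp_pos _) (by positivity)]
    refine le_trans (le_of_eq ?_) h2
    rw [div_pow]; field_simp
  rw [besselKer, show σ + M - 1 = (σ - 1) + M by ring, Real.rpow_add hs, Real.rpow_natCast,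
    sub_eq_add_neg, Real.exp_add]
  have := mul_le_mul_of_nonneg_left h3
    (mul_nonneg (Real.exp_nonneg (-s)) (Real.rpow_nonneg hs.le (σ - 1)))
  nlinarith [this]

theorem integrableOn_besselKer_zero {σ : ℝ} (hσ : 0 < σ) : IntegrableOn (besselKer σ 0) (Ioi 0) := by
  refine (Real.GammaIntegral_convergent hσ).congr_fun (fun s _ => ?_) measurableSet_Ioi
  simp [besselKer]

theorem besselInt_zero (σ : ℝ) : besselInt σ 0 = ∫ s in Ioi (0 : ℝ), Real.exp (-s) * s ^ (σ - 1) := by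
  simp [besselInt, besselKer]

theorem besselKer_anti (σ : ℝ) {u v s : ℝ} (huv : u ≤ v) (hs : 0 < s) :
    besselKer σ v s ≤ besselKer σ u s := by
  refine mul_le_mul_of_nonneg_right (Real.exp_le_exp.2 ?_) (Real.rpow_nonneg hs.le _)
  have := div_le_div_of_nonneg_right huv hs.le
  linarith

theorem besselInt_anti (σ : ℝ) {u v : ℝ} (hu : 0 < u) (huv : u ≤ v) :
    besselInt σ v ≤ besselInt σ u :=
  setIntegral_mono_on (integrableOn_besselKer σ (hu.trans_le huv)) (integrableOn_besselKer σ hu)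
    measurableSet_Ioi fun _ hs => besselKer_anti σ huv hs

theorem besselInt_nonneg (σ u : ℝ) : 0 ≤ besselInt σ u :=
  setIntegral_nonneg measurableSet_Ioi fun _ hs => besselKer_nonneg σ u hs

theorem hasDerivAt_besselKer (σ u : ℝ) {s : ℝ} (hs : 0 < s) :
    HasDerivAt (fun u => besselKer σ u s) (-besselKer (σ - 1) u s) u := by
  have h1 : HasDerivAt (fun u => -s - u / s) (-(1 / s)) u :=
    ((hasDerivAt_id u).div_const s).const_sub (-s)
  have h2 := (h1.exp).mul_const (s ^ (σ - 1))
  refine h2.congr_deriv ?_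
  simp only [besselKer]
  rw [Real.rpow_sub_one hs.ne' (σ - 1)]
  ring

theorem hasDerivAt_besselInt (σ : ℝ) {u : ℝ} (hu : 0 < u) :
    HasDerivAt (besselInt σ) (-besselInt (σ - 1) u) u := by
  have := (hasDerivAt_integral_of_dominated_loc_of_deriv_le (μ := volume.restrict (Ioi (0 : ℝ)))
    (F := fun u s => besselKer σ u s) (F' := fun u s => -besselKer (σ - 1) u s)
    (bound := fun s => besselKer (σ - 1) (u / 2) s) (x₀ := u) (s := Ioi (u / 2))
    (Ioi_mem_nhds (by linarith))
    (.of_forall fun v =>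
      (continuousOn_besselKer σ v).aestronglyMeasurable measurableSet_Ioi)
    (integrableOn_besselKer σ hu)
    ((continuousOn_besselKer (σ - 1) u).aestronglyMeasurable measurableSet_Ioi).neg
    (by
      filter_upwards [ae_restrict_mem measurableSet_Ioi] with s hs v hv
      rw [norm_neg, Real.norm_of_nonneg (besselKer_nonneg _ _ hs)]
      exact besselKer_anti _ (le_of_lt hv) hs)
    (integrableOn_besselKer _ (by linarith))
    (by
      filter_upwards [ae_restrict_mem measurableSet_Ioi] with s hs v hv
      exact hasDerivAt_besselKer σ v hs)).2
  rwa [integral_neg] at this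

theorem besselInt_add_one (σ : ℝ) {u : ℝ} (hu : 0 < u) :
    besselInt (σ + 1) u = u * besselInt (σ - 1) u + σ * besselInt σ u := by
  set f : ℝ → ℝ := fun s => besselKer (σ + 1) u s with hf
  have hd : ∀ s ∈ Ioi (0 : ℝ), HasDerivAt f
      (u * besselKer (σ - 1) u s + σ * besselKer σ u s - besselKer (σ + 1) u s) s := fun s hs => by
    have hs : 0 < s := hs
    have h1 : HasDerivAt (fun s => -s - u / s) (-1 - -u / s ^ 2) s := by
      have := ((hasDerivAt_id s).neg).sub ((hasDerivAt_inv hs.ne').const_mul u)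
      exact this.congr_deriv (by ring)
    have h2 := h1.exp.mul (Real.hasDerivAt_rpow_const (p := σ + 1 - 1) (Or.inl hs.ne'))
    refine h2.congr_deriv ?_
    simp only [besselKer]
    rw [show σ + 1 - 1 = σ by ring, Real.rpow_sub_one hs.ne' (σ - 1), Real.rpow_sub_one hs.ne' σ]
    field_simp
    ring
  have hi0 : IntegrableOn (fun s => u * besselKer (σ - 1) u s + σ * besselKer σ u s) (Ioi 0) :=
    ((integrableOn_besselKer _ hu).const_mul u).add ((integrableOn_besselKer _ hu).const_mul σ)
  have hi : IntegrableOn (fun s => u * besselKer (σ - 1) u s + σ * besselKer σ u s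
      - besselKer (σ + 1) u s) (Ioi 0) := Integrable.sub hi0 (integrableOn_besselKer _ hu)
  have hb : ∀ τ : ℝ, Tendsto (fun s : ℝ => Real.exp (-s) * s ^ τ) atTop (𝓝 0) := fun τ => by
    have := tendsto_rpow_mul_exp_neg_mul_atTop_nhds_zero τ 1 one_pos
    refine this.congr fun s => ?_
    rw [mul_comm]; simp
  have h_inf : Tendsto f atTop (𝓝 0) := by
    refine tendsto_of_tendsto_of_tendsto_of_le_of_le' tendsto_const_nhds (hb σ)
      ?_ ?_
    · filter_upwards [eventually_gt_atTop 0] with s hs using besselKer_nonneg _ _ hs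
    · filter_upwards [eventually_gt_atTop 0] with s hs
      have := besselKer_anti (σ + 1) hu.le hs
      simpa [hf, besselKer] using this
  have h_zero : Tendsto f (𝓝[>] 0) (𝓝 0) := by
    have h1 : Tendsto (fun s : ℝ => Real.exp (-(u * s⁻¹)) * s⁻¹ ^ (-σ)) (𝓝[>] 0) (𝓝 0) := by
      have h2 := (tendsto_rpow_mul_exp_neg_mul_atTop_nhds_zero (-σ) u hu).comp
        tendsto_inv_nhdsGT_zero
      refine h2.congr fun s => ?_
      simp only [Function.comp]
      rw [mul_comm]; simp
    refine tendsto_of_tendsto_of_tendsto_of_le_of_le' tendsto_const_nhds h1 ?_ ?_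
    · filter_upwards [self_mem_nhdsWithin] with s hs using besselKer_nonneg _ _ hs
    · filter_upwards [self_mem_nhdsWithin] with s hs
      have hs : 0 < s := hs
      simp only [hf, besselKer]
      rw [Real.inv_rpow hs.le, Real.rpow_neg hs.le, inv_inv, show σ + 1 - 1 = σ by ring]
      refine mul_le_mul_of_nonneg_right (Real.exp_le_exp.2 ?_) (Real.rpow_nonneg hs.le _)
      rw [div_eq_mul_inv]; linarith
  have key := integral_Ioi_deriv_mul_eq_sub (u := f) (v := fun _ => 1) (v' := fun _ => 0) hd
    (fun s _ => hasDerivAt_const s 1) (hi.congr_fun (fun s _ => by simp) measurableSet_Ioi)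
    (h_zero.congr fun s => by simp) (h_inf.congr fun s => by simp)
  simp only [mul_one, mul_zero, add_zero] at key
  rw [integral_sub hi0 (integrableOn_besselKer _ hu),
    integral_add ((integrableOn_besselKer _ hu).const_mul u)
      ((integrableOn_besselKer _ hu).const_mul σ), integral_const_mul, integral_const_mul] at key
  simp only [besselInt]
  linarith

theorem tendsto_besselInt {σ : ℝ} (hσ : 0 < σ) :
    Tendsto (besselInt σ) (𝓝[>] 0) (𝓝 (Real.Gamma σ)) := by
  rw [Real.Gamma_eq_integral hσ, ← besselInt_zero]
  refine tendsto_integral_filter_of_dominated_convergence (besselKer σ 0)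
    (.of_forall fun v =>
      (continuousOn_besselKer σ v).aestronglyMeasurable measurableSet_Ioi) ?_
    (integrableOn_besselKer_zero hσ) ?_
  · filter_upwards [self_mem_nhdsWithin] with u hu
    filter_upwards [ae_restrict_mem measurableSet_Ioi] with s hs
    rw [Real.norm_of_nonneg (besselKer_nonneg _ _ hs)]
    exact besselKer_anti _ (le_of_lt hu) hs
  · filter_upwards [ae_restrict_mem measurableSet_Ioi] with s hs
    exact ((hasDerivAt_besselKer σ 0 hs).continuousAt.tendsto).mono_left nhdsWithin_le_nhds

theorem exists_besselInt_le_exp (σ : ℝ) :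
    ∃ C, ∀ u, 1 ≤ u → besselInt σ u ≤ C * Real.exp (-Real.sqrt u) := by
  refine ⟨∫ s in Ioi (0 : ℝ), Real.exp (-(s + 1 / s) / 2) * s ^ (σ - 1), fun u hu => ?_⟩
  have hi : IntegrableOn (fun s : ℝ => Real.exp (-(s + 1 / s) / 2) * s ^ (σ - 1)) (Ioi 0) := by
    have h1 := (integrableOn_besselKer σ (u := 1 / 4) (by norm_num))
    have h2 := (integrableOn_Ioi_comp_mul_left_iff (besselKer σ (1 / 4)) 0
      (a := 1 / 2) (by norm_num)).2 (by simpa using h1)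
    refine IntegrableOn.congr_fun (h2.const_mul ((1 / 2 : ℝ) ^ (σ - 1))⁻¹) (fun s hs => ?_) measurableSet_Ioi
    have hs : 0 < s := hs
    simp only [besselKer]
    rw [Real.mul_rpow (by norm_num) hs.le]
    have : ((1 / 2 : ℝ) ^ (σ - 1)) ≠ 0 := (Real.rpow_pos_of_pos (by norm_num) _).ne'
    have e : -(1 / 2 * s) - 1 / 4 / (1 / 2 * s) = -(s + 1 / s) / 2 := by field_simp; ring
    rw [e]
    field_simp
  rw [mul_comm, ← integral_const_mul]
  refine setIntegral_mono_on (integrableOn_besselKer σ (by linarith)) (hi.const_mul _)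
    measurableSet_Ioi fun s hs => ?_
  have hs : 0 < s := hs
  rw [← mul_assoc, ← Real.exp_add]
  refine mul_le_mul_of_nonneg_right (Real.exp_le_exp.2 ?_) (Real.rpow_nonneg hs.le _)
  have h1 : 2 * Real.sqrt u ≤ s + u / s := by
    have h2 : s + u / s - 2 * Real.sqrt u = (s - Real.sqrt u) ^ 2 / s := by
      field_simp
      nlinarith [Real.sq_sqrt (show (0 : ℝ) ≤ u by linarith)]
    have : 0 ≤ (s - Real.sqrt u) ^ 2 / s := by positivity
    linarith
  have h3 : 1 / s ≤ u / s := div_le_div_of_nonneg_right hu hs.le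
  linarith

end

section

/-- The coefficients of the confluent hypergeometric limit function `₀F₁(c; ·)`. -/
def hypCoef (c : ℝ) (k : ℕ) : ℝ := (∏ i ∈ Finset.range k, ((i : ℝ) + 1) * (c + i))⁻¹

/-- The confluent hypergeometric limit function `₀F₁(c; u)`. -/
def hyp (c u : ℝ) : ℝ := ∑' k, hypCoef c k * u ^ k

theorem hypCoef_succ (c : ℝ) (k : ℕ) :
    hypCoef c (k + 1) = hypCoef c k / (((k : ℝ) + 1) * (c + k)) := by
  rw [hypCoef, Finset.prod_range_succ, mul_inv, hypCoef, div_eq_mul_inv]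

section

variable {c : ℝ} (hc : ∀ i : ℕ, c + i ≠ 0)
include hc

theorem hypCoef_ne_zero (k : ℕ) : hypCoef c k ≠ 0 :=
  inv_ne_zero (Finset.prod_ne_zero_iff.2 fun i _ => mul_ne_zero (by positivity) (hc i))

theorem add_one_add_ne_zero (i : ℕ) : c + 1 + i ≠ 0 := by
  have := hc (i + 1); push_cast at this; rwa [add_assoc, add_comm 1]

theorem hypCoef_deriv (k : ℕ) : ((k : ℝ) + 1) * hypCoef c (k + 1) = hypCoef (c + 1) k / c := by
  have hc0 : c ≠ 0 := by simpa using hc 0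
  induction k with
  | zero => simp [hypCoef]
  | succ k ih =>
    have h1 := hc (k + 1)
    have h2 : (k : ℝ) + 1 ≠ 0 := by positivity
    have h3 : (k : ℝ) + 1 + 1 ≠ 0 := by positivity
    rw [hypCoef_succ, hypCoef_succ (c + 1), div_right_comm, ← ih]
    push_cast at h1 ⊢
    rw [show c + 1 + (k : ℝ) = c + (k + 1) by ring]
    field_simp

theorem hypCoef_contiguous (k : ℕ) :
    hypCoef c (k + 1) = hypCoef (c + 1) (k + 1) + hypCoef (c + 2) k / (c * (c + 1)) := by
  have hc0 : c ≠ 0 := by simpa using hc 0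
  have h1 := hc (k + 1)
  have h2 : (k : ℝ) + 1 ≠ 0 := by positivity
  have e1 := hypCoef_deriv hc k
  have e2 := hypCoef_deriv (add_one_add_ne_zero hc) k
  have e3 := hypCoef_succ (c + 1) k
  have h4 : c + 1 ≠ 0 := by simpa using hc 1
  push_cast at h1
  rw [show c + 1 + 1 = c + 2 by ring] at e2
  rw [show c + 1 + (k : ℝ) = c + (k + 1) by ring] at e3
  rw [mul_comm c, ← div_div, ← e2]
  have e4 : hypCoef c (k + 1) = hypCoef (c + 1) k / (c * (k + 1)) := by
    rw [eq_div_iff (by positivity)]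
    rw [eq_div_iff hc0] at e1
    linarith
  rw [e4, e3]
  field_simp

theorem summable_hypCoef (r : ℝ) : Summable fun k => ‖hypCoef c k‖ * |r| ^ k := by
  rcases eq_or_ne r 0 with rfl | hr
  · refine summable_of_ne_finset_zero (s := {0}) fun k hk => ?_
    simp [zero_pow (show k ≠ 0 by simpa using hk)]
  refine summable_of_ratio_test_tendsto_lt_one (l := 0) zero_lt_one
    (.of_forall fun k =>
      mul_ne_zero (norm_ne_zero_iff.2 (hypCoef_ne_zero hc k)) (by positivity)) ?_
  have h1 : Tendsto (fun k : ℕ => |r| * (((k : ℝ) + 1)⁻¹ * |c + k|⁻¹)) atTop (𝓝 (|r| * (0 * 0))) := by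
    refine Tendsto.const_mul _ (Tendsto.mul ?_ ?_)
    · exact tendsto_inv_atTop_zero.comp
        (tendsto_atTop_add_const_right _ _ tendsto_natCast_atTop_atTop)
    · exact tendsto_inv_atTop_zero.comp (tendsto_abs_atTop_atTop.comp
        (tendsto_atTop_add_const_left _ _ tendsto_natCast_atTop_atTop))
  rw [mul_zero, mul_zero] at h1
  refine h1.congr fun k => ?_
  have h2 := norm_ne_zero_iff.2 (hypCoef_ne_zero hc k)
  have h3 : |r| ≠ 0 := abs_ne_zero.2 hr
  have h4 : |c + k| ≠ 0 := abs_ne_zero.2 (hc k)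
  have h5 : ((k : ℝ) + 1) ≠ 0 := by positivity
  rw [hypCoef_succ, norm_div, Real.norm_eq_abs (((k : ℝ) + 1) * (c + k)), abs_mul,
    abs_of_pos (show (0 : ℝ) < k + 1 by positivity), norm_mul, norm_mul, norm_div, norm_mul,
    norm_norm, norm_pow, norm_pow, Real.norm_eq_abs |r|, abs_abs, Real.norm_eq_abs |c + k|, abs_abs,
    Real.norm_of_nonneg (show (0 : ℝ) ≤ k + 1 by positivity), pow_succ]
  field_simp

theorem summable_hyp (u : ℝ) : Summable fun k => hypCoef c k * u ^ k :=
  Summable.of_norm (by simpa [norm_mul, norm_pow] using summable_hypCoef hc u)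

theorem hasDerivAt_hyp (u : ℝ) : HasDerivAt (hyp c) (hyp (c + 1) u / c) u := by
  set r := |u| + 1
  have hr : |r| = r := abs_of_pos (by positivity)
  have hk : ∀ k : ℕ, (k : ℝ) * hypCoef c k * u ^ (k - 1) = match k with
      | 0 => 0 | k + 1 => hypCoef (c + 1) k / c * u ^ k := by
    rintro (_ | k)
    · simp
    · push_cast; rw [hypCoef_deriv hc]
  have hsum : Summable fun k : ℕ => ‖(k : ℝ) * hypCoef c k‖ * r ^ (k - 1) := by
    rw [← summable_nat_add_iff 1]
    have := (summable_hypCoef (add_one_add_ne_zero hc) r).mul_left (|c|⁻¹)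
    refine this.congr fun k => ?_
    have e := hypCoef_deriv hc k
    push_cast
    rw [e, norm_div, Real.norm_eq_abs c, hr]
    ring
  have h1 := hasDerivAt_tsum_of_isPreconnected (t := Metric.ball (0 : ℝ) r) (y₀ := u) (y := u)
    (g := fun k u => hypCoef c k * u ^ k) (g' := fun k u => (k : ℝ) * hypCoef c k * u ^ (k - 1))
    hsum Metric.isOpen_ball (convex_ball _ _).isPreconnected
    (fun k y _ => by
      have := (hasDerivAt_pow k y).const_mul (hypCoef c k)
      exact this.congr_deriv (by ring))
    (fun k y hy => by
      rw [norm_mul, norm_pow]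
      refine mul_le_mul_of_nonneg_left (pow_le_pow_left₀ (norm_nonneg _) ?_ _) (norm_nonneg _)
      exact (by simpa using hy : |y| < r).le)
    (by simp [r]) (summable_hyp hc u) (by simp [r])
  refine h1.congr_deriv ?_
  have hs2 : Summable fun k : ℕ => (k : ℝ) * hypCoef c k * u ^ (k - 1) := by
    refine Summable.of_norm_bounded hsum fun k => ?_
    rw [norm_mul, norm_pow]
    refine mul_le_mul_of_nonneg_left (pow_le_pow_left₀ (norm_nonneg _) ?_ _) (norm_nonneg _)
    simp [r]
  rw [hs2.tsum_eq_zero_add, hyp, ← tsum_div_const]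
  simp only [hk, zero_add]
  exact tsum_congr fun k => by ring

theorem hyp_eq (u : ℝ) : hyp c u = hyp (c + 1) u + u * (hyp (c + 2) u / (c * (c + 1))) := by
  have h1 := add_one_add_ne_zero hc
  have h2 : ∀ i : ℕ, c + 2 + i ≠ 0 := fun i => by
    have := add_one_add_ne_zero h1 i; rwa [show c + 1 + 1 = c + 2 by ring] at this
  rw [hyp, (summable_hyp hc u).tsum_eq_zero_add, hyp, (summable_hyp h1 u).tsum_eq_zero_add, hyp,
    ← tsum_div_const, ← tsum_mul_left]
  rw [add_assoc, ← Summable.tsum_add ((summable_nat_add_iff 1).2 (summable_hyp h1 u))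
    (((summable_hyp h2 u).div_const _).mul_left _)]
  have e : hypCoef c 0 = hypCoef (c + 1) 0 := by simp [hypCoef]
  rw [e, add_right_inj]
  refine tsum_congr fun k => ?_
  rw [hypCoef_contiguous hc]; ring

theorem hyp_ode (u : ℝ) :
    u * (hyp (c + 2) u / (c + 1) / c) + c * (hyp (c + 1) u / c) = hyp c u := by
  have hc0 : c ≠ 0 := by simpa using hc 0
  rw [hyp_eq hc u, mul_div_cancel₀ _ hc0, div_div, mul_comm (c + 1)]; ring

end

theorem contDiff_hyp {c : ℝ} (hc : ∀ i : ℕ, c + i ≠ 0) : ContDiff ℝ ∞ (hyp c) := by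
  rw [contDiff_infty]
  intro m
  induction m generalizing c with
  | zero => exact contDiff_zero.2 (continuous_iff_continuousAt.2 fun u =>
      (hasDerivAt_hyp hc u).continuousAt)
  | succ m ih =>
    rw [show ((m + 1 : ℕ) : WithTop ℕ∞) = m + 1 by norm_cast, contDiff_succ_iff_deriv]
    refine ⟨fun u => (hasDerivAt_hyp hc u).differentiableAt, by simp, ?_⟩
    rw [show deriv (hyp c) = fun u => hyp (c + 1) u / c from
      funext fun u => (hasDerivAt_hyp hc u).deriv]
    exact (ih (add_one_add_ne_zero hc)).div_const c

theorem hyp_zero (c : ℝ) : hyp c 0 = 1 := by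
  rw [hyp, tsum_eq_single 0 (fun k hk => by simp [hk])]
  simp [hypCoef]

theorem exists_const_of_hasDerivAt_zero {f : ℝ → ℝ} (h : ∀ u, 0 < u → HasDerivAt f 0 u) :
    ∃ C, ∀ u, 0 < u → f u = C := by
  obtain ⟨C, hC⟩ := isOpen_Ioi.exists_is_const_of_deriv_eq_zero (s := Ioi (0 : ℝ))
    (convex_Ioi 0).isPreconnected
    (fun u hu => (h u hu).differentiableAt.differentiableWithinAt) (fun u hu => (h u hu).deriv)
  exact ⟨C, hC⟩

/-- The Wronskian of two solutions of `u f'' + c f' = f`. -/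
theorem exists_wronskian_const {c : ℝ} {f f' f'' g g' g'' : ℝ → ℝ}
    (hf : ∀ u, 0 < u → HasDerivAt f (f' u) u) (hf' : ∀ u, 0 < u → HasDerivAt f' (f'' u) u)
    (hg : ∀ u, 0 < u → HasDerivAt g (g' u) u) (hg' : ∀ u, 0 < u → HasDerivAt g' (g'' u) u)
    (h1 : ∀ u, 0 < u → u * f'' u + c * f' u = f u) (h2 : ∀ u, 0 < u → u * g'' u + c * g' u = g u) :
    ∃ C, ∀ u, 0 < u → u ^ c * (f u * g' u - f' u * g u) = C := by
  refine exists_const_of_hasDerivAt_zero fun u hu => ?_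
  have h3 := (Real.hasDerivAt_rpow_const (p := c) (Or.inl hu.ne')).mul
    (((hf u hu).mul (hg' u hu)).sub ((hf' u hu).mul (hg u hu)))
  refine h3.congr_deriv ?_
  simp only [Pi.mul_apply, Pi.sub_apply]
  rw [Real.rpow_sub_one hu.ne', ← h1 u hu, ← h2 u hu]
  field_simp
  ring

section decomposition

variable {σ : ℝ} (hσ : 0 < σ) (hσN : ∀ N : ℕ, σ ≠ N)

include hσN in
theorem one_sub_add_ne_zero (i : ℕ) : 1 - σ + i ≠ 0 := fun h =>
  hσN (i + 1) (by push_cast; linarith)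

include hσ in
theorem one_add_add_ne_zero (i : ℕ) : 1 + σ + i ≠ 0 := by positivity

include hσ hσN in
theorem exists_besselInt_eq :
    ∃ κ, ∀ u, 0 < u →
      besselInt σ u = Real.Gamma σ * hyp (1 - σ) u + κ * (u ^ σ * hyp (1 + σ) u) := by
  have hA := one_sub_add_ne_zero hσN
  have hB := one_add_add_ne_zero hσ
  have hA' := add_one_add_ne_zero hA
  have hB' := add_one_add_ne_zero hB
  set a := hyp (1 - σ)
  set b := hyp (1 + σ)
  set a' : ℝ → ℝ := fun u => hyp (1 - σ + 1) u / (1 - σ)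
  set a'' : ℝ → ℝ := fun u => hyp (1 - σ + 2) u / (1 - σ + 1) / (1 - σ)
  set b' : ℝ → ℝ := fun u => hyp (1 + σ + 1) u / (1 + σ)
  set b'' : ℝ → ℝ := fun u => hyp (1 + σ + 2) u / (1 + σ + 1) / (1 + σ)
  have ha : ∀ u, HasDerivAt a (a' u) u := hasDerivAt_hyp hA
  have ha' : ∀ u, HasDerivAt a' (a'' u) u := fun u => by
    have := (hasDerivAt_hyp hA' u).div_const (1 - σ)
    rwa [show 1 - σ + 1 + 1 = 1 - σ + 2 by ring] at this
  have hb : ∀ u, HasDerivAt b (b' u) u := hasDerivAt_hyp hB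
  have hb' : ∀ u, HasDerivAt b' (b'' u) u := fun u => by
    have := (hasDerivAt_hyp hB' u).div_const (1 + σ)
    rwa [show 1 + σ + 1 + 1 = 1 + σ + 2 by ring] at this
  have oa : ∀ u, u * a'' u + (1 - σ) * a' u = a u := hyp_ode hA
  have ob : ∀ u, u * b'' u + (1 + σ) * b' u = b u := hyp_ode hB
  set d : ℝ → ℝ := fun u => u ^ σ * b u
  set d' : ℝ → ℝ := fun u => σ * u ^ (σ - 1) * b u + u ^ σ * b' u
  set d'' : ℝ → ℝ := fun u => σ * ((σ - 1) * u ^ (σ - 1 - 1)) * b u + 2 * (σ * u ^ (σ - 1)) * b' u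
    + u ^ σ * b'' u
  have hp : ∀ (s u : ℝ), 0 < u → HasDerivAt (fun u : ℝ => u ^ s) (s * u ^ (s - 1)) u := fun s u hu =>
    Real.hasDerivAt_rpow_const (Or.inl hu.ne')
  have hd : ∀ u, 0 < u → HasDerivAt d (d' u) u := fun u hu => (hp σ u hu).mul (hb u)
  have hd' : ∀ u, 0 < u → HasDerivAt d' (d'' u) u := fun u hu =>
    ((((hp (σ - 1) u hu).const_mul σ).mul (hb u)).add ((hp σ u hu).mul (hb' u))).congr_deriv (by
      simp only [d'']; ring)
  have od : ∀ u, 0 < u → u * d'' u + (1 - σ) * d' u = d u := fun u hu => by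
    simp only [d, d', d'', ← ob u]
    rw [Real.rpow_sub_one hu.ne' (σ - 1), Real.rpow_sub_one hu.ne' σ]
    field_simp
    ring
  set g := besselInt σ
  set g' : ℝ → ℝ := fun u => -besselInt (σ - 1) u
  set g'' : ℝ → ℝ := fun u => besselInt (σ - 1 - 1) u
  have hg : ∀ u, 0 < u → HasDerivAt g (g' u) u := fun u hu => hasDerivAt_besselInt σ hu
  have hg' : ∀ u, 0 < u → HasDerivAt g' (g'' u) u := fun u hu => by
    have := (hasDerivAt_besselInt (σ - 1) hu).neg
    rwa [neg_neg] at this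
  have og : ∀ u, 0 < u → u * g'' u + (1 - σ) * g' u = g u := fun u hu => by
    have := besselInt_add_one (σ - 1) hu
    rw [sub_add_cancel] at this
    simp only [g, g', g'', this]; ring
  obtain ⟨C0, h0⟩ := exists_wronskian_const (fun u _ => ha u) (fun u _ => ha' u) hd hd'
    (fun u _ => oa u) od
  obtain ⟨C1, h1⟩ := exists_wronskian_const hg hg' hd hd' og od
  obtain ⟨C2, h2⟩ := exists_wronskian_const (fun u _ => ha u) (fun u _ => ha' u) hg hg'
    (fun u _ => oa u) og
  have hC0 : C0 = σ := by
    have e : ∀ u, 0 < u → σ * (a u * b u) + u * (a u * b' u - a' u * b u) = C0 := fun u hu => by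
      rw [← h0 u hu]
      simp only [d, d']
      rw [Real.rpow_sub_one hu.ne', Real.rpow_sub hu, Real.rpow_one]
      have := (Real.rpow_pos_of_pos hu σ).ne'
      field_simp
      ring
    have hc : ContinuousAt (fun u => σ * (a u * b u) + u * (a u * b' u - a' u * b u)) 0 := by
      have c1 := (ha 0).continuousAt
      have c2 := (hb 0).continuousAt
      have c3 := (ha' 0).continuousAt
      have c4 := (hb' 0).continuousAt
      fun_prop
    have ht := hc.tendsto.mono_left (nhdsWithin_le_nhds (s := Ioi 0))
    have ht2 : Tendsto (fun u => σ * (a u * b u) + u * (a u * b' u - a' u * b u)) (𝓝[>] 0)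
        (𝓝 C0) := tendsto_const_nhds.congr' (by
      filter_upwards [self_mem_nhdsWithin] with u hu using (e u hu).symm)
    have := tendsto_nhds_unique ht2 ht
    simpa [a, b, hyp_zero] using this
  have key : ∀ u, 0 < u → g u = C1 / σ * a u + C2 / σ * d u := fun u hu => by
    have hu' := (Real.rpow_pos_of_pos hu (1 - σ)).ne'
    have : u ^ (1 - σ) * (g u * (a u * d' u - a' u * d u))
        = u ^ (1 - σ) * (a u * (g u * d' u - g' u * d u) + d u * (a u * g' u - a' u * g u)) := by
      ring
    have e : g u * C0 = a u * C1 + d u * C2 := by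
      rw [← h0 u hu, ← h1 u hu, ← h2 u hu]; linarith
    rw [hC0] at e
    field_simp
    linarith
  have hA1 : C1 / σ = Real.Gamma σ := by
    have t1 : Tendsto (fun u => C1 / σ * a u + C2 / σ * d u) (𝓝[>] 0) (𝓝 (C1 / σ * 1 + C2 / σ * (0 * 1))) := by
      have ca := (ha 0).continuousAt.tendsto.mono_left (nhdsWithin_le_nhds (s := Ioi 0))
      have cb := (hb 0).continuousAt.tendsto.mono_left (nhdsWithin_le_nhds (s := Ioi 0))
      simp only [a, b, hyp_zero] at ca cb
      exact (ca.const_mul _).add (((tendsto_rpow_zero_right hσ).mul cb).const_mul _)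
    have t2 := (tendsto_besselInt hσ).congr' (f₂ := fun u => C1 / σ * a u + C2 / σ * d u) (by
      filter_upwards [self_mem_nhdsWithin] with u hu using key u hu)
    have := tendsto_nhds_unique t1 t2
    simpa using this
  exact ⟨C2 / σ, fun u hu => by rw [← hA1]; exact key u hu⟩

end decomposition

end

section

/-- All functions of the family, and their derivatives of order at most `l`, are `O(y^N)` for
`y > 1`, uniformly. -/
def UnifBound {ι : Type*} : ℕ → ℝ → (ι → ℝ → ℝ) → Prop
  | 0, N, g => ∃ C, ∀ i y, 1 < y → |g i y| ≤ C * y ^ N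
  | l + 1, N, g => (∃ C, ∀ i y, 1 < y → |g i y| ≤ C * y ^ N) ∧
      (∀ i y, 1 < y → DifferentiableAt ℝ (g i) y) ∧ UnifBound l N fun i => deriv (g i)

namespace UnifBound

variable {ι : Type*} {l : ℕ} {M N : ℝ} {f g : ι → ℝ → ℝ}

theorem bound (h : UnifBound l N g) : ∃ C, ∀ i y, 1 < y → |g i y| ≤ C * y ^ N := by
  cases l with
  | zero => exact h
  | succ l => exact h.1

theorem bound_nonneg (h : UnifBound l N g) :
    ∃ C, 0 ≤ C ∧ ∀ i y, 1 < y → |g i y| ≤ C * y ^ N := by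
  obtain ⟨C, hC⟩ := h.bound
  refine ⟨max C 0, le_max_right _ _, fun i y hy => (hC i y hy).trans ?_⟩
  exact mul_le_mul_of_nonneg_right (le_max_left _ _) (Real.rpow_nonneg (by linarith) _)

theorem congr (h : UnifBound l N f) (hfg : ∀ i y, 1 < y → f i y = g i y) : UnifBound l N g := by
  have hb : ∀ {f g : ι → ℝ → ℝ}, (∀ i y, 1 < y → f i y = g i y) →
      (∃ C, ∀ i y, 1 < y → |f i y| ≤ C * y ^ N) → ∃ C, ∀ i y, 1 < y → |g i y| ≤ C * y ^ N := by
    rintro f g hfg ⟨C, hC⟩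
    exact ⟨C, fun i y hy => hfg i y hy ▸ hC i y hy⟩
  induction l generalizing f g with
  | zero => exact hb hfg h
  | succ l ih =>
    have he : ∀ i y, 1 < y → f i =ᶠ[𝓝 y] g i := fun i y hy => by
      filter_upwards [Ioi_mem_nhds hy] with z hz using hfg i z hz
    exact ⟨hb hfg h.1, fun i y hy => (h.2.1 i y hy).congr_of_eventuallyEq (he i y hy).symm,
      ih h.2.2 fun i y hy => (he i y hy).deriv_eq⟩

theorem mono (h : UnifBound l M f) (hMN : M ≤ N) : UnifBound l N f := by
  have hb : ∀ {f : ι → ℝ → ℝ}, (∃ C, 0 ≤ C ∧ ∀ i y, 1 < y → |f i y| ≤ C * y ^ M) →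
      ∃ C, ∀ i y, 1 < y → |f i y| ≤ C * y ^ N := by
    rintro f ⟨C, hC0, hC⟩
    exact ⟨C, fun i y hy => (hC i y hy).trans
      (mul_le_mul_of_nonneg_left (Real.rpow_le_rpow_of_exponent_le hy.le hMN) hC0)⟩
  induction l generalizing f with
  | zero => exact hb (bound_nonneg (l := 0) h)
  | succ l ih => exact ⟨hb h.bound_nonneg, h.2.1, ih h.2.2⟩

theorem of_succ (h : UnifBound (l + 1) N f) : UnifBound l N f := by
  induction l generalizing f with
  | zero => exact h.1
  | succ l ih => exact ⟨h.1, h.2.1, ih h.2.2⟩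

theorem add (hf : UnifBound l N f) (hg : UnifBound l N g) :
    UnifBound l N fun i y => f i y + g i y := by
  have hb : ∀ {f g : ι → ℝ → ℝ}, (∃ C, ∀ i y, 1 < y → |f i y| ≤ C * y ^ N) →
      (∃ C, ∀ i y, 1 < y → |g i y| ≤ C * y ^ N) →
      ∃ C, ∀ i y, 1 < y → |f i y + g i y| ≤ C * y ^ N := by
    rintro f g ⟨C, hC⟩ ⟨D, hD⟩
    refine ⟨C + D, fun i y hy => (abs_add_le _ _).trans ?_⟩
    rw [add_mul]
    exact add_le_add (hC i y hy) (hD i y hy)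
  induction l generalizing f g with
  | zero => exact hb hf hg
  | succ l ih =>
    refine ⟨hb hf.1 hg.1, fun i y hy => (hf.2.1 i y hy).add (hg.2.1 i y hy),
      (ih hf.2.2 hg.2.2).congr fun i y hy => ?_⟩
    exact ((hf.2.1 i y hy).hasDerivAt.add (hg.2.1 i y hy).hasDerivAt).deriv.symm

theorem mul (hf : UnifBound l M f) (hg : UnifBound l N g) :
    UnifBound l (M + N) fun i y => f i y * g i y := by
  have hb : ∀ {f g : ι → ℝ → ℝ}, (∃ C, 0 ≤ C ∧ ∀ i y, 1 < y → |f i y| ≤ C * y ^ M) →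
      (∃ C, ∀ i y, 1 < y → |g i y| ≤ C * y ^ N) →
      ∃ C, ∀ i y, 1 < y → |f i y * g i y| ≤ C * y ^ (M + N) := by
    rintro f g ⟨C, hC0, hC⟩ ⟨D, hD⟩
    refine ⟨C * D, fun i y hy => ?_⟩
    have hy0 : 0 < y := by linarith
    rw [abs_mul, Real.rpow_add hy0]
    calc |f i y| * |g i y| ≤ (C * y ^ M) * (D * y ^ N) :=
          mul_le_mul (hC i y hy) (hD i y hy) (abs_nonneg _)
            (mul_nonneg hC0 (Real.rpow_nonneg hy0.le _))
      _ = _ := by ring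
  induction l generalizing f g with
  | zero => exact hb (bound_nonneg (l := 0) hf) hg
  | succ l ih =>
    refine ⟨hb hf.bound_nonneg hg.1, fun i y hy => (hf.2.1 i y hy).mul (hg.2.1 i y hy),
      ((ih hf.2.2 hg.of_succ).add (ih hf.of_succ hg.2.2)).congr fun i y hy => ?_⟩
    exact ((hf.2.1 i y hy).hasDerivAt.mul (hg.2.1 i y hy).hasDerivAt).deriv.symm

theorem zero_fun : UnifBound l N fun (_ : ι) _ => 0 := by
  have hb : ∃ C : ℝ, ∀ (i : ι) y, 1 < y → |(0 : ℝ)| ≤ C * y ^ N := ⟨0, fun _ _ _ => by simp⟩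
  induction l with
  | zero => exact hb
  | succ l ih => exact ⟨hb, fun _ _ _ => differentiableAt_const _, ih.congr fun _ _ _ => by simp⟩

theorem const (c : ℝ) : UnifBound l 0 fun (_ : ι) _ => c := by
  have hb : ∃ C : ℝ, ∀ (i : ι) y, 1 < y → |c| ≤ C * y ^ (0 : ℝ) := ⟨|c|, fun _ _ _ => by simp⟩
  cases l with
  | zero => exact hb
  | succ l => exact ⟨hb, fun _ _ _ => differentiableAt_const _, zero_fun.congr fun _ _ _ => by simp⟩

theorem const_mul (c : ℝ) (hf : UnifBound l N f) : UnifBound l N fun i y => c * f i y := by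
  simpa using (const (ι := ι) (l := l) c).mul hf

theorem rpow (s : ℝ) : UnifBound l s fun (_ : ι) y => y ^ s := by
  have hb : ∀ s : ℝ, ∃ C : ℝ, ∀ (i : ι) y, 1 < y → |y ^ s| ≤ C * y ^ s := fun s =>
    ⟨1, fun _ y hy => by rw [one_mul, abs_of_nonneg (Real.rpow_nonneg (by linarith) _)]⟩
  induction l generalizing s with
  | zero => exact hb s
  | succ l ih =>
    refine ⟨hb s, fun _ y hy => Real.differentiableAt_rpow_const_of_ne _ (by linarith),
      (((ih (s - 1)).const_mul s).mono (by linarith)).congr fun _ y hy => ?_⟩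
    exact (Real.hasDerivAt_rpow_const (Or.inl (by linarith))).deriv.symm

theorem besselOp (m : ℝ) (h : UnifBound (l + 2) N f) :
    UnifBound l N fun i => besselOp m (f i) := by
  have h1 : UnifBound l N fun i => deriv (deriv (f i)) := h.2.2.2.2
  have h2 : UnifBound l N fun i y => m * (y ^ (-1 : ℝ) * deriv (f i) y) :=
    ((((rpow (-1)).mul h.2.2.of_succ)).mono (by linarith)).const_mul m
  refine (h1.add h2).congr fun i y _ => ?_
  rw [_root_.besselOp, Real.rpow_neg_one, mul_assoc]

theorem iteratedDeriv {g : ℝ → ℝ} (h : UnifBound l N fun _ : Unit => g) :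
    ∃ C, ∀ y, 1 < y → |iteratedDeriv l g y| ≤ C * y ^ N := by
  induction l generalizing g with
  | zero =>
    obtain ⟨C, hC⟩ := h
    exact ⟨C, fun y hy => by simpa using hC () y hy⟩
  | succ l ih =>
    obtain ⟨C, hC⟩ := ih h.2.2
    exact ⟨C, fun y hy => by rw [iteratedDeriv_succ']; exact hC y hy⟩

end UnifBound

theorem exists_besselInt_bound (σ a N : ℝ) {c : ℝ} (hc : 0 < c) :
    ∃ C, ∀ y, 1 < y → |y ^ a * besselInt σ ((c * y) ^ 2 / 4)| ≤ C * y ^ N := by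
  obtain ⟨C, hC⟩ := exists_besselInt_le_exp σ
  obtain ⟨M, hM⟩ := exists_nat_ge (a - N)
  have h0 : 0 ≤ C := by
    have := (besselInt_nonneg σ 1).trans (hC 1 le_rfl)
    exact nonneg_of_mul_nonneg_left this (Real.exp_pos _)
  have h1 : ∃ D, 0 ≤ D ∧ ∀ y, 1 < y → besselInt σ ((c * y) ^ 2 / 4) ≤ D * Real.exp (-(c * y / 2)) := by
    refine ⟨max C (besselInt σ (c ^ 2 / 4) * Real.exp 1), le_max_of_le_left h0, fun y hy => ?_⟩
    have hy0 : 0 < y := by linarith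
    rcases le_or_gt 1 ((c * y) ^ 2 / 4) with h | h
    · refine (hC _ h).trans ?_
      have e : Real.sqrt ((c * y) ^ 2 / 4) = c * y / 2 := by
        rw [show (c * y) ^ 2 / 4 = (c * y / 2) ^ 2 by ring, Real.sqrt_sq (by positivity)]
      rw [e]
      exact mul_le_mul_of_nonneg_right (le_max_left _ _) (Real.exp_nonneg _)
    · have h2 : c * y / 2 < 1 := by
        have : (c * y / 2) ^ 2 < 1 ^ 2 := by linarith [show (c * y / 2) ^ 2 = (c * y) ^ 2 / 4 by ring]
        exact lt_of_pow_lt_pow_left₀ 2 zero_le_one this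
      have h3 : besselInt σ ((c * y) ^ 2 / 4) ≤ besselInt σ (c ^ 2 / 4) := by
        refine besselInt_anti σ (by positivity) ?_
        have : c * 1 ≤ c * y := mul_le_mul_of_nonneg_left hy.le hc.le
        have := pow_le_pow_left₀ (by positivity) this 2
        linarith [show (c * 1) ^ 2 = c ^ 2 by ring]
      refine h3.trans ?_
      refine le_trans ?_ (mul_le_mul_of_nonneg_right (le_max_right _ _) (Real.exp_nonneg _))
      rw [mul_assoc, ← Real.exp_add]
      refine le_mul_of_one_le_right (besselInt_nonneg _ _) (Real.one_le_exp (by linarith))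
  obtain ⟨D, hD0, hD⟩ := h1
  refine ⟨D * ((M.factorial : ℝ) * (2 / c) ^ M), fun y hy => ?_⟩
  have hy0 : 0 < y := by linarith
  rw [abs_of_nonneg (mul_nonneg (Real.rpow_nonneg hy0.le _) (besselInt_nonneg _ _))]
  have h4 := Real.pow_div_factorial_le_exp (c * y / 2) (by positivity) M
  have h5 : Real.exp (-(c * y / 2)) ≤ (M.factorial : ℝ) * (2 / c) ^ M * y ^ (-(M : ℝ)) := by
    rw [Real.exp_neg, inv_le_comm₀ (Real.exp_pos _) (by positivity)]
    refine le_trans (le_of_eq ?_) h4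
    rw [Real.rpow_neg hy0.le, Real.rpow_natCast]
    simp only [div_pow, mul_pow]
    field_simp
  calc y ^ a * besselInt σ ((c * y) ^ 2 / 4)
      ≤ y ^ a * (D * ((M.factorial : ℝ) * (2 / c) ^ M * y ^ (-(M : ℝ)))) :=
        mul_le_mul_of_nonneg_left ((hD y hy).trans (mul_le_mul_of_nonneg_left h5 hD0))
          (Real.rpow_nonneg hy0.le _)
    _ = D * ((M.factorial : ℝ) * (2 / c) ^ M) * y ^ (a - M) := by
        rw [sub_eq_add_neg, Real.rpow_add hy0]; ring
    _ ≤ _ := mul_le_mul_of_nonneg_left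
        (Real.rpow_le_rpow_of_exponent_le hy.le (by linarith)) (by positivity)

theorem hasDerivAt_besselInt_sq (σ : ℝ) {c y : ℝ} (hc : c ≠ 0) (hy : y ≠ 0) :
    HasDerivAt (fun y => besselInt σ ((c * y) ^ 2 / 4))
      (-(c ^ 2 * y / 2) * besselInt (σ - 1) ((c * y) ^ 2 / 4)) y := by
  have h1 : HasDerivAt (fun y : ℝ => (c * y) ^ 2 / 4) (c ^ 2 * y / 2) y := by
    have := ((((hasDerivAt_id y).const_mul c).pow 2).div_const 4)
    refine this.congr_deriv ?_
    simp; ring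
  have h2 := (hasDerivAt_besselInt σ (u := (c * y) ^ 2 / 4) (by positivity)).comp y h1
  exact h2.congr_deriv (by ring)

theorem unifBound_besselInt {ι : Type*} (l : ℕ) (N : ℝ) {c : ℝ} (hc : 0 < c) :
    ∀ σ a : ℝ, UnifBound l N fun (_ : ι) y => y ^ a * besselInt σ ((c * y) ^ 2 / 4) := by
  have hb : ∀ σ a : ℝ, ∃ C, ∀ (_ : ι) y, 1 < y →
      |y ^ a * besselInt σ ((c * y) ^ 2 / 4)| ≤ C * y ^ N := fun σ a => by
    obtain ⟨C, hC⟩ := exists_besselInt_bound σ a N hc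
    exact ⟨C, fun _ => hC⟩
  induction l with
  | zero => exact hb
  | succ l ih =>
    intro σ a
    have hd : ∀ y : ℝ, 1 < y → HasDerivAt (fun y => y ^ a * besselInt σ ((c * y) ^ 2 / 4))
        (a * (y ^ (a - 1) * besselInt σ ((c * y) ^ 2 / 4))
          + -(c ^ 2 / 2) * (y ^ (a + 1) * besselInt (σ - 1) ((c * y) ^ 2 / 4))) y := fun y hy => by
      have hy0 : 0 < y := by linarith
      refine ((Real.hasDerivAt_rpow_const (Or.inl hy0.ne')).mul
        (hasDerivAt_besselInt_sq σ hc.ne' hy0.ne')).congr_deriv ?_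
      rw [Real.rpow_add_one hy0.ne']; ring
    exact ⟨hb σ a, fun _ y hy => (hd y hy).differentiableAt,
      (((ih σ (a - 1)).const_mul a).add ((ih (σ - 1) (a + 1)).const_mul _)).congr
        fun _ y hy => (hd y hy).deriv.symm⟩

theorem contDiffOn_besselInt (σ : ℝ) : ContDiffOn ℝ ∞ (besselInt σ) (Ioi 0) := by
  rw [contDiffOn_infty]
  intro m
  induction m generalizing σ with
  | zero => exact contDiffOn_zero.2 fun u hu =>
      (hasDerivAt_besselInt σ hu).continuousAt.continuousWithinAt
  | succ m ih =>
    rw [show ((m + 1 : ℕ) : WithTop ℕ∞) = m + 1 by norm_cast,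
      contDiffOn_succ_iff_deriv_of_isOpen isOpen_Ioi]
    exact ⟨fun u hu => (hasDerivAt_besselInt σ hu).differentiableAt.differentiableWithinAt, by simp,
      (ih (σ - 1)).neg.congr fun u hu => (hasDerivAt_besselInt σ hu).deriv⟩

theorem besselOp_besselInt (σ : ℝ) {c y : ℝ} (hc : 0 < c) (hy : 0 < y) :
    besselOp (1 - 2 * σ) (fun y => besselInt σ ((c * y) ^ 2 / 4)) y
      = c ^ 2 * besselInt σ ((c * y) ^ 2 / 4) := by
  have h1 : deriv (fun y => besselInt σ ((c * y) ^ 2 / 4)) =ᶠ[𝓝 y]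
      fun y => -(c ^ 2 * y / 2) * besselInt (σ - 1) ((c * y) ^ 2 / 4) := by
    filter_upwards [Ioi_mem_nhds hy] with z hz
    exact (hasDerivAt_besselInt_sq σ hc.ne' (ne_of_gt hz)).deriv
  have h2 : HasDerivAt (fun y => -(c ^ 2 * y / 2) * besselInt (σ - 1) ((c * y) ^ 2 / 4)) _ y :=
    ((((hasDerivAt_id y).const_mul (c ^ 2)).div_const 2).neg).mul
      (hasDerivAt_besselInt_sq (σ - 1) hc.ne' hy.ne')
  have h3 := besselInt_add_one (σ - 1) (u := (c * y) ^ 2 / 4) (by positivity)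
  rw [sub_add_cancel] at h3
  rw [besselOp, h1.deriv_eq, h2.deriv, h1.self_of_nhds, h3]
  simp only [Pi.neg_apply, id]
  field_simp
  ring

/-- The normalized solution of `φ'' + (1 - 2σ) t⁻¹ φ' = φ` that decays at infinity. -/
def besselFun (σ t : ℝ) : ℝ := (Real.Gamma σ)⁻¹ * besselInt σ (t ^ 2 / 4)

theorem besselFun_neg (σ t : ℝ) : besselFun σ (-t) = besselFun σ t := by simp [besselFun]

/-- Smooth functions on the line all of whose derivatives are bounded. -/
def BoundedDerivs (f : ℝ → ℝ) : Prop :=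
  ContDiff ℝ ∞ f ∧ ∀ k, ∃ C, ∀ t, |iteratedDeriv k f t| ≤ C

theorem boundedDerivs_of_even {f : ℝ → ℝ} (hf : ContDiff ℝ ∞ f) (he : ∀ t, f (-t) = f t)
    (hb : ∀ l, UnifBound l 0 fun _ : Unit => f) : BoundedDerivs f := by
  refine ⟨hf, fun k => ?_⟩
  obtain ⟨C, hC⟩ := (hb k).iteratedDeriv
  obtain ⟨D, hD⟩ := (isCompact_Icc (a := (-1 : ℝ)) (b := 1)).exists_bound_of_continuousOn
    (hf.continuous_iteratedDeriv k (by exact_mod_cast le_top)).continuousOn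
  refine ⟨max C D, fun t => ?_⟩
  have hn : |iteratedDeriv k f (-t)| = |iteratedDeriv k f t| := by
    have h1 := iteratedDeriv_comp_neg k f t
    simp only [he] at h1
    rw [h1, smul_eq_mul, abs_mul]; simp
  rcases le_or_gt t 1 with h | h
  · rcases le_or_gt (-1) t with h' | h'
    · exact (hD t ⟨h', h⟩).trans (le_max_right _ _)
    · have := hC (-t) (by linarith)
      rw [hn, Real.rpow_zero, mul_one] at this
      exact this.trans (le_max_left _ _)
  · have := hC t h
    rw [Real.rpow_zero, mul_one] at this
    exact this.trans (le_max_left _ _)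

theorem exists_besselFun_eq {σ : ℝ} (hσ : 0 < σ) (hσN : ∀ N : ℕ, σ ≠ N) :
    ∃ E β : ℝ → ℝ, BoundedDerivs E ∧ BoundedDerivs β ∧ (∀ t, E (-t) = E t) ∧
      (∀ t, β (-t) = β t) ∧ E 0 = 1 ∧
      ∀ t, 0 < t → besselFun σ t = E t + t ^ (2 * σ) * β t := by
  obtain ⟨κ, hκ⟩ := exists_besselInt_eq hσ hσN
  have hG := (Real.Gamma_pos_of_pos hσ).ne'
  set χ : ℝ → ℝ := fun t => Real.smoothTransition (2 - 4 * t ^ 2)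
  have hχ : ContDiff ℝ ∞ χ := Real.smoothTransition.contDiff.comp (by fun_prop)
  have hχ1 : ∀ t, 1 < t → χ t = 0 := fun t ht =>
    Real.smoothTransition.zero_of_nonpos (by nlinarith)
  have hχ0 : ∀ᶠ t in 𝓝 (0 : ℝ), χ t = 1 := by
    filter_upwards [Metric.ball_mem_nhds (0 : ℝ) (show (0 : ℝ) < 1 / 2 by norm_num)] with t ht
    refine Real.smoothTransition.one_of_one_le ?_
    have : |t| < 1 / 2 := by simpa using ht
    have := abs_lt.1 this
    nlinarith
  have hφ : ∀ t : ℝ, t ≠ 0 → ContDiffAt ℝ ∞ (besselFun σ) t := fun t ht => by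
    have h1 : ContDiffAt ℝ ∞ (besselInt σ) (t ^ 2 / 4) :=
      (contDiffOn_besselInt σ).contDiffAt (Ioi_mem_nhds (by positivity))
    have h2 : ContDiffAt ℝ ∞ (fun t : ℝ => t ^ 2 / 4) t := by fun_prop
    exact contDiffAt_const.mul (ContDiffAt.comp (g := besselInt σ) t h1 h2)
  have ha : ContDiff ℝ ∞ fun t : ℝ => hyp (1 - σ) (t ^ 2 / 4) :=
    (contDiff_hyp (one_sub_add_ne_zero hσN)).comp (by fun_prop)
  have hb : ContDiff ℝ ∞ fun t : ℝ => hyp (1 + σ) (t ^ 2 / 4) :=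
    (contDiff_hyp (one_add_add_ne_zero hσ)).comp (by fun_prop)
  refine ⟨fun t => χ t * hyp (1 - σ) (t ^ 2 / 4) + (1 - χ t) * besselFun σ t,
    fun t => ((Real.Gamma σ)⁻¹ * κ * 4⁻¹ ^ σ) * (χ t * hyp (1 + σ) (t ^ 2 / 4)),
    boundedDerivs_of_even ?_ ?_ ?_, boundedDerivs_of_even ?_ ?_ ?_, ?_, ?_, ?_, ?_⟩
  · refine contDiff_iff_contDiffAt.2 fun t => ?_
    rcases eq_or_ne t 0 with rfl | ht
    · refine (hχ.mul ha).contDiffAt.congr_of_eventuallyEq ?_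
      filter_upwards [hχ0] with t ht
      rw [ht]; ring
    · exact (hχ.mul ha).contDiffAt.add ((contDiffAt_const.sub hχ.contDiffAt).mul (hφ t ht))
  · intro t; simp [χ, besselFun_neg]
  · intro l
    refine ((unifBound_besselInt l 0 one_pos σ 0).const_mul (Real.Gamma σ)⁻¹).congr fun _ y hy => ?_
    simp [hχ1 y hy, besselFun]
  · exact contDiff_const.mul (hχ.mul hb)
  · intro t; simp [χ]
  · intro l
    exact UnifBound.zero_fun.congr fun _ y hy => by simp [hχ1 y hy]
  · intro t; simp [χ, besselFun_neg]
  · intro t; simp [χ]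
  · simp [hχ0.self_of_nhds, hyp_zero]
  · intro t ht
    have e : (t ^ 2 / 4) ^ σ = 4⁻¹ ^ σ * t ^ (2 * σ) := by
      rw [div_eq_mul_inv, Real.mul_rpow (by positivity) (by positivity), ← Real.rpow_natCast,
        ← Real.rpow_mul ht.le, mul_comm]
      norm_num
    have : besselFun σ t = hyp (1 - σ) (t ^ 2 / 4)
        + t ^ (2 * σ) * ((Real.Gamma σ)⁻¹ * κ * 4⁻¹ ^ σ * hyp (1 + σ) (t ^ 2 / 4)) := by
      rw [besselFun, hκ _ (by positivity), e]
      field_simp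
    simp only [this]; ring

end

section

universe u

variable {n : ℕ}

/-- Functions that are smooth away from the origin and homogeneous of degree `-r`. -/
structure HomSmooth {F : Type*} [NormedAddCommGroup F] [NormedSpace ℝ F] (r : ℝ)
    (g : HalfCoord n → F) : Prop where
  smooth : ContDiffOn ℝ ∞ g {0}ᶜ
  hom : ∀ t : ℝ, 0 < t → ∀ p, p ≠ 0 → g (t • p) = t ^ (-r) • g p

namespace HomSmooth

variable {F : Type*} [NormedAddCommGroup F] [NormedSpace ℝ F] {r : ℝ} {g : HalfCoord n → F}

theorem contDiffAt (h : HomSmooth r g) {p : HalfCoord n} (hp : p ≠ 0) : ContDiffAt ℝ ∞ g p :=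
  h.smooth.contDiffAt (isOpen_compl_singleton.mem_nhds hp)

theorem fderiv (h : HomSmooth r g) : HomSmooth (r + 1) (fderiv ℝ g) := by
  refine ⟨h.smooth.fderiv_of_isOpen isOpen_compl_singleton (by simp), fun t ht p hp => ?_⟩
  have htp : t • p ≠ 0 := smul_ne_zero ht.ne' hp
  have h1 : HasFDerivAt (fun q => g (t • q)) ((_root_.fderiv ℝ g (t • p)).comp
      (t • ContinuousLinearMap.id ℝ (HalfCoord n))) p :=
    ((h.contDiffAt htp).differentiableAt (by simp)).hasFDerivAt.comp p
      ((hasFDerivAt_id p).const_smul t)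
  have h2 : HasFDerivAt (fun q => t ^ (-r) • g q) (t ^ (-r) • _root_.fderiv ℝ g p) p :=
    ((h.contDiffAt hp).differentiableAt (by simp)).hasFDerivAt.const_smul _
  have h3 : (fun q => g (t • q)) =ᶠ[𝓝 p] fun q => t ^ (-r) • g q := by
    filter_upwards [isOpen_compl_singleton.mem_nhds hp] with q hq using h.hom t ht q hq
  have h4 := h1.unique (h2.congr_of_eventuallyEq h3)
  refine ContinuousLinearMap.ext fun v => ?_
  have h5 := congrArg (fun L : HalfCoord n →L[ℝ] F => L v) h4
  simp only [ContinuousLinearMap.comp_apply, smul_apply, ContinuousLinearMap.id_apply, map_smul]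
    at h5
  rw [smul_apply, neg_add', Real.rpow_sub_one ht.ne', div_eq_inv_mul, mul_smul, ← h5,
    inv_smul_smul₀ ht.ne']

theorem fderiv_apply (h : HomSmooth r g) (v : HalfCoord n) :
    HomSmooth (r + 1) fun p => _root_.fderiv ℝ g p v :=
  ⟨h.fderiv.smooth.clm_apply contDiffOn_const, fun t ht p hp => by rw [h.fderiv.hom t ht p hp]; rfl⟩

theorem exists_bound (h : HomSmooth r g) : ∃ C, 0 ≤ C ∧ ∀ p, p ≠ 0 → ‖g p‖ ≤ C * ‖p‖ ^ (-r) := by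
  obtain ⟨C, hC⟩ := (isCompact_sphere (0 : HalfCoord n) 1).exists_bound_of_continuousOn
    (h.smooth.continuousOn.mono fun p hp => by
      rintro rfl; simp at hp)
  refine ⟨max C 0, le_max_right _ _, fun p hp => ?_⟩
  have hp0 : 0 < ‖p‖ := norm_pos_iff.2 hp
  have h1 : ‖p‖⁻¹ • p ≠ 0 := smul_ne_zero (inv_ne_zero hp0.ne') hp
  have h2 := h.hom ‖p‖ hp0 _ h1
  rw [smul_inv_smul₀ hp0.ne'] at h2
  rw [h2, norm_smul, Real.norm_of_nonneg (Real.rpow_nonneg hp0.le _), mul_comm]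
  refine mul_le_mul_of_nonneg_right ((hC _ ?_).trans (le_max_left _ _))
    (Real.rpow_nonneg hp0.le _)
  simp [norm_smul, hp0.ne']

end HomSmooth

/-- The convolution in the tangential variables of a function on the boundary with a kernel. -/
def bdryConv {F : Type*} [NormedAddCommGroup F] [NormedSpace ℝ F] (f : Bdry n → ℝ)
    (g : HalfCoord n → F) (p : HalfCoord n) : F := ∫ z, f z • g (p - (z, 0))

theorem integrable_mul_one_add_norm_rpow {f : Bdry n → ℝ} (hf : MemLp f 2 volume) {r : ℝ}
    (hr : (n : ℝ) < 2 * r) : Integrable fun z => |f z| * (1 + ‖z‖) ^ (-r) := by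
  have h1 : MemLp (fun z : Bdry n => (1 + ‖z‖) ^ (-r)) 2 volume := by
    refine (memLp_two_iff_integrable_sq ?_).2 ?_
    · refine Continuous.aestronglyMeasurable ?_
      refine Continuous.rpow_const (by fun_prop) fun z => Or.inl (by positivity)
    · have := integrable_one_add_norm (E := Bdry n) (μ := volume) (r := 2 * r) (by simpa using hr)
      refine this.congr (.of_forall fun z => ?_)
      simp only
      rw [← Real.rpow_natCast, ← Real.rpow_mul (by positivity)]
      congr 1; push_cast; ring
  exact hf.norm.integrable_mul h1

section

variable {f : Bdry n → ℝ} {r δ : ℝ} {Ω : Set (HalfCoord n)}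

theorem bdryConv_bound {F : Type*} [NormedAddCommGroup F] [NormedSpace ℝ F]
    {g : HalfCoord n → F} {r' : ℝ} (hr0 : 0 < r) (hg : HomSmooth r' g) (hr : r ≤ r') (hδ : 0 < δ)
    (hΩ : ∀ p ∈ Ω, ∀ z, f z ≠ 0 → δ ≤ ‖p - (z, 0)‖) (R : ℝ) :
    ∃ C, ∀ p ∈ Ω, ‖p‖ ≤ R → ∀ z, ‖f z • g (p - (z, 0))‖ ≤ C * (|f z| * (1 + ‖z‖) ^ (-r)) := by
  obtain ⟨C, hC0, hC⟩ := hg.exists_bound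
  set A := (1 + |R|) / δ + 1
  have hA : 0 < A := by positivity
  refine ⟨C * (A ^ r' * 1), fun p hp hpR z => ?_⟩
  by_cases hz : f z = 0
  · simp [hz]
  have hd := hΩ p hp z hz
  have hpos : 0 < ‖p - (z, 0)‖ := hδ.trans_le hd
  have h1 : 1 + ‖z‖ ≤ A * ‖p - (z, 0)‖ := by
    have h2 : ‖z‖ ≤ ‖p‖ + ‖p - (z, 0)‖ := by
      have h3 : ‖((z, 0) : HalfCoord n)‖ = ‖z‖ := by simp [Prod.norm_def]
      have h4 := norm_sub_le p (p - (z, 0))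
      rwa [sub_sub_cancel, h3] at h4
    have h5 : 1 + |R| ≤ (1 + |R|) / δ * ‖p - (z, 0)‖ := by
      rw [div_mul_eq_mul_div, le_div_iff₀ hδ]
      exact mul_le_mul_of_nonneg_left hd (by positivity)
    have : R ≤ |R| := le_abs_self R
    simp only [A, add_mul, one_mul] at h5 ⊢
    linarith
  have hz1 : 1 ≤ 1 + ‖z‖ := by linarith [norm_nonneg z]
  rw [norm_smul, Real.norm_eq_abs]
  have h6 : ‖p - (z, 0)‖ ^ (-r') ≤ A ^ r' * (1 + ‖z‖) ^ (-r) := by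
    have e : ‖p - (z, 0)‖ ^ (-r') = A ^ r' * (A * ‖p - (z, 0)‖) ^ (-r') := by
      rw [Real.mul_rpow hA.le hpos.le, ← mul_assoc, ← Real.rpow_add hA]; simp
    rw [e]
    refine mul_le_mul_of_nonneg_left ?_ (Real.rpow_nonneg hA.le _)
    refine (Real.rpow_le_rpow_of_nonpos (by positivity) h1 (by linarith)).trans ?_
    exact Real.rpow_le_rpow_of_exponent_le hz1 (by linarith)
  calc |f z| * ‖g (p - (z, 0))‖ ≤ |f z| * (C * (A ^ r' * (1 + ‖z‖) ^ (-r))) :=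
        mul_le_mul_of_nonneg_left ((hC _ (norm_pos_iff.1 hpos)).trans
          (mul_le_mul_of_nonneg_left h6 hC0)) (abs_nonneg _)
    _ = _ := by ring

theorem aestronglyMeasurable_bdryConv {F : Type*} [NormedAddCommGroup F] [NormedSpace ℝ F]
    {g : HalfCoord n → F} (hf : AEStronglyMeasurable f volume) (hg : HomSmooth r g) (hδ : 0 < δ)
    (hΩ : ∀ p ∈ Ω, ∀ z, f z ≠ 0 → δ ≤ ‖p - (z, 0)‖) {p : HalfCoord n} (hp : p ∈ Ω) :
    AEStronglyMeasurable (fun z => f z • g (p - (z, 0))) volume := by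
  set S : Set (Bdry n) := {z | p - (z, 0) ≠ 0}
  have hS : IsOpen S := isOpen_compl_singleton.preimage (by fun_prop)
  have h1 : ContinuousOn (fun z : Bdry n => g (p - (z, 0))) S :=
    hg.smooth.continuousOn.comp (by fun_prop) fun z hz => hz
  have h2 : AEStronglyMeasurable (S.indicator fun z => f z • g (p - (z, 0))) volume := by
    rw [aestronglyMeasurable_indicator_iff hS.measurableSet]
    exact hf.restrict.smul (h1.aestronglyMeasurable hS.measurableSet)
  refine h2.congr (.of_forall fun z => ?_)
  by_cases hz : z ∈ S
  · simp [hz]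
  · have h0 : f z = 0 := by
      by_contra h
      have h3 := hΩ p hp z h
      have h4 : p - (z, 0) = 0 := by simpa [S] using hz
      rw [h4, norm_zero] at h3
      linarith
    simp [hz, h0]

variable (hf : MemLp f 2 volume) (hr : (n : ℝ) < 2 * r) (hδ : 0 < δ) (hΩo : IsOpen Ω)
  (hΩ : ∀ p ∈ Ω, ∀ z, f z ≠ 0 → δ ≤ ‖p - (z, 0)‖)
include hf hr hδ hΩ

theorem integrable_bdryConv {F : Type*} [NormedAddCommGroup F] [NormedSpace ℝ F]
    {g : HalfCoord n → F} {r' : ℝ} (hg : HomSmooth r' g) (hr' : r ≤ r') {p : HalfCoord n}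
    (hp : p ∈ Ω) : Integrable fun z => f z • g (p - (z, 0)) := by
  have hr0 : 0 < r := by have : (0 : ℝ) ≤ n := Nat.cast_nonneg n; linarith
  obtain ⟨C, hC⟩ := bdryConv_bound hr0 hg hr' hδ hΩ ‖p‖
  exact ((integrable_mul_one_add_norm_rpow hf hr).const_mul C).mono'
    (aestronglyMeasurable_bdryConv hf.1 hg hδ hΩ hp) (.of_forall fun z => hC p hp le_rfl z)

include hΩo

theorem hasFDerivAt_bdryConv {F : Type*} [NormedAddCommGroup F] [NormedSpace ℝ F]
    {g : HalfCoord n → F} {r' : ℝ} (hg : HomSmooth r' g) (hr' : r ≤ r') {p : HalfCoord n}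
    (hp : p ∈ Ω) : HasFDerivAt (bdryConv f g) (bdryConv f (fderiv ℝ g) p) p := by
  have hr0 : 0 < r := by have : (0 : ℝ) ≤ n := Nat.cast_nonneg n; linarith
  obtain ⟨C, hC⟩ := bdryConv_bound hr0 hg.fderiv (hr'.trans (by linarith)) hδ hΩ (‖p‖ + 1)
  refine hasFDerivAt_integral_of_dominated_of_fderiv_le
    (s := Ω ∩ Metric.ball p 1) (F := fun p z => f z • g (p - (z, 0)))
    (F' := fun p z => f z • fderiv ℝ g (p - (z, 0)))
    (bound := fun z => C * (|f z| * (1 + ‖z‖) ^ (-r)))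
    (inter_mem (hΩo.mem_nhds hp) (Metric.ball_mem_nhds p one_pos)) ?_
    (integrable_bdryConv hf hr hδ hΩ hg hr' hp)
    (aestronglyMeasurable_bdryConv hf.1 hg.fderiv hδ hΩ hp) ?_
    ((integrable_mul_one_add_norm_rpow hf hr).const_mul C) ?_
  · filter_upwards [hΩo.mem_nhds hp] with q hq using aestronglyMeasurable_bdryConv hf.1 hg hδ hΩ hq
  · refine .of_forall fun z q hq => hC q hq.1 ?_ z
    have h1 : ‖q - p‖ < 1 := by simpa [dist_eq_norm] using hq.2
    have h2 := norm_sub_le q (q - p)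
    have h3 := norm_add_le p (q - p)
    rw [add_sub_cancel] at h3
    linarith
  · refine .of_forall fun z q hq => ?_
    by_cases hz : f z = 0
    · simpa [hz] using hasFDerivAt_const (0 : F) q
    have h0 : q - (z, 0) ≠ 0 := norm_pos_iff.1 (hδ.trans_le (hΩ q hq.1 z hz))
    have h1 := ((hg.contDiffAt h0).differentiableAt (by simp)).hasFDerivAt.comp q
      ((hasFDerivAt_id q).sub_const (z, (0 : ℝ)))
    exact h1.const_smul (f z)

theorem contDiffOn_bdryConv : ∀ {F : Type u} [NormedAddCommGroup F] [NormedSpace ℝ F]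
    {g : HalfCoord n → F} {r' : ℝ}, HomSmooth r' g → r ≤ r' → ContDiffOn ℝ ∞ (bdryConv f g) Ω := by
  suffices h : ∀ (m : ℕ) {F : Type u} [NormedAddCommGroup F] [NormedSpace ℝ F]
      {g : HalfCoord n → F} {r' : ℝ}, HomSmooth r' g → r ≤ r' → ContDiffOn ℝ m (bdryConv f g) Ω by
    intro F _ _ g r' hg hr'
    exact contDiffOn_infty.2 fun m => h m hg hr'
  intro m
  induction m with
  | zero =>
    intro F _ _ g r' hg hr'
    exact contDiffOn_zero.2 fun p hp =>
      (hasFDerivAt_bdryConv hf hr hδ hΩo hΩ hg hr' hp).continuousAt.continuousWithinAt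
  | succ m ih =>
    intro F _ _ g r' hg hr'
    rw [show ((m + 1 : ℕ) : WithTop ℕ∞) = m + 1 by norm_cast,
      contDiffOn_succ_iff_fderiv_of_isOpen hΩo]
    exact ⟨fun p hp => (hasFDerivAt_bdryConv hf hr hδ hΩo hΩ hg hr'
      hp).differentiableAt.differentiableWithinAt, by simp,
      (ih hg.fderiv (by linarith)).congr fun p hp =>
        (hasFDerivAt_bdryConv hf hr hδ hΩo hΩ hg hr' hp).fderiv⟩

theorem fderiv_bdryConv_apply {g : HalfCoord n → ℝ} {r' : ℝ} (hg : HomSmooth r' g) (hr' : r ≤ r')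
    {p : HalfCoord n} (hp : p ∈ Ω) (v : HalfCoord n) :
    fderiv ℝ (bdryConv f g) p v = bdryConv f (fun q => fderiv ℝ g q v) p := by
  rw [(hasFDerivAt_bdryConv hf hr hδ hΩo hΩ hg hr' hp).fderiv, bdryConv,
    ContinuousLinearMap.integral_apply
      (integrable_bdryConv hf hr hδ hΩ hg.fderiv (by linarith) hp)]
  rfl

end

end

section

variable {n : ℕ}

/-- The square of the Euclidean norm on the half space. -/
def euclSq (p : HalfCoord n) : ℝ := ‖p.1‖ ^ 2 + p.2 ^ 2

/-- The Euclidean inner product on the half space. -/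
def euclInner (p v : HalfCoord n) : ℝ := inner ℝ p.1 v.1 + p.2 * v.2

/-- The kernel `(|x|² + y²)^{-a}`. -/
def poissonKer (a : ℝ) (p : HalfCoord n) : ℝ := euclSq p ^ (-a)

theorem euclSq_pos {p : HalfCoord n} (hp : p ≠ 0) : 0 < euclSq p := by
  rcases p with ⟨x, y⟩
  by_cases hx : x = 0
  · have hy : y ≠ 0 := by rintro rfl; exact hp (by rw [hx]; rfl)
    simp only [euclSq]; positivity
  · have := norm_pos_iff.2 hx
    simp only [euclSq]; positivity

theorem contDiff_euclSq : ContDiff ℝ ∞ (euclSq (n := n)) :=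
  (contDiff_fst.norm_sq ℝ).add (contDiff_snd.pow 2)

theorem hasFDerivAt_euclSq (p : HalfCoord n) :
    ∃ L : HalfCoord n →L[ℝ] ℝ, HasFDerivAt euclSq L p ∧ ∀ v, L v = 2 * euclInner p v := by
  refine ⟨_, (hasFDerivAt_fst.norm_sq).add (hasFDerivAt_snd.pow 2), fun v => ?_⟩
  simp [euclInner]
  ring

theorem homSmooth_poissonKer (a : ℝ) : HomSmooth (2 * a) (poissonKer (n := n) a) := by
  refine ⟨contDiff_euclSq.contDiffOn.rpow_const_of_ne fun p hp => (euclSq_pos hp).ne',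
    fun t ht p hp => ?_⟩
  have e : euclSq (t • p) = t ^ 2 * euclSq p := by
    simp only [euclSq, Prod.smul_fst, Prod.smul_snd, norm_smul, smul_eq_mul, mul_pow,
      Real.norm_eq_abs, sq_abs]
    ring
  rw [poissonKer, poissonKer, e, Real.mul_rpow (by positivity) (euclSq_pos hp).le, smul_eq_mul,
    ← Real.rpow_natCast, ← Real.rpow_mul ht.le]
  congr 2; push_cast; ring

theorem fderiv_poissonKer (a : ℝ) {p : HalfCoord n} (hp : p ≠ 0) (v : HalfCoord n) :
    fderiv ℝ (poissonKer a) p v = -2 * a * (euclInner p v * poissonKer (a + 1) p) := by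
  obtain ⟨L, hL, hLv⟩ := hasFDerivAt_euclSq p
  have h1 := (Real.hasDerivAt_rpow_const (p := -a) (Or.inl (euclSq_pos hp).ne')).comp_hasFDerivAt p hL
  have h2 : HasFDerivAt (poissonKer a) ((-a * euclSq p ^ (-a - 1)) • L) p := h1
  rw [h2.fderiv, smul_apply, hLv, poissonKer, neg_add', smul_eq_mul]
  ring

theorem fderiv_fderiv_poissonKer (a : ℝ) {p : HalfCoord n} (hp : p ≠ 0) (v : HalfCoord n) :
    fderiv ℝ (fun q => fderiv ℝ (poissonKer a) q v) p v = -2 * a * (euclInner v v *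
      poissonKer (a + 1) p - 2 * (a + 1) * (euclInner p v ^ 2 * poissonKer (a + 1 + 1) p)) := by
  have h1 : (fun q => fderiv ℝ (poissonKer a) q v) =ᶠ[𝓝 p]
      fun q => -2 * a * (euclInner q v * poissonKer (a + 1) q) := by
    filter_upwards [isOpen_compl_singleton.mem_nhds hp] with q hq using fderiv_poissonKer a hq v
  have h2 : HasFDerivAt (fun q : HalfCoord n => euclInner q v)
      (((innerSL ℝ v.1).comp (ContinuousLinearMap.fst ℝ _ _))
        + v.2 • ContinuousLinearMap.snd ℝ _ _) p := by
    refine (ContinuousLinearMap.hasFDerivAt (((innerSL ℝ v.1).comp (ContinuousLinearMap.fst ℝ _ _))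
        + v.2 • ContinuousLinearMap.snd ℝ _ _)).congr_of_eventuallyEq
      (.of_forall fun q => ?_)
    simp [euclInner, real_inner_comm, mul_comm]
  have h3 : HasFDerivAt (poissonKer (n := n) (a + 1)) _ p :=
    (((homSmooth_poissonKer (a + 1)).contDiffAt hp).differentiableAt (by simp)).hasFDerivAt
  have h4 : HasFDerivAt (fun q : HalfCoord n => -2 * a * (euclInner q v * poissonKer (a + 1) q)) _ p :=
    (h2.mul h3).const_mul (-2 * a)
  rw [h1.fderiv_eq, h4.fderiv]
  simp only [smul_apply, add_apply, fderiv_poissonKer _ hp, ContinuousLinearMap.comp_apply,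
    ContinuousLinearMap.coe_fst', ContinuousLinearMap.coe_snd', smul_eq_mul, innerSL_apply_apply]
  simp only [euclInner]
  ring

theorem sum_second_derivs_poissonKer (σ : ℝ) {p : HalfCoord n} (hp : p ∈ upperHalf n) :
    (∑ i : Fin n, fderiv ℝ (fun q => fderiv ℝ (poissonKer (n / 2 + σ)) q
        (EuclideanSpace.basisFun (Fin n) ℝ i, 0)) p (EuclideanSpace.basisFun (Fin n) ℝ i, 0))
      + fderiv ℝ (fun q => fderiv ℝ (poissonKer (n / 2 + σ)) q (0, 1)) p (0, 1)
      + (1 + 2 * σ) * p.2⁻¹ * fderiv ℝ (poissonKer (n / 2 + σ)) p (0, 1) = 0 := by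
  have hy : 0 < p.2 := mem_upperHalf.1 hp
  have hp0 : p ≠ 0 := by rintro rfl; exact lt_irrefl _ hy
  set a := (n : ℝ) / 2 + σ with ha
  simp only [fderiv_fderiv_poissonKer a hp0, fderiv_poissonKer a hp0]
  have hk : poissonKer (a + 1) p = euclSq p * poissonKer (a + 1 + 1) p := by
    rw [poissonKer, poissonKer, neg_add' (a + 1), Real.rpow_sub_one (euclSq_pos hp0).ne',
      mul_div_cancel₀ _ (euclSq_pos hp0).ne']
  have e1 : ∀ i, euclInner ((EuclideanSpace.basisFun (Fin n) ℝ i, 0) : HalfCoord n)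
      (EuclideanSpace.basisFun (Fin n) ℝ i, 0) = 1 := fun i => by
    simp [euclInner]
  have e2 : ∑ i, euclInner p (EuclideanSpace.basisFun (Fin n) ℝ i, 0) ^ 2 = ‖p.1‖ ^ 2 := by
    rw [← (EuclideanSpace.basisFun (Fin n) ℝ).sum_sq_norm_inner_right p.1]
    refine Finset.sum_congr rfl fun i _ => ?_
    simp [euclInner, real_inner_comm]
  have e3 : euclInner p (0, 1) = p.2 := by simp [euclInner]
  have e4 : euclInner ((0, 1) : HalfCoord n) (0, 1) = 1 := by simp [euclInner]
  simp only [e1, e3, e4]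
  have e6 : ∑ i, 2 * (a + 1) * (euclInner p (EuclideanSpace.basisFun (Fin n) ℝ i, 0) ^ 2
      * poissonKer (a + 1 + 1) p) = 2 * (a + 1) * (‖p.1‖ ^ 2 * poissonKer (a + 1 + 1) p) := by
    rw [← e2, Finset.sum_mul, Finset.mul_sum]
  rw [← Finset.mul_sum, Finset.sum_sub_distrib, e6]
  simp only [Finset.sum_const, Finset.card_univ, Fintype.card_fin, nsmul_eq_mul]
  have e5 : (1 + 2 * σ) * p.2⁻¹ * (-2 * a * (p.2 * poissonKer (a + 1) p))
      = (1 + 2 * σ) * (-2 * a * poissonKer (a + 1) p) := by field_simp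
  rw [e5, hk, euclSq, show σ = a - n / 2 by rw [ha]; ring]
  ring

theorem norm_ge_of_mem {p : HalfCoord n} (z : Bdry n) : |p.2| ≤ ‖p - (z, 0)‖ := by
  rw [Prod.norm_def]
  refine le_trans ?_ (le_max_right _ _)
  simp

section

variable {f : Bdry n → ℝ} {σ : ℝ} (hf : MemLp f 2 volume) (hσ : 0 < σ)
include hf hσ

theorem smoothHalf_bdryConv : SmoothHalf (bdryConv f (poissonKer (n / 2 + σ))) := by
  intro p hp
  have hy := mem_upperHalf.1 hp
  have ho : IsOpen {q : HalfCoord n | p.2 / 2 < q.2} := isOpen_lt continuous_const continuous_snd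
  refine ContDiffAt.contDiffWithinAt (ContDiffOn.contDiffAt
    (contDiffOn_bdryConv hf (r := n + 2 * σ) (by linarith [(Nat.cast_nonneg n : (0 : ℝ) ≤ n)])
      (half_pos hy) ho (fun q hq z _ => ?_) (homSmooth_poissonKer _) (by linarith))
    (ho.mem_nhds (by simpa using hy)))
  exact (le_of_lt hq).trans ((le_abs_self _).trans (norm_ge_of_mem z))

theorem weightedLaplacian_bdryConv {p : HalfCoord n} (hp : p ∈ upperHalf n) :
    weightedLaplacian (1 + 2 * σ) (bdryConv f (poissonKer (n / 2 + σ))) p = 0 := by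
  have hy := mem_upperHalf.1 hp
  obtain ⟨k, hkd⟩ : ∃ k : HalfCoord n → ℝ, k = poissonKer (n / 2 + σ) := ⟨_, rfl⟩
  set Ω : Set (HalfCoord n) := {q : HalfCoord n | p.2 / 2 < q.2} with hΩd
  have ho : IsOpen Ω := isOpen_lt continuous_const continuous_snd
  have hr : (n : ℝ) < 2 * (n + 2 * σ) := by linarith [(Nat.cast_nonneg n : (0 : ℝ) ≤ n)]
  have hΩ : ∀ q ∈ Ω, ∀ z, f z ≠ 0 → p.2 / 2 ≤ ‖q - (z, 0)‖ := fun q hq z _ =>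
    (le_of_lt hq).trans ((le_abs_self _).trans (norm_ge_of_mem z))
  have hpΩ : p ∈ Ω := by simpa [hΩd] using hy
  have hk : HomSmooth (2 * (n / 2 + σ)) k := hkd ▸ homSmooth_poissonKer _
  have hk2 : ∀ v, HomSmooth (2 * (n / 2 + σ) + 1) fun q => fderiv ℝ k q v := fun v =>
    hk.fderiv_apply v
  have hU : SmoothHalf (bdryConv f k) := hkd ▸ smoothHalf_bdryConv hf hσ
  rw [← hkd]
  have h1 : ∀ q ∈ Ω, ∀ v, fderiv ℝ (bdryConv f k) q v = bdryConv f (fun q => fderiv ℝ k q v) q :=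
    fun q hq v => fderiv_bdryConv_apply hf hr (half_pos hy) ho hΩ hk (by linarith) hq v
  have h2 : ∀ v, fderiv ℝ (fun q => fderiv ℝ (bdryConv f k) q v) p v
      = bdryConv f (fun q => fderiv ℝ (fun q => fderiv ℝ k q v) q v) p := fun v => by
    rw [← fderiv_bdryConv_apply hf hr (half_pos hy) ho hΩ (hk2 v) (by linarith) hpΩ v]
    congr 1
    refine EventuallyEq.fderiv_eq ?_
    filter_upwards [ho.mem_nhds hpΩ] with q hq using h1 q hq v
  have h3 : partialY (partialY (bdryConv f k)) p
      = fderiv ℝ (fun q => fderiv ℝ (bdryConv f k) q (0, 1)) p (0, 1) := by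
    rw [hU.partialY.partialY_eq hp]
    congr 1
    refine EventuallyEq.fderiv_eq ?_
    filter_upwards [isOpen_upperHalf.mem_nhds hp] with q hq using hU.partialY_eq hq
  rw [weightedLaplacian, hU.tangentialLaplacian_eq hp, h3, hU.partialY_eq hp, h1 p hpΩ]
  simp only [h2, bdryConv]
  have i1 : ∀ v, Integrable fun z => f z • fderiv ℝ k (p - (z, 0)) v := fun v =>
    integrable_bdryConv hf hr (half_pos hy) hΩ (hk2 v) (by linarith) hpΩ
  have i2 : ∀ v, Integrable fun z => f z • fderiv ℝ (fun q => fderiv ℝ k q v) (p - (z, 0)) v :=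
    fun v => integrable_bdryConv hf hr (half_pos hy) hΩ ((hk2 v).fderiv_apply v) (by linarith) hpΩ
  rw [← integral_finsetSum _ fun i _ => i2 _, ← integral_const_mul,
    ← integral_add (integrable_finsetSum _ fun i _ => i2 _) (i2 _)]
  refine (integral_add ((integrable_finsetSum _ fun i _ => i2 _).add (i2 _))
    ((i1 _).const_mul _)).symm.trans ?_
  refine integral_eq_zero_of_ae (.of_forall fun z => ?_)
  have hz : p - (z, 0) ∈ upperHalf n := mem_upperHalf.2 (by simpa using hy)
  have h4 := sum_second_derivs_poissonKer σ hz
  rw [← hkd] at h4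
  have h5 := congrArg (fun t => f z * t) h4
  simp only [mul_zero, mul_add, Finset.mul_sum, Prod.snd_sub, sub_zero] at h5
  refine Eq.trans ?_ h5
  simp only [smul_eq_mul, Pi.add_apply]
  ring

end

/-- The normalization of the Poisson kernel. -/
def poissonConst (n : ℕ) (σ : ℝ) : ℝ :=
  Real.Gamma (n / 2 + σ) / (Real.pi ^ ((n : ℝ) / 2) * Real.Gamma σ)

/-- The Poisson integral of `f`, the solution of `Δ_{1-2σ} W = 0` with boundary values `f`. -/
def poissonInt (σ : ℝ) (f : Bdry n → ℝ) (p : HalfCoord n) : ℝ :=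
  p.2 ^ (2 * σ) * (poissonConst n σ * bdryConv f (poissonKer (n / 2 + σ)) p)

section

variable {f : Bdry n → ℝ} {σ : ℝ} (hf : MemLp f 2 volume) (hσ : 0 < σ)
include hf hσ

theorem smoothHalf_poissonInt : SmoothHalf (poissonInt σ f) :=
  ((smoothHalf_bdryConv hf hσ).const_mul _).mul_right (contDiffOn_rpow_Ioi _)

theorem weightedLaplacian_poissonInt {p : HalfCoord n} (hp : p ∈ upperHalf n) :
    weightedLaplacian (1 - 2 * σ) (poissonInt σ f) p = 0 := by
  have h1 := tangentialOp_lap.ker_rpow_mul (σ := -σ)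
    ((smoothHalf_bdryConv hf hσ).const_mul (poissonConst n σ)) (fun q hq => by
      rw [tangentialOp_lap.gen_const_mul _ _ (smoothHalf_bdryConv hf hσ) hq,
        show 1 - 2 * -σ = 1 + 2 * σ by ring]
      exact mul_eq_zero_of_right _ (weightedLaplacian_bdryConv hf hσ hq)) p hp
  rw [show 1 + 2 * -σ = 1 - 2 * σ by ring, show -(2 * -σ) = 2 * σ by ring] at h1
  exact h1

end

/-- Young's inequality for the convolution of an `L²` function with an integrable kernel. -/
theorem eLpNorm_integral_mul_sub_le {f K : Bdry n → ℝ} (hf : AEStronglyMeasurable f volume)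
    (hK : Measurable K) :
    eLpNorm (fun x => ∫ z, f z * K (x - z)) 2 volume
      ≤ (∫⁻ z, ‖K z‖ₑ) * eLpNorm f 2 volume := by
  set A := ∫⁻ z, ‖K z‖ₑ
  have hfe : AEMeasurable (fun z => ‖f z‖ₑ) volume := hf.enorm
  have hKe : Measurable fun z => ‖K z‖ₑ := hK.enorm
  have hx : ∀ x, ∫⁻ z, ‖K (x - z)‖ₑ = A := fun x =>
    lintegral_sub_left_eq_self (fun z => ‖K z‖ₑ) x
  have h1 : ∀ x, ‖∫ z, f z * K (x - z)‖ₑ ^ (2 : ℝ) ≤ A * ∫⁻ z, ‖f z‖ₑ ^ (2 : ℝ) * ‖K (x - z)‖ₑ := by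
    intro x
    have hm : Measurable fun z => ‖K (x - z)‖ₑ := hKe.comp (measurable_const.sub measurable_id)
    have h2 := ENNReal.lintegral_mul_le_Lp_mul_Lq volume
      (p := 2) (q := 2) (Real.holderConjugate_iff.2 ⟨by norm_num, by norm_num⟩)
      (f := fun z => ‖K (x - z)‖ₑ ^ (1 / 2 : ℝ)) (g := fun z => ‖f z‖ₑ * ‖K (x - z)‖ₑ ^ (1 / 2 : ℝ))
      (hm.pow_const _).aemeasurable (hfe.mul (hm.pow_const _).aemeasurable)
    have e1 : ∀ t : ENNReal, t ^ (1 / 2 : ℝ) * t ^ (1 / 2 : ℝ) = t := fun t => by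
      rw [← ENNReal.rpow_add_of_nonneg _ _ (by norm_num) (by norm_num)]; norm_num
    have e2 : ∀ t : ENNReal, (t ^ (1 / 2 : ℝ)) ^ (2 : ℝ) = t := fun t => by
      rw [← ENNReal.rpow_mul]; norm_num
    have e3 : ∫⁻ z, ‖f z * K (x - z)‖ₑ = ∫⁻ z, ((fun z => ‖K (x - z)‖ₑ ^ (1 / 2 : ℝ)) *
        fun z => ‖f z‖ₑ * ‖K (x - z)‖ₑ ^ (1 / 2 : ℝ)) z := by
      refine lintegral_congr fun z => ?_
      rw [Pi.mul_apply, enorm_mul, mul_left_comm, e1]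
    have h3 : ‖∫ z, f z * K (x - z)‖ₑ ≤ _ :=
      (enorm_integral_le_lintegral_enorm _).trans (e3.le.trans h2)
    refine (ENNReal.rpow_le_rpow h3 (by norm_num)).trans ?_
    rw [ENNReal.mul_rpow_of_nonneg _ _ (by norm_num), e2, e2]
    simp only [e2, hx, ENNReal.mul_rpow_of_nonneg _ _ (show (0 : ℝ) ≤ 2 by norm_num)]
    exact le_rfl
  have hpow : ∀ g : Bdry n → ℝ, eLpNorm g 2 volume ^ (2 : ℝ) = ∫⁻ x, ‖g x‖ₑ ^ (2 : ℝ) := fun g => by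
    simpa using eLpNorm_nnreal_pow_eq_lintegral (f := g) (μ := volume) (p := 2) (by norm_num)
  refine (ENNReal.rpow_le_rpow_iff (show (0 : ℝ) < 2 by norm_num)).1 ?_
  rw [ENNReal.mul_rpow_of_nonneg _ _ (by norm_num), hpow, hpow]
  refine (lintegral_mono h1).trans ?_
  have hmeas : AEMeasurable (Function.uncurry fun (x z : Bdry n) => ‖f z‖ₑ ^ (2 : ℝ) * ‖K (x - z)‖ₑ)
      (volume.prod volume) := by
    refine AEMeasurable.mul ?_ ?_
    · exact (hfe.pow_const _).comp_quasiMeasurePreserving Measure.quasiMeasurePreserving_snd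
    · exact (hKe.comp (measurable_fst.sub measurable_snd)).aemeasurable
  have hsec : AEMeasurable (fun x => ∫⁻ z, ‖f z‖ₑ ^ (2 : ℝ) * ‖K (x - z)‖ₑ) volume :=
    hmeas.lintegral_prod_right'
  rw [lintegral_const_mul'' _ hsec, lintegral_lintegral_swap hmeas]
  have h4 : ∀ z, ∫⁻ x, ‖f z‖ₑ ^ (2 : ℝ) * ‖K (x - z)‖ₑ = ‖f z‖ₑ ^ (2 : ℝ) * A := fun z => by
    rw [lintegral_const_mul _ (show Measurable fun x => ‖K (x - z)‖ₑ from
      hKe.comp (measurable_id.sub_const z))]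
    congr 1
    exact lintegral_sub_right_eq_self (fun x => ‖K x‖ₑ) z
  simp only [h4]
  have hA2 : A ^ (2 : ℝ) = A * A := by rw [ENNReal.rpow_two, sq]
  rw [lintegral_mul_const'' _ (hfe.pow_const _), hA2]
  exact le_of_eq (by ring)

theorem measurable_poissonKer_slice (a y : ℝ) :
    Measurable fun x : Bdry n => poissonKer a (x, y) := by
  unfold poissonKer euclSq
  fun_prop

theorem lintegral_poissonKer_lt_top {σ : ℝ} (hσ : 0 < σ) :
    ∃ A : ENNReal, A ≠ ⊤ ∧ ∀ y : ℝ, 0 < y →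
      ∫⁻ x : Bdry n, ‖y ^ (2 * σ) * poissonKer (n / 2 + σ) (x, y)‖ₑ = A := by
  have hi : Integrable fun x : Bdry n => poissonKer (n / 2 + σ) (x, 1) := by
    have := integrable_rpow_neg_one_add_norm_sq (E := Bdry n) (μ := volume) (r := n + 2 * σ)
      (by simpa using hσ)
    refine this.congr (.of_forall fun x => ?_)
    simp only [poissonKer, euclSq]
    congr 1 <;> ring
  refine ⟨∫⁻ x : Bdry n, ‖poissonKer (n / 2 + σ) (x, 1)‖ₑ, hi.2.ne, fun y hy => ?_⟩
  have h1 : ∀ x : Bdry n, y ^ (2 * σ) * poissonKer (n / 2 + σ) (x, y)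
      = y ^ (-(n : ℝ)) * poissonKer (n / 2 + σ) (y⁻¹ • x, 1) := fun x => by
    have h2 := (homSmooth_poissonKer (n := n) (n / 2 + σ)).hom y hy (y⁻¹ • x, 1)
      (by intro h; simpa using congrArg Prod.snd h)
    simp only [Prod.smul_mk, smul_inv_smul₀ hy.ne', smul_eq_mul, mul_one] at h2
    rw [h2, ← mul_assoc, ← Real.rpow_add hy]
    congr 2; ring
  have hcomp : Integrable fun x : Bdry n => poissonKer (n / 2 + σ) (y⁻¹ • x, 1) :=
    hi.comp_smul (inv_ne_zero hy.ne')
  have h3 : ∀ {g : Bdry n → ℝ}, Integrable g → (∀ x, 0 ≤ g x) →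
      ∫⁻ x, ‖g x‖ₑ = ENNReal.ofReal (∫ x, g x) := fun {g} hg h0 => by
    rw [ofReal_integral_eq_lintegral_ofReal hg (.of_forall h0)]
    exact lintegral_congr fun x => Real.enorm_of_nonneg (h0 x)
  have hpos : ∀ p : HalfCoord n, 0 ≤ poissonKer (n / 2 + σ) p := fun p =>
    Real.rpow_nonneg (by simp only [euclSq]; positivity) _
  simp only [h1]
  rw [h3 (hcomp.const_mul _) (fun x => mul_nonneg (Real.rpow_nonneg hy.le _) (hpos _)),
    h3 hi fun x => hpos _, integral_const_mul,
    Measure.integral_comp_inv_smul volume (fun x : Bdry n => poissonKer (n / 2 + σ) (x, 1)) y]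
  congr 1
  rw [finrank_euclideanSpace_fin, abs_of_pos (by positivity), smul_eq_mul, ← mul_assoc,
    Real.rpow_neg hy.le, Real.rpow_natCast, inv_mul_cancel₀ (by positivity), one_mul]

theorem exists_eLpNorm_poissonInt_le {f : Bdry n → ℝ} {σ : ℝ} (hf : MemLp f 2 volume) (hσ : 0 < σ) :
    ∃ C : ℝ, ∀ y : ℝ, 0 < y → MemLp (fun x => poissonInt σ f (x, y)) 2 volume ∧
      eLpNorm (fun x => poissonInt σ f (x, y)) 2 volume ≤ ENNReal.ofReal C := by
  obtain ⟨A, hA, hAy⟩ := lintegral_poissonKer_lt_top (n := n) hσ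
  set B : ENNReal := ‖poissonConst n σ‖ₑ * (A * eLpNorm f 2 volume)
  have hB : B ≠ ⊤ := ENNReal.mul_ne_top enorm_ne_top (ENNReal.mul_ne_top hA hf.2.ne)
  have hle : ∀ y : ℝ, 0 < y → eLpNorm (fun x => poissonInt σ f (x, y)) 2 volume ≤ B := by
    intro y hy
    have e : (fun x => poissonInt σ f (x, y)) = poissonConst n σ • fun x : Bdry n =>
        ∫ z, f z * (fun w : Bdry n => y ^ (2 * σ) * poissonKer (n / 2 + σ) (w, y)) (x - z) := by
      funext x
      simp only [poissonInt, bdryConv, Pi.smul_apply, smul_eq_mul, Prod.mk_sub_mk, sub_zero]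
      rw [mul_left_comm, ← integral_const_mul]
      congr 1
      exact integral_congr_ae (.of_forall fun z => by ring)
    rw [e, eLpNorm_const_smul]
    refine mul_le_mul_right ?_ _
    rw [← hAy y hy]
    exact eLpNorm_integral_mul_sub_le (K := fun w => y ^ (2 * σ) * poissonKer (n / 2 + σ) (w, y))
      hf.1 ((measurable_poissonKer_slice _ _).const_mul _)
  refine ⟨B.toReal, fun y hy => ?_⟩
  rw [ENNReal.ofReal_toReal hB]
  exact ⟨⟨((smoothHalf_poissonInt hf hσ).slice_contDiff hy).continuous.aestronglyMeasurable,
    (hle y hy).trans_lt hB.lt_top⟩, hle y hy⟩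

end

section

universe u

variable {n : ℕ}

/-- Measurable functions all of whose moments are finite. -/
structure HasMoments {F : Type*} [NormedAddCommGroup F] (g : Bdry n → F) : Prop where
  meas : AEStronglyMeasurable g volume
  int : ∀ k : ℕ, Integrable fun ξ => ‖ξ‖ ^ k * ‖g ξ‖

/-- The function `e^{2πi⟨x, ξ⟩} E(2π|ξ|y)`. -/
def oscKer (E : ℝ → ℝ) (p : HalfCoord n) (ξ : Bdry n) : ℂ :=
  Complex.exp ((2 * Real.pi * inner ℝ p.1 ξ : ℝ) * Complex.I)
    * (E (2 * Real.pi * ‖ξ‖ * p.2) : ℂ)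

/-- The integral `∫ e^{2πi⟨x, ξ⟩} E(2π|ξ|y) g(ξ) dξ`. -/
def oscInt {F : Type*} [NormedAddCommGroup F] [NormedSpace ℂ F] (E : ℝ → ℝ) (g : Bdry n → F)
    (p : HalfCoord n) : F := ∫ ξ, oscKer E p ξ • g ξ

theorem norm_oscKer (E : ℝ → ℝ) (p : HalfCoord n) (ξ : Bdry n) :
    ‖oscKer E p ξ‖ = |E (2 * Real.pi * ‖ξ‖ * p.2)| := by
  rw [oscKer, norm_mul, Complex.norm_exp_ofReal_mul_I, one_mul, Complex.norm_real,
    Real.norm_eq_abs]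

theorem continuous_oscKer {E : ℝ → ℝ} (hE : Continuous E) (p : HalfCoord n) :
    Continuous (oscKer E p) := by
  unfold oscKer; fun_prop

namespace BoundedDerivs

variable {E : ℝ → ℝ}

theorem deriv (hE : BoundedDerivs E) : BoundedDerivs (deriv E) :=
  ⟨(contDiff_infty_iff_deriv.1 hE.1).2, fun k => by
    obtain ⟨C, hC⟩ := hE.2 (k + 1)
    exact ⟨C, fun t => by rw [← iteratedDeriv_succ']; exact hC t⟩⟩

theorem bound (hE : BoundedDerivs E) : ∃ C, ∀ t, |E t| ≤ C := by
  obtain ⟨C, hC⟩ := hE.2 0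
  exact ⟨C, fun t => by simpa using hC t⟩

theorem hasDerivAt (hE : BoundedDerivs E) (t : ℝ) : HasDerivAt E (_root_.deriv E t) t :=
  (hE.1.differentiable (by simp) t).hasDerivAt

end BoundedDerivs

theorem HasMoments.integrable_norm {F : Type*} [NormedAddCommGroup F] {g : Bdry n → F}
    (hg : HasMoments g) : Integrable fun ξ => ‖g ξ‖ := by
  simpa using hg.int 0

theorem HasMoments.of_le {F F' : Type*} [NormedAddCommGroup F] [NormedAddCommGroup F'] {g : Bdry n → F}
    {g' : Bdry n → F'} {C : ℝ}
    (hg : HasMoments g) (hm : AEStronglyMeasurable g' volume)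
    (h : ∀ ξ, ‖g' ξ‖ ≤ C * (‖ξ‖ * ‖g ξ‖)) : HasMoments g' := by
  refine ⟨hm, fun k => ?_⟩
  refine ((hg.int (k + 1)).const_mul C).mono' ((by fun_prop : Continuous fun ξ : Bdry n =>
    ‖ξ‖ ^ k).aestronglyMeasurable.mul hm.norm) (.of_forall fun ξ => ?_)
  rw [Real.norm_of_nonneg (by positivity)]
  calc ‖ξ‖ ^ k * ‖g' ξ‖ ≤ ‖ξ‖ ^ k * (C * (‖ξ‖ * ‖g ξ‖)) :=
        mul_le_mul_of_nonneg_left (h ξ) (by positivity)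
    _ = _ := by ring

section

variable {F : Type*} [NormedAddCommGroup F] [NormedSpace ℂ F] {E : ℝ → ℝ} {g : Bdry n → F}

theorem integrable_oscKer (hE : BoundedDerivs E) (hg : HasMoments g) (p : HalfCoord n) :
    Integrable fun ξ => oscKer E p ξ • g ξ := by
  obtain ⟨C, hC⟩ := hE.bound
  refine (hg.integrable_norm.const_mul C).mono'
    ((continuous_oscKer hE.1.continuous p).aestronglyMeasurable.smul hg.meas)
    (.of_forall fun ξ => ?_)
  rw [norm_smul, norm_oscKer]
  exact mul_le_mul_of_nonneg_right (hC _) (norm_nonneg _)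

/-- The amplitude produced by differentiating `oscInt` in the tangential directions. -/
def tangAmp (g : Bdry n → F) (ξ : Bdry n) : HalfCoord n →L[ℝ] F :=
  ((innerSL ℝ ξ).comp (ContinuousLinearMap.fst ℝ (Bdry n) ℝ)).smulRight
    ((2 * Real.pi * Complex.I : ℂ) • g ξ)

/-- The amplitude produced by differentiating `oscInt` in the normal direction. -/
def normAmp (g : Bdry n → F) (ξ : Bdry n) : HalfCoord n →L[ℝ] F :=
  (ContinuousLinearMap.snd ℝ (Bdry n) ℝ).smulRight ((2 * Real.pi * ‖ξ‖ : ℂ) • g ξ)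

theorem norm_tangAmp_le (g : Bdry n → F) (ξ : Bdry n) :
    ‖tangAmp g ξ‖ ≤ 2 * Real.pi * (‖ξ‖ * ‖g ξ‖) := by
  refine ContinuousLinearMap.opNorm_le_bound _ (by positivity) fun v => ?_
  simp only [tangAmp, ContinuousLinearMap.smulRight_apply, ContinuousLinearMap.comp_apply,
    ContinuousLinearMap.coe_fst', innerSL_apply_apply, norm_smul, norm_mul, Complex.norm_I, mul_one,
    Complex.norm_real, Real.norm_of_nonneg Real.pi_pos.le]
  have h1 := abs_real_inner_le_norm ξ v.1
  have h2 : ‖v.1‖ ≤ ‖v‖ := norm_fst_le v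
  have h3 : |inner ℝ ξ v.1| ≤ ‖ξ‖ * ‖v‖ := h1.trans (mul_le_mul_of_nonneg_left h2 (norm_nonneg _))
  rw [Real.norm_eq_abs]
  calc _ ≤ (‖ξ‖ * ‖v‖) * (‖(2 : ℂ)‖ * Real.pi * ‖g ξ‖) :=
        mul_le_mul_of_nonneg_right h3 (by positivity)
    _ = _ := by rw [Complex.norm_ofNat]; ring

theorem norm_normAmp_le (g : Bdry n → F) (ξ : Bdry n) :
    ‖normAmp g ξ‖ ≤ 2 * Real.pi * (‖ξ‖ * ‖g ξ‖) := by
  refine ContinuousLinearMap.opNorm_le_bound _ (by positivity) fun v => ?_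
  simp only [normAmp, ContinuousLinearMap.smulRight_apply,
    ContinuousLinearMap.coe_snd', norm_smul, norm_mul,
    Complex.norm_real, Real.norm_of_nonneg Real.pi_pos.le, norm_norm]
  have h2 : ‖v.2‖ ≤ ‖v‖ := norm_snd_le v
  calc _ ≤ ‖v‖ * (‖(2 : ℂ)‖ * Real.pi * ‖ξ‖ * ‖g ξ‖) :=
        mul_le_mul_of_nonneg_right h2 (by positivity)
    _ = _ := by rw [Complex.norm_ofNat]; ring

theorem HasMoments.tangAmp (hg : HasMoments g) : HasMoments (tangAmp g) := by
  refine hg.of_le ?_ (norm_tangAmp_le g)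
  refine (ContinuousLinearMap.smulRightL ℝ (HalfCoord n) F).aestronglyMeasurable_comp₂ ?_
    (hg.meas.const_smul _)
  exact (Continuous.clm_comp (innerSL ℝ).continuous continuous_const).aestronglyMeasurable

theorem HasMoments.normAmp (hg : HasMoments g) : HasMoments (normAmp g) := by
  refine hg.of_le ?_ (norm_normAmp_le g)
  refine (ContinuousLinearMap.smulRightL ℝ (HalfCoord n) F).aestronglyMeasurable_comp₂
    aestronglyMeasurable_const (AEStronglyMeasurable.smul ?_ hg.meas)
  exact (by fun_prop : Continuous fun ξ : Bdry n => (2 * Real.pi * ‖ξ‖ : ℂ)).aestronglyMeasurable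

theorem hasFDerivAt_oscKer (hE : BoundedDerivs E) (p : HalfCoord n) (ξ : Bdry n) :
    HasFDerivAt (fun p => oscKer E p ξ • g ξ)
      (oscKer E p ξ • tangAmp g ξ + oscKer (deriv E) p ξ • normAmp g ξ) p := by
  have h1 : HasFDerivAt (fun p : HalfCoord n => 2 * Real.pi * inner ℝ p.1 ξ)
      ((2 * Real.pi) • ((innerSL ℝ ξ).comp (ContinuousLinearMap.fst ℝ (Bdry n) ℝ))) p := by
    refine (ContinuousLinearMap.hasFDerivAt ((2 * Real.pi) • ((innerSL ℝ ξ).comp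
      (ContinuousLinearMap.fst ℝ (Bdry n) ℝ)))).congr_of_eventuallyEq
      (.of_forall fun q => ?_)
    simp [real_inner_comm]
  have h2 : HasFDerivAt (fun p : HalfCoord n => 2 * Real.pi * ‖ξ‖ * p.2)
      ((2 * Real.pi * ‖ξ‖) • ContinuousLinearMap.snd ℝ (Bdry n) ℝ) p :=
    (hasFDerivAt_snd).const_mul _
  have h3 := ((Complex.ofRealCLM.hasFDerivAt.comp p h1).mul_const Complex.I).cexp
  have h4 := Complex.ofRealCLM.hasFDerivAt.comp p ((hE.hasDerivAt _).comp_hasFDerivAt p h2)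
  refine ((h3.mul h4).smul_const (g ξ)).congr_fderiv (ContinuousLinearMap.ext fun v => ?_)
  simp only [oscKer, tangAmp, normAmp, Function.comp_apply, Complex.ofRealCLM_apply,
    ContinuousLinearMap.smulRight_apply, add_apply, smul_apply, ContinuousLinearMap.comp_apply,
    ContinuousLinearMap.coe_fst', ContinuousLinearMap.coe_snd', innerSL_apply_apply, smul_eq_mul]
  rw [← Complex.coe_smul, ← Complex.coe_smul, smul_smul, smul_smul, smul_smul, smul_smul,
    ← add_smul]
  congr 1
  push_cast
  ring

theorem hasFDerivAt_oscInt (hE : BoundedDerivs E) (hg : HasMoments g) (p : HalfCoord n) :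
    HasFDerivAt (oscInt E g) (oscInt E (tangAmp g) p + oscInt (deriv E) (normAmp g) p) p := by
  obtain ⟨C, hC⟩ := hE.bound
  obtain ⟨D, hD⟩ := hE.deriv.bound
  rw [oscInt, oscInt, ← integral_add (integrable_oscKer hE hg.tangAmp p)
    (integrable_oscKer hE.deriv hg.normAmp p)]
  refine hasFDerivAt_integral_of_dominated_of_fderiv_le (s := univ)
    (bound := fun ξ => C * ‖tangAmp g ξ‖ + D * ‖normAmp g ξ‖) univ_mem
    (.of_forall fun q => (integrable_oscKer hE hg q).1) (integrable_oscKer hE hg p)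
    ((integrable_oscKer hE hg.tangAmp p).1.add (integrable_oscKer hE.deriv hg.normAmp p).1)
    (.of_forall fun ξ q _ => ?_)
    ((hg.tangAmp.integrable_norm.const_mul C).add (hg.normAmp.integrable_norm.const_mul D))
    (.of_forall fun ξ q _ => hasFDerivAt_oscKer hE q ξ)
  refine (norm_add_le _ _).trans (add_le_add ?_ ?_)
  · rw [norm_smul, norm_oscKer]
    exact mul_le_mul_of_nonneg_right (hC _) (norm_nonneg _)
  · rw [norm_smul, norm_oscKer]
    exact mul_le_mul_of_nonneg_right (hD _) (norm_nonneg _)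

end

theorem contDiff_oscInt : ∀ {F : Type u} [NormedAddCommGroup F] [NormedSpace ℂ F] {E : ℝ → ℝ}
    {g : Bdry n → F}, BoundedDerivs E → HasMoments g → ContDiff ℝ ∞ (oscInt E g) := by
  suffices h : ∀ (m : ℕ) {F : Type u} [NormedAddCommGroup F] [NormedSpace ℂ F] {E : ℝ → ℝ}
      {g : Bdry n → F}, BoundedDerivs E → HasMoments g → ContDiff ℝ m (oscInt E g) by
    intro F _ _ E g hE hg
    exact contDiff_infty.2 fun m => h m hE hg
  intro m
  induction m with
  | zero =>
    intro F _ _ E g hE hg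
    exact contDiff_zero.2 (continuous_iff_continuousAt.2 fun p =>
      (hasFDerivAt_oscInt hE hg p).continuousAt)
  | succ m ih =>
    intro F _ _ E g hE hg
    rw [show ((m + 1 : ℕ) : WithTop ℕ∞) = m + 1 by norm_cast, contDiff_succ_iff_fderiv]
    refine ⟨fun p => (hasFDerivAt_oscInt hE hg p).differentiableAt, by simp, ?_⟩
    rw [show fderiv ℝ (oscInt E g) = fun p => oscInt E (tangAmp g) p
      + oscInt (deriv E) (normAmp g) p from funext fun p => (hasFDerivAt_oscInt hE hg p).fderiv]
    exact (ih hE hg.tangAmp).add (ih hE.deriv hg.normAmp)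

theorem oscInt_even {F : Type*} [NormedAddCommGroup F] [NormedSpace ℂ F] {E : ℝ → ℝ}
    (hE : ∀ t, E (-t) = E t) (g : Bdry n → F) (x : Bdry n) (y : ℝ) :
    oscInt E g (x, -y) = oscInt E g (x, y) := by
  simp only [oscInt, oscKer, mul_neg, hE]

open scoped FourierTransform

theorem hasMoments_schwartz (φ : SchwartzMap (Bdry n) ℂ) : HasMoments φ :=
  ⟨φ.continuous.aestronglyMeasurable, fun k => φ.integrable_pow_mul volume k⟩

/-- The Gaussian whose Fourier transform is `exp (-π² |ξ|² y² / s)`. -/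
def gaussKer (y s : ℝ) (w : Bdry n) : ℝ :=
  (s / (Real.pi * y ^ 2)) ^ ((n : ℝ) / 2) * Real.exp (-(s * ‖w‖ ^ 2 / y ^ 2))

theorem integral_fourier_mul_gauss (φ : SchwartzMap (Bdry n) ℂ) (x : Bdry n) {y s : ℝ} (hy : 0 < y)
    (hs : 0 < s) :
    ∫ ξ, Complex.exp ((2 * Real.pi * inner ℝ x ξ : ℝ) * Complex.I)
        * (Real.exp (-((2 * Real.pi * ‖ξ‖ * y) ^ 2 / 4 / s)) : ℂ) * 𝓕 φ ξ
      = ∫ z, φ z * (gaussKer y s (x - z) : ℂ) := by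
  set b : ℝ := Real.pi ^ 2 * y ^ 2 / s
  have hb : 0 < b := by positivity
  set g : Bdry n → ℂ := fun v =>
    Complex.exp (-(b : ℂ) * ‖v‖ ^ 2 + 2 * Real.pi * Complex.I * inner ℝ x v)
  have hg : Integrable g := by
    have := GaussianFourier.integrable_cexp_neg_mul_sq_norm_add (V := Bdry n) (b := (b : ℂ))
      (by simpa using hb) (2 * Real.pi * Complex.I) x
    exact this
  have h1 := VectorFourier.integral_bilin_fourierIntegral_eq_flip (.mul ℂ ℂ) (L := innerₗ (Bdry n))
    Real.continuous_fourierChar continuous_inner (φ.integrable (μ := volume)) hg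
  have h2 : ∫ ξ, 𝓕 (φ : Bdry n → ℂ) ξ * g ξ = ∫ z, φ z * 𝓕 g z := by
    simpa using! h1
  have h3 : ∀ z, 𝓕 g z = (gaussKer y s (x - z) : ℂ) := fun z => by
    rw [fourier_gaussian_innerProductSpace' (by simpa using hb), finrank_euclideanSpace_fin,
      gaussKer]
    rw [Complex.ofReal_mul, Complex.ofReal_cpow (by positivity), Complex.ofReal_exp]
    have e1 : ((Real.pi : ℂ) / b) = ((s / (Real.pi * y ^ 2) : ℝ) : ℂ) := by
      simp only [b]; push_cast
      have : (Real.pi : ℂ) ≠ 0 := by exact_mod_cast Real.pi_ne_zero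
      have : (y : ℂ) ≠ 0 := by exact_mod_cast hy.ne'
      have : (s : ℂ) ≠ 0 := by exact_mod_cast hs.ne'
      field_simp
    have e2 : (-(Real.pi : ℂ) ^ 2 * (‖x - z‖ : ℂ) ^ 2 / b)
        = ((-(s * ‖x - z‖ ^ 2 / y ^ 2) : ℝ) : ℂ) := by
      simp only [b]; push_cast
      have : (Real.pi : ℂ) ≠ 0 := by exact_mod_cast Real.pi_ne_zero
      have : (y : ℂ) ≠ 0 := by exact_mod_cast hy.ne'
      have : (s : ℂ) ≠ 0 := by exact_mod_cast hs.ne'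
      field_simp
    rw [e1, e2]; push_cast; rfl
  simp only [h3] at h2
  rw [← h2]
  refine integral_congr_ae (.of_forall fun ξ => ?_)
  simp only [g, SchwartzMap.fourier_coe]
  rw [mul_comm, Complex.ofReal_exp, ← Complex.exp_add]
  congr 2
  simp only [b]; push_cast
  ring

theorem integrable_gaussKer_gamma {σ : ℝ} (hσ : 0 < σ) {y : ℝ} (hy : 0 < y) (w : Bdry n) :
    (∫ s in Ioi (0 : ℝ), Real.exp (-s) * s ^ (σ - 1) * gaussKer y s w)
      = Real.Gamma σ * (y ^ (2 * σ) * (poissonConst n σ * poissonKer (n / 2 + σ) (w, y))) := by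
  have ha : 0 < (n : ℝ) / 2 + σ := by positivity
  set r : ℝ := 1 + ‖w‖ ^ 2 / y ^ 2
  have hr : 0 < r := by positivity
  have h1 := Real.integral_rpow_mul_exp_neg_mul_Ioi ha hr
  have h2 : ∀ s ∈ Ioi (0 : ℝ), Real.exp (-s) * s ^ (σ - 1) * gaussKer y s w
      = (Real.pi * y ^ 2) ^ (-((n : ℝ) / 2)) * (s ^ ((n : ℝ) / 2 + σ - 1) * Real.exp (-(r * s))) :=
    fun s hs => by
      have hs : 0 < s := hs
      rw [gaussKer, Real.div_rpow hs.le (by positivity), Real.rpow_neg (by positivity),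
        show (n : ℝ) / 2 + σ - 1 = (σ - 1) + n / 2 by ring, Real.rpow_add hs,
        show -(r * s) = -s + -(s * ‖w‖ ^ 2 / y ^ 2) by simp only [r]; field_simp; ring,
        Real.exp_add]
      ring
  rw [setIntegral_congr_fun measurableSet_Ioi h2, integral_const_mul, h1]
  have hG := (Real.Gamma_pos_of_pos hσ).ne'
  have hq : (1 / r) = y ^ 2 * (euclSq (w, y))⁻¹ := by
    have : euclSq (w, y) = y ^ 2 * r := by
      simp only [euclSq, r]; field_simp; ring
    rw [this]; field_simp
  have hq0 : 0 < euclSq ((w, y) : HalfCoord n) := by simp only [euclSq]; positivity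
  have hy2 : ∀ t : ℝ, (y ^ 2) ^ t = y ^ (2 * t) := fun t => by
    rw [← Real.rpow_natCast, ← Real.rpow_mul hy.le]; norm_num
  rw [hq, Real.mul_rpow Real.pi_pos.le (by positivity), Real.mul_rpow (by positivity) (by positivity),
    Real.inv_rpow hq0.le, ← Real.rpow_neg hq0.le, poissonConst, poissonKer, hy2, hy2,
    Real.rpow_neg Real.pi_pos.le]
  have e : y ^ (2 * -((n : ℝ) / 2)) * y ^ (2 * ((n : ℝ) / 2 + σ)) = y ^ (2 * σ) := by
    rw [← Real.rpow_add hy]; congr 1; ring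
  have hpi := (Real.rpow_pos_of_pos Real.pi_pos ((n : ℝ) / 2)).ne'
  rw [← e]
  field_simp

theorem integrable_exp_rpow_mul_gaussKer {σ : ℝ} (hσ : 0 < σ) (y : ℝ) (φ : SchwartzMap (Bdry n) ℂ)
    (x : Bdry n) :
    Integrable (Function.uncurry fun (z : Bdry n) (s : ℝ) =>
      φ z * ((Real.exp (-s) * s ^ (σ - 1) * gaussKer y s (x - z) : ℝ) : ℂ))
      (volume.prod (volume.restrict (Ioi (0 : ℝ)))) := by
  have h1 := Real.GammaIntegral_convergent (s := (n : ℝ) / 2 + σ) (by positivity)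
  have h2 : Integrable fun z => ‖φ z‖ := φ.integrable.norm
  have h3 := (h2.mul_prod (ν := volume.restrict (Ioi (0 : ℝ)))
    (h1.const_mul ((Real.pi * y ^ 2) ^ (-((n : ℝ) / 2)))))
  refine h3.mono' ?_ ?_
  · refine Measurable.aestronglyMeasurable ?_
    unfold gaussKer Function.uncurry
    have := φ.continuous.measurable
    fun_prop
  · have hpos : ∀ᵐ q : Bdry n × ℝ ∂(volume.prod (volume.restrict (Ioi (0 : ℝ)))), 0 < q.2 :=
      Measure.quasiMeasurePreserving_snd.ae (p := fun s : ℝ => 0 < s)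
        (ae_restrict_mem measurableSet_Ioi)
    filter_upwards [hpos] with q hq
    rw [Function.uncurry, norm_mul, Complex.norm_real]
    refine mul_le_mul_of_nonneg_left ?_ (norm_nonneg _)
    rw [Real.norm_of_nonneg (by unfold gaussKer; positivity), gaussKer,
      Real.div_rpow hq.le (by positivity), Real.rpow_neg (by positivity),
      show (n : ℝ) / 2 + σ - 1 = (σ - 1) + n / 2 by ring, Real.rpow_add hq]
    have : Real.exp (-(q.2 * ‖x - q.1‖ ^ 2 / y ^ 2)) ≤ 1 :=
      Real.exp_le_one_iff.2 (neg_nonpos.2 (by positivity))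
    have h0 : 0 ≤ Real.exp (-q.2) * q.2 ^ (σ - 1) * (q.2 ^ ((n : ℝ) / 2)
        * ((Real.pi * y ^ 2) ^ ((n : ℝ) / 2))⁻¹) := by positivity
    calc _ = (Real.exp (-q.2) * q.2 ^ (σ - 1) * (q.2 ^ ((n : ℝ) / 2)
        * ((Real.pi * y ^ 2) ^ ((n : ℝ) / 2))⁻¹)) * Real.exp (-(q.2 * ‖x - q.1‖ ^ 2 / y ^ 2)) := by
          ring
      _ ≤ _ := mul_le_of_le_one_right h0 this
      _ = _ := by ring

theorem oscInt_besselFun (φ : SchwartzMap (Bdry n) ℂ) {σ : ℝ} (hσ : 0 < σ) (x : Bdry n) {y : ℝ}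
    (hy : 0 < y) :
    oscInt (besselFun σ) (𝓕 φ : SchwartzMap (Bdry n) ℂ) (x, y) = ∫ z, φ z *
      ((y ^ (2 * σ) * (poissonConst n σ * poissonKer (n / 2 + σ) (x - z, y)) : ℝ) : ℂ) := by
  have hG : (Real.Gamma σ : ℂ) ≠ 0 := by exact_mod_cast (Real.Gamma_pos_of_pos hσ).ne'
  set e : Bdry n → ℂ := fun ξ => Complex.exp ((2 * Real.pi * inner ℝ x ξ : ℝ) * Complex.I)
  have he : Continuous e := by fun_prop
  set ψ : SchwartzMap (Bdry n) ℂ := 𝓕 φ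
  have hint : Integrable (Function.uncurry fun (ξ : Bdry n) (s : ℝ) =>
      e ξ * ψ ξ * (besselKer σ ((2 * Real.pi * ‖ξ‖ * y) ^ 2 / 4) s : ℂ))
      (volume.prod (volume.restrict (Ioi (0 : ℝ)))) := by
    refine ((ψ.integrable.norm).mul_prod (ν := volume.restrict (Ioi (0 : ℝ)))
      (integrableOn_besselKer_zero hσ)).mono' ?_ ?_
    · refine Measurable.aestronglyMeasurable ?_
      unfold besselKer Function.uncurry
      have := ψ.continuous.measurable
      have := he.measurable
      fun_prop
    · have hpos : ∀ᵐ q : Bdry n × ℝ ∂(volume.prod (volume.restrict (Ioi (0 : ℝ)))), 0 < q.2 :=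
        Measure.quasiMeasurePreserving_snd.ae (p := fun s : ℝ => 0 < s)
          (ae_restrict_mem measurableSet_Ioi)
      filter_upwards [hpos] with q hq
      rw [Function.uncurry, norm_mul, norm_mul, Complex.norm_real,
        Real.norm_of_nonneg (besselKer_nonneg _ _ hq), Complex.norm_exp_ofReal_mul_I, one_mul]
      exact mul_le_mul_of_nonneg_left (besselKer_anti σ (by positivity) hq) (norm_nonneg _)
  have h1 : oscInt (besselFun σ) ψ (x, y) = (Real.Gamma σ : ℂ)⁻¹ * ∫ ξ, ∫ s in Ioi (0 : ℝ),
      e ξ * ψ ξ * (besselKer σ ((2 * Real.pi * ‖ξ‖ * y) ^ 2 / 4) s : ℂ) := by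
    rw [oscInt, ← integral_const_mul]
    refine integral_congr_ae (.of_forall fun ξ => ?_)
    simp only [oscKer, besselFun, besselInt, smul_eq_mul]
    rw [integral_const_mul, integral_complex_ofReal]
    push_cast
    simp only [e]
    push_cast
    ring
  have h2 : ∀ s ∈ Ioi (0 : ℝ), ∫ ξ, e ξ * ψ ξ *
      (besselKer σ ((2 * Real.pi * ‖ξ‖ * y) ^ 2 / 4) s : ℂ)
      = ∫ z, φ z * ((Real.exp (-s) * s ^ (σ - 1) * gaussKer y s (x - z) : ℝ) : ℂ) := fun s hs => by
    have h3 := congrArg (fun t => ((Real.exp (-s) * s ^ (σ - 1) : ℝ) : ℂ) * t)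
      (integral_fourier_mul_gauss φ x hy hs)
    simp only [← integral_const_mul] at h3
    refine Eq.trans (integral_congr_ae (.of_forall fun ξ => ?_)) (h3.trans
      (integral_congr_ae (.of_forall fun z => ?_)))
    · simp only [besselKer, e, ψ]
      rw [sub_eq_add_neg, Real.exp_add]
      push_cast; ring
    · push_cast; ring
  rw [h1, integral_integral_swap hint, setIntegral_congr_fun measurableSet_Ioi h2,
    ← integral_integral_swap (integrable_exp_rpow_mul_gaussKer hσ y φ x), ← integral_const_mul]
  refine integral_congr_ae (.of_forall fun z => ?_)
  simp only
  rw [integral_const_mul, integral_complex_ofReal, integrable_gaussKer_gamma hσ hy]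
  push_cast
  field_simp

end

section

variable {n : ℕ}

open scoped FourierTransform Manifold

theorem besselFun_zero {σ : ℝ} (hσ : 0 < σ) : besselFun σ 0 = 1 := by
  have hG := (Real.Gamma_pos_of_pos hσ).ne'
  rw [besselFun, show (0 : ℝ) ^ 2 / 4 = 0 by norm_num, besselInt_zero, ← Real.Gamma_eq_integral hσ,
    inv_mul_cancel₀ hG]

theorem poissonKer_neg (a : ℝ) (x : Bdry n) (y : ℝ) : poissonKer a (x, -y) = poissonKer a (x, y) := by
  simp [poissonKer, euclSq]

theorem bdryConv_neg (f : Bdry n → ℝ) (a : ℝ) (x : Bdry n) (y : ℝ) :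
    bdryConv f (poissonKer a) (x, -y) = bdryConv f (poissonKer a) (x, y) := by
  simp only [bdryConv, Prod.mk_sub_mk, sub_zero, poissonKer_neg]

theorem oscInt_zero {E : ℝ → ℝ} (hE : E 0 = 1) (φ : SchwartzMap (Bdry n) ℂ) (x : Bdry n) :
    oscInt E (𝓕 φ : SchwartzMap (Bdry n) ℂ) (x, 0) = φ x := by
  have h1 : (𝓕⁻ (𝓕 φ) : SchwartzMap (Bdry n) ℂ) x = φ x := by
    rw [FourierTransform.fourierInv_fourier_eq]
  rw [← h1, SchwartzMap.fourierInv_coe, Real.fourierInv_eq']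
  refine integral_congr_ae (.of_forall fun ξ => ?_)
  simp only [oscKer, mul_zero, hE, Complex.ofReal_one, mul_one, real_inner_comm]

theorem HasMoments.rpow_mul {g : Bdry n → ℂ} (hg : HasMoments g) {s : ℝ} (hs : 0 ≤ s) :
    HasMoments fun ξ => (((2 * Real.pi * ‖ξ‖) ^ s : ℝ) : ℂ) * g ξ := by
  obtain ⟨M, hM⟩ := exists_nat_ge s
  have hc : Continuous fun ξ : Bdry n => (2 * Real.pi * ‖ξ‖) ^ s :=
    Continuous.rpow_const (by fun_prop) fun _ => Or.inr hs
  have hm := (Complex.continuous_ofReal.comp hc).aestronglyMeasurable.mul hg.meas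
  refine ⟨hm, fun k => ?_⟩
  refine (((hg.int k).add (hg.int (k + M))).const_mul ((2 * Real.pi) ^ s)).mono'
    ((by fun_prop : Continuous fun ξ : Bdry n => ‖ξ‖ ^ k).aestronglyMeasurable.mul hm.norm)
    (.of_forall fun ξ => ?_)
  rw [Real.norm_of_nonneg (by positivity), norm_mul, Complex.norm_real,
    Real.norm_of_nonneg (by positivity), Real.mul_rpow (by positivity) (norm_nonneg _)]
  have h1 : ‖ξ‖ ^ s ≤ 1 + ‖ξ‖ ^ M := by
    rcases le_or_gt ‖ξ‖ 1 with h | h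
    · have := Real.rpow_le_one (norm_nonneg ξ) h hs
      have : 0 ≤ ‖ξ‖ ^ M := by positivity
      linarith
    · have := Real.rpow_le_rpow_of_exponent_le h.le hM
      rw [Real.rpow_natCast] at this
      linarith
  simp only [Pi.add_apply]
  calc ‖ξ‖ ^ k * ((2 * Real.pi) ^ s * ‖ξ‖ ^ s * ‖g ξ‖)
      = (2 * Real.pi) ^ s * (‖ξ‖ ^ k * ‖g ξ‖) * ‖ξ‖ ^ s := by ring
    _ ≤ (2 * Real.pi) ^ s * (‖ξ‖ ^ k * ‖g ξ‖) * (1 + ‖ξ‖ ^ M) :=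
        mul_le_mul_of_nonneg_left h1 (by positivity)
    _ = _ := by ring

section

variable {f : Bdry n → ℝ} {σ : ℝ} (hf : ContDiff ℝ ∞ f) (hσ : 0 < σ) (hσN : ∀ N : ℕ, σ ≠ N)
include hf hσ hσN

/-- The structure of the Poisson integral of a test function. -/
theorem exists_poissonInt_eq_of_hasCompactSupport (hc : HasCompactSupport f) :
    ∃ F G : HalfCoord n → ℝ, ContDiff ℝ ∞ F ∧ ContDiff ℝ ∞ G ∧
      (∀ x y, F (x, -y) = F (x, y)) ∧ (∀ x y, G (x, -y) = G (x, y)) ∧ (∀ x, F (x, 0) = f x) ∧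
      ∀ x y, 0 < y → poissonInt σ f (x, y) = F (x, y) + y ^ (2 * σ) * G (x, y) := by
  obtain ⟨E, β, hE, hβ, hEe, hβe, hE0, hφ⟩ := exists_besselFun_eq hσ hσN
  have hcc : HasCompactSupport fun x => (f x : ℂ) := hc.comp_left (g := ((↑) : ℝ → ℂ)) (by simp)
  set φ : SchwartzMap (Bdry n) ℂ := hcc.toSchwartzMap (Complex.ofRealCLM.contDiff.comp hf)
  have hφf : ∀ x, φ x = f x := fun x => rfl
  set ψ : SchwartzMap (Bdry n) ℂ := 𝓕 φ with hψ
  have hψm := hasMoments_schwartz ψ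
  have hg := hψm.rpow_mul (s := 2 * σ) (by positivity)
  set g : Bdry n → ℂ := fun ξ => (((2 * Real.pi * ‖ξ‖) ^ (2 * σ) : ℝ) : ℂ) * ψ ξ
  refine ⟨fun p => (oscInt E ψ p).re, fun p => (oscInt β g p).re,
    Complex.reCLM.contDiff.comp (contDiff_oscInt hE hψm),
    Complex.reCLM.contDiff.comp (contDiff_oscInt hβ hg),
    fun x y => congrArg Complex.re (oscInt_even hEe _ x y),
    fun x y => congrArg Complex.re (oscInt_even hβe _ x y),
    fun x => by simp only; rw [hψ, oscInt_zero hE0, hφf, Complex.ofReal_re], fun x y hy => ?_⟩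
  have h1 := oscInt_besselFun φ hσ x hy
  have h2 : oscInt (besselFun σ) (𝓕 φ : SchwartzMap (Bdry n) ℂ) (x, y)
      = oscInt E ψ (x, y) + ((y ^ (2 * σ) : ℝ) : ℂ) * oscInt β g (x, y) := by
    simp only [oscInt]
    rw [← integral_const_mul, ← integral_add (integrable_oscKer hE hψm _)
      ((integrable_oscKer hβ hg _).const_mul _)]
    refine integral_congr_ae (.of_forall fun ξ => ?_)
    have h3 : besselFun σ (2 * Real.pi * ‖ξ‖ * y) = E (2 * Real.pi * ‖ξ‖ * y)
        + (2 * Real.pi * ‖ξ‖) ^ (2 * σ) * (y ^ (2 * σ) * β (2 * Real.pi * ‖ξ‖ * y)) := by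
      rcases eq_or_ne ξ 0 with rfl | hξ
      · simp [besselFun_zero hσ, hE0, Real.zero_rpow (show 2 * σ ≠ 0 by positivity)]
      · have := norm_pos_iff.2 hξ
        rw [hφ _ (by positivity), Real.mul_rpow (by positivity) hy.le]; ring
    simp only [oscKer, g, h3, ← hψ, smul_eq_mul]
    push_cast
    ring
  have h4 : (poissonInt σ f (x, y) : ℂ) = oscInt (besselFun σ) (𝓕 φ : SchwartzMap (Bdry n) ℂ) (x, y) := by
    rw [h1, poissonInt, bdryConv, ← integral_const_mul, ← integral_const_mul,
      ← integral_complex_ofReal]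
    refine integral_congr_ae (.of_forall fun z => ?_)
    simp only [hφf, smul_eq_mul, Prod.mk_sub_mk, sub_zero]
    push_cast; ring
  have h5 := congrArg Complex.re (h4.trans h2)
  rwa [Complex.ofReal_re, Complex.add_re, Complex.re_ofReal_mul] at h5

theorem exists_poissonInt_eq_local (hf2 : MemLp f 2 volume) (x₀ : Bdry n) :
    ∃ F G : HalfCoord n → ℝ, ContDiffOn ℝ ∞ F (Metric.ball x₀ (1 / 2) ×ˢ univ) ∧
      ContDiffOn ℝ ∞ G (Metric.ball x₀ (1 / 2) ×ˢ univ) ∧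
      (∀ x y, F (x, -y) = F (x, y)) ∧ (∀ x y, G (x, -y) = G (x, y)) ∧
      (∀ x ∈ Metric.ball x₀ (1 / 2), F (x, 0) = f x) ∧
      ∀ x y, 0 < y → poissonInt σ f (x, y) = F (x, y) + y ^ (2 * σ) * G (x, y) := by
  set χ : ContDiffBump x₀ := ⟨1, 2, one_pos, one_lt_two⟩
  have hχ : ContDiff ℝ ∞ χ := χ.contDiff
  set f0 : Bdry n → ℝ := fun x => χ x * f x
  set f1 : Bdry n → ℝ := fun x => (1 - χ x) * f x
  have hf0 : ContDiff ℝ ∞ f0 := hχ.mul hf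
  have hc0 : HasCompactSupport f0 := χ.hasCompactSupport.mul_right
  have h02 : MemLp f0 2 volume := hf0.continuous.memLp_of_hasCompactSupport hc0
  have h12 : MemLp f1 2 volume := by
    have : f1 = f - f0 := by funext x; simp only [f0, f1, Pi.sub_apply]; ring
    rw [this]; exact hf2.sub h02
  obtain ⟨F, G, hF, hG, hFe, hGe, hF0, hW⟩ :=
    exists_poissonInt_eq_of_hasCompactSupport hf0 hσ hσN hc0
  have hr : (n : ℝ) < 2 * (n + 2 * σ) := by linarith [(Nat.cast_nonneg n : (0 : ℝ) ≤ n)]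
  have hk : HomSmooth (2 * (n / 2 + σ)) (poissonKer (n := n) (n / 2 + σ)) := homSmooth_poissonKer _
  have hfar := contDiffOn_bdryConv (f := f1) (Ω := Metric.ball x₀ (1 / 2) ×ˢ univ) h12 hr one_half_pos
    (Metric.isOpen_ball.prod isOpen_univ) (fun p hp z hz => by
      have h1 : 1 ≤ dist z x₀ := by
        by_contra h
        exact hz (by
          simp only [f1]
          rw [χ.one_of_mem_closedBall (Metric.mem_closedBall.2 (not_le.1 h).le)]; simp)
      have h2 : dist p.1 x₀ < 1 / 2 := hp.1
      have h3 : ‖p.1 - z‖ ≤ ‖p - (z, 0)‖ := norm_fst_le (p - (z, 0))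
      have h4 := dist_triangle_left z x₀ p.1
      rw [dist_eq_norm p.1 z] at h4
      linarith) hk (by linarith)
  refine ⟨F, fun p => G p + poissonConst n σ * bdryConv f1 (poissonKer (n / 2 + σ)) p,
    hF.contDiffOn, hG.contDiffOn.add (contDiffOn_const.mul hfar), hFe,
    fun x y => by simp only [hGe, bdryConv_neg], fun x hx => ?_, fun x y hy => ?_⟩
  · rw [hF0]
    simp only [f0]
    rw [χ.one_of_mem_closedBall (Metric.mem_closedBall.2 ?_), one_mul]
    exact (Metric.mem_ball.1 hx).le.trans (by norm_num [χ])
  · have ho : ∀ q ∈ {q : HalfCoord n | y / 2 < q.2}, ∀ (z : Bdry n), y / 2 ≤ ‖q - (z, 0)‖ :=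
      fun q hq z => (le_of_lt hq).trans ((le_abs_self _).trans (norm_ge_of_mem z))
    have hp : ((x, y) : HalfCoord n) ∈ {q : HalfCoord n | y / 2 < q.2} := by simpa using hy
    have e : bdryConv f (poissonKer (n / 2 + σ)) (x, y) = bdryConv f0 (poissonKer (n / 2 + σ)) (x, y)
        + bdryConv f1 (poissonKer (n / 2 + σ)) (x, y) := by
      simp only [bdryConv]
      rw [← integral_add
        (integrable_bdryConv h02 hr (half_pos hy) (fun q hq z _ => ho q hq z) hk (by linarith) hp)
        (integrable_bdryConv h12 hr (half_pos hy) (fun q hq z _ => ho q hq z) hk (by linarith) hp)]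
      refine integral_congr_ae (.of_forall fun z => ?_)
      simp only [f0, f1, smul_eq_mul]; ring
    have h1 := hW x y hy
    rw [poissonInt] at h1 ⊢
    rw [e]
    simp only at h1 ⊢
    linear_combination h1

/-- The structure of the Poisson integral of a smooth function. -/
theorem exists_poissonInt_eq (hf2 : MemLp f 2 volume) :
    ∃ F G : HalfCoord n → ℝ, ContDiff ℝ ∞ F ∧ ContDiff ℝ ∞ G ∧
      (∀ x y, F (x, -y) = F (x, y)) ∧ (∀ x y, G (x, -y) = G (x, y)) ∧ (∀ x, F (x, 0) = f x) ∧
      ∀ x y, 0 < y → poissonInt σ f (x, y) = F (x, y) + y ^ (2 * σ) * G (x, y) := by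
  set t : HalfCoord n → Set (ℝ × ℝ) := fun p => {ab |
    (p.2 ≠ 0 → poissonInt σ f (p.1, |p.2|) = ab.1 + |p.2| ^ (2 * σ) * ab.2) ∧
    (p.2 = 0 → ab.1 = f p.1)}
  have ht : ∀ p, Convex ℝ (t p) := by
    intro p a ha b hb r s _ _ hrs
    refine ⟨fun h => ?_, fun h => ?_⟩
    · have h1 := ha.1 h
      have h2 := hb.1 h
      simp only [Prod.fst_add, Prod.smul_fst, Prod.snd_add, Prod.smul_snd, smul_eq_mul]
      linear_combination r * h1 + s * h2 - (poissonInt σ f (p.1, |p.2|)) * hrs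
    · have h1 := ha.2 h
      have h2 := hb.2 h
      simp only [Prod.fst_add, Prod.smul_fst, smul_eq_mul]
      linear_combination r * h1 + s * h2 + f p.1 * hrs
  obtain ⟨g, hg⟩ := exists_contMDiffMap_forall_mem_convex_of_local (n := (⊤ : ℕ∞))
    (I := 𝓘(ℝ, HalfCoord n)) (t := t) ht (fun p => by
    obtain ⟨F, G, hF, hG, hFe, hGe, hF0, hW⟩ := exists_poissonInt_eq_local hf hσ hσN hf2 p.1
    refine ⟨Metric.ball p.1 (1 / 2) ×ˢ univ, (Metric.isOpen_ball.prod isOpen_univ).mem_nhds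
      ⟨Metric.mem_ball_self one_half_pos, mem_univ _⟩, fun q => (F q, G q),
      contMDiffOn_iff_contDiffOn.2 (hF.prodMk hG), fun q hq => ⟨fun h => ?_, fun h => ?_⟩⟩
    · rw [hW q.1 |q.2| (abs_pos.2 h)]
      rcases abs_choice q.2 with h' | h'
      · rw [h']
      · rw [h', hFe, hGe]
    · have := hF0 q.1 hq.1
      rwa [← h] at this)
  have hgs : ContDiff ℝ ∞ g := g.contMDiff.contDiff
  have hneg : ContDiff ℝ ∞ fun p : HalfCoord n => ((p.1, -p.2) : HalfCoord n) := by fun_prop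
  refine ⟨fun p => ((g p).1 + (g (p.1, -p.2)).1) / 2, fun p => ((g p).2 + (g (p.1, -p.2)).2) / 2,
    ((contDiff_fst.comp hgs).add (contDiff_fst.comp (hgs.comp hneg))).div_const 2,
    ((contDiff_snd.comp hgs).add (contDiff_snd.comp (hgs.comp hneg))).div_const 2,
    fun x y => by simp only [neg_neg]; ring, fun x y => by simp only [neg_neg]; ring,
    fun x => ?_, fun x y hy => ?_⟩
  · have h1 := (hg (x, 0)).2 rfl
    simp only [neg_zero, h1]; ring
  · have h1 := (hg (x, y)).1 hy.ne'
    have h2 := (hg (x, -y)).1 (neg_ne_zero.2 hy.ne')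
    simp only [abs_neg, abs_of_pos hy] at h1 h2
    simp only
    linear_combination (1 / 2) * h1 + (1 / 2) * h2

end

end

section

variable {n : ℕ}

theorem contDiff_tangentialLaplacian {F : HalfCoord n → ℝ} (hF : ContDiff ℝ ∞ F) :
    ContDiff ℝ ∞ (tangentialLaplacian F) := by
  rw [contDiff_iff_contDiffAt]
  intro p
  set R := 1 - p.2
  have h1 : SmoothHalf fun q : HalfCoord n => F (q.1, q.2 - R) :=
    (hF.comp (by fun_prop : ContDiff ℝ ∞ fun q : HalfCoord n => ((q.1, q.2 - R) : HalfCoord n))).contDiffOn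
  have h2 : ContDiff ℝ ∞ fun q : HalfCoord n => ((q.1, q.2 + R) : HalfCoord n) := by fun_prop
  have h3 := (h1.tangentialLaplacian.contDiffAt (p := (p.1, p.2 + R))
    (mem_upperHalf.2 (by simp [R]))).comp p h2.contDiffAt
  refine h3.congr_of_eventuallyEq (.of_forall fun q => ?_)
  simp [tangentialLaplacian]

theorem ContDiff.smoothHalf {F : HalfCoord n → ℝ} (hF : ContDiff ℝ ∞ F) : SmoothHalf F :=
  hF.contDiffOn

/-- The structure `F + y ^ s G` is stable under the tangential Laplacian. -/
theorem exists_iterate_tangentialLaplacian_eq {W F G : HalfCoord n → ℝ} (s : ℝ)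
    (hF : ContDiff ℝ ∞ F) (hG : ContDiff ℝ ∞ G)
    (hW : ∀ p ∈ upperHalf n, W p = F p + p.2 ^ s * G p) (j : ℕ) :
    ∃ F' G' : HalfCoord n → ℝ, ContDiff ℝ ∞ F' ∧ ContDiff ℝ ∞ G' ∧
      (∀ x, F' (x, 0) = laplacian^[j] (fun x => F (x, 0)) x) ∧
      ∀ p ∈ upperHalf n, tangentialLaplacian^[j] W p = F' p + p.2 ^ s * G' p := by
  induction j with
  | zero => exact ⟨F, G, hF, hG, fun x => rfl, hW⟩
  | succ j ih =>
    obtain ⟨F', G', hF', hG', h0, h1⟩ := ih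
    refine ⟨_, _, contDiff_tangentialLaplacian hF', contDiff_tangentialLaplacian hG', fun x => ?_,
      fun p hp => ?_⟩
    · have : (fun x => F' (x, 0)) = laplacian^[j] (fun x => F (x, 0)) := funext h0
      rw [iterate_succ_apply', ← this]; rfl
    · have hZ := tangentialOp_lap (n := n)
      rw [iterate_succ_apply', hZ.congr (V := F' + fun p => p.2 ^ s * G' p) h1 hp,
        hZ.add hF'.smoothHalf (hG'.smoothHalf.mul_right (contDiffOn_rpow_Ioi s)) hp, Pi.add_apply,
        hZ.mul (fun y => y ^ s) hG'.smoothHalf hp]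

theorem tendsto_add_rpow_mul {F G : HalfCoord n → ℝ} {s : ℝ} (hs : 0 < s) (hF : Continuous F)
    (hG : Continuous G) (x : Bdry n) :
    Tendsto (fun y : ℝ => F (x, y) + y ^ s * G (x, y)) (𝓝[>] 0) (𝓝 (F (x, 0))) := by
  have h : Tendsto (fun y : ℝ => ((x, y) : HalfCoord n)) (𝓝[>] 0) (𝓝 (x, 0)) :=
    ((Continuous.prodMk_right x).tendsto 0).mono_left nhdsWithin_le_nhds
  have := ((hF.tendsto (x, 0)).comp h).add
    ((tendsto_rpow_zero_right hs).mul ((hG.tendsto (x, 0)).comp h))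
  simpa using this

theorem normalOp_eq_gen (m : ℝ) : (normalOp m : (HalfCoord n → ℝ) → HalfCoord n → ℝ)
    = genLaplacian (fun U p => 0 * U p) m := by
  funext U p; simp [normalOp, genLaplacian]

namespace TangentialOp

variable {Z : (HalfCoord n → ℝ) → HalfCoord n → ℝ} {U : HalfCoord n → ℝ}

theorem comm_gen (hZ : TangentialOp Z) (a : ℝ) (hU : SmoothHalf U) :
    EqOn (Z (genLaplacian Z a U)) (genLaplacian Z a (Z U)) (upperHalf n) := fun p hp => by
  have hi : ContDiffOn ℝ ∞ (fun y : ℝ => a * y⁻¹) (Ioi 0) := contDiffOn_const.mul contDiffOn_inv_Ioi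
  have h1 : genLaplacian Z a U
      = (Z U + partialY (partialY U)) + fun p => (a * p.2⁻¹) * partialY U p := rfl
  rw [h1, hZ.add ((hZ.smooth hU).add hU.partialY.partialY) (hU.partialY.mul_right hi) hp,
    Pi.add_apply, hZ.add (hZ.smooth hU) hU.partialY.partialY hp,
    hZ.mul (fun y => a * y⁻¹) hU.partialY hp, Pi.add_apply, hZ.comm hU.partialY hp,
    partialY_congr (hZ.comm hU) hp]
  simp only [hZ.comm hU hp, genLaplacian]

theorem ker_apply (hZ : TangentialOp Z) {a : ℝ} (hU : SmoothHalf U)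
    (hk : ∀ p ∈ upperHalf n, genLaplacian Z a U p = 0) :
    ∀ p ∈ upperHalf n, genLaplacian Z a (Z U) p = 0 := fun p hp => by
  rw [← hZ.comm_gen a hU hp, hZ.congr (V := fun p => (fun _ => (0 : ℝ)) p.2 * U p)
    (fun q hq => by simp [hk q hq]) hp, hZ.mul (fun _ => (0 : ℝ)) hU hp]
  simp

theorem normalOp_iterate (hZ : TangentialOp Z) {a : ℝ} (j : ℕ) (hU : SmoothHalf U)
    (hk : ∀ p ∈ upperHalf n, genLaplacian Z a U p = 0) :
    EqOn ((normalOp a)^[j] U) (fun p => (-1) ^ j * Z^[j] U p) (upperHalf n) := by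
  induction j generalizing U with
  | zero => intro p _; simp
  | succ j ih =>
    intro p hp
    have h1 : EqOn (normalOp a U) (fun p => -1 * Z U p) (upperHalf n) := fun q hq => by
      have := hk q hq
      simp only [genLaplacian, normalOp] at this ⊢
      linarith
    have h0 := tangentialOp_smul (n := n) 0
    rw [normalOp_eq_gen] at h1 ih ⊢
    rw [Function.iterate_succ_apply, Function.iterate_succ_apply, h0.iter_congr a j h1 hp,
      h0.iter_const_mul a (-1) j (hZ.smooth hU) hp]
    simp only [ih (hZ.smooth hU) (hZ.ker_apply hU hk) hp]
    ring

end TangentialOp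

theorem evenFactor_ne_zero_of_ne {σ : ℝ} (hσN : ∀ N : ℕ, σ ≠ N) (j : ℕ) : evenFactor σ j ≠ 0 := by
  refine Finset.prod_ne_zero_iff.2 fun l _ => mul_ne_zero (by positivity) fun h => ?_
  exact hσN (l + 1) (by push_cast; linarith)

/-- The expansion of the Poisson integral at the boundary, with the coefficients of its first
part. -/
theorem exists_evenExp_poissonInt {f : Bdry n → ℝ} {σ : ℝ} (hf : ContDiff ℝ ∞ f) (hσ : 0 < σ)
    (hσN : ∀ N : ℕ, σ ≠ N) (hf2 : MemLp f 2 volume) :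
    ∃ F G : HalfCoord n → ℝ, ContDiff ℝ ∞ F ∧ ContDiff ℝ ∞ G ∧
      (∀ x y, F (x, -y) = F (x, y)) ∧ (∀ x y, G (x, -y) = G (x, y)) ∧ (∀ x, F (x, 0) = f x) ∧
      (∀ x y, 0 < y → poissonInt σ f (x, y) = F (x, y) + y ^ (2 * σ) * G (x, y)) ∧
      ∀ x J, EvenExp J (fun y => F (x, y))
        fun j => (-1) ^ j * laplacian^[j] f x / evenFactor σ j := by
  obtain ⟨F, G, hF, hG, hFe, hGe, hF0, hW⟩ := exists_poissonInt_eq hf hσ hσN hf2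
  have hF' := isSmoothEven_of_even hF hFe
  have hG' := isSmoothEven_of_even hG hGe
  refine ⟨F, G, hF, hG, hFe, hGe, hF0, hW, fun x J => ?_⟩
  convert hF'.evenExp x J using 2 with j
  set v : ℕ → ℝ := fun i =>
    iteratedDerivWithin (2 * i) (fun y => F (x, y)) (Ici 0) 0 / ((2 * i).factorial : ℝ)
  have hx := (EvenExp.hasExp hσ (hF'.evenExp x (0 + 1 + j)) (hG'.evenExp x (0 + 1 + j))
    (U := fun y => poissonInt σ f (x, y)) (fun y hy => hW x y hy)).tendsto_normalOp hσ
  obtain ⟨F', G', hF1, hG1, h0, h1⟩ := exists_iterate_tangentialLaplacian_eq (W := poissonInt σ f)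
    (2 * σ) hF hG
    (fun p hp => hW p.1 p.2 (mem_upperHalf.1 hp)) j
  have h2 := (tendsto_add_rpow_mul (by positivity : 0 < 2 * σ) hF1.continuous hG1.continuous
    x).const_mul ((-1) ^ j)
  rw [h0, funext hF0] at h2
  have h3 := tendsto_nhds_unique_of_eventuallyEq hx h2 (by
    filter_upwards [self_mem_nhdsWithin] with y hy
    have hp : ((x, y) : HalfCoord n) ∈ upperHalf n := mem_upperHalf.2 hy
    rw [tangentialOp_lap.normalOp_iterate j (smoothHalf_poissonInt hf2 hσ)
      (fun p hp => weightedLaplacian_poissonInt hf2 hσ hp) hp]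
    simp only [h1 _ hp])
  rw [div_eq_iff (evenFactor_ne_zero_of_ne hσN j), ← h3]
  ring

namespace ModerateGrowth

variable {U V : HalfCoord n → ℝ}

theorem congr (hU : ModerateGrowth U) (h : EqOn V U (upperHalf n)) : ModerateGrowth V := by
  obtain ⟨C, N, hC⟩ := hU
  refine ⟨C, N, fun y hy => ?_⟩
  have : (fun x => V (x, y)) = fun x => U (x, y) := funext fun x => h (mem_upperHalf.2 hy)
  rw [this]; exact hC y hy

theorem add (hU : ModerateGrowth U) (hV : ModerateGrowth V) : ModerateGrowth (U + V) := by
  obtain ⟨C, N, hC⟩ := hU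
  obtain ⟨D, M, hD⟩ := hV
  refine ⟨|C| + |D|, N + M, fun y hy => ⟨(hC y hy).1.add (hD y hy).1, ?_⟩⟩
  have h1 : (1 : ℝ) ≤ 1 + y := by linarith
  refine (eLpNorm_add_le (hC y hy).1.1 (hD y hy).1.1 (by norm_num)).trans
    ((add_le_add (hC y hy).2 (hD y hy).2).trans ?_)
  rw [add_mul, ENNReal.ofReal_add (by positivity) (by positivity)]
  refine add_le_add (ENNReal.ofReal_le_ofReal ?_) (ENNReal.ofReal_le_ofReal ?_)
  · exact mul_le_mul (le_abs_self C) (pow_le_pow_right₀ h1 (by omega)) (by positivity) (abs_nonneg C)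
  · exact mul_le_mul (le_abs_self D) (pow_le_pow_right₀ h1 (by omega)) (by positivity) (abs_nonneg D)

theorem rpow_mul (hU : ModerateGrowth U) (s : ℝ) (hs : 0 ≤ s) (c : ℝ) :
    ModerateGrowth fun p => (c * p.2 ^ s) * U p := by
  obtain ⟨C, N, hC⟩ := hU
  refine ⟨|c| * |C|, ⌈s⌉₊ + N, fun y hy => ⟨(hC y hy).1.const_mul (c * y ^ s), ?_⟩⟩
  have h1 : (1 : ℝ) ≤ 1 + y := by linarith
  have h2 : y ^ s ≤ (1 + y) ^ ⌈s⌉₊ := by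
    rw [← Real.rpow_natCast]
    exact (Real.rpow_le_rpow hy.le (by linarith) hs).trans
      (Real.rpow_le_rpow_of_exponent_le h1 (Nat.le_ceil s))
  have h3 := eLpNorm_const_smul (c * y ^ s) (fun x => U (x, y)) 2 (volume : Measure (Bdry n))
  refine (le_of_eq h3).trans ((mul_le_mul_right (hC y hy).2 _).trans ?_)
  rw [← ofReal_norm, ← ENNReal.ofReal_mul (norm_nonneg _)]
  refine ENNReal.ofReal_le_ofReal ?_
  rw [norm_mul, Real.norm_eq_abs, Real.norm_of_nonneg (Real.rpow_nonneg hy.le s), pow_add]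
  calc |c| * y ^ s * (C * (1 + y) ^ N) ≤ |c| * y ^ s * (|C| * (1 + y) ^ N) := by
        gcongr
        exact le_abs_self C
    _ ≤ |c| * (1 + y) ^ ⌈s⌉₊ * (|C| * (1 + y) ^ N) := by gcongr
    _ = _ := by ring

theorem exists_toReal_le (hU : ModerateGrowth U) : ∃ (C : ℝ) (N : ℕ), 0 ≤ C ∧ ∀ y, 0 < y →
    MemLp (fun x => U (x, y)) 2 volume ∧ (eLpNorm (fun x => U (x, y)) 2 volume).toReal ≤ C * (1 + y) ^ N := by
  obtain ⟨C, N, h⟩ := hU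
  refine ⟨|C|, N, abs_nonneg C, fun y hy => ⟨(h y hy).1, ENNReal.toReal_le_of_le_ofReal (by positivity)
    ((h y hy).2.trans (ENNReal.ofReal_le_ofReal ?_))⟩⟩
  gcongr
  exact le_abs_self C

theorem const_mul (hU : ModerateGrowth U) (c : ℝ) : ModerateGrowth fun p => c * U p := by
  simpa using hU.rpow_mul 0 le_rfl c

theorem sum {ι : Type*} (s : Finset ι) (c : ι → ℝ) {f : ι → HalfCoord n → ℝ}
    (hf : ∀ i ∈ s, ModerateGrowth (f i)) : ModerateGrowth fun p => ∑ i ∈ s, c i * f i p := by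
  classical
  induction s using Finset.induction_on with
  | empty => exact ⟨0, 0, fun y _ => by simp⟩
  | insert i s hi ih =>
    simp only [Finset.sum_insert hi]
    exact ((hf i (Finset.mem_insert_self i s)).const_mul (c i)).add
      (ih fun j hj => hf j (Finset.mem_insert_of_mem hj))

end ModerateGrowth

theorem moderateGrowth_poissonInt {f : Bdry n → ℝ} {σ : ℝ} (hf : MemLp f 2 volume) (hσ : 0 < σ) :
    ModerateGrowth (poissonInt σ f) := by
  obtain ⟨C, hC⟩ := exists_eLpNorm_poissonInt_le hf hσ
  exact ⟨C, 0, fun y hy => by simpa using hC y hy⟩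

/-- Solutions of `Δ_m ^ (N + 1) U = 0`, `m = 1 - 2 μ`, of moderate growth, with their expansions at
the boundary. -/
structure IsSolutionTerm (μ : ℝ) (N : ℕ) (U : HalfCoord n → ℝ) (v w : Bdry n → ℕ → ℝ) : Prop where
  smooth : SmoothHalf U
  growth : ModerateGrowth U
  eqn : ∀ p ∈ upperHalf n, (weightedLaplacian (1 - 2 * μ))^[N + 1] U p = 0
  mem : ∃ F G : HalfCoord n → ℝ, ContDiff ℝ ∞ F ∧ ContDiff ℝ ∞ G ∧
      (∀ x y, F (x, -y) = F (x, y)) ∧ (∀ x y, G (x, -y) = G (x, y)) ∧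
      ∀ p ∈ upperHalf n, U p = F p + p.2 ^ (2 * μ) * G p
  exp : ∀ x J, HasExp μ J (fun y => U (x, y)) (v x) (w x)

theorem IsSolutionTerm.sum {μ : ℝ} {N : ℕ} {ι : Type*} (s : Finset ι) (c : ι → ℝ)
    {U : ι → HalfCoord n → ℝ} {v w : ι → Bdry n → ℕ → ℝ}
    (h : ∀ i ∈ s, IsSolutionTerm μ N (U i) (v i) (w i)) :
    IsSolutionTerm μ N (fun p => ∑ i ∈ s, c i * U i p) (fun x j => ∑ i ∈ s, c i * v i x j)
      (fun x j => ∑ i ∈ s, c i * w i x j) := by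
  obtain ⟨h1, h2⟩ := tangentialOp_lap.iter_sum (1 - 2 * μ) (N + 1) s c
    fun i hi => (h i hi).smooth
  refine ⟨h1, ModerateGrowth.sum s c fun i hi => (h i hi).growth, fun p hp => ?_, ?_,
    fun x J => HasExp.sum s c fun i hi => (h i hi).exp x J⟩
  · refine (h2 hp).trans (Finset.sum_eq_zero fun i hi => ?_)
    have := (h i hi).eqn p hp
    rw [weightedLaplacian_eq_gen] at this
    rw [this, mul_zero]
  · have h3 := fun i : s => (h i i.2).mem
    choose F G hF hG hFe hGe hU using h3
    refine ⟨fun p => ∑ i : s, c i * F i p, fun p => ∑ i : s, c i * G i p,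
      ContDiff.sum fun i _ => contDiff_const.mul (hF i), ContDiff.sum fun i _ => contDiff_const.mul (hG i),
      fun x y => by simp only [hFe], fun x y => by simp only [hGe], fun p hp => ?_⟩
    rw [Finset.mul_sum, ← Finset.sum_add_distrib, ← Finset.sum_coe_sort s]
    exact Finset.sum_congr rfl fun i _ => by rw [hU i p hp]; ring

/-- The expansion coefficients `(-1)^i Δ^i f / evenFactor σ i`, shifted by `j`. -/
def shiftedCoef (σ : ℝ) (f : Bdry n → ℝ) (j : ℕ) (x : Bdry n) (i : ℕ) : ℝ :=
  if j ≤ i then (-1) ^ (i - j) * laplacian^[i - j] f x / evenFactor σ (i - j) else 0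

section

variable {μ : ℝ} {N : ℕ} {f : Bdry n → ℝ} (h0 : 0 < μ) (h1 : μ < 1) (hf : ContDiff ℝ ∞ f)
  (hf2 : MemLp f 2 volume) {j : ℕ} (hj : j ≤ N) {σ : ℝ} (hσ : 0 < σ) (hσN : ∀ M : ℕ, σ ≠ M)
include h0 h1 hf hf2 hj hσ hσN

theorem isSolutionTerm_even (e : σ = N + μ - 2 * j) :
    ∃ w, (∀ x i, i + j < N → w x i = 0) ∧
      IsSolutionTerm μ N (fun p => p.2 ^ (2 * (j : ℝ)) * poissonInt σ f p) (shiftedCoef σ f j) w := by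
  obtain ⟨F, G, hF, hG, hFe, hGe, hF0, hW, hexp⟩ := exists_evenExp_poissonInt hf hσ hσN hf2
  have hs := smoothHalf_poissonInt hf2 hσ
  have hnat : ∀ (i : ℕ) (y : ℝ), y ^ (2 * (i : ℝ)) = y ^ (2 * i) := fun i y => by
    rw [← Real.rpow_natCast]; push_cast; rfl
  have hrel : ∀ y : ℝ, 0 < y → y ^ (2 * (j : ℝ)) * y ^ (2 * σ)
      = y ^ (2 * μ) * y ^ (2 * ((N - j : ℕ) : ℝ)) := fun y hy => by
    rw [← Real.rpow_add hy, ← Real.rpow_add hy, e, Nat.cast_sub hj]; ring_nf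
  refine ⟨fun x i => if N - j ≤ i then iteratedDerivWithin (2 * (i - (N - j))) (fun y => G (x, y)) (Ici 0) 0
      / ((2 * (i - (N - j))).factorial : ℝ) else 0, fun x i hi => if_neg (by omega),
    hs.mul_right (contDiffOn_rpow_Ioi _), ?_, fun p hp => ?_, ?_, fun x J => ?_⟩
  · simpa using (moderateGrowth_poissonInt hf2 hσ).rpow_mul (2 * (j : ℝ)) (by positivity) 1
  · simp only [hnat]
    refine tangentialOp_lap.iter_pow_mul_eq_zero h0 h1 N j _ hj hs (fun q hq => ?_) p hp
    rw [show 1 - 2 * μ - 2 * ((N : ℝ) - 2 * j) = 1 - 2 * σ by rw [e]; ring]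
    exact weightedLaplacian_poissonInt hf2 hσ hq
  · refine ⟨fun p => p.2 ^ (2 * j) * F p, fun p => p.2 ^ (2 * (N - j)) * G p, by fun_prop, by fun_prop,
      fun x y => by simp only [hFe, even_two.mul_right j |>.neg_pow],
      fun x y => by simp only [hGe, even_two.mul_right (N - j) |>.neg_pow], fun p hp => ?_⟩
    have hy := mem_upperHalf.1 hp
    have := hrel p.2 hy
    simp only [hW p.1 p.2 hy, ← hnat]
    linear_combination G p * this
  · refine EvenExp.hasExp h0 (EvenExp.shift (hexp x) j J)
      (EvenExp.shift ((isSmoothEven_of_even hG hGe).evenExp x) (N - j) J) fun y hy => ?_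
    rw [hW x y hy]
    linear_combination G (x, y) * hrel y hy

theorem isSolutionTerm_odd (e : σ = N - μ - 2 * j) :
    ∃ v, (∀ x i, i + j < N → v x i = 0) ∧
      IsSolutionTerm μ N (fun p => p.2 ^ (2 * μ + 2 * (j : ℝ)) * poissonInt σ f p) v
        (shiftedCoef σ f j) := by
  obtain ⟨F, G, hF, hG, hFe, hGe, hF0, hW, hexp⟩ := exists_evenExp_poissonInt hf hσ hσN hf2
  have hs := smoothHalf_poissonInt hf2 hσ
  have hnat : ∀ (i : ℕ) (y : ℝ), y ^ (2 * (i : ℝ)) = y ^ (2 * i) := fun i y => by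
    rw [← Real.rpow_natCast]; push_cast; rfl
  have hrel : ∀ y : ℝ, 0 < y → y ^ (2 * μ + 2 * (j : ℝ)) * y ^ (2 * σ)
      = y ^ (2 * ((N - j : ℕ) : ℝ)) := fun y hy => by
    rw [← Real.rpow_add hy, e, Nat.cast_sub hj]; ring_nf
  have hrel2 : ∀ y : ℝ, 0 < y → y ^ (2 * μ + 2 * (j : ℝ)) = y ^ (2 * μ) * y ^ (2 * (j : ℝ)) :=
    fun y hy => Real.rpow_add hy _ _
  refine ⟨fun x i => if N - j ≤ i then iteratedDerivWithin (2 * (i - (N - j))) (fun y => G (x, y)) (Ici 0) 0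
      / ((2 * (i - (N - j))).factorial : ℝ) else 0, fun x i hi => if_neg (by omega),
    hs.mul_right (contDiffOn_rpow_Ioi _), ?_, fun p hp => ?_, ?_, fun x J => ?_⟩
  · simpa using (moderateGrowth_poissonInt hf2 hσ).rpow_mul (2 * μ + 2 * (j : ℝ)) (by positivity) 1
  · have hc : EqOn (fun p : HalfCoord n => p.2 ^ (2 * μ + 2 * (j : ℝ)) * poissonInt σ f p)
        (fun p => p.2 ^ (2 * (N - j)) * (p.2 ^ (-(2 * σ)) * poissonInt σ f p)) (upperHalf n) :=
      fun q hq => by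
        have hy := mem_upperHalf.1 hq
        simp only [← hnat, ← hrel q.2 hy, Real.rpow_neg hy.le]
        field_simp
    rw [weightedLaplacian_eq_gen, tangentialOp_lap.iter_congr _ (N + 1) hc hp]
    refine tangentialOp_lap.iter_pow_mul_eq_zero h0 h1 N (N - j) _ (Nat.sub_le N j)
      (hs.mul_right (contDiffOn_rpow_Ioi _)) (fun q hq => ?_) p hp
    rw [show 1 - 2 * μ - 2 * ((N : ℝ) - 2 * ((N - j : ℕ) : ℝ)) = 1 + 2 * σ by
      rw [e, Nat.cast_sub hj]; ring]
    exact tangentialOp_lap.ker_rpow_mul hs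
      (fun p hp => weightedLaplacian_poissonInt hf2 hσ hp) q hq
  · refine ⟨fun p => p.2 ^ (2 * (N - j)) * G p, fun p => p.2 ^ (2 * j) * F p, by fun_prop, by fun_prop,
      fun x y => by simp only [hGe, even_two.mul_right (N - j) |>.neg_pow],
      fun x y => by simp only [hFe, even_two.mul_right j |>.neg_pow], fun p hp => ?_⟩
    have hy := mem_upperHalf.1 hp
    have := hrel p.2 hy
    simp only [hW p.1 p.2 hy, ← hnat]
    linear_combination G p * this + F p * hrel2 p.2 hy
  · refine EvenExp.hasExp h0 (EvenExp.shift ((isSmoothEven_of_even hG hGe).evenExp x) (N - j) J)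
      (EvenExp.shift (hexp x) j J) fun y hy => ?_
    rw [hW x y hy]
    linear_combination G (x, y) * hrel y hy + F (x, y) * hrel2 y hy

end

theorem gamma_add_nat {c : ℝ} (hc : ∀ i : ℕ, c + i ≠ 0) (j : ℕ) :
    Real.Gamma (c + j) = Real.Gamma c * ∏ i ∈ Finset.range j, (c + i) := by
  induction j with
  | zero => simp
  | succ j ih =>
    rw [Nat.cast_succ, ← add_assoc, Real.Gamma_add_one (hc j), ih, Finset.prod_range_succ]; ring

theorem gamma_ne_zero_of_add_ne_zero {c : ℝ} (hc : ∀ i : ℕ, c + i ≠ 0) : Real.Gamma c ≠ 0 :=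
  Real.Gamma_ne_zero fun m h => hc m (by rw [h]; simp)

theorem gamma_add_nat_ne_zero {c : ℝ} (hc : ∀ i : ℕ, c + i ≠ 0) (j : ℕ) :
    Real.Gamma (c + j) ≠ 0 :=
  gamma_ne_zero_of_add_ne_zero fun i h => hc (j + i) (by push_cast; linarith)

theorem evenFactor_eq_gamma {σ : ℝ} (hσ : ∀ i : ℕ, (1 - σ) + i ≠ 0) (j : ℕ) :
    evenFactor σ j = 4 ^ j * j.factorial * (Real.Gamma (1 - σ + j) / Real.Gamma (1 - σ)) := by
  rw [gamma_add_nat hσ, mul_div_cancel_left₀ _ (gamma_ne_zero_of_add_ne_zero hσ)]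
  induction j with
  | zero => simp [evenFactor]
  | succ j ih =>
    have : evenFactor σ (j + 1) = evenFactor σ j * (2 * (j + 1) * (2 * (j + 1) - 2 * σ)) :=
      Finset.prod_range_succ _ _
    rw [this, ih, Finset.prod_range_succ, Nat.factorial_succ]
    push_cast; ring

theorem oddFactor_eq_gamma {μ : ℝ} (hμ : 0 < μ) (j : ℕ) :
    oddFactor μ j = 2 * 4 ^ j * j.factorial * (Real.Gamma (1 + μ + j) / Real.Gamma μ) := by
  have h1 : ∀ i : ℕ, 1 + μ + i ≠ 0 := fun i => by positivity
  rw [gamma_add_nat h1, add_comm 1 μ, Real.Gamma_add_one hμ.ne', mul_assoc μ, mul_div_assoc,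
    mul_div_cancel_left₀ _ (Real.Gamma_pos_of_pos hμ).ne']
  induction j with
  | zero => simp [oddFactor]
  | succ j ih =>
    have : oddFactor μ (j + 1) = oddFactor μ j * ((2 * μ + 2 * (j + 1)) * (2 * (j + 1))) := by
      simp only [oddFactor, Finset.prod_range_succ]; ring
    rw [this, ih, Finset.prod_range_succ, Nat.factorial_succ]
    push_cast; ring

/-- The coefficient of `F^{(2j)}` in the solution of the Dirichlet problem. -/
def evenCoef (μ : ℝ) (j : ℕ) : ℝ :=
  (-1 : ℝ) ^ j * (2 : ℝ) ^ (-(2 * (j : ℤ)))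
    * (Real.Gamma (1 - μ) / ((j.factorial : ℝ) * Real.Gamma (1 + j - μ)))

/-- The coefficient of `Φ^{(2j)}` in the solution of the Dirichlet problem. -/
def oddCoef (μ : ℝ) (j : ℕ) : ℝ :=
  (-1 : ℝ) ^ (j + 1) * (2 : ℝ) ^ (-(2 * (j : ℤ)) - 1)
    * (Real.Gamma μ / ((j.factorial : ℝ) * Real.Gamma (1 + j + μ)))

theorem two_zpow_neg (j : ℕ) : (2 : ℝ) ^ (-(2 * (j : ℤ))) = (4 ^ j)⁻¹ := by
  rw [zpow_neg, zpow_mul]; norm_num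

theorem two_zpow_neg_sub_one (j : ℕ) : (2 : ℝ) ^ (-(2 * (j : ℤ)) - 1) = (2 * 4 ^ j)⁻¹ := by
  rw [zpow_sub_one₀ two_ne_zero, two_zpow_neg, mul_inv]; ring

/-- The Gamma factor identity behind the even boundary operators. -/
theorem evenFactor_mul_evenCoef {μ σ : ℝ} (hμ1 : μ < 1) (hσN : ∀ N : ℕ, σ ≠ N) (i l : ℕ) :
    (-1) ^ (l + i) * (evenFactor μ (l + i) * (evenCoef μ l * ((-1) ^ i / evenFactor σ i)))
      = ((l + i).choose i : ℝ) * ((Real.Gamma (1 + (l + i : ℕ) - μ) * Real.Gamma (1 - σ))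
        / (Real.Gamma (1 + l - μ) * Real.Gamma (1 - σ + i))) := by
  have h1 : ∀ j : ℕ, 1 - μ + j ≠ 0 := fun j => by
    have : (0 : ℝ) ≤ j := Nat.cast_nonneg j
    linarith
  have h2 : ∀ j : ℕ, 1 - σ + j ≠ 0 := fun j h => hσN (j + 1) (by push_cast; linarith)
  have g1 := gamma_ne_zero_of_add_ne_zero h1
  have g2 := gamma_ne_zero_of_add_ne_zero h2
  have g3 := gamma_add_nat_ne_zero h1 l
  have g4 := gamma_add_nat_ne_zero h2 i
  have f1 : ((l.factorial : ℝ)) ≠ 0 := by positivity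
  have f2 : ((i.factorial : ℝ)) ≠ 0 := by positivity
  rw [evenFactor_eq_gamma h1, evenFactor_eq_gamma h2, evenCoef, two_zpow_neg,
    Nat.choose_symm_add.symm, Nat.cast_add_choose, show (1 : ℝ) + l - μ = 1 - μ + l by ring,
    show (1 : ℝ) + (l + i : ℕ) - μ = 1 - μ + (l + i : ℕ) by ring, pow_add, pow_add]
  have s : ((-1 : ℝ) ^ l * (-1) ^ i) * ((-1) ^ l * (-1) ^ i) = 1 := by
    rw [← pow_add, ← mul_pow]; norm_num
  field_simp
  linear_combination Real.Gamma (1 - μ + (l + i : ℕ)) * s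

/-- The Gamma factor identity behind the odd boundary operators. -/
theorem oddFactor_mul_oddCoef {μ σ : ℝ} (hμ : 0 < μ) (hσN : ∀ N : ℕ, σ ≠ N) (i l : ℕ) :
    (-1) ^ (l + i + 1) * (oddFactor μ (l + i) * (oddCoef μ l * ((-1) ^ i / evenFactor σ i)))
      = ((l + i).choose i : ℝ) * ((Real.Gamma (1 + (l + i : ℕ) + μ) * Real.Gamma (1 - σ))
        / (Real.Gamma (1 + l + μ) * Real.Gamma (1 - σ + i))) := by
  have h1 : ∀ j : ℕ, 1 + μ + j ≠ 0 := fun j => by positivity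
  have h2 : ∀ j : ℕ, 1 - σ + j ≠ 0 := fun j h => hσN (j + 1) (by push_cast; linarith)
  have g1 := (Real.Gamma_pos_of_pos hμ).ne'
  have g2 := gamma_ne_zero_of_add_ne_zero h2
  have g3 := gamma_add_nat_ne_zero h1 l
  have g4 := gamma_add_nat_ne_zero h2 i
  have f1 : ((l.factorial : ℝ)) ≠ 0 := by positivity
  have f2 : ((i.factorial : ℝ)) ≠ 0 := by positivity
  rw [oddFactor_eq_gamma hμ, evenFactor_eq_gamma h2, oddCoef, two_zpow_neg_sub_one,
    Nat.choose_symm_add.symm, Nat.cast_add_choose, show (1 : ℝ) + l + μ = 1 + μ + l by ring,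
    show (1 : ℝ) + (l + i : ℕ) + μ = 1 + μ + (l + i : ℕ) by ring, pow_succ, pow_add, pow_add, pow_succ]
  have s : ((-1 : ℝ) ^ l * (-1) ^ i) * ((-1) ^ l * (-1) ^ i) = 1 := by
    rw [← pow_add, ← mul_pow]; norm_num
  field_simp
  linear_combination s

theorem evenFactor_mul_evenCoef_self {μ : ℝ} (hμ1 : μ < 1) (j : ℕ) :
    (-1) ^ j * (evenFactor μ j * evenCoef μ j) = 1 := by
  have h1 : ∀ j : ℕ, 1 - μ + j ≠ 0 := fun j => by
    have : (0 : ℝ) ≤ j := Nat.cast_nonneg j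
    linarith
  have g1 := gamma_ne_zero_of_add_ne_zero h1
  have g3 := gamma_add_nat_ne_zero h1 j
  have f1 : ((j.factorial : ℝ)) ≠ 0 := by positivity
  rw [evenFactor_eq_gamma h1, evenCoef, two_zpow_neg, show (1 : ℝ) + j - μ = 1 - μ + j by ring]
  have s : (-1 : ℝ) ^ j * (-1) ^ j = 1 := by rw [← mul_pow]; norm_num
  field_simp
  linear_combination s

theorem oddFactor_mul_oddCoef_self {μ : ℝ} (hμ : 0 < μ) (j : ℕ) :
    (-1) ^ (j + 1) * (oddFactor μ j * oddCoef μ j) = 1 := by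
  have h1 : ∀ j : ℕ, 1 + μ + j ≠ 0 := fun j => by positivity
  have g1 := (Real.Gamma_pos_of_pos hμ).ne'
  have g3 := gamma_add_nat_ne_zero h1 j
  have f1 : ((j.factorial : ℝ)) ≠ 0 := by positivity
  rw [oddFactor_eq_gamma hμ, oddCoef, two_zpow_neg_sub_one, show (1 : ℝ) + j + μ = 1 + μ + j by ring,
    pow_succ]
  have s : (-1 : ℝ) ^ j * (-1) ^ j = 1 := by rw [← mul_pow]; norm_num
  field_simp
  linear_combination s

/-- A finite sum of shifted expansions, split into the top term and the rest. -/
theorem sum_shiftedCoef {σ c : ℕ → ℝ} {f : ℕ → Bdry n → ℝ} {j p : ℕ} (hj : j ≤ p) (x : Bdry n) :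
    ∑ l ∈ Finset.range (p + 1), c l * shiftedCoef (σ l) (f l) l x j
      = c j * f j x + ∑ i : Fin j, c (j - (i.1 + 1)) * ((-1) ^ (i.1 + 1)
        * laplacian^[i.1 + 1] (f (j - (i.1 + 1))) x / evenFactor (σ (j - (i.1 + 1))) (i.1 + 1)) := by
  have h1 : ∑ l ∈ Finset.range (p + 1), c l * shiftedCoef (σ l) (f l) l x j
      = ∑ l ∈ Finset.range (j + 1), c l * shiftedCoef (σ l) (f l) l x j := by
    refine (Finset.sum_subset (Finset.range_mono (by omega)) fun l _ hl => ?_).symm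
    rw [shiftedCoef, if_neg (by simpa using hl), mul_zero]
  rw [h1, Finset.sum_range_succ, add_comm, ← Finset.sum_range_reflect, Finset.sum_range]
  congr 1
  · simp [shiftedCoef, evenFactor]
  · refine Finset.sum_congr rfl fun i _ => ?_
    have hi := i.2
    rw [show j - 1 - i.1 = j - (i.1 + 1) by omega, shiftedCoef, if_pos (by omega),
      show j - (j - (i.1 + 1)) = i.1 + 1 by omega]

/-- The even boundary data of a function with the expansion of the solution. -/
theorem evenBdryOp_eq {γ : ℝ} (hγN : ∀ N : ℕ, γ ≠ N) {f : ℕ → Bdry n → ℝ} {U : HalfCoord n → ℝ} {p : ℕ}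
    (h : ∀ j ≤ p, ∀ x, Tendsto (fun y => (normalOp (weightExp γ))^[j] U (x, y)) (𝓝[>] 0)
      (𝓝 (evenFactor (Int.fract γ) j * ∑ l ∈ Finset.range (p + 1),
        evenCoef (Int.fract γ) l * shiftedCoef (γ - 2 * l) (f l) l x j))) :
    ∀ j ≤ p, evenBdryOp γ U j = f j := by
  intro j
  induction j using Nat.strong_induction_on with
  | _ j ih =>
    intro hj
    funext x
    rw [evenBdryOp, (h j hj x).limUnder_eq, sum_shiftedCoef hj]
    have hN : ∀ l ≤ p, ∀ N : ℕ, γ - 2 * (l : ℝ) ≠ N := fun l _ N e =>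
      hγN (N + 2 * l) (by push_cast; linarith)
    have e1 := evenFactor_mul_evenCoef_self (Int.fract_lt_one γ) j
    rw [mul_add, mul_add, add_sub_assoc, Finset.mul_sum, Finset.mul_sum, ← Finset.sum_sub_distrib,
      Finset.sum_eq_zero, add_zero]
    · linear_combination f j x * e1
    · intro i _
      have hi := i.2
      have hji : j - (i.1 + 1) + (i.1 + 1) = j := by omega
      have e2 := evenFactor_mul_evenCoef (Int.fract_lt_one γ) (hN (j - (i.1 + 1)) (by omega)) (i.1 + 1)
        (j - (i.1 + 1))
      rw [hji] at e2
      rw [ih (j - (i.1 + 1)) (by omega) (by omega), show (1 : ℝ) + 2 * j - 2 * ((i.1 : ℝ) + 1) - γ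
        = 1 - (γ - 2 * ((j - (i.1 + 1) : ℕ) : ℝ)) by rw [Nat.cast_sub (by omega)]; push_cast; ring,
        show (1 : ℝ) + 2 * j - ((i.1 : ℝ) + 1) - γ
          = 1 - (γ - 2 * ((j - (i.1 + 1) : ℕ) : ℝ)) + ((i.1 + 1 : ℕ) : ℝ) by
          rw [Nat.cast_sub (by omega)]; push_cast; ring,
        show (1 : ℝ) + j - ((i.1 : ℝ) + 1) - Int.fract γ
          = 1 + ((j - (i.1 + 1) : ℕ) : ℝ) - Int.fract γ by
          rw [Nat.cast_sub (by omega)]; push_cast; ring]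
      rw [← e2]
      ring

/-- The odd boundary data of a function with the expansion of the solution. -/
theorem oddBdryOp_eq {γ : ℝ} (hμ : 0 < Int.fract γ)
    {f : ℕ → Bdry n → ℝ} {U : HalfCoord n → ℝ} {p : ℕ}
    (hN : ∀ l ≤ p, ∀ N : ℕ, ⌊γ⌋₊ - Int.fract γ - 2 * (l : ℝ) ≠ N)
    (h : ∀ j ≤ p, ∀ x, Tendsto
      (fun y => y ^ weightExp γ * partialY ((normalOp (weightExp γ))^[j] U) (x, y)) (𝓝[>] 0)
      (𝓝 (oddFactor (Int.fract γ) j * ∑ l ∈ Finset.range (p + 1),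
        oddCoef (Int.fract γ) l * shiftedCoef (⌊γ⌋₊ - Int.fract γ - 2 * l) (f l) l x j))) :
    ∀ j ≤ p, oddBdryOp γ U j = f j := by
  intro j
  induction j using Nat.strong_induction_on with
  | _ j ih =>
    intro hj
    funext x
    rw [oddBdryOp, (h j hj x).limUnder_eq, sum_shiftedCoef hj]
    have e1 := oddFactor_mul_oddCoef_self hμ j
    rw [mul_add, mul_add, add_sub_assoc, Finset.mul_sum, Finset.mul_sum, ← Finset.sum_sub_distrib,
      Finset.sum_eq_zero, add_zero]
    · linear_combination f j x * e1
    · intro i _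
      have hi := i.2
      have hji : j - (i.1 + 1) + (i.1 + 1) = j := by omega
      have e2 := oddFactor_mul_oddCoef hμ (hN (j - (i.1 + 1)) (by omega)) (i.1 + 1)
        (j - (i.1 + 1))
      rw [hji] at e2
      rw [ih (j - (i.1 + 1)) (by omega) (by omega),
        show (1 : ℝ) + 2 * j - 2 * ((i.1 : ℝ) + 1) - ⌊γ⌋₊ + Int.fract γ
          = 1 - (⌊γ⌋₊ - Int.fract γ - 2 * ((j - (i.1 + 1) : ℕ) : ℝ)) by
          rw [Nat.cast_sub (by omega)]; push_cast; ring,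
        show (1 : ℝ) + 2 * j - ((i.1 : ℝ) + 1) - ⌊γ⌋₊ + Int.fract γ
          = 1 - (⌊γ⌋₊ - Int.fract γ - 2 * ((j - (i.1 + 1) : ℕ) : ℝ)) + ((i.1 + 1 : ℕ) : ℝ) by
          rw [Nat.cast_sub (by omega)]; push_cast; ring,
        show (1 : ℝ) + j - ((i.1 : ℝ) + 1) + Int.fract γ
          = 1 + ((j - (i.1 + 1) : ℕ) : ℝ) + Int.fract γ by
          rw [Nat.cast_sub (by omega)]; push_cast; ring]
      rw [← e2]
      ring

/-- Conjugation of the hyperbolic eigenvalue equation to the weighted Laplacian. -/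
theorem hyperbolicLaplacian_rpow_mul {W : HalfCoord n → ℝ} (hW : SmoothHalf W) (σ : ℝ)
    {p : HalfCoord n} (hp : p ∈ upperHalf n) :
    hyperbolicLaplacian (fun p => p.2 ^ (((n : ℝ) - 2 * σ) / 2) * W p) p
      + ((n : ℝ) ^ 2 / 4 - σ ^ 2) * (p.2 ^ (((n : ℝ) - 2 * σ) / 2) * W p)
      = p.2 ^ 2 * p.2 ^ (((n : ℝ) - 2 * σ) / 2) * weightedLaplacian (1 - 2 * σ) W p := by
  set s := ((n : ℝ) - 2 * σ) / 2 with hs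
  have hy := mem_upperHalf.1 hp
  have hd1 : ∀ y : ℝ, 0 < y → HasDerivAt (fun y : ℝ => y ^ s) (s * y ^ (s - 1)) y :=
    fun y hy => Real.hasDerivAt_rpow_const (Or.inl hy.ne')
  have hd2 : ∀ y : ℝ, 0 < y → HasDerivAt (fun y : ℝ => s * y ^ (s - 1))
      (s * ((s - 1) * y ^ (s - 1 - 1))) y :=
    fun y hy => (Real.hasDerivAt_rpow_const (Or.inl hy.ne')).const_mul _
  have h1 := partialY_mul_eqOn hW hd1 hp
  have h2 := (tangentialOp_smul (n := n) 0).gen_mul 0 hW hd1 hd2 hp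
  have h3 := tangentialOp_lap.mul (fun y => y ^ s) hW hp
  simp only [genLaplacian, zero_mul, add_zero, zero_add, mul_zero] at h2
  simp only [hyperbolicLaplacian, h1, h2, h3, weightedLaplacian, Real.rpow_sub_one hy.ne']
  have hn : (n : ℝ) = 2 * s + 2 * σ := by rw [hs]; ring
  rw [hn]
  field_simp
  ring

theorem isPoissonSolution_poissonInt {f : Bdry n → ℝ} {σ : ℝ} (hf : ContDiff ℝ ∞ f) (hσ : 0 < σ)
    (hσN : ∀ N : ℕ, σ ≠ N) (hf2 : MemLp f 2 volume) :
    IsPoissonSolution σ f fun p => p.2 ^ (((n : ℝ) - 2 * σ) / 2) * poissonInt σ f p := by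
  have hs := smoothHalf_poissonInt hf2 hσ
  have hc : ∀ p ∈ upperHalf n, p.2 ^ (-(((n : ℝ) - 2 * σ) / 2)) *
      (p.2 ^ (((n : ℝ) - 2 * σ) / 2) * poissonInt σ f p) = poissonInt σ f p := fun p hp => by
    have hy := mem_upperHalf.1 hp
    rw [← mul_assoc, ← Real.rpow_add hy, neg_add_cancel, Real.rpow_zero, one_mul]
  refine ⟨hs.mul_right (contDiffOn_rpow_Ioi _), fun x y hy => ?_, fun x => ?_,
    (moderateGrowth_poissonInt hf2 hσ).congr fun p hp => hc p hp⟩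
  · have hp : ((x, y) : HalfCoord n) ∈ upperHalf n := mem_upperHalf.2 hy
    rw [hyperbolicLaplacian_rpow_mul hs σ hp, weightedLaplacian_poissonInt hf2 hσ hp, mul_zero]
  · obtain ⟨F, G, hF, hG, -, -, hF0, hW, -⟩ := exists_evenExp_poissonInt hf hσ hσN hf2
    have := tendsto_add_rpow_mul (by positivity : 0 < 2 * σ) hF.continuous hG.continuous x
    rw [hF0] at this
    refine this.congr' ?_
    filter_upwards [self_mem_nhdsWithin] with y hy
    rw [← hW x y hy]
    exact (hc (x, y) (mem_upperHalf.2 hy)).symm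

theorem smoothHalf_of_isPoissonSolution {f : Bdry n → ℝ} {σ : ℝ} {P : HalfCoord n → ℝ}
    (hP : IsPoissonSolution σ f P) :
    SmoothHalf (fun p => p.2 ^ (-(((n : ℝ) - 2 * σ) / 2)) * P p) :=
  SmoothHalf.mul_right hP.smooth (contDiffOn_rpow_Ioi _)

theorem weightedLaplacian_of_isPoissonSolution {f : Bdry n → ℝ} {σ : ℝ} {P : HalfCoord n → ℝ}
    (hP : IsPoissonSolution σ f P) : ∀ p ∈ upperHalf n,
    weightedLaplacian (1 - 2 * σ) (fun p => p.2 ^ (-(((n : ℝ) - 2 * σ) / 2)) * P p) p = 0 := by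
  intro p hp
  have hy := mem_upperHalf.1 hp
  set W : HalfCoord n → ℝ := fun p => p.2 ^ (-(((n : ℝ) - 2 * σ) / 2)) * P p
  have hWs : SmoothHalf W := smoothHalf_of_isPoissonSolution hP
  have e : EqOn P (fun p => p.2 ^ (((n : ℝ) - 2 * σ) / 2) * W p) (upperHalf n) := fun q hq => by
    have hy := mem_upperHalf.1 hq
    simp only [W]
    rw [← mul_assoc, ← Real.rpow_add hy, add_neg_cancel, Real.rpow_zero, one_mul]
  have h1 := hyperbolicLaplacian_rpow_mul hWs σ hp
  have h2 := hP.eqn p.1 p.2 hy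
  simp only [hyperbolicLaplacian, partialY_congr e hp, partialY_congr (partialY_congr e) hp, e hp,
    tangentialOp_lap.congr e hp] at h1 h2
  rw [h2] at h1
  have : p.2 ^ 2 * p.2 ^ (((n : ℝ) - 2 * σ) / 2) ≠ 0 := by positivity
  exact (mul_eq_zero.1 h1.symm).resolve_left this

section

variable {γ : ℝ} (hγ : 0 < γ) (hγN : ∀ N : ℕ, γ ≠ N)
include hγ hγN

theorem fract_pos_of_ne : 0 < Int.fract γ := by
  refine (Int.fract_nonneg γ).lt_of_ne fun h => hγN ⌊γ⌋₊ ?_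
  rw [natCast_floor_eq_intCast_floor hγ.le]
  have := Int.self_sub_fract γ
  rw [← h] at this; simpa using this

omit hγN in
theorem eq_floor_add_fract : γ = ⌊γ⌋₊ + Int.fract γ := by
  rw [natCast_floor_eq_intCast_floor hγ.le]
  exact (Int.floor_add_fract γ).symm

end

/-- The explicit solution of the Dirichlet problem. -/
def dirichletSol (γ : ℝ) (f φ : ℕ → Bdry n → ℝ) (p : HalfCoord n) : ℝ :=
  ∑ j ∈ Finset.range (⌊γ / 2⌋₊ + 1), evenCoef (Int.fract γ) j
      * (p.2 ^ (2 * (j : ℝ)) * poissonInt (γ - 2 * j) (f j) p)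
    + ∑ j ∈ Finset.range (⌊γ⌋₊ - ⌊γ / 2⌋₊), oddCoef (Int.fract γ) j
      * (p.2 ^ (2 * Int.fract γ + 2 * (j : ℝ)) * poissonInt (⌊γ⌋₊ - Int.fract γ - 2 * j) (φ j) p)

section

variable {γ : ℝ} (hγ : 0 < γ) (hγN : ∀ N : ℕ, γ ≠ N)
include hγ hγN

theorem even_index_pos {j : ℕ} (hj : j ≤ ⌊γ / 2⌋₊) :
    0 < γ - 2 * (j : ℝ) ∧ ∀ M : ℕ, γ - 2 * (j : ℝ) ≠ M := by
  have h2 : ∀ M : ℕ, γ - 2 * (j : ℝ) ≠ M := fun M h => hγN (M + 2 * j) (by push_cast; linarith)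
  have h1 := Nat.floor_le (by positivity : 0 ≤ γ / 2)
  have h3 : (j : ℝ) ≤ ⌊γ / 2⌋₊ := by exact_mod_cast hj
  refine ⟨lt_of_le_of_ne (by linarith) fun h => h2 0 (by simpa using h.symm), h2⟩

theorem odd_index_pos {j : ℕ} (hj : j < ⌊γ⌋₊ - ⌊γ / 2⌋₊) :
    0 < (⌊γ⌋₊ : ℝ) - Int.fract γ - 2 * j ∧ ∀ M : ℕ, (⌊γ⌋₊ : ℝ) - Int.fract γ - 2 * j ≠ M := by
  rw [Nat.floor_div_ofNat] at hj
  have h1 : 2 * j + 1 ≤ ⌊γ⌋₊ := by change j < ⌊γ⌋₊ - ⌊γ⌋₊ / 2 at hj; omega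
  have h2 : 2 * (j : ℝ) + 1 ≤ ⌊γ⌋₊ := by exact_mod_cast h1
  have h3 := Int.fract_lt_one γ
  refine ⟨by linarith, fun M h => ?_⟩
  have h4 := fract_pos_of_ne hγ hγN
  have h5 : (⌊γ⌋₊ : ℝ) - (2 * j : ℕ) - M = Int.fract γ := by push_cast; linarith
  rw [← h5] at h3 h4
  have h6 : (M : ℝ) + (2 * j : ℕ) < ⌊γ⌋₊ := by linarith
  have h7 : (⌊γ⌋₊ : ℝ) < M + (2 * j : ℕ) + 1 := by linarith
  norm_cast at h6 h7
  omega

theorem isDirichletSolution_dirichletSol {f φ : ℕ → Bdry n → ℝ}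
    (hf : ∀ j ≤ ⌊γ / 2⌋₊, ContDiff ℝ ∞ (f j) ∧ MemLp (f j) 2 volume)
    (hφ : ∀ j < ⌊γ⌋₊ - ⌊γ / 2⌋₊, ContDiff ℝ ∞ (φ j) ∧ MemLp (φ j) 2 volume) :
    IsDirichletSolution γ f φ (dirichletSol γ f φ) := by
  set N := ⌊γ⌋₊
  set p := ⌊γ / 2⌋₊ with hpd
  set μ := Int.fract γ
  have hpN : p = N / 2 := by rw [hpd, Nat.floor_div_ofNat]
  have hμ : 0 < μ := fract_pos_of_ne hγ hγN
  have hμ1 : μ < 1 := Int.fract_lt_one γ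
  have hγe : γ = N + μ := eq_floor_add_fract hγ
  have he := fun j (hj : j ≤ p) => isSolutionTerm_even hμ hμ1 (hf j hj).1 (hf j hj).2
    (by omega : j ≤ N) (even_index_pos hγ hγN hj).1 (even_index_pos hγ hγN hj).2 (by rw [hγe])
  have ho := fun j (hj : j < N - p) => isSolutionTerm_odd hμ hμ1 (hφ j hj).1 (hφ j hj).2
    (by omega : j ≤ N) (odd_index_pos hγ hγN hj).1 (odd_index_pos hγ hγN hj).2 rfl
  choose! w' hw' hes using he
  choose! v' hv' hos using ho
  have key := IsSolutionTerm.sum (μ := μ) (N := N) (n := n)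
    ((Finset.range (p + 1)).disjSum (Finset.range (N - p)))
    (Sum.elim (evenCoef μ) (oddCoef μ))
    (U := Sum.elim (fun j p => p.2 ^ (2 * (j : ℝ)) * poissonInt (γ - 2 * j) (f j) p)
      (fun j p => p.2 ^ (2 * μ + 2 * (j : ℝ)) * poissonInt (N - μ - 2 * j) (φ j) p))
    (v := Sum.elim (fun j => shiftedCoef (γ - 2 * j) (f j) j) v')
    (w := Sum.elim w' (fun j => shiftedCoef (N - μ - 2 * j) (φ j) j)) (by
      rintro (j | j) hj
      · exact hes j (by simpa [Nat.lt_succ_iff] using hj)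
      · exact hos j (by simpa using hj))
  simp only [Finset.sum_disjSum, Sum.elim_inl, Sum.elim_inr] at key
  change IsSolutionTerm μ N (dirichletSol γ f φ) _ _ at key
  obtain ⟨hs, hg, hq, ⟨F, G, hF, hG, hFe, hGe, hV⟩, hexp⟩ := key
  refine ⟨⟨F, G, isSmoothEven_of_even hF hFe, isSmoothEven_of_even hG hGe,
    fun x y hy => hV _ (mem_upperHalf.2 hy)⟩, hg, fun x y hy => hq _ (mem_upperHalf.2 hy), ?_, ?_⟩
  · refine evenBdryOp_eq hγN fun j hj x => ?_
    have hz : ∑ l ∈ Finset.range (N - p), oddCoef μ l * v' l x j = 0 :=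
      Finset.sum_eq_zero fun l hl => by
        have hl := Finset.mem_range.1 hl
        rw [hv' l hl x j (by omega), mul_zero]
    have h := (hexp x (0 + 1 + j)).tendsto_normalOp hμ
    simp only [hz, add_zero] at h
    exact h
  · intro j hj
    refine oddBdryOp_eq (p := N - p - 1) hμ (fun l hl M => (odd_index_pos hγ hγN (by omega)).2 M)
      (fun j hj x => ?_) j (by omega)
    have hz : ∑ l ∈ Finset.range (p + 1), evenCoef μ l * w' l x j = 0 :=
      Finset.sum_eq_zero fun l hl => by
        have hl := Finset.mem_range.1 hl
        rw [hw' l (by omega) x j (by omega), mul_zero]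
    have h := (hexp x (0 + 1 + j)).tendsto_partialY_normalOp hμ hμ1
    simp only [hz, zero_add] at h
    rw [show N - p - 1 + 1 = N - p by omega]
    exact h

end

end

section

section volterra

variable {E : Type*} [NormedAddCommGroup E]

/-- Functions that are continuous on `(0, ∞)` and bounded on the intervals `(0, Y]`. -/
structure LocBounded (f : ℝ → E) : Prop where
  cont : ContinuousOn f (Ioi 0)
  bdd : ∀ Y : ℝ, ∃ C : ℝ, ∀ y ∈ Ioc 0 Y, ‖f y‖ ≤ C

namespace LocBounded

variable {f g : ℝ → E}

theorem add (hf : LocBounded f) (hg : LocBounded g) : LocBounded fun y => f y + g y := by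
  refine ⟨hf.cont.add hg.cont, fun Y => ?_⟩
  obtain ⟨C, hC⟩ := hf.bdd Y
  obtain ⟨D, hD⟩ := hg.bdd Y
  exact ⟨C + D, fun y hy => (norm_add_le _ _).trans (add_le_add (hC y hy) (hD y hy))⟩

theorem sub (hf : LocBounded f) (hg : LocBounded g) : LocBounded fun y => f y - g y := by
  refine ⟨hf.cont.sub hg.cont, fun Y => ?_⟩
  obtain ⟨C, hC⟩ := hf.bdd Y
  obtain ⟨D, hD⟩ := hg.bdd Y
  exact ⟨C + D, fun y hy => (norm_sub_le _ _).trans (add_le_add (hC y hy) (hD y hy))⟩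

theorem const_smul {𝕜 : Type*} [NormedField 𝕜] [NormedSpace 𝕜 E] (hf : LocBounded f) (c : 𝕜) :
    LocBounded fun y => c • f y := by
  refine ⟨hf.cont.const_smul c, fun Y => ?_⟩
  obtain ⟨C, hC⟩ := hf.bdd Y
  exact ⟨‖c‖ * C, fun y hy => (norm_smul_le _ _).trans (by gcongr; exact hC y hy)⟩

theorem congr (hf : LocBounded f) (h : ∀ y, 0 < y → g y = f y) : LocBounded g :=
  ⟨hf.cont.congr fun y hy => h y hy, fun Y => (hf.bdd Y).imp fun _ hC y hy => by
    rw [h y hy.1]; exact hC y hy⟩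

theorem rpow {q : ℝ} (hq : 0 ≤ q) : LocBounded fun y : ℝ => y ^ q :=
  ⟨fun y _ => (Real.continuousAt_rpow_const y q (Or.inr hq)).continuousWithinAt, fun Y =>
    ⟨Y ^ q, fun y hy => by
      rw [Real.norm_of_nonneg (Real.rpow_nonneg hy.1.le q)]
      exact Real.rpow_le_rpow hy.1.le hy.2 hq⟩⟩

variable [NormedSpace ℝ E]

theorem intervalIntegrable_rpow_smul (hf : LocBounded f) {s : ℝ} (hs : -1 < s) {y : ℝ} (hy : 0 < y) :
    IntervalIntegrable (fun t => t ^ s • f t) volume 0 y := by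
  obtain ⟨C, hC⟩ := hf.bdd y
  have h1 := intervalIntegral.intervalIntegrable_rpow' (a := 0) (b := y) hs
  rw [intervalIntegrable_iff_integrableOn_Ioc_of_le hy.le] at h1 ⊢
  refine Integrable.smul_bdd (C := C) ?_ ?_ ?_
  · exact h1
  · exact (hf.cont.mono Ioc_subset_Ioi_self).aestronglyMeasurable measurableSet_Ioc
  · exact (ae_restrict_iff' measurableSet_Ioc).2 (.of_forall fun t ht => hC t ht)

theorem hasDerivAt_integral [CompleteSpace E] (hf : LocBounded f) {s : ℝ} (hs : -1 < s) {y : ℝ} (hy : 0 < y) :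
    HasDerivAt (fun y => ∫ t in (0 : ℝ)..y, t ^ s • f t) (y ^ s • f y) y := by
  have hc : ContinuousOn (fun t : ℝ => t ^ s • f t) (Ioi 0) :=
    ContinuousOn.smul (fun t ht => (Real.continuousAt_rpow_const t s
      (Or.inl (ne_of_gt ht))).continuousWithinAt) hf.cont
  refine intervalIntegral.integral_hasDerivAt_right (hf.intervalIntegrable_rpow_smul hs hy) ?_
    (hc.continuousAt (Ioi_mem_nhds hy))
  exact ⟨Ioi 0, Ioi_mem_nhds hy, hc.aestronglyMeasurable measurableSet_Ioi⟩

end LocBounded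

variable [NormedSpace ℝ E]

/-- A right inverse of `∂_y² + (1 - 2 μ) y⁻¹ ∂_y`. -/
def volterra (μ : ℝ) (f : ℝ → E) (y : ℝ) : E :=
  (2 * μ)⁻¹ • ∫ t in (0 : ℝ)..y, (y ^ (2 * μ) * t ^ (1 - 2 * μ) - t) • f t

variable {μ : ℝ} (h0 : 0 < μ) (h1 : μ < 1) {f g : ℝ → E}

include h1 in
theorem volterra_eq (hf : LocBounded f) {y : ℝ} (hy : 0 < y) :
    volterra μ f y = (2 * μ)⁻¹ • (y ^ (2 * μ) • (∫ t in (0 : ℝ)..y, t ^ (1 - 2 * μ) • f t)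
      - ∫ t in (0 : ℝ)..y, t ^ (1 : ℝ) • f t) := by
  rw [volterra, ← intervalIntegral.integral_smul (y ^ (2 * μ)), ← intervalIntegral.integral_sub
    (f := fun t => y ^ (2 * μ) • t ^ (1 - 2 * μ) • f t)
    ((hf.intervalIntegrable_rpow_smul (by linarith) hy).smul _)
    (hf.intervalIntegrable_rpow_smul (by norm_num) hy)]
  simp only [sub_smul, mul_smul, Real.rpow_one]

include h1 in
theorem intervalIntegrable_volterra (hf : LocBounded f) {y : ℝ} (hy : 0 < y) :
    IntervalIntegrable (fun t => (y ^ (2 * μ) * t ^ (1 - 2 * μ) - t) • f t) volume 0 y := by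
  have := ((hf.intervalIntegrable_rpow_smul (s := 1 - 2 * μ) (by linarith) hy).smul (y ^ (2 * μ))).sub
    (hf.intervalIntegrable_rpow_smul (s := 1) (by norm_num) hy)
  refine this.congr (fun t _ => ?_)
  simp only [Pi.smul_apply, sub_smul, mul_smul, Real.rpow_one]

include h1 in
theorem volterra_add (hf : LocBounded f) (hg : LocBounded g) {y : ℝ} (hy : 0 < y) :
    volterra μ (fun y => f y + g y) y = volterra μ f y + volterra μ g y := by
  simp only [volterra, smul_add]
  rw [intervalIntegral.integral_add (intervalIntegrable_volterra h1 hf hy)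
    (intervalIntegrable_volterra h1 hg hy), smul_add]

theorem volterra_congr {y : ℝ} (h : ∀ t, 0 < t → f t = g t) (hy : 0 < y) :
    volterra μ f y = volterra μ g y := by
  simp only [volterra]
  congr 1
  refine intervalIntegral.integral_congr_ae (.of_forall fun t ht => ?_)
  rw [uIoc_of_le hy.le] at ht
  simp only [h t ht.1]

theorem volterra_const_smul {𝕜 : Type*} [NormedField 𝕜] [NormedSpace 𝕜 E] [SMulCommClass ℝ 𝕜 E]
    [NormedAlgebra ℝ 𝕜] [IsScalarTower ℝ 𝕜 E]
    (c : 𝕜) (f : ℝ → E) (y : ℝ) : volterra μ (fun y => c • f y) y = c • volterra μ f y := by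
  simp only [volterra]
  rw [smul_comm c, ← intervalIntegral.integral_smul c]
  simp only [smul_comm c]

include h0 h1 in
theorem volterra_rpow {q : ℝ} (hq : 0 ≤ q) {y : ℝ} (hy : 0 < y) :
    volterra μ (fun t => t ^ q) y = y ^ (q + 2) / ((q + 2) * (q + 2 - 2 * μ)) := by
  have e1 : ∀ s : ℝ, -1 < s → ∫ t in (0 : ℝ)..y, (t ^ s) • (t ^ q : ℝ) = y ^ (s + q + 1) / (s + q + 1) := by
    intro s hs
    have h2 := integral_rpow (a := 0) (b := y) (r := s + q) (Or.inl (by linarith))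
    rw [Real.zero_rpow (show s + q + 1 ≠ 0 by linarith), sub_zero] at h2
    rw [← h2]
    exact intervalIntegral.integral_congr_ae (.of_forall fun t ht => by
      rw [uIoc_of_le hy.le] at ht
      rw [smul_eq_mul, ← Real.rpow_add ht.1])
  rw [volterra_eq h1 (LocBounded.rpow hq) hy, e1 _ (by linarith), e1 _ (by norm_num)]
  have e2 : y ^ (1 - 2 * μ + q + 1) = y ^ (q + 2) * (y ^ (2 * μ))⁻¹ := by
    rw [← Real.rpow_neg hy.le, ← Real.rpow_add hy]; ring_nf
  rw [e2, show 1 + q + 1 = q + 2 by ring, show 1 - 2 * μ + q + 1 = q + 2 - 2 * μ by ring]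
  have h3 : q + 2 - 2 * μ ≠ 0 := by linarith
  have h4 : y ^ (2 * μ) ≠ 0 := by positivity
  simp only [smul_eq_mul]
  field_simp
  ring

include h0 h1 in
theorem norm_volterra_le {q C : ℝ} (hq : 0 ≤ q) {y : ℝ} (hy : 0 < y)
    (hb : ∀ t ∈ Ioc 0 y, ‖f t‖ ≤ C * t ^ q) :
    ‖volterra μ f y‖ ≤ C * (y ^ (q + 2) / ((q + 2) * (q + 2 - 2 * μ))) := by
  rw [← volterra_rpow h0 h1 hq hy]
  have e : C * volterra μ (fun t => t ^ q) y
      = (2 * μ)⁻¹ * ∫ t in (0 : ℝ)..y, (y ^ (2 * μ) * t ^ (1 - 2 * μ) - t) * (C * t ^ q) := by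
    rw [← smul_eq_mul C, ← volterra_const_smul C (fun t : ℝ => t ^ q)]; simp only [volterra, smul_eq_mul]
  rw [e, volterra, norm_smul, norm_inv, Real.norm_of_nonneg (by positivity : 0 ≤ 2 * μ)]
  gcongr
  refine intervalIntegral.norm_integral_le_of_norm_le hy.le (.of_forall fun t ht => ?_)
    (intervalIntegrable_volterra (f := fun t : ℝ => C * t ^ q) h1 ((LocBounded.rpow hq).const_smul C) hy)
  have hk : 0 ≤ y ^ (2 * μ) * t ^ (1 - 2 * μ) - t := by
    have h2 : t ^ (2 * μ) ≤ y ^ (2 * μ) := Real.rpow_le_rpow ht.1.le ht.2 (by positivity)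
    have h3 : t ^ (2 * μ) * t ^ (1 - 2 * μ) = t := by
      rw [← Real.rpow_add ht.1]; simp
    have h4 := mul_le_mul_of_nonneg_right h2 (Real.rpow_nonneg ht.1.le (1 - 2 * μ))
    linarith
  rw [norm_smul, Real.norm_of_nonneg hk]
  exact mul_le_mul_of_nonneg_left (hb t ht) hk

include h0 h1 in
theorem hasDerivAt_volterra [CompleteSpace E] (hf : LocBounded f) {y : ℝ} (hy : 0 < y) :
    HasDerivAt (volterra μ f) (y ^ (2 * μ - 1) • ∫ t in (0 : ℝ)..y, t ^ (1 - 2 * μ) • f t) y := by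
  have d1 : HasDerivAt (fun y : ℝ => y ^ (2 * μ)) (2 * μ * y ^ (2 * μ - 1)) y :=
    Real.hasDerivAt_rpow_const (Or.inl hy.ne')
  have d2 := hf.hasDerivAt_integral (s := 1 - 2 * μ) (by linarith) hy
  have d3 := hf.hasDerivAt_integral (s := 1) (by norm_num) hy
  have d := ((d1.smul d2).sub d3).const_smul (2 * μ)⁻¹
  have h3 : y ^ (2 * μ) * y ^ (1 - 2 * μ) = y := by rw [← Real.rpow_add hy]; simp
  refine (d.congr_deriv ?_).congr_of_eventuallyEq ?_
  · rw [smul_smul, h3, Real.rpow_one, add_sub_cancel_left, smul_smul, ← mul_assoc,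
      inv_mul_cancel₀ (by positivity), one_mul]
  · filter_upwards [lt_mem_nhds hy] with z hz
    rw [volterra_eq h1 hf hz]; rfl

include h0 h1 in
theorem LocBounded.volterra [CompleteSpace E] (hf : LocBounded f) : LocBounded (volterra μ f) := by
  refine ⟨fun y hy => (hasDerivAt_volterra h0 h1 hf hy).continuousAt.continuousWithinAt, fun Y => ?_⟩
  obtain ⟨C, hC⟩ := hf.bdd Y
  refine ⟨|C| * (Y ^ (0 + 2 : ℝ) / ((0 + 2) * (0 + 2 - 2 * μ))), fun y hy => ?_⟩
  refine (norm_volterra_le (C := |C|) h0 h1 le_rfl hy.1 fun t ht => ?_).trans ?_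
  · rw [Real.rpow_zero, mul_one]
    exact (hC t ⟨ht.1, ht.2.trans hy.2⟩).trans (le_abs_self C)
  · have : 0 < 0 + 2 - 2 * μ := by linarith
    have h2 := hy.1.le
    have h3 := hy.2
    gcongr

include h0 h1 in
theorem contDiffOn_volterra {f : ℝ → ℝ} (hf : LocBounded f) (hs : ContDiffOn ℝ ∞ f (Ioi 0)) :
    ContDiffOn ℝ ∞ (volterra μ f) (Ioi 0) := by
  have hI : ContDiffOn ℝ ∞ (fun y => ∫ t in (0 : ℝ)..y, t ^ (1 - 2 * μ) • f t) (Ioi 0) := by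
    rw [contDiffOn_infty_iff_deriv_of_isOpen isOpen_Ioi]
    have hd := fun y (hy : y ∈ Ioi (0 : ℝ)) => hf.hasDerivAt_integral (s := 1 - 2 * μ) (by linarith) hy
    refine ⟨fun y hy => (hd y hy).differentiableAt.differentiableWithinAt, ?_⟩
    exact ((contDiffOn_rpow_Ioi (1 - 2 * μ)).smul hs).congr fun y hy => (hd y hy).deriv
  rw [contDiffOn_infty_iff_deriv_of_isOpen isOpen_Ioi]
  refine ⟨fun y hy => (hasDerivAt_volterra h0 h1 hf hy).differentiableAt.differentiableWithinAt, ?_⟩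
  exact ((contDiffOn_rpow_Ioi (2 * μ - 1)).smul hI).congr fun y hy =>
    (hasDerivAt_volterra h0 h1 hf hy).deriv

include h0 h1 in
theorem besselOp_volterra {f : ℝ → ℝ} (hf : LocBounded f) {y : ℝ} (hy : 0 < y) :
    besselOp (1 - 2 * μ) (volterra μ f) y = f y := by
  have e : deriv (volterra μ f) =ᶠ[𝓝 y]
      fun y => y ^ (2 * μ - 1) • ∫ t in (0 : ℝ)..y, t ^ (1 - 2 * μ) • f t := by
    filter_upwards [lt_mem_nhds hy] with z hz using (hasDerivAt_volterra h0 h1 hf hz).deriv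
  have d1 : HasDerivAt (fun y : ℝ => y ^ (2 * μ - 1)) ((2 * μ - 1) * y ^ (2 * μ - 1 - 1)) y :=
    Real.hasDerivAt_rpow_const (Or.inl hy.ne')
  have d2 := hf.hasDerivAt_integral (s := 1 - 2 * μ) (by linarith) hy
  have d3 := (d1.smul d2).deriv
  rw [besselOp, e.deriv_eq, e.eq_of_nhds]
  refine Eq.trans (congrArg (· + _) d3) ?_
  have h3 : y ^ (2 * μ - 1) * y ^ (1 - 2 * μ) = 1 := by rw [← Real.rpow_add hy]; simp
  simp only [smul_eq_mul]
  rw [Real.rpow_sub_one hy.ne' (2 * μ - 1)]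
  linear_combination f y * h3

end volterra

end

section

section besselPos

variable {m : ℝ} {f g : ℝ → ℝ}

theorem ContDiffOn.deriv_Ioi (hf : ContDiffOn ℝ ∞ f (Ioi 0)) : ContDiffOn ℝ ∞ (deriv f) (Ioi 0) :=
  ((contDiffOn_infty_iff_deriv_of_isOpen isOpen_Ioi).1 hf).2

theorem ContDiffOn.hasDerivAt_Ioi (hf : ContDiffOn ℝ ∞ f (Ioi 0)) {y : ℝ} (hy : 0 < y) :
    HasDerivAt f (deriv f y) y :=
  ((hf.contDiffAt (Ioi_mem_nhds hy)).differentiableAt (by simp)).hasDerivAt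

theorem ContDiffOn.besselOp (hf : ContDiffOn ℝ ∞ f (Ioi 0)) (m : ℝ) :
    ContDiffOn ℝ ∞ (besselOp m f) (Ioi 0) :=
  hf.deriv_Ioi.deriv_Ioi.add ((contDiffOn_const.mul contDiffOn_inv_Ioi).mul hf.deriv_Ioi)

theorem eqOn_deriv_Ioi (h : EqOn f g (Ioi 0)) : EqOn (deriv f) (deriv g) (Ioi 0) := fun y hy =>
  EventuallyEq.deriv_eq (by filter_upwards [Ioi_mem_nhds hy] with z hz using h hz)

theorem eqOn_besselOp_Ioi (h : EqOn f g (Ioi 0)) : EqOn (besselOp m f) (besselOp m g) (Ioi 0) :=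
  fun y hy => by
    simp only [besselOp, eqOn_deriv_Ioi h hy, eqOn_deriv_Ioi (eqOn_deriv_Ioi h) hy]

theorem besselOp_sub_Ioi (hf : ContDiffOn ℝ ∞ f (Ioi 0)) (hg : ContDiffOn ℝ ∞ g (Ioi 0)) :
    EqOn (besselOp m fun y => f y - g y) (fun y => besselOp m f y - besselOp m g y) (Ioi 0) := by
  have h1 : EqOn (deriv fun y => f y - g y) (fun y => deriv f y - deriv g y) (Ioi 0) :=
    fun y hy => ((hf.hasDerivAt_Ioi hy).sub (hg.hasDerivAt_Ioi hy)).deriv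
  intro y hy
  have h2 : deriv (fun y => deriv f y - deriv g y) y = deriv (deriv f) y - deriv (deriv g) y :=
    ((hf.deriv_Ioi.hasDerivAt_Ioi hy).sub (hg.deriv_Ioi.hasDerivAt_Ioi hy)).deriv
  simp only [besselOp, h1 hy, eqOn_deriv_Ioi h1 hy, h2]
  ring

theorem ContDiffOn.besselOp_iterate (hf : ContDiffOn ℝ ∞ f (Ioi 0)) (m : ℝ) (j : ℕ) :
    ContDiffOn ℝ ∞ ((_root_.besselOp m)^[j] f) (Ioi 0) := by
  induction j with
  | zero => exact hf
  | succ j ih => rw [iterate_succ_apply']; exact ih.besselOp m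

theorem eqOn_besselOp_iterate_Ioi (h : EqOn f g (Ioi 0)) (j : ℕ) :
    EqOn ((besselOp m)^[j] f) ((besselOp m)^[j] g) (Ioi 0) := by
  induction j with
  | zero => exact h
  | succ j ih => simp only [iterate_succ_apply']; exact eqOn_besselOp_Ioi ih

theorem besselOp_iterate_sub_Ioi (hf : ContDiffOn ℝ ∞ f (Ioi 0)) (hg : ContDiffOn ℝ ∞ g (Ioi 0))
    (j : ℕ) : EqOn ((besselOp m)^[j] fun y => f y - g y)
      (fun y => (besselOp m)^[j] f y - (besselOp m)^[j] g y) (Ioi 0) := by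
  induction j with
  | zero => exact fun _ _ => rfl
  | succ j ih =>
    simp only [iterate_succ_apply']
    exact (eqOn_besselOp_Ioi ih).trans
      (besselOp_sub_Ioi (hf.besselOp_iterate m j) (hg.besselOp_iterate m j))

theorem exists_of_besselOp_eq_zero {μ : ℝ} (h0 : 0 < μ) (hf : ContDiffOn ℝ ∞ f (Ioi 0))
    (h : ∀ y, 0 < y → besselOp (1 - 2 * μ) f y = 0) :
    ∃ a b : ℝ, ∀ y, 0 < y → f y = a + b * y ^ (2 * μ) := by
  obtain ⟨c, hc⟩ := exists_const_of_hasDerivAt_zero (f := fun y => y ^ (1 - 2 * μ) * deriv f y)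
    fun y hy => by
      have d1 := (Real.hasDerivAt_rpow_const (p := 1 - 2 * μ) (Or.inl hy.ne')).mul
        (hf.deriv_Ioi.hasDerivAt_Ioi hy)
      refine d1.congr_deriv ?_
      have h2 := h y hy
      rw [besselOp] at h2
      rw [Real.rpow_sub_one hy.ne']
      linear_combination y ^ (1 - 2 * μ) * h2
  obtain ⟨a, ha⟩ := exists_const_of_hasDerivAt_zero (f := fun y => f y - c / (2 * μ) * y ^ (2 * μ))
    fun y hy => by
      have d1 := (hf.hasDerivAt_Ioi hy).sub
        ((Real.hasDerivAt_rpow_const (p := 2 * μ) (Or.inl hy.ne')).const_mul (c / (2 * μ)))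
      refine d1.congr_deriv ?_
      have h3 : y ^ (2 * μ - 1) * y ^ (1 - 2 * μ) = 1 := by rw [← Real.rpow_add hy]; simp
      have h4 := hc y hy
      rw [← h4]
      field_simp
      linear_combination (-deriv f y) * h3
  exact ⟨a, c / (2 * μ), fun y hy => by linarith [ha y hy]⟩

theorem locBounded_expSum {μ : ℝ} (h0 : 0 < μ) (v w : ℕ → ℝ) (J : ℕ) : LocBounded (expSum μ v w J) := by
  induction J with
  | zero =>
    have e : expSum μ v w 0 = fun _ => 0 := by funext y; simp [expSum]
    rw [e]
    exact ⟨continuousOn_const, fun Y => ⟨0, fun y _ => by simp⟩⟩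
  | succ J ih =>
    have e : expSum μ v w (J + 1) = fun y => expSum μ v w J y
        + (v J • y ^ (2 * (J : ℝ)) + w J • y ^ (2 * μ + 2 * (J : ℝ))) := by
      funext y; simp [expSum, Finset.sum_range_succ]
    rw [e]
    exact ih.add (((LocBounded.rpow (by positivity)).const_smul (v J)).add
      ((LocBounded.rpow (by positivity)).const_smul (w J)))

theorem volterra_expSum {μ : ℝ} (h0 : 0 < μ) (h1 : μ < 1) (v w : ℕ → ℝ) (J : ℕ) {y : ℝ} (hy : 0 < y) :
    volterra μ (expSum μ v w J) y = ∑ i ∈ Finset.range J,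
      (v i / ((2 * i + 2) * (2 * i + 2 - 2 * μ)) * y ^ (2 * ((i : ℝ) + 1))
        + w i / ((2 * μ + 2 * i + 2) * (2 * i + 2)) * y ^ (2 * μ + 2 * ((i : ℝ) + 1))) := by
  induction J with
  | zero =>
    have : expSum μ v w 0 = fun _ => 0 := by funext y; simp [expSum]
    rw [this]; simp [volterra]
  | succ J ih =>
    have e : expSum μ v w (J + 1) = fun y => expSum μ v w J y
        + (v J • y ^ (2 * (J : ℝ)) + w J • y ^ (2 * μ + 2 * (J : ℝ))) := by
      funext y; simp [expSum, Finset.sum_range_succ]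
    have l1 : LocBounded fun y : ℝ => v J • y ^ (2 * (J : ℝ)) :=
      (LocBounded.rpow (by positivity)).const_smul (v J)
    have l2 : LocBounded fun y : ℝ => w J • y ^ (2 * μ + 2 * (J : ℝ)) :=
      (LocBounded.rpow (by positivity)).const_smul (w J)
    rw [e, volterra_add h1 (locBounded_expSum h0 v w J) (l1.add l2) hy, volterra_add h1 l1 l2 hy,
      volterra_const_smul, volterra_const_smul, volterra_rpow h0 h1 (by positivity) hy,
      volterra_rpow h0 h1 (by positivity) hy, ih, Finset.sum_range_succ]
    simp only [smul_eq_mul]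
    rw [show 2 * (J : ℝ) + 2 = 2 * (J + 1) by ring, show 2 * μ + 2 * (J : ℝ) + 2 = 2 * μ + 2 * (J + 1) by ring,
      show 2 * μ + 2 * ((J : ℝ) + 1) - 2 * μ = 2 * (J + 1) by ring]
    ring

theorem exists_expSum_of_besselOp_iterate_eq_zero {μ : ℝ} (h0 : 0 < μ) (h1 : μ < 1) (j : ℕ) :
    ∀ {f : ℝ → ℝ}, ContDiffOn ℝ ∞ f (Ioi 0) →
      (∀ y, 0 < y → (besselOp (1 - 2 * μ))^[j] f y = 0) →
      ∃ v w : ℕ → ℝ, ∀ y, 0 < y → f y = expSum μ v w j y := by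
  induction j with
  | zero => exact fun _ h => ⟨0, 0, fun y hy => by simpa [expSum] using h y hy⟩
  | succ j ih =>
    intro f hf h
    obtain ⟨v, w, hvw⟩ := ih (hf.besselOp (1 - 2 * μ)) fun y hy => h y hy
    have hl := locBounded_expSum h0 v w j
    have hs : ContDiffOn ℝ ∞ (expSum μ v w j) (Ioi 0) :=
      (hf.besselOp (1 - 2 * μ)).congr fun y hy => (hvw y hy).symm
    obtain ⟨a, b, hab⟩ := exists_of_besselOp_eq_zero (f := fun y => f y - volterra μ (expSum μ v w j) y) h0
      (hf.sub (contDiffOn_volterra h0 h1 hl hs)) fun y hy => by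
        rw [besselOp_sub_Ioi hf (contDiffOn_volterra h0 h1 hl hs) hy]
        simp only [hvw y hy, besselOp_volterra h0 h1 hl hy, sub_self]
    refine ⟨fun i => if i = 0 then a else v (i - 1) / ((2 * (i - 1 : ℕ) + 2) * (2 * (i - 1 : ℕ) + 2 - 2 * μ)),
      fun i => if i = 0 then b else w (i - 1) / ((2 * μ + 2 * (i - 1 : ℕ) + 2) * (2 * (i - 1 : ℕ) + 2)),
      fun y hy => ?_⟩
    have h2 := hab y hy
    rw [volterra_expSum h0 h1 v w j hy] at h2
    rw [expSum, Finset.sum_range_succ']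
    simp
    linarith

end besselPos

section picard

variable {E : Type*} [NormedAddCommGroup E] [NormedSpace ℝ E] [CompleteSpace E] {μ : ℝ}

/-- One step `u_l ↦ u_l - S u_{l+1}` of the Picard scheme on sequences of functions. -/
def picStep (μ : ℝ) (u : ℕ → ℝ → E) (l : ℕ) (y : ℝ) : E := u l y - volterra μ (u (l + 1)) y

theorem locBounded_picStep_iterate (h0 : 0 < μ) (h1 : μ < 1) {u : ℕ → ℝ → E}
    (hu : ∀ l, LocBounded (u l)) (i : ℕ) : ∀ l, LocBounded ((picStep μ)^[i] u l) := by
  induction i with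
  | zero => exact hu
  | succ i ih =>
    intro l
    rw [iterate_succ_apply']
    exact (ih l).sub ((ih (l + 1)).volterra h0 h1)

omit [CompleteSpace E] in
theorem volterra_isBigO (h0 : 0 < μ) (h1 : μ < 1) {f : ℝ → E} {ρ : ℝ} (hρ : 0 ≤ ρ)
    (h : f =O[𝓝[>] 0] fun y : ℝ => y ^ ρ) : volterra μ f =O[𝓝[>] 0] fun y : ℝ => y ^ ρ := by
  obtain ⟨C, hC⟩ := h.bound
  obtain ⟨δ, hδ, hδC⟩ := mem_nhdsGT_iff_exists_Ioo_subset.1 hC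
  refine Asymptotics.IsBigO.of_bound (C / ((ρ + 2) * (ρ + 2 - 2 * μ))) ?_
  filter_upwards [Ioo_mem_nhdsGT (lt_min hδ one_pos)] with y hy
  have hy1 : y < δ := hy.2.trans_le (min_le_left _ _)
  have hy2 : y < 1 := hy.2.trans_le (min_le_right _ _)
  have hb : ∀ t ∈ Ioc 0 y, ‖f t‖ ≤ C * t ^ ρ := fun t ht => by
    have := hδC ⟨ht.1, ht.2.trans_lt hy1⟩
    simpa only [Set.mem_ofPred_eq, Real.norm_of_nonneg (Real.rpow_nonneg ht.1.le ρ)] using this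
  have hCy := norm_volterra_le h0 h1 hρ hy.1 hb
  rw [Real.norm_of_nonneg (Real.rpow_nonneg hy.1.le ρ)]
  have hC0 : 0 ≤ C := by
    have := (norm_nonneg _).trans (hb y ⟨hy.1, le_rfl⟩)
    exact nonneg_of_mul_nonneg_left this (Real.rpow_pos_of_pos hy.1 ρ)
  have h3 : 0 < ρ + 2 - 2 * μ := by linarith
  have h4 : y ^ (ρ + 2) ≤ y ^ ρ := Real.rpow_le_rpow_of_exponent_ge hy.1 hy2.le (by linarith)
  calc ‖volterra μ f y‖ ≤ _ := hCy
    _ ≤ C * (y ^ ρ / ((ρ + 2) * (ρ + 2 - 2 * μ))) := by gcongr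
    _ = _ := by ring

omit [CompleteSpace E] in
theorem picStep_iterate_isBigO (h0 : 0 < μ) (h1 : μ < 1) {u : ℕ → ℝ → E} {ρ : ℝ} (hρ : 0 ≤ ρ)
    (hu : ∀ l, u l =O[𝓝[>] 0] fun y : ℝ => y ^ ρ) (i : ℕ) :
    ∀ l, (picStep μ)^[i] u l =O[𝓝[>] 0] fun y : ℝ => y ^ ρ := by
  induction i with
  | zero => exact hu
  | succ i ih =>
    intro l
    rw [iterate_succ_apply']
    exact (ih l).sub (volterra_isBigO h0 h1 hρ (ih (l + 1)))

theorem contDiffOn_picStep_iterate (h0 : 0 < μ) (h1 : μ < 1) {u : ℕ → ℝ → ℝ}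
    (hu : ∀ l, LocBounded (u l)) (hs : ∀ l, ContDiffOn ℝ ∞ (u l) (Ioi 0)) (i : ℕ) :
    ∀ l, ContDiffOn ℝ ∞ ((picStep μ)^[i] u l) (Ioi 0) := by
  induction i with
  | zero => exact hs
  | succ i ih =>
    intro l
    rw [iterate_succ_apply']
    exact (ih l).sub (contDiffOn_volterra h0 h1 (locBounded_picStep_iterate h0 h1 hu i (l + 1)) (ih (l + 1)))

/-- The operator `u_l ↦ T u_l - u_{l+1}` on sequences of functions. -/
def seqOp (μ : ℝ) (u : ℕ → ℝ → ℝ) (l : ℕ) (y : ℝ) : ℝ := besselOp (1 - 2 * μ) (u l) y - u (l + 1) y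

theorem besselOp_iterate_picStep (h0 : 0 < μ) (h1 : μ < 1) {u : ℕ → ℝ → ℝ}
    (hu : ∀ l, LocBounded (u l)) (hs : ∀ l, ContDiffOn ℝ ∞ (u l) (Ioi 0)) (i : ℕ) :
    ∀ l, EqOn ((besselOp (1 - 2 * μ))^[i] ((picStep μ)^[i] u l)) ((seqOp μ)^[i] u l) (Ioi 0) := by
  induction i with
  | zero => exact fun l _ _ => rfl
  | succ i ih =>
    intro l
    have hl := locBounded_picStep_iterate h0 h1 hu i
    have hc := contDiffOn_picStep_iterate h0 h1 hu hs i
    set v := (picStep μ)^[i] u with hv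
    have e1 : EqOn (besselOp (1 - 2 * μ) (picStep μ v l))
        (fun y => besselOp (1 - 2 * μ) (v l) y - v (l + 1) y) (Ioi 0) := fun y hy => by
      have := besselOp_sub_Ioi (m := 1 - 2 * μ) (hc l)
        (contDiffOn_volterra h0 h1 (hl (l + 1)) (hc (l + 1))) hy
      simp only [besselOp_volterra h0 h1 (hl (l + 1)) hy] at this
      exact this
    intro y hy
    rw [Function.iterate_succ_apply, iterate_succ_apply', iterate_succ_apply', ← hv,
      eqOn_besselOp_iterate_Ioi e1 i hy,
      besselOp_iterate_sub_Ioi ((hc l).besselOp _) (hc (l + 1)) i hy, seqOp, ← ih (l + 1) hy,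
      ← eqOn_besselOp_Ioi (ih l) hy, ← Function.iterate_succ_apply, iterate_succ_apply']

end picard

end

section

variable {n : ℕ}

/-- Smooth functions of compact support. -/
structure IsTest (g : Bdry n → ℝ) : Prop where
  smooth : ContDiff ℝ ∞ g
  supp : HasCompactSupport g

/-- `-Δ` on the boundary. -/
def negLap (g : Bdry n → ℝ) : Bdry n → ℝ := fun x => -laplacian g x

theorem contDiff_laplacian {g : Bdry n → ℝ} (hg : ContDiff ℝ ∞ g) :
    ContDiff ℝ ∞ (laplacian g) := by
  have h1 : ContDiff ℝ ∞ fun p : HalfCoord n => g p.1 := hg.comp contDiff_fst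
  have h2 := contDiff_tangentialLaplacian h1
  have h3 : ContDiff ℝ ∞ fun x : Bdry n => ((x, 0) : HalfCoord n) := contDiff_prodMk_left (0 : ℝ)
  have h4 := h2.comp h3
  have e : tangentialLaplacian (fun p : HalfCoord n => g p.1) ∘ (fun x : Bdry n => ((x, 0) : HalfCoord n))
      = laplacian g := by
    funext x; simp only [Function.comp, tangentialLaplacian]
  rw [e] at h4
  exact h4

theorem laplacian_eq_zero_of_notMem_tsupport {g : Bdry n → ℝ} {x : Bdry n} (hx : x ∉ tsupport g) :
    laplacian g x = 0 := by
  have h1 : g =ᶠ[𝓝 x] fun _ => 0 := notMem_tsupport_iff_eventuallyEq.1 hx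
  have h2 := (InnerProductSpace.laplacian_congr_nhds h1).eq_of_nhds
  simpa using h2

theorem IsTest.negLap {g : Bdry n → ℝ} (hg : IsTest g) : IsTest (negLap g) := by
  refine ⟨(contDiff_laplacian hg.smooth).neg, hg.supp.mono' fun x hx => ?_⟩
  by_contra h
  exact hx (by simp [_root_.negLap, laplacian_eq_zero_of_notMem_tsupport h])

theorem IsTest.negLap_iterate {g : Bdry n → ℝ} (hg : IsTest g) (l : ℕ) : IsTest (_root_.negLap^[l] g) := by
  induction l with
  | zero => exact hg
  | succ l ih => rw [iterate_succ_apply']; exact ih.negLap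

theorem IsTest.memLp {g : Bdry n → ℝ} (hg : IsTest g) : MemLp g 2 volume :=
  hg.smooth.continuous.memLp_of_hasCompactSupport hg.supp

theorem abs_integral_mul_le {α : Type*} [MeasurableSpace α] {ν : Measure α} {f g : α → ℝ}
    (hf : MemLp f 2 ν) (hg : MemLp g 2 ν) :
    |∫ x, f x * g x ∂ν| ≤ (eLpNorm f 2 ν).toReal * (eLpNorm g 2 ν).toReal := by
  rw [← ENNReal.toReal_mul, ← Real.norm_eq_abs]
  refine (norm_integral_le_lintegral_norm _).trans ?_
  simp only [ofReal_norm]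
  refine ENNReal.toReal_mono (ENNReal.mul_ne_top hf.eLpNorm_ne_top hg.eLpNorm_ne_top) ?_
  have h := eLpNorm_smul_le_mul_eLpNorm (p := 2) (q := 2) (r := 1) hg.1 hf.1
  rw [eLpNorm_one_eq_lintegral_enorm] at h
  simpa only [Pi.smul_apply', smul_eq_mul] using h

/-- The pairing of the slices of `D` with a function of `x`. -/
def testInt (D : HalfCoord n → ℝ) (g : Bdry n → ℝ) (y : ℝ) : ℝ := ∫ x, D (x, y) * g x

theorem testInt_congr {D D' : HalfCoord n → ℝ} (h : EqOn D D' (upperHalf n)) (g : Bdry n → ℝ) {y : ℝ}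
    (hy : 0 < y) : testInt D g y = testInt D' g y :=
  integral_congr_ae (.of_forall fun x => by simp only [h (mem_upperHalf.2 hy : ((x, y) : HalfCoord n) ∈ _)])

section

variable {D : HalfCoord n → ℝ} {g : Bdry n → ℝ} (hD : SmoothHalf D) (hg : IsTest g)
include hD hg

theorem integrable_testInt {y : ℝ} (hy : 0 < y) : Integrable fun x => D (x, y) * g x :=
  ((hD.slice_contDiff hy).continuous.mul hg.smooth.continuous).integrable_of_hasCompactSupport
    hg.supp.mul_left

theorem hasDerivAt_testInt {y : ℝ} (hy : 0 < y) :
    HasDerivAt (testInt D g) (testInt (partialY D) g y) y := by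
  have hcK : IsCompact (tsupport g ×ˢ Icc (y / 2) (y + 1)) := hg.supp.isCompact.prod isCompact_Icc
  obtain ⟨C, hC⟩ := hcK.exists_bound_of_continuousOn (f := partialY D)
    (ContDiffOn.continuousOn hD.partialY |>.mono fun p hp => mem_upperHalf.2 (by linarith [hp.2.1]))
  refine (hasDerivAt_integral_of_dominated_loc_of_deriv_le (s := Ioo (y / 2) (y + 1))
    (F := fun y x => D (x, y) * g x) (F' := fun y x => partialY D (x, y) * g x)
    (bound := fun x => C * |g x|) (Ioo_mem_nhds (by linarith) (by linarith)) ?_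
    (integrable_testInt hD hg hy) (integrable_testInt hD.partialY hg hy).1 ?_ ?_ ?_).2
  · filter_upwards [lt_mem_nhds hy] with z hz using (integrable_testInt hD hg hz).1
  · refine .of_forall fun x z hz => ?_
    rw [norm_mul, Real.norm_eq_abs (g x)]
    by_cases hx : x ∈ tsupport g
    · exact mul_le_mul_of_nonneg_right (hC (x, z) ⟨hx, hz.1.le, hz.2.le⟩) (abs_nonneg _)
    · rw [image_eq_zero_of_notMem_tsupport hx]; simp
  · exact ((hg.smooth.continuous.integrable_of_hasCompactSupport hg.supp).abs).const_mul C
  · refine .of_forall fun x z hz => ?_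
    exact (hD.hasDerivAt_partialY (p := (x, z)) (mem_upperHalf.2 (by linarith [hz.1]))).mul_const _

theorem contDiffOn_testInt : ContDiffOn ℝ ∞ (testInt D g) (Ioi 0) := by
  rw [contDiffOn_infty]
  intro N
  induction N generalizing D with
  | zero =>
    exact contDiffOn_zero.2 fun y hy => (hasDerivAt_testInt hD hg hy).continuousAt.continuousWithinAt
  | succ N ih =>
    push_cast
    rw [contDiffOn_succ_iff_deriv_of_isOpen isOpen_Ioi]
    refine ⟨fun y hy => (hasDerivAt_testInt hD hg hy).differentiableAt.differentiableWithinAt,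
      fun h => by simp at h, ?_⟩
    exact (ih hD.partialY).congr fun y hy => (hasDerivAt_testInt hD hg hy).deriv

theorem besselOp_testInt (m : ℝ) {y : ℝ} (hy : 0 < y) :
    besselOp m (testInt D g) y = testInt (normalOp m D) g y := by
  have e : EqOn (deriv (testInt D g)) (testInt (partialY D) g) (Ioi 0) :=
    fun y hy => (hasDerivAt_testInt hD hg hy).deriv
  rw [besselOp, eqOn_deriv_Ioi e hy, e hy, (hasDerivAt_testInt hD.partialY hg hy).deriv]
  simp only [testInt, normalOp, add_mul]
  rw [integral_add (integrable_testInt hD.partialY.partialY hg hy)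
    (by simpa only [mul_assoc] using ((integrable_testInt hD.partialY hg hy).const_mul (m * y⁻¹)))]
  congr 1
  simp only [mul_assoc]
  rw [integral_const_mul, integral_const_mul]

theorem testInt_tangentialLaplacian {y : ℝ} (hy : 0 < y) :
    testInt (tangentialLaplacian D) g y = testInt D (laplacian g) y := by
  obtain ⟨R, hR⟩ := hg.supp.isCompact.isBounded.subset_closedBall (0 : Bdry n)
  set χ : ContDiffBump (0 : Bdry n) := ⟨|R| + 1, |R| + 2, by positivity, by linarith⟩
  have ha := hD.slice_contDiff hy
  have hc : ContDiff ℝ ∞ fun x => χ x * D (x, y) := χ.contDiff.mul ha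
  set A : SchwartzMap (Bdry n) ℝ :=
    HasCompactSupport.toSchwartzMap (f := fun x => χ x * D (x, y)) χ.hasCompactSupport.mul_right hc with hA
  set G : SchwartzMap (Bdry n) ℝ := HasCompactSupport.toSchwartzMap hg.supp hg.smooth
  have h1 := SchwartzMap.integral_mul_laplacian_right_eq_left A G (μ := volume)
  simp only [SchwartzMap.laplacian_apply] at h1
  have hAc : (A : Bdry n → ℝ) = fun x => χ x * D (x, y) := rfl
  have hGc : (G : Bdry n → ℝ) = g := rfl
  rw [hAc, hGc] at h1
  have hχ : ∀ x ∈ tsupport g, ∀ᶠ z in 𝓝 x, χ z = 1 := fun x hx => by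
    have h2 : ‖x‖ < |R| + 1 := by
      have := mem_closedBall_zero_iff.1 (hR hx)
      linarith [le_abs_self R]
    filter_upwards [continuous_norm.continuousAt.eventually (gt_mem_nhds h2)] with z hz
    exact χ.one_of_mem_closedBall (by simpa [χ] using le_of_lt hz)
  have e1 : testInt D (laplacian g) y
      = ∫ x, χ x * D (x, y) * laplacian g x := by
    refine integral_congr_ae (.of_forall fun x => ?_)
    by_cases hx : x ∈ tsupport g
    · simp only [(hχ x hx).self_of_nhds, one_mul]
    · simp only [laplacian_eq_zero_of_notMem_tsupport hx, mul_zero]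
  have e2 : testInt (tangentialLaplacian D) g y
      = ∫ x, laplacian (fun x => χ x * D (x, y)) x * g x := by
    refine integral_congr_ae (.of_forall fun x => ?_)
    by_cases hx : x ∈ tsupport g
    · have h3 : (fun x => χ x * D (x, y)) =ᶠ[𝓝 x] fun x => D (x, y) := by
        filter_upwards [hχ x hx] with z hz
        rw [hz, one_mul]
      have h4 := (InnerProductSpace.laplacian_congr_nhds h3).eq_of_nhds
      simp only [h4]; rfl
    · simp only [image_eq_zero_of_notMem_tsupport hx, mul_zero]
  rw [e1, e2, h1]

theorem seqOp_testInt {μ : ℝ} {y : ℝ} (hy : 0 < y) :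
    besselOp (1 - 2 * μ) (testInt D g) y - testInt D (negLap g) y
      = testInt (weightedLaplacian (1 - 2 * μ) D) g y := by
  have e : testInt D (negLap g) y = -testInt D (laplacian g) y := by
    simp only [testInt, negLap, mul_neg, integral_neg]
  rw [e, ← testInt_tangentialLaplacian hD hg hy, besselOp_testInt hD hg _ hy, sub_neg_eq_add, testInt, testInt,
    ← integral_add (integrable_testInt ?_ hg hy) (integrable_testInt hD.tangentialLaplacian hg hy)]
  · refine integral_congr_ae (.of_forall fun x => ?_)
    simp only [normalOp, weightedLaplacian]; ring
  · rw [normalOp_eq_gen]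
    exact (tangentialOp_smul 0).gen_smooth _ hD

theorem seqOp_iterate_testInt {μ : ℝ} (i : ℕ) : ∀ l, EqOn ((seqOp μ)^[i] (fun l => testInt D (negLap^[l] g)) l)
    (testInt ((weightedLaplacian (1 - 2 * μ))^[i] D) (negLap^[l] g)) (Ioi 0) := by
  induction i with
  | zero => exact fun l _ _ => rfl
  | succ i ih =>
    intro l y hy
    have hs : SmoothHalf ((weightedLaplacian (1 - 2 * μ))^[i] D) := by
      rw [weightedLaplacian_eq_gen]
      exact tangentialOp_lap.iter_smooth _ i hD
    rw [iterate_succ_apply', iterate_succ_apply', seqOp, eqOn_besselOp_Ioi (ih l) hy,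
      ih (l + 1) hy, iterate_succ_apply', seqOp_testInt hs (hg.negLap_iterate l) hy]

theorem locBounded_testInt (hgr : ModerateGrowth D) : LocBounded (testInt D g) := by
  refine ⟨(contDiffOn_testInt hD hg).continuousOn, fun Y => ?_⟩
  obtain ⟨C, N, hC0, hC⟩ := hgr.exists_toReal_le
  refine ⟨C * (1 + Y) ^ N * (eLpNorm g 2 volume).toReal, fun y hy => ?_⟩
  refine (abs_integral_mul_le (hC y hy.1).1 hg.memLp).trans ?_
  have h2 := hy.1.le
  refine mul_le_mul_of_nonneg_right ((hC y hy.1).2.trans ?_) ENNReal.toReal_nonneg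
  gcongr
  exact hy.2

theorem exists_expSum_picStep {μ : ℝ} (h0 : 0 < μ) (h1 : μ < 1) {k : ℕ} (hgr : ModerateGrowth D)
    (hk : ∀ p ∈ upperHalf n, (weightedLaplacian (1 - 2 * μ))^[k] D p = 0) :
    ∃ v w : ℕ → ℝ, ∀ y, 0 < y →
      (picStep μ)^[k] (fun l => testInt D (negLap^[l] g)) 0 y = expSum μ v w k y := by
  have hl := fun l => locBounded_testInt hD (hg.negLap_iterate l) hgr
  have hs := fun l => contDiffOn_testInt hD (hg.negLap_iterate l)
  refine exists_expSum_of_besselOp_iterate_eq_zero h0 h1 k (contDiffOn_picStep_iterate h0 h1 hl hs k 0)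
    fun y hy => ?_
  rw [besselOp_iterate_picStep h0 h1 hl hs k 0 hy, seqOp_iterate_testInt hD hg k 0 hy]
  exact integral_eq_zero_of_ae (.of_forall fun x => by
    simp [hk (x, y) (mem_upperHalf.2 hy)])

end

end

section

/-- The exponents `2 i` and `2 μ + 2 i`. -/
def expo (μ : ℝ) (i : ℕ × Bool) : ℝ := 2 * i.1 + if i.2 then 2 * μ else 0

theorem expo_injective {μ : ℝ} (h0 : 0 < μ) (h1 : μ < 1) : Function.Injective (expo μ) := by
  rintro ⟨i, a⟩ ⟨j, b⟩ h
  have key : ∀ i j : ℕ, (i : ℝ) ≠ j + μ := fun i j e => by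
    have e1 : (j : ℝ) < i := by linarith
    have e2 : (i : ℝ) < j + 1 := by linarith
    norm_cast at e1 e2
    omega
  cases a <;> cases b <;> simp only [expo, if_true, if_false, Bool.false_eq_true, add_zero] at h
  · simpa using h
  · exact absurd (by linarith) (key i j)
  · exact absurd (by linarith) (key j i)
  · simpa using h

/-- The coefficients below the order of vanishing of a sum of powers are zero. -/
theorem eq_zero_of_sum_rpow_isBigO {E : Type*} [NormedAddCommGroup E] [NormedSpace ℝ E] {ι : Type*}
    {A : Finset ι} {e : ι → ℝ} (he : Function.Injective e) {c : ι → E} {ρ : ℝ}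
    (h : (fun y : ℝ => ∑ i ∈ A, y ^ e i • c i) =O[𝓝[>] 0] fun y : ℝ => y ^ ρ) :
    ∀ i ∈ A, e i < ρ → c i = 0 := by
  classical
  by_contra! hcon
  obtain ⟨i0, hi0, hlt0, hne0⟩ := hcon
  obtain ⟨j, hj, hmin⟩ := Finset.exists_min_image (A.filter fun i => e i < ρ ∧ c i ≠ 0) e
    ⟨i0, Finset.mem_filter.2 ⟨hi0, hlt0, hne0⟩⟩
  obtain ⟨hjA, hjρ, hjc⟩ := Finset.mem_filter.1 hj
  have t1 : Tendsto (fun y : ℝ => y ^ (-e j) • ∑ i ∈ A, y ^ e i • c i) (𝓝[>] 0) (𝓝 (c j)) := by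
    have h2 : Tendsto (fun y : ℝ => ∑ i ∈ A, y ^ (e i - e j) • c i) (𝓝[>] 0)
        (𝓝 (∑ i ∈ A, if i = j then c i else 0)) := by
      refine tendsto_finsetSum _ fun i hi => ?_
      rcases eq_or_ne i j with rfl | hij
      · simp only [sub_self, Real.rpow_zero, one_smul, if_true]
        exact tendsto_const_nhds
      rw [if_neg hij]
      rcases eq_or_ne (c i) 0 with hci | hci
      · simp [hci]
      have h3 : e j < e i := by
        refine lt_of_le_of_ne ?_ fun h => hij (he h.symm)
        by_contra! hlt
        exact absurd (hmin i (Finset.mem_filter.2 ⟨hi, hlt.trans hjρ, hci⟩)) (not_le.2 hlt)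
      have := (tendsto_rpow_zero_right (sub_pos.2 h3)).smul_const (c i)
      rwa [zero_smul] at this
    rw [Finset.sum_ite_eq' A j c, if_pos hjA] at h2
    refine h2.congr' ?_
    filter_upwards [self_mem_nhdsWithin] with y hy
    have hy : 0 < y := hy
    rw [Finset.smul_sum]
    refine Finset.sum_congr rfl fun i _ => ?_
    rw [smul_smul, ← Real.rpow_add hy, neg_add_eq_sub]
  have t2 : (fun y : ℝ => y ^ (-e j) • ∑ i ∈ A, y ^ e i • c i) =O[𝓝[>] 0] fun y : ℝ => y ^ (ρ - e j) := by
    refine ((Asymptotics.isBigO_refl (fun y : ℝ => y ^ (-e j)) _).smul h).congr' EventuallyEq.rfl ?_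
    filter_upwards [self_mem_nhdsWithin] with y hy
    have hy : 0 < y := hy
    rw [smul_eq_mul, ← Real.rpow_add hy, neg_add_eq_sub]
  exact hjc (tendsto_nhds_unique t1 (t2.trans_tendsto (tendsto_rpow_zero_right (sub_pos.2 hjρ))))

/-- The index set of the exponents above `γ`. -/
def expoAbove (μ γ : ℝ) (k : ℕ) : Finset (ℕ × Bool) :=
  (Finset.range k ×ˢ Finset.univ).filter fun i => γ < expo μ i

theorem expSum_eq_sum_expo (μ : ℝ) (v w : ℕ → ℝ) (k : ℕ) (y : ℝ) :
    expSum μ v w k y = ∑ i ∈ Finset.range k ×ˢ Finset.univ, y ^ expo μ i • (if i.2 then w i.1 else v i.1) := by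
  rw [Finset.sum_product, expSum]
  refine Finset.sum_congr rfl fun i _ => ?_
  simp [expo, add_comm, mul_comm]

theorem exists_sum_picStep {n : ℕ} {D : HalfCoord n → ℝ} {g : Bdry n → ℝ} (hD : SmoothHalf D)
    (hg : IsTest g) {μ γ ρ : ℝ} (h0 : 0 < μ) (h1 : μ < 1) (hγ : 0 ≤ γ) (hρ : γ < ρ) {k : ℕ} (hgr : ModerateGrowth D)
    (hk : ∀ p ∈ upperHalf n, (weightedLaplacian (1 - 2 * μ))^[k] D p = 0)
    (ho : ∀ g, IsTest g → testInt D g =O[𝓝[>] 0] fun y : ℝ => y ^ ρ) :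
    ∃ c : ℕ × Bool → ℝ, ∀ y, 0 < y → (picStep μ)^[k] (fun l => testInt D (negLap^[l] g)) 0 y
      = ∑ i ∈ expoAbove μ γ k, y ^ expo μ i • c i := by
  obtain ⟨v, w, hvw⟩ := exists_expSum_picStep hD hg h0 h1 hgr hk
  have hO := picStep_iterate_isBigO h0 h1 (hγ.trans hρ.le) (fun l => ho _ (hg.negLap_iterate l)) k 0
  have hO2 : (fun y : ℝ => ∑ i ∈ Finset.range k ×ˢ Finset.univ,
      y ^ expo μ i • (if i.2 then w i.1 else v i.1)) =O[𝓝[>] 0] fun y : ℝ => y ^ ρ := by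
    refine hO.congr' ?_ EventuallyEq.rfl
    filter_upwards [self_mem_nhdsWithin] with y hy
    rw [hvw y hy, expSum_eq_sum_expo]
  have hz := eq_zero_of_sum_rpow_isBigO (expo_injective h0 h1) hO2
  refine ⟨fun i => if i.2 then w i.1 else v i.1, fun y hy => ?_⟩
  rw [hvw y hy, expSum_eq_sum_expo, expoAbove, Finset.sum_filter]
  refine Finset.sum_congr rfl fun i hi => ?_
  by_cases h2 : γ < expo μ i
  · rw [if_pos h2]
  · rw [if_neg h2, hz i hi (lt_of_le_of_lt (not_lt.1 h2) hρ), smul_zero]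

section hilbert

variable {H : Type*} [NormedAddCommGroup H] [InnerProductSpace ℂ H]

local notation "⟪" x ", " y "⟫" => inner ℂ x y

/-- The scalar sequences obtained by pairing vector valued functions with a fixed vector. -/
def pairSeq (U : ℕ → ℝ → H) (h : H) (l : ℕ) (y : ℝ) : ℂ := ⟪U l y, h⟫

/-- Local uniform bounds on a sequence of vector valued functions. -/
def SeqBounded (U : ℕ → ℝ → H) : Prop := ∀ Y : ℝ, ∃ B : ℝ, ∀ l, ∀ y ∈ Ioc 0 Y, ‖U l y‖ ≤ B

variable {U : ℕ → ℝ → H} (hU : SeqBounded U) {T : Set H} (hT : Dense (Submodule.span ℂ T : Set H))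
  (hc : ∀ h ∈ T, ∀ l, ContinuousOn (pairSeq U h l) (Ioi 0))

include hU hT hc in
theorem locBounded_pairSeq (h : H) (l : ℕ) : LocBounded (pairSeq U h l) := by
  have hb : ∀ (h : H) (Y : ℝ), ∃ C, ∀ y ∈ Ioc 0 Y, ‖pairSeq U h l y‖ ≤ C * ‖h‖ := fun h Y => by
    obtain ⟨B, hB⟩ := hU Y
    exact ⟨B, fun y hy => (norm_inner_le_norm _ _).trans
      (mul_le_mul_of_nonneg_right (hB l y hy) (norm_nonneg h))⟩
  refine ⟨?_, fun Y => (hb h Y).imp' (· * ‖h‖) fun C hC => hC⟩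
  have hspan : ∀ g ∈ Submodule.span ℂ T, ContinuousOn (pairSeq U g l) (Ioi 0) := by
    intro g hg
    induction hg using Submodule.span_induction with
    | mem x hx => exact hc x hx l
    | zero =>
      have e : pairSeq U 0 l = fun _ => 0 := by funext t; simp [pairSeq]
      rw [e]; exact continuousOn_const
    | add x y _ _ hx hy =>
      have e : pairSeq U (x + y) l = fun t => pairSeq U x l t + pairSeq U y l t := by
        funext t; simp [pairSeq]
      rw [e]; exact hx.add hy
    | smul a x _ hx =>
      have e : pairSeq U (a • x) l = fun t => a * pairSeq U x l t := by
        funext t; simp [pairSeq]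
      rw [e]; exact continuousOn_const.mul hx
  have key : ∀ Y : ℝ, ContinuousOn (pairSeq U h l) (Ioo 0 Y) := fun Y => by
    refine continuousOn_of_uniform_approx_of_continuousOn fun u hu => ?_
    obtain ⟨ε, hε, hεu⟩ := Metric.mem_uniformity_dist.1 hu
    obtain ⟨B, hB⟩ := hU Y
    obtain ⟨g, hg, hgd⟩ := Metric.dense_iff.1 hT h (ε / (|B| + 1)) (by positivity)
    refine ⟨pairSeq U g l, (hspan g hgd).mono fun y hy => hy.1, fun y hy => hεu ?_⟩
    rw [dist_eq_norm, pairSeq, pairSeq, ← inner_sub_right]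
    have h1 : ‖h - g‖ < ε / (|B| + 1) := by rw [← dist_eq_norm, dist_comm]; exact hg
    have h2 := hB l y ⟨hy.1, hy.2.le⟩
    calc ‖⟪U l y, h - g⟫‖ ≤ ‖U l y‖ * ‖h - g‖ := norm_inner_le_norm _ _
      _ ≤ (|B| + 1) * ‖h - g‖ := by gcongr; linarith [le_abs_self B]
      _ < (|B| + 1) * (ε / (|B| + 1)) := by gcongr
      _ = ε := by field_simp
  intro y hy
  exact ((key (y + 1)).continuousAt (Ioo_mem_nhds hy (by linarith))).continuousWithinAt

theorem picStep_iterate_add {μ : ℝ} (h0 : 0 < μ) (h1 : μ < 1) {u v : ℕ → ℝ → ℂ} (hu : ∀ l, LocBounded (u l))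
    (hv : ∀ l, LocBounded (v l)) (i : ℕ) : ∀ l y, 0 < y →
    (picStep μ)^[i] (fun l y => u l y + v l y) l y = (picStep μ)^[i] u l y + (picStep μ)^[i] v l y := by
  induction i with
  | zero => exact fun _ _ _ => rfl
  | succ i ih =>
    intro l y hy
    simp only [iterate_succ_apply', picStep]
    rw [ih l y hy, volterra_congr (ih (l + 1)) hy,
      volterra_add h1 (locBounded_picStep_iterate h0 h1 hu i _) (locBounded_picStep_iterate h0 h1 hv i _) hy]
    ring

theorem picStep_iterate_smul {μ : ℝ} (a : ℂ) (u : ℕ → ℝ → ℂ) (i : ℕ) : ∀ l y, 0 < y →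
    (picStep μ)^[i] (fun l y => a • u l y) l y = a • (picStep μ)^[i] u l y := by
  induction i with
  | zero => exact fun _ _ _ => rfl
  | succ i ih =>
    intro l y hy
    simp only [iterate_succ_apply', picStep]
    rw [ih l y hy, volterra_congr (ih (l + 1)) hy, volterra_const_smul, smul_sub]

theorem norm_picStep_iterate_le {μ : ℝ} (h0 : 0 < μ) (h1 : μ < 1) {u : ℕ → ℝ → ℂ} {B Y : ℝ}
    (hu : ∀ l, ∀ y ∈ Ioc 0 Y, ‖u l y‖ ≤ B) (i : ℕ) :
    ∀ l, ∀ y ∈ Ioc 0 Y, ‖(picStep μ)^[i] u l y‖ ≤ (1 + Y ^ (0 + 2 : ℝ) / ((0 + 2) * (0 + 2 - 2 * μ))) ^ i * B := by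
  induction i with
  | zero => simpa using hu
  | succ i ih =>
    intro l y hy
    set K := 1 + Y ^ (0 + 2 : ℝ) / ((0 + 2) * (0 + 2 - 2 * μ))
    rw [iterate_succ_apply', picStep]
    have h2 := norm_volterra_le (f := (picStep μ)^[i] u (l + 1)) (C := K ^ i * B) h0 h1 le_rfl hy.1
      fun t ht => by rw [Real.rpow_zero, mul_one]; exact ih (l + 1) t ⟨ht.1, ht.2.trans hy.2⟩
    have h3 := ih l y hy
    have hB : 0 ≤ K ^ i * B := (norm_nonneg _).trans h3
    have h4 : 0 < 0 + 2 - 2 * μ := by linarith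
    have h5 : y ^ (0 + 2 : ℝ) / ((0 + 2) * (0 + 2 - 2 * μ)) ≤ K - 1 := by
      simp only [K, add_sub_cancel_left]
      have := hy.1.le
      have := hy.2
      gcongr
    calc _ ≤ _ := norm_sub_le _ _
      _ ≤ K ^ i * B + K ^ i * B * (K - 1) := by
        refine add_le_add h3 (h2.trans ?_)
        gcongr
      _ = _ := by ring

end hilbert

end

section

section hilbert

variable {H : Type*} [NormedAddCommGroup H] [InnerProductSpace ℂ H]
  {U : ℕ → ℝ → H} (hU : SeqBounded U) {T : Set H} (hT : Dense (Submodule.span ℂ T : Set H))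
  (hc : ∀ h ∈ T, ∀ l, ContinuousOn (pairSeq U h l) (Ioi 0)) {μ : ℝ} (h0 : 0 < μ) (h1 : μ < 1)

/-- The iterated Picard step of the pairings, as a linear map. -/
def picLinear (k : ℕ) : H →ₗ[ℂ] ℝ → ℂ where
  toFun h y := if 0 < y then (picStep μ)^[k] (pairSeq U h) 0 y else 0
  map_add' x z := by
    funext y
    by_cases hy : 0 < y
    · simp only [if_pos hy, Pi.add_apply]
      rw [← picStep_iterate_add h0 h1 (locBounded_pairSeq hU hT hc x) (locBounded_pairSeq hU hT hc z) k 0 y hy]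
      rw [show pairSeq U (x + z) = fun l y => pairSeq U x l y + pairSeq U z l y by
        funext l t; simp [pairSeq]]
    · simp [if_neg hy]
  map_smul' a x := by
    funext y
    by_cases hy : 0 < y
    · simp only [if_pos hy, Pi.smul_apply, RingHom.id_apply]
      rw [← picStep_iterate_smul a _ k 0 y hy]
      rw [show pairSeq U (a • x) = fun l y => a • pairSeq U x l y by funext l t; simp [pairSeq]]
    · simp [if_neg hy]

include hU hT hc h0 h1 in
theorem continuous_picLinear (k : ℕ) : Continuous (picLinear hU hT hc h0 h1 k) := by
  refine continuous_pi fun y => ?_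
  by_cases hy : 0 < y
  · obtain ⟨B, hB⟩ := hU y
    have hl : Continuous ((LinearMap.proj y : (ℝ → ℂ) →ₗ[ℂ] ℂ) ∘ₗ picLinear hU hT hc h0 h1 k) := by
      refine AddMonoidHomClass.continuous_of_bound _
        ((1 + y ^ (0 + 2 : ℝ) / ((0 + 2) * (0 + 2 - 2 * μ))) ^ k * B) fun h => ?_
      have := norm_picStep_iterate_le (u := pairSeq U h) (B := B * ‖h‖) (Y := y) h0 h1
        (fun l t ht => (norm_inner_le_norm _ _).trans (mul_le_mul_of_nonneg_right (hB l t ht) (norm_nonneg h)))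
        k 0 y ⟨hy, le_rfl⟩
      rw [← mul_assoc] at this
      simpa [picLinear, hy] using this
    exact hl
  · have : (fun h => picLinear hU hT hc h0 h1 k h y) = fun _ => 0 := by
      funext h; simp [picLinear, hy]
    rw [this]; exact continuous_const

include hU hT hc h0 h1 in
/-- If the Picard steps of the pairings with a total set are sums of powers, then so are all of them,
and the coefficients are represented by vectors. -/
theorem exists_riesz_picStep [CompleteSpace H] {ι : Type*} {A : Finset ι} {e : ι → ℝ}
    (he : Function.Injective e) {k : ℕ}
    (hr : ∀ h ∈ T, ∃ c : ι → ℂ, ∀ y, 0 < y → (picStep μ)^[k] (pairSeq U h) 0 y = ∑ i ∈ A, y ^ e i • c i) :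
    ∃ v : ι → H, ∀ h y, 0 < y →
      (picStep μ)^[k] (pairSeq U h) 0 y = ∑ i ∈ A, y ^ e i • inner ℂ (v i) h := by
  classical
  set r := picLinear hU hT hc h0 h1 k with hrdef
  set b : A → ℝ → ℂ := fun i y => if 0 < y then ((y ^ e i : ℝ) : ℂ) else 0 with hb
  set S := Submodule.span ℂ (range b)
  have hfd : FiniteDimensional ℂ S := FiniteDimensional.span_of_finite ℂ (finite_range b)
  have hcl : IsClosed (S : Set (ℝ → ℂ)) := S.closed_of_finiteDimensional
  have hmem : ∀ h, r h ∈ S := by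
    have h2 : (Submodule.span ℂ T) ≤ S.comap r := by
      refine Submodule.span_le.2 fun h hh => ?_
      obtain ⟨c, hcc⟩ := hr h hh
      have : r h = ∑ i : A, c i • b i := by
        funext y
        by_cases hy : 0 < y
        · simp only [hrdef, picLinear, LinearMap.coe_mk, AddHom.coe_mk, if_pos hy, hcc y hy, hb, Finset.sum_apply,
            Pi.smul_apply]
          rw [← Finset.sum_coe_sort A]
          refine Finset.sum_congr rfl fun i _ => ?_
          rw [smul_eq_mul, mul_comm, Complex.real_smul]
        · simp [hrdef, picLinear, hy, hb]
      rw [SetLike.mem_coe, Submodule.mem_comap, this]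
      exact S.sum_mem fun i _ => S.smul_mem _ (Submodule.subset_span (mem_range_self i))
    intro h
    have h3 : IsClosed (r ⁻¹' (S : Set (ℝ → ℂ))) := hcl.preimage (continuous_picLinear hU hT hc h0 h1 k)
    exact (closure_minimal (s := (Submodule.span ℂ T : Set H)) h2 h3) (hT h)
  have hli : LinearIndependent ℂ b := by
    rw [Fintype.linearIndependent_iff]
    intro g hg
    have hz := fun ρ : ℝ => eq_zero_of_sum_rpow_isBigO (E := ℂ) (A := Finset.univ) (e := fun i : A => e i)
      (fun i j hij => Subtype.ext (he hij)) (c := g) (ρ := ρ)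
    intro i
    refine hz (e i + 1) ?_ i (Finset.mem_univ i) (by linarith)
    refine (Asymptotics.isBigO_zero _ _).congr' ?_ EventuallyEq.rfl
    filter_upwards [self_mem_nhdsWithin] with y hy
    have := congrFun hg y
    simp only [Finset.sum_apply, Pi.smul_apply, hb, if_pos (mem_Ioi.1 hy), Pi.zero_apply] at this
    rw [← this]
    refine Finset.sum_congr rfl fun i _ => ?_
    rw [smul_eq_mul, mul_comm, Complex.real_smul]
  set Bs := Module.Basis.span hli with hBs
  set rS : H →ₗ[ℂ] S := r.codRestrict S hmem
  have hrS : Continuous rS := (continuous_picLinear hU hT hc h0 h1 k).subtype_mk _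
  have hco : ∀ i, Continuous (Bs.coord i ∘ₗ rS) := fun i =>
    ((Bs.coord i).continuous_of_finiteDimensional).comp hrS
  refine ⟨fun i => if hi : i ∈ A then (InnerProductSpace.toDual ℂ H).symm ⟨Bs.coord ⟨i, hi⟩ ∘ₗ rS, hco _⟩ else 0,
    fun h y hy => ?_⟩
  have h5 := Bs.sum_repr (rS h)
  have h6 := congrFun (congrArg Subtype.val h5) y
  have h7 : ((rS h : S) : ℝ → ℂ) y = (picStep μ)^[k] (pairSeq U h) 0 y := by
    simp [rS, hrdef, picLinear, hy]
  rw [h7] at h6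
  rw [← h6, ← Finset.sum_coe_sort A]
  simp only [AddSubmonoidClass.coe_finsetSum, Finset.sum_apply, Submodule.coe_smul, Pi.smul_apply]
  refine Finset.sum_congr rfl fun i _ => ?_
  rw [dif_pos i.2, InnerProductSpace.toDual_symm_apply]
  simp [hBs, Module.Basis.span_apply, hb, hy, mul_comm]

end hilbert

end

section

variable {E : Type*} [NormedAddCommGroup E] [NormedSpace ℝ E] {μ : ℝ}

theorem picStep_iterate_congr {u v : ℕ → ℝ → E} (k : ℕ) : ∀ j, (∀ l ≤ j + k, ∀ y, 0 < y → u l y = v l y) →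
    ∀ y, 0 < y → (picStep μ)^[k] u j y = (picStep μ)^[k] v j y := by
  induction k with
  | zero => exact fun j h y hy => h j le_rfl y hy
  | succ k ih =>
    intro j h y hy
    rw [iterate_succ_apply', iterate_succ_apply', picStep, picStep,
      ih j (fun l hl => h l (by omega)) y hy,
      volterra_congr (ih (j + 1) fun l hl => h l (by omega)) hy]

theorem picStep_iterate_shift (u : ℕ → ℝ → E) (j k : ℕ) : ∀ l,
    (picStep μ)^[k] (fun l => u (l + j)) l = (picStep μ)^[k] u (l + j) := by
  induction k with
  | zero => exact fun l => rfl
  | succ k ih =>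
    intro l
    funext y
    rw [iterate_succ_apply', iterate_succ_apply', picStep, picStep, ih, ih, add_right_comm]

variable (μ) in
/-- The coefficients of the iterated integrals of a power: the `s`-th Volterra iterate of `y ^ q` is
`powCoef μ q s * y ^ (q + 2 s)`. -/
def powCoef (q : ℝ) (s : ℕ) : ℝ :=
  (∏ i ∈ Finset.range s, (q + 2 * i + 2) * (q + 2 * i + 2 - 2 * μ))⁻¹

theorem powCoef_succ (q : ℝ) (s : ℕ) :
    powCoef μ q (s + 1) = powCoef μ q s / ((q + 2 * s + 2) * (q + 2 * s + 2 - 2 * μ)) := by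
  rw [powCoef, Finset.prod_range_succ, mul_inv, powCoef, div_eq_mul_inv]

variable (h1 : μ < 1) {q : ℝ} (hq : 0 ≤ q)
include h1 hq

theorem powCoef_pos (s : ℕ) : 0 < powCoef μ q s := by
  refine inv_pos.2 (Finset.prod_pos fun i _ => mul_pos (by positivity) ?_)
  have : (0 : ℝ) ≤ 2 * i := by positivity
  linarith

theorem powCoef_le (s : ℕ) : powCoef μ q s ≤ (4 * (1 - μ))⁻¹ ^ s / s.factorial := by
  induction s with
  | zero => simp [powCoef]
  | succ s ih =>
    rw [powCoef_succ, pow_succ, Nat.factorial_succ]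
    have h3 : 0 < 1 - μ := by linarith
    have h4 : 4 * (1 - μ) * (s + 1) ≤ (q + 2 * s + 2) * (q + 2 * s + 2 - 2 * μ) := by
      have h5 : (0 : ℝ) ≤ s := by positivity
      calc 4 * (1 - μ) * (s + 1) = (2 * (s + 1)) * (2 - 2 * μ) := by ring
        _ ≤ _ := mul_le_mul (by linarith) (by linarith) (by linarith) (by linarith)
    calc powCoef μ q s / ((q + 2 * s + 2) * (q + 2 * s + 2 - 2 * μ))
        ≤ ((4 * (1 - μ))⁻¹ ^ s / s.factorial) / (4 * (1 - μ) * (s + 1)) := by gcongr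
      _ = _ := by
        push_cast
        rw [inv_pow]
        field_simp

omit h1 hq in
theorem multichoose_le (k s : ℕ) : (Nat.multichoose k s : ℝ) ≤ 2 ^ k * 2 ^ s := by
  rw [Nat.multichoose_eq, ← pow_add]
  exact_mod_cast (Nat.choose_le_two_pow _ _).trans (Nat.pow_le_pow_right two_pos (Nat.sub_le _ _))

/-- A majorant of the terms of `powSer`. -/
theorem norm_powSer_term_le {c : ℕ → E} {C Λ : ℝ} (hc : ∀ s, ‖c s‖ ≤ C * Λ ^ s) (k s : ℕ) {y Y : ℝ} (hy : 0 < y)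
    (hY : y ≤ Y) : ‖((Nat.multichoose k s : ℝ) * powCoef μ q s * y ^ (q + 2 * s)) • c s‖
      ≤ 2 ^ k * Y ^ q * C * ((2 * (4 * (1 - μ))⁻¹ * Y ^ 2 * Λ) ^ s / s.factorial) := by
  have h3 : 0 < 1 - μ := by linarith
  have h4 := (powCoef_pos h1 hq s).le
  have hY0 : 0 < Y := hy.trans_le hY
  rw [norm_smul, Real.norm_of_nonneg (by positivity), Real.rpow_add hy, mul_comm 2 (s : ℝ),
    Real.rpow_natCast_mul hy.le, Real.rpow_two, ← pow_mul, mul_comm s 2, pow_mul]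
  have hC := (norm_nonneg _).trans (hc s)
  calc _ ≤ (2 ^ k * 2 ^ s) * ((4 * (1 - μ))⁻¹ ^ s / s.factorial) * (Y ^ q * (Y ^ 2) ^ s) * (C * Λ ^ s) := by
        gcongr
        · exact multichoose_le k s
        · exact powCoef_le h1 hq s
        · exact hc s
    _ = _ := by simp only [mul_pow]; ring

omit h1 hq in
theorem summable_majorant (a b : ℝ) : Summable fun s : ℕ => a * (b ^ s / s.factorial) :=
  (Real.summable_pow_div_factorial b).mul_left a

variable (μ) in
omit h1 hq in
/-- The solution of the `k`-fold Picard equation with right hand side `y ^ q • c l`. -/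
def powSer (q : ℝ) (k : ℕ) (c : ℕ → E) (y : ℝ) : E :=
  ∑' s : ℕ, ((Nat.multichoose k s : ℝ) * powCoef μ q s * y ^ (q + 2 * s)) • c s

variable [CompleteSpace E]

theorem hasSum_powSer {c : ℕ → E} {C Λ : ℝ} (hc : ∀ s, ‖c s‖ ≤ C * Λ ^ s) (k : ℕ) {y : ℝ} (hy : 0 < y) :
    HasSum (fun s : ℕ => ((Nat.multichoose k s : ℝ) * powCoef μ q s * y ^ (q + 2 * s)) • c s) (powSer μ q k c y) :=
  (Summable.of_norm_bounded (summable_majorant _ _) fun s => norm_powSer_term_le h1 hq hc k s hy le_rfl).hasSum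

omit [CompleteSpace E] in
theorem norm_powSer_le {c : ℕ → E} {C Λ : ℝ} (hc : ∀ s, ‖c s‖ ≤ C * Λ ^ s) (k : ℕ) {y Y : ℝ} (hy : 0 < y)
    (hY : y ≤ Y) : ‖powSer μ q k c y‖
      ≤ ∑' s : ℕ, 2 ^ k * Y ^ q * C * ((2 * (4 * (1 - μ))⁻¹ * Y ^ 2 * Λ) ^ s / s.factorial) :=
  tsum_of_norm_bounded (summable_majorant _ _).hasSum fun s => norm_powSer_term_le h1 hq hc k s hy hY

theorem locBounded_powSer {c : ℕ → E} {C Λ : ℝ} (hc : ∀ s, ‖c s‖ ≤ C * Λ ^ s) (k : ℕ) :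
    LocBounded (powSer μ q k c) := by
  refine ⟨fun y hy => ?_, fun Y => ⟨_, fun y hy => norm_powSer_le h1 hq hc k hy.1 hy.2⟩⟩
  have h2 : ContinuousOn (powSer μ q k c) (Ioo 0 (y + 1)) := by
    refine continuousOn_tsum (fun s => ?_) (summable_majorant _ _)
      fun s t ht => norm_powSer_term_le h1 hq hc k s ht.1 ht.2.le
    refine ContinuousOn.smul (continuousOn_const.mul ?_) continuousOn_const
    exact fun t ht => (Real.continuousAt_rpow_const t _ (Or.inl ht.1.ne')).continuousWithinAt
  exact (h2.continuousAt (Ioo_mem_nhds hy (by linarith))).continuousWithinAt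

omit hq [CompleteSpace E] in
theorem hasSum_volterra {F : ℕ → ℝ → E} {f : ℝ → E} {M : ℕ → ℝ} {y : ℝ} (hy : 0 < y) (hM : Summable M)
    (hF : ∀ s, LocBounded (F s)) (hb : ∀ s, ∀ t ∈ Ioc 0 y, ‖F s t‖ ≤ M s)
    (hf : ∀ t ∈ Ioc 0 y, HasSum (fun s => F s t) (f t)) :
    HasSum (fun s => volterra μ (F s) y) (volterra μ f y) := by
  have hK : IntervalIntegrable (fun t : ℝ => y ^ (2 * μ) * t ^ (1 - 2 * μ) - t) volume 0 y :=
    ((intervalIntegral.intervalIntegrable_rpow' (by linarith)).const_mul _).sub intervalIntegral.intervalIntegrable_id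
  simp only [volterra]
  refine HasSum.const_smul _ ?_
  refine intervalIntegral.hasSum_integral_of_dominated_convergence
    (fun s t => |y ^ (2 * μ) * t ^ (1 - 2 * μ) - t| * M s) (fun s => ?_) (fun s => ?_) ?_ ?_ ?_
  · rw [uIoc_of_le hy.le]
    refine ContinuousOn.aestronglyMeasurable ?_ measurableSet_Ioc
    refine ContinuousOn.smul (fun t ht => ?_) ((hF s).1.mono fun t ht => ht.1)
    exact ((continuousAt_const.mul (Real.continuousAt_rpow_const t _ (Or.inl ht.1.ne'))).sub
      continuousAt_id).continuousWithinAt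
  · refine .of_forall fun t ht => ?_
    rw [uIoc_of_le hy.le] at ht
    rw [norm_smul, Real.norm_eq_abs]
    exact mul_le_mul_of_nonneg_left (hb s t ht) (abs_nonneg _)
  · exact .of_forall fun t _ => hM.mul_left _
  · simp only [tsum_mul_left]
    exact hK.abs.mul_const _
  · refine .of_forall fun t ht => ?_
    rw [uIoc_of_le hy.le] at ht
    exact (hf t ht).const_smul _

omit hq in
theorem volterra_rpow_smul (h0 : 0 < μ) (hq : 0 ≤ q) (c : E) {y : ℝ} (hy : 0 < y) :
    volterra μ (fun t => t ^ q • c) y = (y ^ (q + 2) / ((q + 2) * (q + 2 - 2 * μ))) • c := by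
  rw [← volterra_rpow h0 h1 hq hy]
  simp only [volterra, smul_smul]
  rw [intervalIntegral.integral_smul_const, smul_smul]
  simp only [smul_eq_mul]

theorem picStep_powSer (h0 : 0 < μ) {c : ℕ → E} {C Λ : ℝ} (hc : ∀ s, ‖c s‖ ≤ C * Λ ^ s) (k : ℕ) {y : ℝ} (hy : 0 < y) :
    powSer μ q (k + 1) c y - volterra μ (powSer μ q (k + 1) fun s => c (s + 1)) y = powSer μ q k c y := by
  have hc' : ∀ s, ‖c (s + 1)‖ ≤ C * Λ * Λ ^ s := fun s => (hc (s + 1)).trans (le_of_eq (by ring))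
  have e : ∀ s : ℕ, q + 2 * s + 2 = q + 2 * (s + 1 : ℕ) := fun s => by push_cast; ring
  have hG : HasSum (fun s : ℕ => ((Nat.multichoose (k + 1) s : ℝ) * powCoef μ q (s + 1) *
      y ^ (q + 2 * (s + 1 : ℕ))) • c (s + 1)) (volterra μ (powSer μ q (k + 1) fun s => c (s + 1)) y) := by
    have h2 := hasSum_volterra (μ := μ) h1 hy (summable_majorant _ _)
      (F := fun s t => ((Nat.multichoose (k + 1) s : ℝ) * powCoef μ q s * t ^ (q + 2 * s)) • c (s + 1))
      (f := powSer μ q (k + 1) fun s => c (s + 1)) (fun s => ?_)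
      (fun s t ht => norm_powSer_term_le h1 hq hc' (k + 1) s ht.1 ht.2) fun t ht => hasSum_powSer h1 hq hc' (k + 1) ht.1
    · convert h2 using 2 with s
      simp only [mul_smul]
      rw [volterra_const_smul (𝕜 := ℝ), volterra_const_smul (𝕜 := ℝ), volterra_rpow_smul h1 h0 (by positivity) _ hy, powCoef_succ, e]
      simp only [smul_smul]
      congr 1
      ring
    · simp only [mul_smul]
      refine ((LocBounded.congr (f := fun t : ℝ => t ^ (q + 2 * s) • c (s + 1)) ?_ fun _ _ => rfl).const_smul _).const_smul _
      have h3 := LocBounded.rpow (q := q + 2 * s) (by positivity)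
      refine ⟨h3.1.smul continuousOn_const, fun Y => ?_⟩
      obtain ⟨B, hB⟩ := h3.2 Y
      exact ⟨B * ‖c (s + 1)‖, fun t ht => (norm_smul_le _ _).trans (by gcongr; exact hB t ht)⟩
  have hF := (hasSum_nat_add_iff' 1).2 (hasSum_powSer h1 hq hc (k + 1) hy)
  have hT := (hasSum_nat_add_iff' 1).2 (hasSum_powSer h1 hq hc k hy)
  have h4 := hF.sub hG
  have h5 : (fun s : ℕ => ((Nat.multichoose (k + 1) (s + 1) : ℝ) * powCoef μ q (s + 1) *
      y ^ (q + 2 * (s + 1 : ℕ))) • c (s + 1) - ((Nat.multichoose (k + 1) s : ℝ) * powCoef μ q (s + 1) *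
      y ^ (q + 2 * (s + 1 : ℕ))) • c (s + 1)) = fun s : ℕ => ((Nat.multichoose k (s + 1) : ℝ) * powCoef μ q (s + 1) *
      y ^ (q + 2 * (s + 1 : ℕ))) • c (s + 1) := by
    funext s
    rw [← sub_smul, Nat.multichoose_succ_succ]
    push_cast
    congr 1
    ring
  rw [h5] at h4
  have h6 := h4.unique hT
  simp only [Finset.range_one, Finset.sum_singleton, Nat.multichoose_zero_right] at h6
  rw [sub_right_comm] at h6
  exact sub_left_injective h6

theorem picStep_iterate_powSer (h0 : 0 < μ) {c : ℕ → E} {C Λ : ℝ} (hc : ∀ s, ‖c s‖ ≤ C * Λ ^ s) (k : ℕ) :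
    ∀ l y, 0 < y → (picStep μ)^[k] (fun l => powSer μ q k fun s => c (s + l)) l y = y ^ q • c l := by
  have hb : ∀ l s, ‖c (s + l)‖ ≤ C * Λ ^ l * Λ ^ s := fun l s => (hc _).trans (le_of_eq (by ring))
  induction k with
  | zero =>
    intro l y hy
    have h2 := hasSum_powSer h1 hq (hb l) 0 hy
    refine h2.unique ?_
    have h3 := hasSum_single (f := fun s : ℕ => ((Nat.multichoose 0 s : ℝ) * powCoef μ q s * y ^ (q + 2 * s)) • c (s + l)) 0
      fun s hs => by
        obtain ⟨s, rfl⟩ := Nat.exists_eq_succ_of_ne_zero hs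
        simp
    simpa [powCoef] using h3
  | succ k ih =>
    intro l y hy
    rw [Function.iterate_succ_apply, ← ih l y hy]
    refine picStep_iterate_congr k l (fun j _ t ht => ?_) y hy
    have := picStep_powSer h1 hq h0 (hb j) k ht
    rw [← this, picStep]
    simp only [add_right_comm _ 1 j, ← add_assoc]

omit hq [CompleteSpace E] in
/-- Uniqueness for the iterated Picard equation. -/
theorem eq_zero_of_picStep_iterate_eq_zero (h0 : 0 < μ) {Λ : ℝ} (hΛ : 0 ≤ Λ) (k : ℕ) {z : ℕ → ℝ → E}
    (hb : ∀ Y : ℝ, ∃ C : ℝ, ∀ l, ∀ y ∈ Ioc 0 Y, ‖z l y‖ ≤ C * Λ ^ l)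
    (hz : ∀ l y, 0 < y → (picStep μ)^[k] z l y = 0) : ∀ l y, 0 < y → z l y = 0 := by
  induction k generalizing z with
  | zero => exact hz
  | succ k ih =>
    have hw : ∀ l y, 0 < y → picStep μ z l y = 0 := by
      refine ih (fun Y => ?_) fun l y hy => hz l y hy
      obtain ⟨C, hC⟩ := hb Y
      set K := Y ^ (0 + 2 : ℝ) / ((0 + 2) * (0 + 2 - 2 * μ)) with hK
      refine ⟨C + C * Λ * K, fun l y hy => ?_⟩
      have h4 : 0 < 0 + 2 - 2 * μ := by linarith
      have h5 : y ^ (0 + 2 : ℝ) / ((0 + 2) * (0 + 2 - 2 * μ)) ≤ K := by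
        have := hy.1.le
        have := hy.2
        rw [hK]
        gcongr
      have h6 := norm_volterra_le (f := z (l + 1)) (C := C * Λ ^ (l + 1)) h0 h1 le_rfl hy.1 fun t ht => by
        rw [Real.rpow_zero, mul_one]; exact hC _ t ⟨ht.1, ht.2.trans hy.2⟩
      have h7 := (norm_nonneg _).trans (hC (l + 1) y hy)
      calc _ ≤ _ := norm_sub_le _ _
        _ ≤ C * Λ ^ l + C * Λ ^ (l + 1) * K := by
          refine add_le_add (hC l y hy) (h6.trans ?_)
          gcongr
        _ = _ := by ring
    intro l y hy
    obtain ⟨C, hC⟩ := hb y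
    have key : ∀ j l, ∀ t ∈ Ioc 0 y, ‖z l t‖ ≤ C * Λ ^ (l + j) * powCoef μ 0 j * t ^ (2 * j : ℝ) := by
      intro j
      induction j with
      | zero => intro l t ht; simpa [powCoef] using hC l t ht
      | succ j ihj =>
        intro l t ht
        have h2 := hw l t ht.1
        rw [picStep, sub_eq_zero] at h2
        rw [h2]
        have h3 := norm_volterra_le (f := z (l + 1)) (q := 2 * j) (C := C * Λ ^ (l + 1 + j) * powCoef μ 0 j) h0 h1
          (by positivity) ht.1 fun r hr => ihj (l + 1) r ⟨hr.1, hr.2.trans ht.2⟩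
        refine h3.trans (le_of_eq ?_)
        rw [powCoef_succ]
        push_cast
        rw [show (2 : ℝ) * (j + 1) = 2 * j + 2 by ring]
        ring
    have h8 : Tendsto (fun j : ℕ => C * Λ ^ l * ((Λ * (4 * (1 - μ))⁻¹ * y ^ 2) ^ j / j.factorial)) atTop (𝓝 (C * Λ ^ l * 0)) :=
      (FloorSemiring.tendsto_pow_div_factorial_atTop _).const_mul _
    rw [mul_zero] at h8
    refine norm_le_zero_iff.1 (ge_of_tendsto' h8 fun j => (key j l y ⟨hy, le_rfl⟩).trans ?_)
    have h9 : 0 ≤ C * Λ ^ l := (norm_nonneg _).trans (hC l y ⟨hy, le_rfl⟩)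
    rw [mul_comm 2 (j : ℝ), Real.rpow_natCast_mul hy.le, Real.rpow_two, pow_add, ← mul_assoc, mul_assoc (C * Λ ^ l), mul_assoc (C * Λ ^ l)]
    refine mul_le_mul_of_nonneg_left ?_ h9
    calc _ ≤ Λ ^ j * ((4 * (1 - μ))⁻¹ ^ j / j.factorial) * (y ^ j) ^ 2 := by
          gcongr
          exact powCoef_le h1 le_rfl j
      _ = _ := by rw [pow_right_comm]; simp only [mul_pow]; ring

end

section

theorem contDiff_tsum_mul_pow {b : ℕ → ℝ} {C B : ℝ} (hb : ∀ s, |b s| ≤ C * (B ^ s / s.factorial)) :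
    ContDiff ℝ ∞ fun u : ℝ => ∑' s, b s * u ^ s := by
  set p := FormalMultilinearSeries.ofScalars (𝕜 := ℝ) ℝ b
  have hr : p.radius = ⊤ := by
    refine FormalMultilinearSeries.radius_eq_top_of_summable_norm _ fun r => ?_
    refine Summable.of_nonneg_of_le (fun s => by positivity) (fun s => ?_)
      ((Real.summable_pow_div_factorial (B * r)).mul_left C)
    rw [FormalMultilinearSeries.ofScalars_norm, Real.norm_eq_abs, mul_pow]
    calc |b s| * (r : ℝ) ^ s ≤ (C * (B ^ s / s.factorial)) * r ^ s := by gcongr; exact hb s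
      _ = _ := by ring
  have h1 := p.hasFPowerSeriesOnBall (by rw [hr]; simp)
  have h2 : AnalyticOnNhd ℝ p.sum univ := fun x _ => by
    refine h1.analyticOnNhd x ?_
    simp [hr]
  have h3 : p.sum = fun u : ℝ => ∑' s, b s * u ^ s := by
    funext u
    simp [FormalMultilinearSeries.sum, p, mul_comm]
  rw [← h3]
  exact h2.contDiff

theorem besselOp_const_mul_field (m c : ℝ) (f : ℝ → ℝ) :
    besselOp m (fun y => c * f y) = fun y => c * besselOp m f y := by
  have h1 : deriv (fun y => c * f y) = fun y => c * deriv f y := by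
    funext z; exact deriv_const_mul_field _
  have h2 : deriv (fun y => c * deriv f y) = fun y => c * deriv (deriv f) y := by
    funext z; exact deriv_const_mul_field _
  funext y
  simp only [besselOp, h1, h2]
  ring

/-- The operator `∂_y² + (1 - 2 μ) y⁻¹ ∂_y - Λ`. -/
def helm (μ Λ : ℝ) (f : ℝ → ℝ) (y : ℝ) : ℝ := besselOp (1 - 2 * μ) f y - Λ * f y

variable {μ Λ : ℝ} {f g e : ℝ → ℝ}

theorem _root_.ContDiffOn.helm (hf : ContDiffOn ℝ ∞ f (Ioi 0)) (μ Λ : ℝ) : ContDiffOn ℝ ∞ (helm μ Λ f) (Ioi 0) :=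
  (hf.besselOp _).sub (contDiffOn_const.mul hf)

theorem _root_.ContDiffOn.helm_iterate (hf : ContDiffOn ℝ ∞ f (Ioi 0)) (μ Λ : ℝ) (i : ℕ) :
    ContDiffOn ℝ ∞ ((_root_.helm μ Λ)^[i] f) (Ioi 0) := by
  induction i with
  | zero => exact hf
  | succ i ih => rw [iterate_succ_apply']; exact ih.helm μ Λ

theorem helm_congr_nhds {y : ℝ} (h : f =ᶠ[𝓝 y] g) : helm μ Λ f =ᶠ[𝓝 y] helm μ Λ g := by
  filter_upwards [h, h.deriv, h.deriv.deriv] with z h1 h2 h3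
  simp only [helm, besselOp, h1, h2, h3]

theorem helm_iterate_congr_nhds {y : ℝ} (h : f =ᶠ[𝓝 y] g) (i : ℕ) :
    (helm μ Λ)^[i] f =ᶠ[𝓝 y] (helm μ Λ)^[i] g := by
  induction i with
  | zero => exact h
  | succ i ih => rw [iterate_succ_apply', iterate_succ_apply']; exact helm_congr_nhds ih

theorem seqOp_iterate_pow (i : ℕ) : ∀ l y, (seqOp μ)^[i] (fun l y => Λ ^ l * f y) l y = Λ ^ l * (helm μ Λ)^[i] f y := by
  induction i generalizing f with
  | zero => exact fun _ _ => rfl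
  | succ i ih =>
    intro l y
    have h : (seqOp μ fun l y => Λ ^ l * f y) = fun l y => Λ ^ l * helm μ Λ f y := by
      funext l t
      rw [seqOp, besselOp_const_mul_field, helm]
      ring
    rw [Function.iterate_succ_apply, Function.iterate_succ_apply, h, ih]

/-- The factor produced by the iterated Bessel operator on a power. -/
def powFactor (μ q : ℝ) (i : ℕ) : ℝ := ∏ l ∈ Finset.range i, (q - 2 * l) * (q - 2 * l - 2 * μ)

theorem besselOp_iterate_rpow (μ q : ℝ) (i : ℕ) :
    EqOn ((besselOp (1 - 2 * μ))^[i] fun y => y ^ q) (fun y => powFactor μ q i * y ^ (q - 2 * i)) (Ioi 0) := by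
  induction i with
  | zero => intro y _; simp [powFactor]
  | succ i ih =>
    intro y hy
    rw [iterate_succ_apply', eqOn_besselOp_Ioi ih hy, besselOp_const_mul_field]
    simp only
    rw [besselOp_rpow μ _ hy, powFactor, powFactor, Finset.prod_range_succ]
    push_cast
    rw [show q - 2 * (i : ℝ) - 2 = q - 2 * (i + 1) by ring]
    ring

theorem powFactor_even (μ : ℝ) {a i : ℕ} (h : a < i) : powFactor μ (2 * a) i = 0 :=
  Finset.prod_eq_zero (Finset.mem_range.2 h) (by simp)

theorem powFactor_odd (μ : ℝ) {a i : ℕ} (h : a < i) : powFactor μ (2 * a + 2 * μ) i = 0 :=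
  Finset.prod_eq_zero (Finset.mem_range.2 h) (by simp)

theorem powFactor_expo (μ : ℝ) {j : ℕ × Bool} {i : ℕ} (h : j.1 < i) : powFactor μ (expo μ j) i = 0 := by
  rcases j with ⟨a, b⟩
  cases b
  · simpa [expo] using powFactor_even μ h
  · simpa [expo] using powFactor_odd μ h

/-- The growing solutions of the iterated Helmholtz equation, with leading term `y ^ q`. -/
def solPow (μ q : ℝ) (k : ℕ) (Λ y : ℝ) : ℝ := powSer μ q k (fun s => Λ ^ s) y

section

variable (h1 : μ < 1) {q : ℝ} (hq : 0 ≤ q)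
include h1 hq

theorem exists_solPow_eq (k : ℕ) : ∃ A : ℝ → ℝ, ContDiff ℝ ∞ A ∧ A 0 = 1 ∧
    ∀ Λ y, 0 < y → solPow μ q k Λ y = y ^ q * A (Λ * y ^ 2) := by
  refine ⟨fun u => ∑' s : ℕ, ((Nat.multichoose k s : ℝ) * powCoef μ q s) * u ^ s,
    contDiff_tsum_mul_pow (C := 2 ^ k) (B := 2 * (4 * (1 - μ))⁻¹) fun s => ?_, ?_, fun Λ y hy => ?_⟩
  · have h4 := (powCoef_pos h1 hq s).le
    rw [abs_of_nonneg (by positivity)]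
    calc _ ≤ (2 ^ k * 2 ^ s) * ((4 * (1 - μ))⁻¹ ^ s / s.factorial) := by
          gcongr
          · exact multichoose_le k s
          · exact powCoef_le h1 hq s
      _ = _ := by rw [mul_pow]; ring
  · simp only
    rw [tsum_eq_single 0 fun s hs => by simp [hs]]
    simp [powCoef]
  · simp only [solPow, powSer, smul_eq_mul]
    rw [← tsum_mul_left]
    refine tsum_congr fun s => ?_
    rw [Real.rpow_add hy, mul_pow, show (2 : ℝ) * s = ((2 * s : ℕ) : ℝ) by push_cast; rfl, Real.rpow_natCast, pow_mul]
    ring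

theorem contDiffOn_solPow (k : ℕ) (Λ : ℝ) : ContDiffOn ℝ ∞ (solPow μ q k Λ) (Ioi 0) := by
  obtain ⟨A, hA, _, h⟩ := exists_solPow_eq h1 hq k
  refine ((contDiffOn_rpow_Ioi q).mul (ContDiff.contDiffOn (f := fun y => A (Λ * y ^ 2)) (hA.comp (by fun_prop)))).congr fun y hy => h Λ y hy

theorem symbolBound_solPow (k : ℕ) (Λ : ℝ) : SymbolBound (q + 1) fun y => solPow μ q k Λ y - y ^ q := by
  obtain ⟨A, hA, hA0, h⟩ := exists_solPow_eq h1 hq k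
  have h2 : SymbolBound ((1 : ℕ) : ℝ) fun y => A (Λ * y ^ 2) - 1 := by
    refine symbolBound_of_contDiffOn (ContDiff.contDiffOn ((hA.comp (by fun_prop)).sub contDiff_const)) fun j hj => ?_
    obtain rfl : j = 0 := by omega
    simp [hA0]
  rw [Nat.cast_one] at h2
  refine ((SymbolBound.rpow q).mul h2).congr ?_
  filter_upwards [self_mem_nhdsWithin] with y hy
  rw [h Λ y hy]; ring

theorem helm_iterate_solPow (h0 : 0 < μ) {k : ℕ} (hk : powFactor μ q k = 0) (hΛ : 0 ≤ Λ) {y : ℝ} (hy : 0 < y) :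
    (helm μ Λ)^[k] (solPow μ q k Λ) y = 0 := by
  have hc : ∀ s, ‖Λ ^ s‖ ≤ 1 * Λ ^ s := fun s => by rw [one_mul, Real.norm_of_nonneg (by positivity)]
  have e : (fun (l : ℕ) => powSer μ q k fun s => Λ ^ (s + l)) = fun l y => Λ ^ l * solPow μ q k Λ y := by
    funext l y
    simp only [solPow, powSer, smul_eq_mul]
    rw [← tsum_mul_left]
    exact tsum_congr fun s => by ring
  have h2 := picStep_iterate_powSer h1 hq h0 hc k 0
  rw [e] at h2
  have h3 := besselOp_iterate_picStep h0 h1 (u := fun l y => Λ ^ l * solPow μ q k Λ y)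
    (fun l => (locBounded_powSer h1 hq hc k).const_smul (Λ ^ l))
    (fun l => contDiffOn_const.mul (contDiffOn_solPow h1 hq k Λ)) k 0 hy
  rw [seqOp_iterate_pow, eqOn_besselOp_iterate_Ioi (g := fun y => y ^ q) (fun t ht => by rw [h2 t ht]; simp) k hy,
    besselOp_iterate_rpow μ q k hy, hk] at h3
  simpa using h3.symm

end

/-- The Helmholtz operators are the operators of the half space of dimension one. -/
theorem genLaplacian_iterate_eq_helm (i : ℕ) (p : HalfCoord 0) :
    (genLaplacian (fun (U : HalfCoord 0 → ℝ) p => -Λ * U p) (1 - 2 * μ))^[i] (fun p => f p.2) p = (helm μ Λ)^[i] f p.2 := by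
  induction i generalizing f with
  | zero => rfl
  | succ i ih =>
    have h : genLaplacian (fun (U : HalfCoord 0 → ℝ) p => -Λ * U p) (1 - 2 * μ) (fun p => f p.2)
        = fun p => helm μ Λ f p.2 := by
      funext p
      simp only [genLaplacian, helm, besselOp, partialY]
      ring
    rw [Function.iterate_succ_apply, Function.iterate_succ_apply, h, ih]

end

section

variable {μ Λ : ℝ}

theorem contDiffOn_besselFun_mul (σ : ℝ) {c : ℝ} (hc : 0 < c) :
    ContDiffOn ℝ ∞ (fun y => besselFun σ (c * y)) (Ioi 0) := by
  refine contDiffOn_const.mul ?_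
  refine (contDiffOn_besselInt σ).comp (t := Ioi 0) (by fun_prop) fun y hy => ?_
  have : 0 < c * y := mul_pos hc hy
  exact mem_Ioi.2 (by positivity)

theorem smoothHalf_of_contDiffOn {n : ℕ} {f : ℝ → ℝ} (hf : ContDiffOn ℝ ∞ f (Ioi 0)) :
    SmoothHalf fun p : HalfCoord n => f p.2 :=
  hf.comp contDiffOn_snd fun _ hp => mem_upperHalf.1 hp

theorem genLaplacian_besselFun (σ : ℝ) {c : ℝ} (hc : 0 < c) {p : HalfCoord 0} (hp : p ∈ upperHalf 0) :
    genLaplacian (fun (U : HalfCoord 0 → ℝ) p => -(c ^ 2) * U p) (1 - 2 * σ) (fun p => besselFun σ (c * p.2)) p = 0 := by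
  have h1 : besselOp (1 - 2 * σ) (fun y => besselFun σ (c * y)) p.2 = c ^ 2 * besselFun σ (c * p.2) := by
    simp only [besselFun]
    rw [besselOp_const_mul_field]
    simp only
    rw [besselOp_besselInt σ hc (mem_upperHalf.1 hp)]
    ring
  simp only [genLaplacian, partialY]
  rw [besselOp] at h1
  linarith

theorem symbolBound_besselFun {σ : ℝ} (hσ : 0 < σ) (hσN : ∀ N : ℕ, σ ≠ N) {c : ℝ} (hc : 0 < c) :
    SymbolBound (min 1 (2 * σ)) fun y => besselFun σ (c * y) - 1 := by
  obtain ⟨E, β, hE, hβ, -, -, hE0, h⟩ := exists_besselFun_eq hσ hσN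
  have h2 : SymbolBound ((1 : ℕ) : ℝ) fun y => E (c * y) - 1 := by
    refine symbolBound_of_contDiffOn (ContDiff.contDiffOn ((hE.1.comp (by fun_prop)).sub contDiff_const)) fun j hj => ?_
    obtain rfl : j = 0 := by omega
    simp [hE0]
  have h3 : SymbolBound ((0 : ℕ) : ℝ) fun y => β (c * y) :=
    symbolBound_of_contDiffOn (ContDiff.contDiffOn (hβ.1.comp (by fun_prop))) fun j hj => absurd hj (by omega)
  have h4 := ((SymbolBound.rpow (2 * σ)).mul h3).const_mul (c ^ (2 * σ))
  rw [Nat.cast_zero, add_zero] at h4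
  rw [Nat.cast_one] at h2
  refine ((h2.mono (min_le_left _ _)).add (h4.mono (min_le_right _ _))).congr ?_
  filter_upwards [self_mem_nhdsWithin] with y hy
  have hy : 0 < y := hy
  rw [h (c * y) (by positivity), Real.mul_rpow hc.le hy.le]; ring

theorem natCast_add_ne (M : ℤ) {μ : ℝ} (h0 : 0 < μ) (h1 : μ < 1) (N : ℕ) : (M : ℝ) + μ ≠ N := fun h => by
  have e1 : (M : ℝ) < (N : ℤ) := by push_cast; linarith
  have e2 : ((N : ℤ) : ℝ) < M + 1 := by push_cast; linarith
  norm_cast at e1 e2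
  omega

/-- Decaying solutions of the iterated Helmholtz equation, with prescribed leading exponent. -/
theorem exists_decaying (h0 : 0 < μ) (h1 : μ < 1) (hΛ : 0 < Λ) (N : ℕ) (i : ℕ × Bool)
    (hi : expo μ i < N + μ) :
    ∃ e : ℝ → ℝ, ContDiffOn ℝ ∞ e (Ioi 0) ∧ (∀ y, 0 < y → (helm μ Λ)^[N + 1] e y = 0) ∧
      (∃ ε, 0 < ε ∧ ε ≤ 1 ∧ SymbolBound (expo μ i + ε) fun y => e y - y ^ expo μ i) ∧
      ∀ l M, UnifBound l M fun _ : ℝ => e := by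
  obtain ⟨j, b⟩ := i
  set q := expo μ (j, b) with hq
  have hjN : j ≤ N := by
    have h : 2 * (j : ℝ) ≤ q := by rw [hq, expo]; split_ifs <;> linarith
    have : 2 * (j : ℝ) < N + 1 := by linarith
    norm_cast at this
    omega
  set c := √Λ
  have hc : 0 < c := Real.sqrt_pos.2 hΛ
  have hc2 : c ^ 2 = Λ := Real.sq_sqrt hΛ.le
  set σ := N + μ - q with hσd
  have hσ : 0 < σ := by linarith
  have hσN : ∀ M : ℕ, σ ≠ M := fun M => by
    cases b
    · have := natCast_add_ne (N - 2 * j) h0 h1 M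
      push_cast at this
      rw [hσd, hq, expo]
      simp only [Bool.false_eq_true, if_false]
      intro h; exact this (by linarith)
    · have := natCast_add_ne (N - 2 * j - 1) (μ := 1 - μ) (by linarith) (by linarith) M
      push_cast at this
      rw [hσd, hq, expo]
      simp only [if_true]
      intro h; exact this (by linarith)
  have hs := contDiffOn_besselFun_mul σ hc
  have hW := smoothHalf_of_contDiffOn (n := 0) hs
  have hZ := tangentialOp_smul (n := 0) (-(c ^ 2))
  refine ⟨fun y => y ^ q * besselFun σ (c * y), (contDiffOn_rpow_Ioi q).mul hs, fun y hy => ?_,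
    ⟨min 1 (2 * σ), lt_min one_pos (by positivity), min_le_left _ _, ?_⟩, fun l M => ?_⟩
  · have hp : ((0, y) : HalfCoord 0) ∈ upperHalf 0 := mem_upperHalf.2 hy
    have hg := genLaplacian_iterate_eq_helm (μ := μ) (Λ := c ^ 2) (f := fun y => y ^ q * besselFun σ (c * y)) (N + 1) (0, y)
    rw [← hc2, ← hg]
    cases b
    · have e : (fun p : HalfCoord 0 => p.2 ^ q * besselFun σ (c * p.2)) = fun p => p.2 ^ (2 * j) * besselFun σ (c * p.2) := by
        funext p
        rw [hq, expo, if_neg (by simp), add_zero, ← Real.rpow_natCast]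
        push_cast; rfl
      rw [e]
      refine hZ.iter_pow_mul_eq_zero h0 h1 N j _ hjN hW (fun p hp => ?_) _ hp
      rw [← genLaplacian_besselFun σ hc hp]
      congr 1
      rw [hσd, hq, expo, if_neg (by simp)]; ring
    · have e : EqOn (fun p : HalfCoord 0 => p.2 ^ q * besselFun σ (c * p.2))
          (fun p => p.2 ^ (2 * (N - j)) * (p.2 ^ (-(2 * σ)) * besselFun σ (c * p.2))) (upperHalf 0) := fun p hp => by
        have hy := mem_upperHalf.1 hp
        simp only
        rw [← mul_assoc, ← Real.rpow_natCast, ← Real.rpow_add hy]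
        congr 2
        rw [hσd, hq, expo, if_pos rfl]
        push_cast [Nat.cast_sub hjN]
        ring
      rw [hZ.iter_congr _ (N + 1) e hp]
      refine hZ.iter_pow_mul_eq_zero h0 h1 N (N - j) _ (Nat.sub_le N j)
        (hW.mul_right (contDiffOn_rpow_Ioi _)) (fun p hp => ?_) _ hp
      rw [← hZ.ker_rpow_mul hW (fun p hp => genLaplacian_besselFun σ hc hp) p hp]
      congr 1
      rw [hσd, hq, expo, if_pos rfl]
      push_cast [Nat.cast_sub hjN]
      ring
  · refine ((SymbolBound.rpow q).mul (symbolBound_besselFun hσ hσN hc)).congr ?_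
    exact .of_forall fun y => by ring
  · refine ((unifBound_besselInt (ι := ℝ) l M hc σ q).const_mul (Real.Gamma σ)⁻¹).congr fun _ y _ => ?_
    simp only [besselFun]
    ring

section bracket

variable {f e : ℝ → ℝ}

/-- The Green bracket of the `k`-th iterate of the Helmholtz operator. -/
def greenBracket (μ Λ : ℝ) (k : ℕ) (f e : ℝ → ℝ) (y : ℝ) : ℝ :=
  ∑ i ∈ Finset.range k, y ^ (1 - 2 * μ) * (deriv ((helm μ Λ)^[i] f) y * (helm μ Λ)^[k - 1 - i] e y
    - (helm μ Λ)^[i] f y * deriv ((helm μ Λ)^[k - 1 - i] e) y)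

theorem hasDerivAt_green {y : ℝ} (hy : 0 < y) (hf : ContDiffOn ℝ ∞ f (Ioi 0)) (he : ContDiffOn ℝ ∞ e (Ioi 0)) :
    HasDerivAt (fun y => y ^ (1 - 2 * μ) * (deriv f y * e y - f y * deriv e y))
      (y ^ (1 - 2 * μ) * (helm μ Λ f y * e y - f y * helm μ Λ e y)) y := by
  have d1 : HasDerivAt (fun y : ℝ => y ^ (1 - 2 * μ)) ((1 - 2 * μ) * y ^ (1 - 2 * μ - 1)) y :=
    Real.hasDerivAt_rpow_const (Or.inl hy.ne')
  have df := hf.hasDerivAt_Ioi hy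
  have de := he.hasDerivAt_Ioi hy
  have ddf := hf.deriv_Ioi.hasDerivAt_Ioi hy
  have dde := he.deriv_Ioi.hasDerivAt_Ioi hy
  refine (d1.mul ((ddf.mul de).sub (df.mul dde))).congr_deriv ?_
  have : y ^ (1 - 2 * μ - 1) = y ^ (1 - 2 * μ) * y⁻¹ := by rw [Real.rpow_sub_one hy.ne', div_eq_mul_inv]
  rw [this]
  simp only [helm, besselOp, Pi.sub_apply, Pi.mul_apply]
  ring

theorem hasDerivAt_greenBracket {y : ℝ} (hy : 0 < y) (k : ℕ) (hf : ContDiffOn ℝ ∞ f (Ioi 0)) (he : ContDiffOn ℝ ∞ e (Ioi 0)) :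
    HasDerivAt (greenBracket μ Λ k f e)
      (y ^ (1 - 2 * μ) * ((helm μ Λ)^[k] f y * e y - f y * (helm μ Λ)^[k] e y)) y := by
  have h1 : ∀ i ∈ Finset.range k, HasDerivAt (fun y => y ^ (1 - 2 * μ) * (deriv ((helm μ Λ)^[i] f) y * (helm μ Λ)^[k - 1 - i] e y
      - (helm μ Λ)^[i] f y * deriv ((helm μ Λ)^[k - 1 - i] e) y))
      (y ^ (1 - 2 * μ) * ((helm μ Λ)^[i + 1] f y * (helm μ Λ)^[k - (i + 1)] e y) -
        y ^ (1 - 2 * μ) * ((helm μ Λ)^[i] f y * (helm μ Λ)^[k - i] e y)) y := fun i hi => by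
    refine (hasDerivAt_green (Λ := Λ) hy (hf.helm_iterate μ Λ i) (he.helm_iterate μ Λ (k - 1 - i))).congr_deriv ?_
    have h2 := Finset.mem_range.1 hi
    rw [← iterate_succ_apply' (helm μ Λ), ← iterate_succ_apply' (helm μ Λ),
      show k - 1 - i = k - (i + 1) by omega, show (k - (i + 1)).succ = k - i by omega]
    ring
  refine (HasDerivAt.fun_sum h1).congr_deriv ?_
  rw [Finset.sum_range_sub (fun i => y ^ (1 - 2 * μ) * ((helm μ Λ)^[i] f y * (helm μ Λ)^[k - i] e y))]
  simp only [Nat.sub_self, Nat.sub_zero, Function.iterate_zero, id]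
  ring

theorem greenBracket_congr_nhds {y : ℝ} (k : ℕ) {e' : ℝ → ℝ} (h : e =ᶠ[𝓝 y] e') :
    greenBracket μ Λ k f e y = greenBracket μ Λ k f e' y := by
  refine Finset.sum_congr rfl fun i _ => ?_
  have := helm_iterate_congr_nhds (μ := μ) (Λ := Λ) h (k - 1 - i)
  rw [this.eq_of_nhds, this.deriv_eq]

end bracket

end

section

variable {μ Λ : ℝ} {f e : ℝ → ℝ}

theorem unifBound_translate {h : ℝ → ℝ} (l : ℕ) (hs : ContDiff ℝ ∞ h) (hc : HasCompactSupport (deriv h))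
    (hb : ∃ C, ∀ t, |h t| ≤ C) : UnifBound l 0 fun R t : ℝ => h (R + 1 - t) := by
  have hb' : ∃ C, ∀ R y : ℝ, 1 < y → |h (R + 1 - y)| ≤ C * y ^ (0 : ℝ) := by
    obtain ⟨C, hC⟩ := hb
    exact ⟨C, fun R y _ => by simpa using hC _⟩
  induction l generalizing h with
  | zero => exact hb'
  | succ l ih =>
    have hd : ContDiff ℝ ∞ (deriv h) := (contDiff_infty_iff_deriv.1 hs).2
    have e : ∀ R y : ℝ, HasDerivAt (fun t : ℝ => h (R + 1 - t)) (-deriv h (R + 1 - y)) y := fun R y => by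
      have h1 := (hs.differentiable (by simp) (R + 1 - y)).hasDerivAt
      have h2 : HasDerivAt (fun t : ℝ => R + 1 - t) (-1) y := (hasDerivAt_id y).const_sub _
      exact (h1.comp y h2).congr_deriv (by ring)
    have hbd : ∃ C, ∀ t, |deriv h t| ≤ C := hd.continuous.bounded_above_of_compact_support hc
    refine ⟨hb', fun R y _ => (e R y).differentiableAt, ?_⟩
    refine ((ih hd hc.deriv hbd ?_).const_mul (-1)).congr fun R y _ => ?_
    · obtain ⟨C, hC⟩ := hbd
      exact ⟨C, fun R y _ => by simpa using hC _⟩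
    · rw [(e R y).deriv]; ring

theorem hasCompactSupport_deriv_smoothTransition : HasCompactSupport (deriv Real.smoothTransition) := by
  refine HasCompactSupport.intro (isCompact_Icc (a := (0 : ℝ)) (b := 1)) fun t ht => ?_
  rcases lt_or_ge t 0 with h | h
  · have : Real.smoothTransition =ᶠ[𝓝 t] fun _ => 0 := by
      filter_upwards [gt_mem_nhds h] with s hs using Real.smoothTransition.zero_of_nonpos hs.le
    rw [this.deriv_eq]; simp
  · have h1 : 1 < t := by by_contra! h2; exact ht ⟨h, h2⟩
    have : Real.smoothTransition =ᶠ[𝓝 t] fun _ => 1 := by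
      filter_upwards [lt_mem_nhds h1] with s hs using Real.smoothTransition.one_of_one_le hs.le
    rw [this.deriv_eq]; simp

theorem UnifBound.helm_iterate {ι : Type*} {N : ℝ} {g : ι → ℝ → ℝ} (hg : ∀ l, UnifBound l N g) (i : ℕ) :
    ∀ l, UnifBound l N fun R => (helm μ Λ)^[i] (g R) := by
  induction i with
  | zero => exact hg
  | succ i ih =>
    intro l
    refine (((ih (l + 2)).besselOp (1 - 2 * μ)).add ((ih l).const_mul (-Λ))).congr fun R y _ => ?_
    rw [iterate_succ_apply', helm]
    ring

theorem greenBracket_eq_zero (k : ℕ) (hf : ContDiffOn ℝ ∞ f (Ioi 0)) (he : ContDiffOn ℝ ∞ e (Ioi 0))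
    (hf0 : ∀ y, 0 < y → (helm μ Λ)^[k] f y = 0) (he0 : ∀ y, 0 < y → (helm μ Λ)^[k] e y = 0)
    (hb : ∀ l M, UnifBound l M fun _ : ℝ => e) {M : ℝ} (hM0 : 0 ≤ M)
    (hM : IntegrableOn (fun y => f y ^ 2 * (1 + y) ^ (-M)) (Ioi 1)) {y : ℝ} (hy : 0 < y) :
    greenBracket μ Λ k f e y = 0 := by
  obtain ⟨c, hc⟩ := exists_const_of_hasDerivAt_zero (f := greenBracket μ Λ k f e) fun t ht =>
    (hasDerivAt_greenBracket ht k hf he).congr_deriv (by rw [hf0 t ht, he0 t ht]; ring)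
  rw [hc y hy]
  set ψ : ℝ → ℝ → ℝ := fun R t => Real.smoothTransition (R + 1 - t) with hψ
  have hψs : ∀ R, ContDiff ℝ ∞ (ψ R) := fun R => Real.smoothTransition.contDiff.comp (by fun_prop)
  set E : ℝ → ℝ → ℝ := fun R t => ψ R t * e t with hE
  have hψe : ∀ R, ContDiffOn ℝ ∞ (E R) (Ioi 0) := fun R => (hψs R).contDiffOn.mul he
  set a := (1 - 2 * μ) + M / 2 + 1 with ha
  have hB : UnifBound 0 (-a) fun R => (helm μ Λ)^[k] (E R) := by
    refine UnifBound.helm_iterate (fun l => ?_) k 0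
    have h1 := (unifBound_translate l Real.smoothTransition.contDiff hasCompactSupport_deriv_smoothTransition
      ⟨1, fun t => by
        rw [abs_of_nonneg (Real.smoothTransition.nonneg t)]
        exact Real.smoothTransition.le_one t⟩).mul (hb l (-a))
    rwa [zero_add] at h1
  obtain ⟨C, hC0, hC⟩ := hB.bound_nonneg
  set H : ℝ → ℝ := fun t => f t ^ 2 * (1 + t) ^ (-M) + 2 ^ M * t ^ (-2 : ℝ)
  have hHi : IntegrableOn H (Ioi 1) :=
    hM.add ((integrableOn_Ioi_rpow_of_lt (by norm_num) one_pos).const_mul _)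
  have hHle : ∀ R t, 1 < t → |t ^ (1 - 2 * μ) * (f t * (helm μ Λ)^[k] (E R) t)| ≤ C * H t := by
    intro R t ht
    have ht0 : 0 < t := by linarith
    have h1 := hC R t ht
    rw [abs_mul, abs_mul, abs_of_nonneg (by positivity : 0 ≤ t ^ (1 - 2 * μ))]
    have h2 : t ^ (1 - 2 * μ) * (|f t| * t ^ (-a)) ≤ H t := by
      have e1 : t ^ (1 - 2 * μ) * (|f t| * t ^ (-a)) = |f t| * t ^ (-(M / 2) - 1) := by
        rw [mul_left_comm, ← Real.rpow_add ht0, ha]; ring_nf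
      have hp : 0 < 1 + t := by linarith
      have e2 : t ^ (-(M / 2) - 1) ≤ (1 + t) ^ (-(M / 2)) * (2 ^ (M / 2) * t ^ (-1 : ℝ)) := by
        have h3 : (1 + t) ^ (M / 2) ≤ (2 * t) ^ (M / 2) := Real.rpow_le_rpow hp.le (by linarith) (by positivity)
        rw [Real.mul_rpow (by norm_num) ht0.le] at h3
        rw [sub_eq_add_neg, Real.rpow_add ht0, Real.rpow_neg ht0.le, Real.rpow_neg hp.le, ← mul_assoc]
        gcongr
        rw [inv_mul_eq_div, le_div_iff₀ (by positivity), inv_mul_le_iff₀ (by positivity)]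
        linarith
      rw [e1]
      have e3 : ((1 + t) ^ (-(M / 2))) ^ 2 = (1 + t) ^ (-M) := by
        rw [← Real.rpow_mul_natCast hp.le]; congr 1; push_cast; ring
      have e4 : (2 ^ (M / 2) * t ^ (-1 : ℝ)) ^ 2 = 2 ^ M * t ^ (-2 : ℝ) := by
        rw [mul_pow, ← Real.rpow_mul_natCast (by norm_num), ← Real.rpow_mul_natCast ht0.le]
        congr 2 <;> push_cast <;> ring
      calc |f t| * t ^ (-(M / 2) - 1) ≤ |f t| * ((1 + t) ^ (-(M / 2)) * (2 ^ (M / 2) * t ^ (-1 : ℝ))) := by gcongr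
        _ = (|f t| * (1 + t) ^ (-(M / 2))) * (2 ^ (M / 2) * t ^ (-1 : ℝ)) := by ring
        _ ≤ (|f t| * (1 + t) ^ (-(M / 2))) ^ 2 + (2 ^ (M / 2) * t ^ (-1 : ℝ)) ^ 2 := by
          nlinarith [sq_nonneg ((|f t| * (1 + t) ^ (-(M / 2))) - (2 ^ (M / 2) * t ^ (-1 : ℝ))),
            sq_nonneg (|f t| * (1 + t) ^ (-(M / 2))), sq_nonneg (2 ^ (M / 2) * t ^ (-1 : ℝ))]
        _ = H t := by rw [e4, mul_pow, sq_abs, e3]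
    calc _ ≤ t ^ (1 - 2 * μ) * (|f t| * (C * t ^ (-a))) := by gcongr
      _ = C * (t ^ (1 - 2 * μ) * (|f t| * t ^ (-a))) := by ring
      _ ≤ C * H t := by gcongr
  have key : ∀ R : ℝ, 3 < R → |c| ≤ ∫ t in (R - 1)..(R + 2), C * H t := by
    intro R hR
    have hd : ∀ t ∈ uIcc (R - 1) (R + 2), HasDerivAt (greenBracket μ Λ k f (E R))
        (-(t ^ (1 - 2 * μ) * (f t * (helm μ Λ)^[k] (E R) t))) t := fun t ht => by
      rw [uIcc_of_le (by linarith)] at ht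
      have ht0 : 0 < t := by linarith [ht.1]
      refine (hasDerivAt_greenBracket ht0 k hf (hψe R)).congr_deriv ?_
      rw [hf0 t ht0]; ring
    have hcont : ContinuousOn (fun t => -(t ^ (1 - 2 * μ) * (f t * (helm μ Λ)^[k] (E R) t)))
        (uIcc (R - 1) (R + 2)) := by
      rw [uIcc_of_le (by linarith)]
      have hsub : Icc (R - 1) (R + 2) ⊆ Ioi 0 := fun t ht => by
        have := ht.1
        exact mem_Ioi.2 (by linarith)
      exact (((contDiffOn_rpow_Ioi _).continuousOn.mul (hf.continuousOn.mul
        ((hψe R).helm_iterate μ Λ k).continuousOn)).neg).mono hsub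
    have h1 := intervalIntegral.integral_eq_sub_of_hasDerivAt hd hcont.intervalIntegrable
    have h2 : greenBracket μ Λ k f (E R) (R - 1) = c := by
      rw [← hc (R - 1) (by linarith)]
      refine greenBracket_congr_nhds k ?_
      filter_upwards [gt_mem_nhds (show R - 1 < R by linarith)] with t ht
      simp only [hE, hψ]
      rw [Real.smoothTransition.one_of_one_le (by linarith), one_mul]
    have h3 : greenBracket μ Λ k f (E R) (R + 2) = 0 := by
      have h4 : greenBracket μ Λ k f (E R) (R + 2) = greenBracket μ Λ k f (fun _ => 0) (R + 2) := by
        refine greenBracket_congr_nhds k ?_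
        filter_upwards [lt_mem_nhds (show R + 1 < R + 2 by linarith)] with t ht
        simp only [hE, hψ]
        rw [Real.smoothTransition.zero_of_nonpos (by linarith), zero_mul]
      have h5 : ∀ i, (helm μ Λ)^[i] (fun _ => 0) = fun _ => 0 := fun i => by
        induction i with
        | zero => rfl
        | succ i ih =>
          rw [iterate_succ_apply', ih]; funext t; simp [helm, besselOp]
      rw [h4]
      simp [greenBracket, h5]
    rw [h2, h3, zero_sub] at h1
    rw [← abs_neg, ← h1, ← Real.norm_eq_abs]
    refine intervalIntegral.norm_integral_le_of_norm_le (by linarith) (.of_forall fun t ht => ?_) ?_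
    · rw [norm_neg]
      exact hHle R t (by linarith [ht.1])
    · refine IntegrableOn.intervalIntegrable ?_
      rw [uIcc_of_le (by linarith)]
      exact (hHi.mono_set fun t ht => mem_Ioi.2 (by linarith [ht.1])).const_mul C
  have hlim := intervalIntegral_tendsto_integral_Ioi 1 (hHi.const_mul C) tendsto_id
  have hl1 := hlim.comp (tendsto_atTop_add_const_right _ 2 tendsto_id)
  have hl2 := hlim.comp (tendsto_atTop_add_const_right _ (-1) tendsto_id)
  have hl := hl1.sub hl2
  rw [sub_self] at hl
  have hle : |c| ≤ 0 := by
    refine ge_of_tendsto hl ?_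
    filter_upwards [eventually_gt_atTop 3] with R hR
    refine (key R hR).trans (le_of_eq ?_)
    have hii : ∀ b, 1 < b → IntervalIntegrable (fun t => C * H t) volume 1 b := fun b hb' => by
      rw [intervalIntegrable_iff_integrableOn_Ioc_of_le hb'.le]
      exact (hHi.mono_set fun t ht => ht.1).const_mul C
    simp only [Function.comp, id]
    rw [intervalIntegral.integral_interval_sub_left (hii _ (by linarith)) (hii _ (by linarith))]
    rfl
  exact abs_nonpos_iff.1 hle

end

section

variable {μ Λ : ℝ} {f e : ℝ → ℝ}

theorem SymbolBound.tendsto_leading {a s ε : ℝ} (hε : 0 < ε) (h : SymbolBound (s + ε) fun y => f y - a * y ^ s) :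
    Tendsto (fun y => y ^ (-s) * f y) (𝓝[>] 0) (𝓝 a) ∧
      Tendsto (fun y => y ^ (1 - s) * _root_.deriv f y) (𝓝[>] 0) (𝓝 (a * s)) := by
  have key : ∀ (t r : ℝ) (F g : ℝ → ℝ) (b : ℝ), SymbolBound r g → 0 < r - t →
      (∀ᶠ y in 𝓝[>] (0 : ℝ), F y = g y + b * y ^ t) → Tendsto (fun y => y ^ (-t) * F y) (𝓝[>] 0) (𝓝 b) := by
    intro t r F g b hg hr hF
    have h1 := (((SymbolBound.rpow (-t)).mul hg).tendsto (by linarith)).add_const b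
    rw [zero_add] at h1
    refine h1.congr' ?_
    filter_upwards [hF, self_mem_nhdsWithin] with y hy hy0
    have hy0 : 0 < y := hy0
    rw [hy, mul_add, mul_left_comm, ← Real.rpow_add hy0, neg_add_cancel, Real.rpow_zero, mul_one]
  refine ⟨key s (s + ε) f _ a h (by linarith) (.of_forall fun y => by ring), ?_⟩
  have h2 := key (s - 1) (s + ε - 1) (_root_.deriv f) _ (a * s) h.deriv (by linarith) ?_
  · simpa only [neg_sub] using h2
  · filter_upwards [h.differentiableAt, self_mem_nhdsWithin] with y hd hy0
    have d1 := (Real.hasDerivAt_rpow_const (p := s) (Or.inl (ne_of_gt (mem_Ioi.1 hy0)))).const_mul a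
    have d2 := hd.hasDerivAt.add d1
    have e1 : ((fun y => f y - a * y ^ s) + fun y => a * y ^ s) = f := by funext z; simp
    rw [e1] at d2
    rw [d2.deriv]; ring

theorem SymbolBound.helm {r : ℝ} (h : SymbolBound r f) (μ Λ : ℝ) : SymbolBound (r - 2) (helm μ Λ f) :=
  (h.besselOp _).sub ((h.mono (by linarith)).const_mul Λ)

theorem symbolBound_helm_sub {a s ε : ℝ} (hε : ε ≤ 1) (h : SymbolBound (s + ε) fun y => f y - a * y ^ s) :
    SymbolBound (s - 2 + ε) fun y => helm μ Λ f y - a * (s * (s - 2 * μ)) * y ^ (s - 2) := by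
  have h1 := h.helm μ Λ
  have h2 : SymbolBound (s - 2 + ε) fun y => -(Λ * a) * y ^ s :=
    ((SymbolBound.rpow s).mono (by linarith)).const_mul _
  rw [show s + ε - 2 = s - 2 + ε by ring] at h1
  refine (h1.add h2).congr ?_
  have h3 := besselOp_add (1 - 2 * μ) h ((SymbolBound.rpow s).const_mul a)
  have e1 : (fun y => f y - a * y ^ s + a * y ^ s) = f := by funext z; ring
  rw [e1] at h3
  filter_upwards [h3, self_mem_nhdsWithin] with y hy hy0
  rw [besselOp_const_mul_field] at hy
  simp only [besselOp_rpow μ s (mem_Ioi.1 hy0)] at hy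
  simp only [helm, hy]
  ring

theorem symbolBound_helm_iterate_sub {a s ε : ℝ} (hε : ε ≤ 1) (h : SymbolBound (s + ε) fun y => f y - a * y ^ s) (i : ℕ) :
    SymbolBound (s - 2 * i + ε) fun y => (helm μ Λ)^[i] f y - a * powFactor μ s i * y ^ (s - 2 * i) := by
  induction i with
  | zero => simpa [powFactor] using h
  | succ i ih =>
    have h1 := symbolBound_helm_sub (μ := μ) (Λ := Λ) hε ih
    rw [iterate_succ_apply', powFactor, Finset.prod_range_succ]
    push_cast
    rw [show s - 2 * ((i : ℝ) + 1) = s - 2 * i - 2 by ring]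
    simpa only [powFactor, mul_assoc] using h1

theorem tendsto_greenBracket {a s b t ε δ : ℝ} (hε : 0 < ε) (hε1 : ε ≤ 1) (hδ : 0 < δ) (hδ1 : δ ≤ 1)
    (hf : SymbolBound (s + ε) fun y => f y - a * y ^ s) (he : SymbolBound (t + δ) fun y => e y - b * y ^ t)
    (N : ℕ) (hst : s + t = 2 * (N + μ)) :
    Tendsto (greenBracket μ Λ (N + 1) f e) (𝓝[>] 0) (𝓝 (∑ i ∈ Finset.range (N + 1),
      a * b * (powFactor μ s i * powFactor μ t (N - i) * (s - 2 * i - (t - 2 * (N - i : ℕ)))))) := by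
  refine tendsto_finsetSum _ fun i hi => ?_
  have hiN : i ≤ N := Nat.lt_succ_iff.1 (Finset.mem_range.1 hi)
  obtain ⟨h1, h2⟩ := SymbolBound.tendsto_leading hε (symbolBound_helm_iterate_sub (μ := μ) (Λ := Λ) hε1 hf i)
  obtain ⟨h3, h4⟩ := SymbolBound.tendsto_leading hδ (symbolBound_helm_iterate_sub (μ := μ) (Λ := Λ) hδ1 he (N - i))
  have h5 := (h2.mul h3).sub (h1.mul h4)
  rw [show a * b * (powFactor μ s i * powFactor μ t (N - i) * (s - 2 * i - (t - 2 * (N - i : ℕ))))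
    = a * powFactor μ s i * (s - 2 * i) * (b * powFactor μ t (N - i))
      - a * powFactor μ s i * (b * powFactor μ t (N - i) * (t - 2 * (N - i : ℕ))) by ring]
  refine h5.congr' ?_
  filter_upwards [self_mem_nhdsWithin] with y hy0
  have hy0 : 0 < y := hy0
  rw [Nat.add_sub_cancel]
  have e1 : y ^ (1 - (s - 2 * i)) * y ^ (-(t - 2 * (N - i : ℕ))) = y ^ (1 - 2 * μ) := by
    rw [← Real.rpow_add hy0]
    congr 1
    rw [Nat.cast_sub hiN]; linarith
  have e2 : y ^ (-(s - 2 * i)) * y ^ (1 - (t - 2 * (N - i : ℕ))) = y ^ (1 - 2 * μ) := by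
    rw [← Real.rpow_add hy0]
    congr 1
    rw [Nat.cast_sub hiN]; linarith
  linear_combination deriv ((helm μ Λ)^[i] f) y * (helm μ Λ)^[N - i] e y * e1
    - (helm μ Λ)^[i] f y * deriv ((helm μ Λ)^[N - i] e) y * e2

theorem powFactor_ne_zero {q : ℝ} {i : ℕ} (h : ∀ l < i, q ≠ 2 * l ∧ q ≠ 2 * l + 2 * μ) : powFactor μ q i ≠ 0 :=
  Finset.prod_ne_zero_iff.2 fun l hl => by
    obtain ⟨h1, h2⟩ := h l (Finset.mem_range.1 hl)
    exact mul_ne_zero (sub_ne_zero.2 h1) fun h3 => h2 (by linarith)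

/-- The exponent dual to `expo μ i` with respect to the bracket. -/
theorem expo_dual (μ : ℝ) {N a : ℕ} (ha : a ≤ N) (b : Bool) :
    expo μ (a, b) + expo μ (N - a, !b) = 2 * (N + μ) := by
  cases b <;> simp [expo, Nat.cast_sub ha] <;> ring

theorem sum_powFactor_ne_zero (h0 : 0 < μ) (h1 : μ < 1) {N a : ℕ} (ha : a ≤ N) (b : Bool) {v : ℝ} (hv : v ≠ 0) :
    ∑ i ∈ Finset.range (N + 1), v * 1 * (powFactor μ (expo μ (a, b)) i * powFactor μ (expo μ (N - a, !b)) (N - i)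
      * (expo μ (a, b) - 2 * i - (expo μ (N - a, !b) - 2 * (N - i : ℕ)))) ≠ 0 := by
  have hne : ∀ (a : ℕ) (b : Bool), powFactor μ (expo μ (a, b)) a ≠ 0 := fun a b =>
    powFactor_ne_zero fun l hl => by
      have e1 : expo μ (l, false) = 2 * l := by simp [expo]
      have e2 : expo μ (l, true) = 2 * l + 2 * μ := by simp [expo]
      rw [← e2, ← e1]
      constructor <;> intro h <;> have := congrArg Prod.fst (expo_injective h0 h1 h) <;> simp only at this <;> omega
  rw [Finset.sum_eq_single a]
  · refine mul_ne_zero (by simpa using hv) (mul_ne_zero (mul_ne_zero (hne a b) (hne (N - a) (!b))) ?_)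
    cases b <;> simp [expo] <;> exact h0.ne'
  · intro i hi hia
    have := Finset.mem_range.1 hi
    rcases lt_or_gt_of_ne hia with h | h
    · rw [powFactor_expo μ (j := (N - a, !b)) (i := N - i) (by simp only; omega)]; ring
    · rw [powFactor_expo μ (j := (a, b)) h]; ring
  · intro h; exact absurd (Finset.mem_range.2 (by omega)) h

/-- A combination of the growing solutions with exponents above `N + μ` that has polynomial growth
in the mean is trivial. -/
theorem eq_zero_of_sum_solPow (h0 : 0 < μ) (h1 : μ < 1) (hΛ : 0 < Λ) (N : ℕ) {v : ℕ × Bool → ℝ} {M : ℝ} (hM0 : 0 ≤ M)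
    (hM : IntegrableOn (fun y => (∑ i ∈ expoAbove μ (N + μ) (N + 1), v i * solPow μ (expo μ i) (N + 1) Λ y) ^ 2
      * (1 + y) ^ (-M)) (Ioi 1)) : ∀ i ∈ expoAbove μ (N + μ) (N + 1), v i = 0 := by
  by_contra! hcon
  obtain ⟨i0, hi0, hv0⟩ := hcon
  set A := expoAbove μ (N + μ) (N + 1) with hA
  obtain ⟨i, hi, hmin⟩ := Finset.exists_min_image (A.filter fun i => v i ≠ 0) (expo μ) ⟨i0, Finset.mem_filter.2 ⟨hi0, hv0⟩⟩
  obtain ⟨hiA, hvi⟩ := Finset.mem_filter.1 hi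
  have hq : ∀ i, 0 ≤ expo μ i := fun i => by
    unfold expo; split_ifs <;> positivity
  have hAm : ∀ j ∈ A, j.1 ≤ N ∧ N + μ < expo μ j := fun j hj => by
    simp only [hA, expoAbove, Finset.mem_filter, Finset.mem_product, Finset.mem_range] at hj
    exact ⟨by omega, hj.2⟩
  set f := fun y => ∑ i ∈ A, v i * solPow μ (expo μ i) (N + 1) Λ y
  have hk : ∀ j ∈ A, ∀ y, 0 < y → (helm μ Λ)^[N + 1] (solPow μ (expo μ j) (N + 1) Λ) y = 0 := fun j hj y hy =>
    helm_iterate_solPow h1 (hq j) h0 (powFactor_expo μ (by have := (hAm j hj).1; omega)) hΛ.le hy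
  have hfs : ContDiffOn ℝ ∞ f (Ioi 0) :=
    ContDiffOn.sum fun j _ => contDiffOn_const.mul (contDiffOn_solPow h1 (hq j) _ Λ)
  have hfk : ∀ y, 0 < y → (helm μ Λ)^[N + 1] f y = 0 := by
    intro y hy
    have hZ := tangentialOp_smul (n := 0) (-Λ)
    have hp : ((0, y) : HalfCoord 0) ∈ upperHalf 0 := mem_upperHalf.2 hy
    have e1 := genLaplacian_iterate_eq_helm (μ := μ) (Λ := Λ) (f := f) (N + 1) (0, y)
    have e2 := (hZ.iter_sum (1 - 2 * μ) (N + 1) A v (f := fun j p => solPow μ (expo μ j) (N + 1) Λ p.2)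
      fun j _ => smoothHalf_of_contDiffOn (contDiffOn_solPow h1 (hq j) _ Λ)).2 hp
    rw [← e1]
    refine Eq.trans e2 (Finset.sum_eq_zero fun j hj => ?_)
    rw [genLaplacian_iterate_eq_helm, hk j hj y hy, mul_zero]
  obtain ⟨ha, hab⟩ := hAm i hiA
  have hdual := expo_dual μ ha i.2
  obtain ⟨e, hes, hek, ⟨δ, hδ, hδ1, heδ⟩, heb⟩ := exists_decaying h0 h1 hΛ N (N - i.1, !i.2) (by
    have : expo μ i = expo μ (i.1, i.2) := rfl
    linarith)
  obtain ⟨ε, hε, hε1, hsf⟩ : ∃ ε, 0 < ε ∧ ε ≤ 1 ∧ SymbolBound (expo μ i + ε) fun y => f y - v i * y ^ expo μ i := by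
    have hex : ∃ ε, 0 < ε ∧ ε ≤ 1 ∧ ∀ j ∈ A, j ≠ i → v j ≠ 0 → expo μ i + ε ≤ expo μ j := by
      have h2 : ∀ j ∈ A, ∃ ε, 0 < ε ∧ (j ≠ i → v j ≠ 0 → expo μ i + ε ≤ expo μ j) := fun j hj => by
        by_cases hji : j ≠ i ∧ v j ≠ 0
        · have h3 := hmin j (Finset.mem_filter.2 ⟨hj, hji.2⟩)
          have h4 : expo μ i < expo μ j := lt_of_le_of_ne h3 fun h => hji.1 (expo_injective h0 h1 h.symm)
          exact ⟨expo μ j - expo μ i, by linarith, fun _ _ => by linarith⟩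
        · exact ⟨1, one_pos, fun h3 h4 => absurd ⟨h3, h4⟩ hji⟩
      choose! w hw hw2 using h2
      obtain ⟨j, hj, hjm⟩ := Finset.exists_min_image A w ⟨i, hiA⟩
      exact ⟨min (w j) 1, lt_min (hw j hj) one_pos, min_le_right _ _, fun l hl hli hvl =>
        le_trans (by gcongr; exact (min_le_left _ _).trans (hjm l hl)) (hw2 l hl hli hvl)⟩
    obtain ⟨ε, hε, hε1, hεA⟩ := hex
    refine ⟨ε, hε, hε1, ?_⟩
    have h2 : ∀ j ∈ A, SymbolBound (expo μ i + ε) fun y =>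
        v j * solPow μ (expo μ j) (N + 1) Λ y - if j = i then v i * y ^ expo μ i else 0 := fun j hj => by
      have h3 := symbolBound_solPow h1 (hq j) (N + 1) Λ
      by_cases hji : j = i
      · subst hji
        simp only [if_true]
        refine ((h3.mono (by linarith)).const_mul (v j)).congr (.of_forall fun y => by ring)
      · by_cases hvj : v j = 0
        · simpa [hvj, hji] using (SymbolBound.zero_fun (r := expo μ i + ε))
        · have h4 := hεA j hj hji hvj
          have h5 := (((h3.mono (s := expo μ j) (by linarith)).add (SymbolBound.rpow _)).mono h4).const_mul (v j)
          exact h5.congr (.of_forall fun y => by simp [hji])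
    refine (SymbolBound.sum A h2).congr (.of_forall fun y => ?_)
    simp only
    rw [Finset.sum_sub_distrib, Finset.sum_ite_eq' A i, if_pos hiA]
  have hlim := tendsto_greenBracket (μ := μ) (Λ := Λ) (b := 1) hε hε1 hδ hδ1 hsf (by simpa only [one_mul] using heδ) N hdual
  have hz : Tendsto (greenBracket μ Λ (N + 1) f e) (𝓝[>] 0) (𝓝 0) := by
    refine tendsto_const_nhds.congr' ?_
    filter_upwards [self_mem_nhdsWithin] with y hy
    exact (greenBracket_eq_zero (N + 1) hfs hes hfk hek heb hM0 hM hy).symm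
  exact sum_powFactor_ne_zero h0 h1 ha i.2 hvi (tendsto_nhds_unique hlim hz)

end

section

variable {n : ℕ} {g : Bdry n → ℝ}

/-- The symbol of minus the Laplacian. -/
def freqSq (ξ : Bdry n) : ℝ := (2 * Real.pi * ‖ξ‖) ^ 2

theorem freqSq_nonneg (ξ : Bdry n) : 0 ≤ freqSq ξ := sq_nonneg _

theorem continuous_freqSq : Continuous (freqSq : Bdry n → ℝ) := by unfold freqSq; fun_prop

/-- A test function as a complex valued Schwartz function. -/
def cxTest (hg : IsTest g) : 𝓢(Bdry n, ℂ) :=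
  HasCompactSupport.toSchwartzMap (f := fun x => (g x : ℂ))
    (hg.supp.comp_left (g := fun r : ℝ => (r : ℂ)) Complex.ofReal_zero)
    (Complex.ofRealCLM.contDiff.comp hg.smooth)

theorem cxTest_apply (hg : IsTest g) (x : Bdry n) : cxTest hg x = g x := rfl

theorem fourier_cxTest_negLap (hg : IsTest g) (ξ : Bdry n) :
    𝓕 (cxTest hg.negLap) ξ = freqSq ξ * 𝓕 (cxTest hg) ξ := by
  have e : cxTest hg.negLap = -laplacian (cxTest hg) := by
    ext x
    rw [_root_.neg_apply, SchwartzMap.laplacian_apply, cxTest_apply, negLap]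
    have h1 := ((contDiff_infty.1 hg.smooth 2).contDiffAt (x := x)).laplacian_CLM_comp_left (l := Complex.ofRealCLM)
    have h2 : (cxTest hg : Bdry n → ℂ) = Complex.ofRealCLM ∘ g := rfl
    rw [h2, h1]
    simp
  have ht : (fun x : Bdry n => ‖x‖ ^ 2).HasTemperateGrowth := by fun_prop
  rw [e, SchwartzMap.laplacian_eq_fourierMultiplierCLM, SchwartzMap.fourierMultiplierCLM_apply]
  rw [FourierTransform.fourier_neg, FourierTransform.fourier_smul, FourierTransform.fourier_fourierInv_eq]
  simp only [_root_.neg_apply, _root_.smul_apply]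
  rw [SchwartzMap.smulLeftCLM_apply_apply (by exact ht)]
  simp only [freqSq, Complex.real_smul]
  push_cast
  ring

theorem fourier_cxTest_negLap_iterate (hg : IsTest g) (l : ℕ) (ξ : Bdry n) :
    𝓕 (cxTest (hg.negLap_iterate l)) ξ = freqSq ξ ^ l * 𝓕 (cxTest hg) ξ := by
  induction l with
  | zero => simp
  | succ l ih =>
    have h : cxTest (hg.negLap_iterate (l + 1)) = cxTest (hg.negLap_iterate l).negLap := by
      ext x; simp only [cxTest_apply, iterate_succ_apply']
    rw [h, fourier_cxTest_negLap (hg.negLap_iterate l), ih]; ring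

theorem exists_fourier_cxTest_eq (hg : IsTest g) (k : ℕ) :
    ∃ (g' : Bdry n → ℝ) (hg' : IsTest g'), ∀ ξ, 𝓕 (cxTest hg') ξ = (1 + freqSq ξ : ℝ) ^ k * 𝓕 (cxTest hg) ξ := by
  induction k with
  | zero => exact ⟨g, hg, fun ξ => by simp⟩
  | succ k ih =>
    obtain ⟨g', hg', h⟩ := ih
    have ht : IsTest fun x => g' x + negLap g' x := ⟨hg'.smooth.add hg'.negLap.smooth, hg'.supp.add hg'.negLap.supp⟩
    refine ⟨_, ht, fun ξ => ?_⟩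
    have e : cxTest ht = cxTest hg' + cxTest hg'.negLap := by
      ext x; simp [cxTest_apply]
    rw [e, FourierTransform.fourier_add, _root_.add_apply, fourier_cxTest_negLap hg', h]
    push_cast
    ring

theorem IsTest.translate (hg : IsTest g) (a : Bdry n) : IsTest fun x => g (x + a) :=
  ⟨hg.smooth.comp (by fun_prop), hg.supp.comp_homeomorph (Homeomorph.addRight a)⟩

theorem fourier_cxTest_translate (hg : IsTest g) (a ξ : Bdry n) :
    𝓕 (cxTest (hg.translate a)) ξ = (Real.fourierChar (inner ℝ a ξ) : ℂ) * 𝓕 (cxTest hg) ξ := by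
  have h := congrFun (VectorFourier.fourierIntegral_comp_add_right Real.fourierChar volume (innerₗ (Bdry n))
    (cxTest hg : Bdry n → ℂ) a) ξ
  rw [Circle.smul_def, smul_eq_mul] at h
  exact h

/-- For every ball there is a test function whose Fourier transform does not vanish on it. -/
theorem exists_fourier_ne_zero (n : ℕ) (r : ℝ) : ∃ (g : Bdry n → ℝ) (hg : IsTest g),
    ∀ ξ, ‖ξ‖ ≤ r → 𝓕 (cxTest hg) ξ ≠ 0 := by
  set ε : ℝ := (8 * Real.pi * (|r| + 1))⁻¹ with hε
  have hε0 : 0 < ε := by positivity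
  set b : ContDiffBump (0 : Bdry n) := ⟨ε / 2, ε, by positivity, by linarith⟩
  have hg : IsTest b := ⟨b.contDiff, b.hasCompactSupport⟩
  refine ⟨b, hg, fun ξ hξ h0 => ?_⟩
  have hpos : 0 < ∫ x, b x := b.integral_pos
  have hint : Integrable fun x => ((b x : ℝ) : ℂ) := b.integrable.ofReal
  have h1 : 𝓕 (cxTest hg) ξ = ∫ x, Complex.exp ((↑(-2 * Real.pi * inner ℝ x ξ) * Complex.I)) • (b x : ℂ) :=
    Real.fourier_eq' _ ξ
  have h2 : ‖∫ x, (Complex.exp ((↑(-2 * Real.pi * inner ℝ x ξ) * Complex.I)) • (b x : ℂ) - (b x : ℂ))‖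
      ≤ ∫ x, 1 / 2 * b x := by
    refine norm_integral_le_of_norm_le (b.integrable.const_mul _) (.of_forall fun x => ?_)
    rw [smul_eq_mul, ← sub_one_mul, norm_mul, Complex.norm_real, Real.norm_of_nonneg b.nonneg]
    by_cases hx : x ∈ Metric.ball (0 : Bdry n) ε
    · refine mul_le_mul_of_nonneg_right ?_ b.nonneg
      rw [mul_comm _ Complex.I]
      refine Real.norm_exp_I_mul_ofReal_sub_one_le.trans ?_
      have hx' : ‖x‖ ≤ ε := (mem_ball_zero_iff.1 hx).le
      rw [norm_mul, norm_mul, norm_neg, Real.norm_ofNat, Real.norm_of_nonneg Real.pi_pos.le]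
      have h3 : ‖inner ℝ x ξ‖ ≤ ε * (|r| + 1) := (norm_inner_le_norm x ξ).trans
        (mul_le_mul hx' (hξ.trans (by linarith [le_abs_self r])) (norm_nonneg _) hε0.le)
      have h4 : ε * (|r| + 1) = (8 * Real.pi)⁻¹ := by rw [hε, mul_inv]; field_simp
      calc 2 * Real.pi * ‖inner ℝ x ξ‖ ≤ 2 * Real.pi * (8 * Real.pi)⁻¹ := by rw [← h4]; gcongr
        _ = 1 / 4 := by field_simp; norm_num
        _ ≤ 1 / 2 := by norm_num
    · have : b x = 0 := by
        have h5 := b.support_eq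
        by_contra h6
        exact hx (h5 ▸ (Function.mem_support.2 h6))
      simp [this]
  rw [integral_sub ?_ hint, ← h1, h0, zero_sub, norm_neg, integral_complex_ofReal, Complex.norm_real,
    Real.norm_of_nonneg hpos.le, integral_const_mul] at h2
  · linarith
  · refine hint.bdd_mul (c := 1) ?_ (.of_forall fun x => ?_)
    · exact (Continuous.aestronglyMeasurable (by fun_prop))
    · rw [Complex.norm_exp_ofReal_mul_I]

/-- The transforms of `(1 - Δ)^k g`, for test functions `g`. -/
def transTests (n k : ℕ) : Set (Lp ℂ 2 (volume : Measure (Bdry n))) :=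
  {h | ∃ (g : Bdry n → ℝ) (hg : IsTest g), ∀ᵐ ξ, h ξ = (1 + freqSq ξ : ℝ) ^ k * 𝓕 (cxTest hg) ξ}

theorem exists_mem_transTests (hg : IsTest g) (k : ℕ) : ∃ h ∈ transTests n k,
    ∀ᵐ ξ, h ξ = (1 + freqSq ξ : ℝ) ^ k * 𝓕 (cxTest hg) ξ := by
  obtain ⟨g', hg', h⟩ := exists_fourier_cxTest_eq hg k
  have h2 : ∀ᵐ ξ, ((𝓕 (cxTest hg')).toLp 2 volume) ξ = (1 + freqSq ξ : ℝ) ^ k * 𝓕 (cxTest hg) ξ := by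
    filter_upwards [SchwartzMap.coeFn_toLp (𝓕 (cxTest hg')) 2 volume] with ξ hξ
    rw [hξ, h]
  exact ⟨_, ⟨g, hg, h2⟩, h2⟩

theorem ae_eq_zero_of_fourier_eq_zero {H : Bdry n → ℂ} (hH : Integrable H) (h0 : ∀ a, 𝓕 H a = 0) :
    ∀ᵐ ξ, H ξ = 0 := by
  refine ae_eq_zero_of_integral_contDiff_smul_eq_zero hH.locallyIntegrable fun g hg hgs => ?_
  set G := cxTest ⟨hg, hgs⟩
  have h1 := VectorFourier.integral_fourierIntegral_smul_eq_flip (μ := volume) (ν := volume)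
    (L := innerₗ (Bdry n)) Real.continuous_fourierChar continuous_inner hH (𝓕⁻ G).integrable
  have h2 : ∀ ξ, VectorFourier.fourierIntegral Real.fourierChar volume (innerₗ (Bdry n)) H ξ = 0 := h0
  simp only [h2, zero_smul, integral_zero] at h1
  have h3 : ∀ x, VectorFourier.fourierIntegral Real.fourierChar volume (innerₗ (Bdry n)).flip (𝓕⁻ G : 𝓢(Bdry n, ℂ)) x = g x := by
    intro x
    have h4 : (𝓕 (𝓕⁻ G : 𝓢(Bdry n, ℂ)) : 𝓢(Bdry n, ℂ)) x = g x := by rw [FourierTransform.fourier_fourierInv_eq]; rfl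
    rw [← h4, flip_innerₗ]; rfl
  simp only [h3] at h1
  rw [h1]
  exact integral_congr_ae (.of_forall fun x => by simp only [smul_eq_mul, Complex.real_smul, mul_comm])

theorem dense_transTests (n k : ℕ) : Dense (Submodule.span ℂ (transTests n k) : Set (Lp ℂ 2 (volume : Measure (Bdry n)))) := by
  rw [Submodule.dense_iff_topologicalClosure_eq_top, Submodule.topologicalClosure_eq_top_iff, Submodule.eq_bot_iff]
  intro h hh
  rw [Submodule.mem_orthogonal] at hh
  have key : ∀ r : ℕ, ∀ᵐ ξ, ‖ξ‖ ≤ r → h ξ = 0 := by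
    intro r
    obtain ⟨g, hg, hne⟩ := exists_fourier_ne_zero n r
    obtain ⟨t, htm, ht⟩ := exists_mem_transTests hg k
    have hi : Integrable fun ξ => inner ℂ (t ξ) (h ξ) := L2.integrable_inner t h
    have hz := ae_eq_zero_of_fourier_eq_zero hi fun a => by
      obtain ⟨s, hsm, hs⟩ := exists_mem_transTests (hg.translate a) k
      have h1 := hh s (Submodule.subset_span hsm)
      rw [L2.inner_def] at h1
      rw [Real.fourier_eq, ← h1]
      refine integral_congr_ae ?_
      filter_upwards [ht, hs] with ξ h2 h3
      rw [h2, h3, fourier_cxTest_translate hg, Circle.smul_def, AddChar.map_neg_eq_inv, Circle.coe_inv_eq_conj,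
        real_inner_comm a ξ]
      simp only [RCLike.inner_apply, map_mul, smul_eq_mul]
      ring
    filter_upwards [hz, ht] with ξ h1 h2 h3
    rw [RCLike.inner_apply, mul_eq_zero, map_eq_zero, h2] at h1
    refine h1.resolve_right (mul_ne_zero (pow_ne_zero _ ?_) (hne ξ h3))
    have := freqSq_nonneg ξ
    exact_mod_cast (by positivity : 0 < 1 + freqSq ξ).ne'
  rw [Lp.eq_zero_iff_ae_eq_zero]
  filter_upwards [ae_all_iff.2 key] with ξ hξ
  obtain ⟨r, hr⟩ := exists_nat_ge ‖ξ‖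
  exact hξ r hr

end

section

variable {n : ℕ}

/-- The slices of `D`, as complex valued square integrable functions. -/
def sliceLp (D : HalfCoord n → ℝ) (y : ℝ) : Lp ℂ 2 (volume : Measure (Bdry n)) :=
  open scoped Classical in if h : MemLp (fun x => (D (x, y) : ℂ)) 2 volume then h.toLp else 0

theorem coeFn_sliceLp {D : HalfCoord n → ℝ} (hD : ModerateGrowth D) {y : ℝ} (hy : 0 < y) :
    sliceLp D y =ᵐ[volume] fun x => (D (x, y) : ℂ) := by
  obtain ⟨C, N, h⟩ := hD
  have h2 : MemLp (fun x => (D (x, y) : ℂ)) 2 volume := (h y hy).1.ofReal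
  rw [sliceLp, dif_pos h2]
  exact h2.coeFn_toLp

theorem exists_norm_sliceLp_le {D : HalfCoord n → ℝ} (hD : ModerateGrowth D) :
    ∃ (C : ℝ) (N : ℕ), 0 ≤ C ∧ ∀ y, 0 < y → ‖sliceLp D y‖ ≤ C * (1 + y) ^ N := by
  have h3 := fun (y : ℝ) (hy : 0 < y) => coeFn_sliceLp hD hy
  obtain ⟨C, N, hC, h⟩ := hD.exists_toReal_le
  refine ⟨C, N, hC, fun y hy => ?_⟩
  rw [Lp.norm_def, eLpNorm_congr_ae (h3 y hy),
    eLpNorm_congr_norm_ae (g := fun x => D (x, y)) (.of_forall fun x => by simp)]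
  exact (h y hy).2

/-- Multiplication of a square integrable function by a bounded function. -/
def mulLp (m : Bdry n → ℝ) (F : Lp ℂ 2 (volume : Measure (Bdry n))) : Lp ℂ 2 (volume : Measure (Bdry n)) :=
  open scoped Classical in if h : MemLp (fun ξ => (m ξ : ℂ) * F ξ) 2 volume then h.toLp else 0

section

variable {m : Bdry n → ℝ} (hm : Measurable m) {C : ℝ} (hb : ∀ ξ, |m ξ| ≤ C) (F : Lp ℂ 2 (volume : Measure (Bdry n)))
include hm hb

theorem coeFn_mulLp : mulLp m F =ᵐ[volume] fun ξ => (m ξ : ℂ) * F ξ := by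
  have h2 : MemLp (fun ξ => (m ξ : ℂ) * F ξ) 2 volume := by
    refine MemLp.of_le_mul (c := C) (Lp.memLp F) ?_ (.of_forall fun ξ => ?_)
    · exact (Complex.measurable_ofReal.comp hm).aestronglyMeasurable.mul (Lp.aestronglyMeasurable F)
    · rw [norm_mul, Complex.norm_real]
      exact mul_le_mul_of_nonneg_right (hb ξ) (norm_nonneg _)
  rw [mulLp, dif_pos h2]
  exact h2.coeFn_toLp

theorem norm_mulLp_le : ‖mulLp m F‖ ≤ C * ‖F‖ := by
  refine Lp.norm_le_mul_norm_of_ae_le_mul ?_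
  filter_upwards [coeFn_mulLp hm hb F] with ξ hξ
  rw [hξ, norm_mul, Complex.norm_real]
  exact mul_le_mul_of_nonneg_right (hb ξ) (norm_nonneg _)

end

/-- The multipliers `λ ^ min l k / (1 + λ) ^ k`. -/
def specMul (k l : ℕ) (ξ : Bdry n) : ℝ := freqSq ξ ^ min l k / (1 + freqSq ξ) ^ k

theorem measurable_specMul (k l : ℕ) : Measurable (specMul k l : Bdry n → ℝ) :=
  (continuous_freqSq.measurable.pow_const _).div ((continuous_freqSq.measurable.const_add 1).pow_const k)

theorem abs_specMul_le (k l : ℕ) (ξ : Bdry n) : |specMul k l ξ| ≤ 1 := by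
  have h := freqSq_nonneg ξ
  rw [specMul, abs_of_nonneg (by positivity)]
  refine div_le_one_of_le₀ ?_ (by positivity)
  calc freqSq ξ ^ min l k ≤ (1 + freqSq ξ) ^ min l k := pow_le_pow_left₀ h (by linarith) _
    _ ≤ _ := pow_le_pow_right₀ (by linarith) (min_le_right _ _)

/-- The damped transforms of the slices. -/
def specSeq (D : HalfCoord n → ℝ) (k l : ℕ) (y : ℝ) : Lp ℂ 2 (volume : Measure (Bdry n)) :=
  mulLp (specMul k l) (𝓕 (sliceLp D y))

variable {D : HalfCoord n → ℝ}

theorem coeFn_specSeq (D : HalfCoord n → ℝ) (k l : ℕ) (y : ℝ) :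
    specSeq D k l y =ᵐ[volume] fun ξ => (specMul k l ξ : ℂ) * 𝓕 (sliceLp D y) ξ :=
  coeFn_mulLp (measurable_specMul k l) (abs_specMul_le k l) _

theorem seqBounded_specSeq (hgr : ModerateGrowth D) (k : ℕ) :
    SeqBounded fun l y => if 0 < y then specSeq D k l y else 0 := by
  obtain ⟨C, N, hC, h⟩ := exists_norm_sliceLp_le hgr
  refine fun Y => ⟨C * (1 + Y) ^ N, fun l y hy => ?_⟩
  simp only [if_pos hy.1]
  have h1 := hy.1
  have h2 := hy.2
  calc _ ≤ 1 * ‖𝓕 (sliceLp D y)‖ := norm_mulLp_le (measurable_specMul k l) (abs_specMul_le k l) _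
    _ = ‖sliceLp D y‖ := by rw [one_mul, Lp.norm_fourier_eq]
    _ ≤ C * (1 + y) ^ N := h y hy.1
    _ ≤ _ := by gcongr

theorem inner_specSeq (hgr : ModerateGrowth D) {k : ℕ} {t : Lp ℂ 2 (volume : Measure (Bdry n))} {g : Bdry n → ℝ}
    (hg : IsTest g) (ht : ∀ᵐ ξ, t ξ = (1 + freqSq ξ : ℝ) ^ k * 𝓕 (cxTest hg) ξ) (l : ℕ) {y : ℝ} (hy : 0 < y) :
    inner ℂ (specSeq D k l y) t = (testInt D (negLap^[min l k] g) y : ℂ) := by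
  set G := cxTest (hg.negLap_iterate (min l k)) with hG
  have h1 : inner ℂ (𝓕 (sliceLp D y)) (𝓕 (G.toLp 2 volume)) = inner ℂ (sliceLp D y) (G.toLp 2 volume) :=
    Lp.inner_fourier_eq _ _
  rw [SchwartzMap.toLp_fourier_eq] at h1
  calc inner ℂ (specSeq D k l y) t = inner ℂ (𝓕 (sliceLp D y)) ((𝓕 G).toLp 2 volume) := by
        rw [L2.inner_def, L2.inner_def]
        refine integral_congr_ae ?_
        filter_upwards [ht, coeFn_specSeq D k l y, SchwartzMap.coeFn_toLp (𝓕 G) 2 volume] with ξ h2 h3 h4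
        have h := freqSq_nonneg ξ
        have h5 : ((1 + freqSq ξ : ℝ) : ℂ) ≠ 0 := by exact_mod_cast (by positivity : 0 < 1 + freqSq ξ).ne'
        rw [h2, h3, h4, hG, fourier_cxTest_negLap_iterate hg, specMul]
        simp only [RCLike.inner_apply, map_mul, Complex.conj_ofReal]
        rw [Complex.ofReal_div, Complex.ofReal_pow, Complex.ofReal_pow]
        field_simp
    _ = inner ℂ (sliceLp D y) (G.toLp 2 volume) := h1
    _ = _ := by
        rw [L2.inner_def, testInt, ← integral_complex_ofReal]
        refine integral_congr_ae ?_
        filter_upwards [coeFn_sliceLp hgr hy, SchwartzMap.coeFn_toLp G 2 volume] with x h2 h3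
        rw [h2, h3, hG, cxTest_apply]
        simp only [RCLike.inner_apply, Complex.conj_ofReal]
        push_cast; ring

theorem picStep_iterate_ofReal (μ : ℝ) (u : ℕ → ℝ → ℝ) (i : ℕ) : ∀ l y,
    (picStep μ)^[i] (fun l y => (u l y : ℂ)) l y = ((picStep μ)^[i] u l y : ℝ) := by
  induction i with
  | zero => exact fun _ _ => rfl
  | succ i ih =>
    intro l y
    have e : (picStep μ)^[i] (fun l y => (u l y : ℂ)) (l + 1) = fun y => (((picStep μ)^[i] u (l + 1) y : ℝ) : ℂ) :=
      funext (ih (l + 1))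
    rw [iterate_succ_apply', iterate_succ_apply', picStep, picStep, ih, e, Complex.ofReal_sub]
    congr 1
    simp only [volterra]
    rw [Complex.real_smul, smul_eq_mul, Complex.ofReal_mul, ← intervalIntegral.integral_ofReal]
    simp

theorem exists_spec_coef (hD : SmoothHalf D) (hgr : ModerateGrowth D) {μ γ ρ : ℝ} (h0 : 0 < μ) (h1 : μ < 1)
    (hγ : 0 ≤ γ) (hρ : γ < ρ) {k : ℕ} (hk : ∀ p ∈ upperHalf n, (weightedLaplacian (1 - 2 * μ))^[k] D p = 0)
    (ho : ∀ g, IsTest g → testInt D g =O[𝓝[>] 0] fun y : ℝ => y ^ ρ) :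
    ∃ v : ℕ × Bool → Lp ℂ 2 (volume : Measure (Bdry n)), ∀ h : Lp ℂ 2 (volume : Measure (Bdry n)),
      (∀ l, LocBounded fun y => inner ℂ (specSeq D k l y) h) ∧ ∀ y, 0 < y →
      (picStep μ)^[k] (fun l y => inner ℂ (specSeq D k l y) h) 0 y = ∑ i ∈ expoAbove μ γ k, y ^ expo μ i • inner ℂ (v i) h := by
  set U : ℕ → ℝ → Lp ℂ 2 (volume : Measure (Bdry n)) := fun l y => if 0 < y then specSeq D k l y else 0 with hU
  have hUe : ∀ h l y, 0 < y → pairSeq U h l y = inner ℂ (specSeq D k l y) h := fun h l y hy => by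
    simp only [pairSeq, hU, if_pos hy]
  have hc : ∀ h ∈ transTests n k, ∀ l, ContinuousOn (pairSeq U h l) (Ioi 0) := by
    rintro h ⟨g, hg, hh⟩ l
    have h2 := (contDiffOn_testInt hD (hg.negLap_iterate (min l k))).continuousOn
    refine (Complex.continuous_ofReal.comp_continuousOn h2).congr fun y hy => ?_
    rw [hUe h l y hy, inner_specSeq hgr hg hh l hy]; rfl
  obtain ⟨v, hv⟩ := exists_riesz_picStep (seqBounded_specSeq hgr k) (dense_transTests n k) hc h0 h1 (k := k)
    (A := expoAbove μ γ k) (expo_injective h0 h1) (by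
      rintro h ⟨g, hg, hh⟩
      obtain ⟨c, hcs⟩ := exists_sum_picStep hD hg h0 h1 hγ hρ hgr hk ho
      refine ⟨fun i => (c i : ℂ), fun y hy => ?_⟩
      rw [picStep_iterate_congr (v := fun l y => (testInt D (negLap^[l] g) y : ℂ)) k 0 (fun l hl t ht => by
        rw [hUe h l t ht, inner_specSeq hgr hg hh l ht, min_eq_left (by omega)]) y hy,
        picStep_iterate_ofReal, hcs y hy]
      push_cast
      simp)
  refine ⟨v, fun h => ⟨fun l => ?_, fun y hy => ?_⟩⟩
  · exact (locBounded_pairSeq (seqBounded_specSeq hgr k) (dense_transTests n k) hc h l).congr fun y hy => (hUe h l y hy).symm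
  · rw [← hv h y hy]
    exact picStep_iterate_congr k 0 (fun l _ t ht => (hUe h l t ht).symm) y hy

end

section

section picard

variable {μ : ℝ} (h0 : 0 < μ) (h1 : μ < 1)
include h0 h1

theorem picStep_iterate_sum {ι : Type*} (A : Finset ι) {u : ι → ℕ → ℝ → ℂ} (hu : ∀ i ∈ A, ∀ l, LocBounded (u i l)) (k : ℕ) :
    (∀ l, LocBounded fun y => ∑ i ∈ A, u i l y) ∧ ∀ l y, 0 < y →
    (picStep μ)^[k] (fun l y => ∑ i ∈ A, u i l y) l y = ∑ i ∈ A, (picStep μ)^[k] (u i) l y := by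
  classical
  induction A using Finset.induction_on with
  | empty =>
    simp only [Finset.sum_empty]
    refine ⟨fun l => ⟨continuousOn_const, fun Y => ⟨0, fun y _ => by simp⟩⟩, fun l y hy => ?_⟩
    have := picStep_iterate_smul (μ := μ) (0 : ℂ) (fun _ _ => 0) k l y hy
    simpa using this
  | insert i A hi ih =>
    obtain ⟨ih1, ih2⟩ := ih fun j hj => hu j (Finset.mem_insert_of_mem hj)
    have hui := hu i (Finset.mem_insert_self i A)
    simp only [Finset.sum_insert hi]
    refine ⟨fun l => (hui l).add (ih1 l), fun l y hy => ?_⟩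
    rw [← ih2 l y hy]
    exact picStep_iterate_add h0 h1 hui ih1 k l y hy

theorem eq_sum_powSer {z : ℕ → ℝ → ℂ} (hz : ∀ l, LocBounded (z l)) {Λ : ℝ} (hΛ : 0 ≤ Λ)
    (hb : ∀ Y : ℝ, ∃ C : ℝ, ∀ l, ∀ y ∈ Ioc 0 Y, ‖z l y‖ ≤ C * Λ ^ l) {ι : Type*} {A : Finset ι} {e : ι → ℝ}
    (he : ∀ i, 0 ≤ e i) {c : ι → ℕ → ℂ} {B : ι → ℝ} (hc : ∀ i s, ‖c i s‖ ≤ B i * Λ ^ s) {k : ℕ}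
    (h : ∀ l y, 0 < y → (picStep μ)^[k] z l y = ∑ i ∈ A, y ^ e i • c i l) {y : ℝ} (hy : 0 < y) :
    z 0 y = ∑ i ∈ A, powSer μ (e i) k (c i) y := by
  set u : ι → ℕ → ℝ → ℂ := fun i l => powSer μ (e i) k fun s => c i (s + l) with hu
  have hcl : ∀ i l s, ‖c i (s + l)‖ ≤ B i * Λ ^ l * Λ ^ s := fun i l s => (hc i _).trans (le_of_eq (by ring))
  have hul : ∀ i ∈ A, ∀ l, LocBounded (u i l) := fun i _ l => locBounded_powSer h1 (he i) (hcl i l) k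
  obtain ⟨hs1, hs2⟩ := picStep_iterate_sum h0 h1 A hul k
  have hz0 := eq_zero_of_picStep_iterate_eq_zero (z := fun l y => z l y + (-1 : ℂ) • ∑ i ∈ A, u i l y) h1 h0 hΛ k
    (fun Y => ?_) (fun l y hy => ?_) 0 y hy
  · simpa [hu, ← sub_eq_add_neg, sub_eq_zero] using hz0
  · obtain ⟨C, hC⟩ := hb Y
    refine ⟨C + ∑ i ∈ A, ∑' s : ℕ, 2 ^ k * Y ^ e i * B i * ((2 * (4 * (1 - μ))⁻¹ * Y ^ 2 * Λ) ^ s / s.factorial),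
      fun l y hy => ?_⟩
    rw [add_mul, Finset.sum_mul]
    refine (norm_add_le _ _).trans (add_le_add (hC l y hy) ?_)
    rw [neg_one_smul, norm_neg]
    refine (norm_sum_le _ _).trans (Finset.sum_le_sum fun i _ => ?_)
    refine (norm_powSer_le h1 (he i) (hcl i l) k hy.1 hy.2).trans (le_of_eq ?_)
    rw [← tsum_mul_right]
    exact tsum_congr fun s => by ring
  · rw [picStep_iterate_add h0 h1 hz (fun l => (hs1 l).const_smul (-1 : ℂ)) k l y hy, picStep_iterate_smul _ _ k l y hy,
      hs2 l y hy, h l y hy]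
    simp only [hu, picStep_iterate_powSer h1 (he _) h0 (hc _) k l y hy]
    simp

end picard

variable {n : ℕ}

section mul

variable {m : Bdry n → ℝ} (hm : Measurable m) {C : ℝ} (hb : ∀ ξ, |m ξ| ≤ C) (F h : Lp ℂ 2 (volume : Measure (Bdry n)))
include hm hb

theorem inner_mulLp_left : inner ℂ (mulLp m F) h = ∫ ξ, (m ξ : ℂ) * inner ℂ (F ξ) (h ξ) := by
  rw [L2.inner_def]
  refine integral_congr_ae ?_
  filter_upwards [coeFn_mulLp hm hb F] with ξ hξ
  rw [hξ]
  simp only [RCLike.inner_apply, map_mul, Complex.conj_ofReal]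
  ring

theorem inner_mulLp_right : inner ℂ F (mulLp m h) = ∫ ξ, (m ξ : ℂ) * inner ℂ (F ξ) (h ξ) := by
  rw [L2.inner_def]
  refine integral_congr_ae ?_
  filter_upwards [coeFn_mulLp hm hb h] with ξ hξ
  rw [hξ]
  simp only [RCLike.inner_apply]
  ring

end mul

/-- The powers of `λ`, cut off at `λ ≤ R`. -/
def cutPow (R : ℝ) (j : ℕ) (ξ : Bdry n) : ℝ := {ξ | freqSq ξ ≤ R}.indicator (fun ξ => freqSq ξ ^ j) ξ

theorem measurableSet_freqSq_le (R : ℝ) : MeasurableSet {ξ : Bdry n | freqSq ξ ≤ R} :=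
  measurableSet_le continuous_freqSq.measurable measurable_const

theorem measurable_cutPow (R : ℝ) (j : ℕ) : Measurable (cutPow R j : Bdry n → ℝ) :=
  (continuous_freqSq.measurable.pow_const j).indicator (measurableSet_freqSq_le R)

theorem cutPow_of_le {R : ℝ} {ξ : Bdry n} (h : freqSq ξ ≤ R) (j : ℕ) : cutPow R j ξ = freqSq ξ ^ j :=
  indicator_of_mem (s := {ξ : Bdry n | freqSq ξ ≤ R}) h _

theorem cutPow_of_not_le {R : ℝ} {ξ : Bdry n} (h : ¬freqSq ξ ≤ R) (j : ℕ) : cutPow R j ξ = 0 :=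
  indicator_of_notMem (s := {ξ : Bdry n | freqSq ξ ≤ R}) h _

theorem abs_cutPow_le {R : ℝ} (hR : 0 ≤ R) (j : ℕ) (ξ : Bdry n) : |cutPow R j ξ| ≤ R ^ j := by
  by_cases h : freqSq ξ ≤ R
  · rw [cutPow_of_le h, abs_of_nonneg (pow_nonneg (freqSq_nonneg ξ) j)]
    exact pow_le_pow_left₀ (freqSq_nonneg ξ) h j
  · rw [cutPow_of_not_le h, abs_zero]; positivity

variable {D : HalfCoord n → ℝ} {μ : ℝ} (h0 : 0 < μ) (h1 : μ < 1)

theorem expo_nonneg (h0 : 0 < μ) (i : ℕ × Bool) : 0 ≤ expo μ i := by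
  unfold expo; split_ifs <;> positivity

include h1 in
theorem continuous_solPow {q : ℝ} (hq : 0 ≤ q) (k : ℕ) {y : ℝ} (hy : 0 < y) : Continuous fun Λ => solPow μ q k Λ y := by
  obtain ⟨A, hA, -, h⟩ := exists_solPow_eq h1 hq k
  simp only [fun Λ => h Λ y hy]
  exact continuous_const.mul (hA.continuous.comp (by fun_prop))

include h1 in
theorem powSer_inner_cutPow {q : ℝ} (hq : 0 ≤ q) (k : ℕ) {R y : ℝ} (hR : 0 ≤ R) (hy : 0 < y)
    (v h : Lp ℂ 2 (volume : Measure (Bdry n))) :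
    powSer μ q k (fun s => inner ℂ v (mulLp (cutPow R s) h)) y
      = inner ℂ (mulLp (fun ξ => cutPow R 0 ξ * solPow μ q k (freqSq ξ) y) v) h := by
  have hi : Integrable fun ξ => inner ℂ (v ξ) (h ξ) := L2.integrable_inner v h
  have hR1 : ∀ ξ : Bdry n, freqSq ξ ≤ R → ∀ s, ‖freqSq ξ ^ s‖ ≤ 1 * R ^ s := fun ξ hξ s => by
    rw [one_mul, norm_pow, Real.norm_of_nonneg (freqSq_nonneg ξ)]
    exact pow_le_pow_left₀ (freqSq_nonneg ξ) hξ s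
  have hb : ∀ ξ : Bdry n, |cutPow R 0 ξ * solPow μ q k (freqSq ξ) y|
      ≤ |∑' s : ℕ, 2 ^ k * y ^ q * 1 * ((2 * (4 * (1 - μ))⁻¹ * y ^ 2 * R) ^ s / s.factorial)| := fun ξ => by
    by_cases hξ : freqSq ξ ≤ R
    · rw [cutPow_of_le hξ, pow_zero, one_mul, ← Real.norm_eq_abs, solPow]
      exact (norm_powSer_le h1 hq (hR1 ξ hξ) k hy le_rfl).trans (le_abs_self _)
    · rw [cutPow_of_not_le hξ, zero_mul, abs_zero]
      exact abs_nonneg _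
  have hm : Measurable fun ξ : Bdry n => cutPow R 0 ξ * solPow μ q k (freqSq ξ) y :=
    (measurable_cutPow R 0).mul ((continuous_solPow h1 hq k hy).measurable.comp continuous_freqSq.measurable)
  rw [inner_mulLp_left hm hb]
  set w : ℕ → ℝ := fun s => (Nat.multichoose k s : ℝ) * powCoef μ q s * y ^ (q + 2 * s) with hw
  have hF : ∀ s, Integrable fun ξ : Bdry n => ((w s * cutPow R s ξ : ℝ) : ℂ) * inner ℂ (v ξ) (h ξ) := fun s => by
    refine hi.bdd_mul (c := |w s| * R ^ s) ?_ (.of_forall fun ξ => ?_)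
    · exact (Complex.measurable_ofReal.comp ((measurable_cutPow R s).const_mul _)).aestronglyMeasurable
    · rw [Complex.norm_real, norm_mul]
      exact mul_le_mul_of_nonneg_left (abs_cutPow_le hR s ξ) (abs_nonneg _)
  have hsum : Summable fun s => ‖w s‖ * R ^ s := by
    refine Summable.of_nonneg_of_le (fun s => by positivity) (fun s => ?_) (summable_majorant (2 ^ k * y ^ q * 1) (2 * (4 * (1 - μ))⁻¹ * y ^ 2 * R))
    have := norm_powSer_term_le (E := ℝ) (c := fun s => R ^ s) (C := 1) (Λ := R) h1 hq
      (fun s => by rw [one_mul, Real.norm_of_nonneg (by positivity)]) k s hy le_rfl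
    rwa [norm_smul, Real.norm_of_nonneg (pow_nonneg hR s)] at this
  have hS := hasSum_integral_of_summable_integral_norm hF (by
    refine Summable.of_nonneg_of_le (fun s => integral_nonneg fun ξ => norm_nonneg _) (fun s => ?_)
      (hsum.mul_right (∫ ξ, ‖inner ℂ (v ξ) (h ξ)‖))
    rw [← integral_const_mul]
    refine integral_mono (hF s).norm (hi.norm.const_mul _) fun ξ => ?_
    simp only [norm_mul, Complex.norm_real]
    gcongr
    exact abs_cutPow_le hR s ξ)
  have e1 : powSer μ q k (fun s => inner ℂ v (mulLp (cutPow R s) h)) y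
      = ∑' s, ∫ ξ, ((w s * cutPow R s ξ : ℝ) : ℂ) * inner ℂ (v ξ) (h ξ) := by
    refine tsum_congr fun s => ?_
    simp only
    rw [inner_mulLp_right (measurable_cutPow R s) (abs_cutPow_le hR s), Complex.real_smul, ← integral_const_mul]
    refine integral_congr_ae (.of_forall fun ξ => ?_)
    simp only [hw]; push_cast; ring
  rw [e1, hS.tsum_eq]
  refine integral_congr_ae (.of_forall fun ξ => ?_)
  simp only
  rw [tsum_mul_right, ← Complex.ofReal_tsum]
  congr 2
  by_cases hξ : freqSq ξ ≤ R
  · simp only [cutPow_of_le hξ, solPow, powSer, hw, smul_eq_mul, pow_zero, one_mul]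
  · simp [cutPow_of_not_le hξ]

end

section

variable {n : ℕ} {D : HalfCoord n → ℝ} {μ : ℝ}

theorem inner_specSeq_cutPow (k : ℕ) {l : ℕ} (hl : l ≤ k) {R : ℝ} (hR : 0 ≤ R) (j : ℕ) (t : ℝ)
    (h : Lp ℂ 2 (volume : Measure (Bdry n))) :
    inner ℂ (specSeq D k l t) (mulLp (cutPow R j) h) = inner ℂ (specSeq D k 0 t) (mulLp (cutPow R (l + j)) h) := by
  rw [L2.inner_def, L2.inner_def]
  refine integral_congr_ae ?_
  filter_upwards [coeFn_specSeq D k l t, coeFn_specSeq D k 0 t, coeFn_mulLp (measurable_cutPow R j) (abs_cutPow_le hR j) h,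
    coeFn_mulLp (measurable_cutPow R (l + j)) (abs_cutPow_le hR (l + j)) h] with ξ e1 e2 e3 e4
  rw [e1, e2, e3, e4]
  have e5 : specMul k l ξ * cutPow R j ξ = specMul k 0 ξ * cutPow R (l + j) ξ := by
    by_cases hξ : freqSq ξ ≤ R
    · rw [cutPow_of_le hξ, cutPow_of_le hξ, specMul, specMul, min_eq_left hl, pow_add]
      simp only [zero_le, inf_of_le_left, pow_zero]
      ring
    · rw [cutPow_of_not_le hξ, cutPow_of_not_le hξ]; ring
  have e6 : (specMul k l ξ : ℂ) * cutPow R j ξ = specMul k 0 ξ * cutPow R (l + j) ξ := by exact_mod_cast e5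
  simp only [RCLike.inner_apply, map_mul, Complex.conj_ofReal]
  linear_combination h ξ * (starRingEnd ℂ) (𝓕 (sliceLp D t) ξ) * e6

theorem specSeq_ae_eq (h0 : 0 < μ) (h1 : μ < 1) (hgr : ModerateGrowth D) {k : ℕ} {A : Finset (ℕ × Bool)}
    {v : ℕ × Bool → Lp ℂ 2 (volume : Measure (Bdry n))}
    (hv : ∀ h : Lp ℂ 2 (volume : Measure (Bdry n)), (∀ l, LocBounded fun y => inner ℂ (specSeq D k l y) h) ∧ ∀ y, 0 < y →
      (picStep μ)^[k] (fun l y => inner ℂ (specSeq D k l y) h) 0 y = ∑ i ∈ A, y ^ expo μ i • inner ℂ (v i) h)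
    {y : ℝ} (hy : 0 < y) :
    ∀ᵐ ξ, specSeq D k 0 y ξ = ∑ i ∈ A, (solPow μ (expo μ i) k (freqSq ξ) y : ℂ) * v i ξ := by
  have key : ∀ R : ℕ, ∀ᵐ ξ, freqSq ξ ≤ R →
      specSeq D k 0 y ξ = ∑ i ∈ A, (solPow μ (expo μ i) k (freqSq ξ) y : ℂ) * v i ξ := by
    intro R
    have hR : (0 : ℝ) ≤ R := by positivity
    have hq := expo_nonneg (μ := μ) h0
    set m : ℕ × Bool → Bdry n → ℝ := fun i ξ => cutPow R 0 ξ * solPow μ (expo μ i) k (freqSq ξ) y with hm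
    have hmm : ∀ i, Measurable (m i) := fun i =>
      (measurable_cutPow (R : ℝ) 0).mul ((continuous_solPow h1 (hq i) k hy).measurable.comp continuous_freqSq.measurable)
    have hmb : ∀ i, ∃ C, ∀ ξ, |m i ξ| ≤ C := fun i => by
      obtain ⟨C, hC⟩ := (isCompact_Icc (a := (0 : ℝ)) (b := R)).exists_bound_of_continuousOn
        (continuous_solPow h1 (hq i) k hy).continuousOn
      refine ⟨C, fun ξ => ?_⟩
      have hC0 := (norm_nonneg _).trans (hC 0 ⟨le_rfl, hR⟩)
      by_cases hξ : freqSq ξ ≤ R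
      · simp only [hm, cutPow_of_le hξ, pow_zero, one_mul]
        exact hC _ ⟨freqSq_nonneg ξ, hξ⟩
      · simpa [hm, cutPow_of_not_le hξ] using hC0
    choose C hC using hmb
    have hE : mulLp (cutPow (R : ℝ) 0) (specSeq D k 0 y) = ∑ i ∈ A, mulLp (m i) (v i) := by
      refine ext_inner_right ℂ fun h => ?_
      set z : ℕ → ℝ → ℂ := fun l t => inner ℂ (specSeq D k 0 t) (mulLp (cutPow (R : ℝ) l) h)
      have hcut : ∀ s, ‖mulLp (cutPow (R : ℝ) s) h‖ ≤ (R : ℝ) ^ s * ‖h‖ := fun s =>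
        norm_mulLp_le (measurable_cutPow _ s) (abs_cutPow_le hR s) h
      have hsum := eq_sum_powSer h0 h1 (z := z) (fun l => (hv _).1 0) hR (fun Y => ?_) (A := A) hq
        (c := fun i s => inner ℂ (v i) (mulLp (cutPow (R : ℝ) s) h)) (B := fun i => ‖v i‖ * ‖h‖) (fun i s => ?_)
        (k := k) (fun l t ht => ?_) hy
      · rw [inner_mulLp_left (measurable_cutPow _ 0) (abs_cutPow_le hR 0),
          ← inner_mulLp_right (measurable_cutPow _ 0) (abs_cutPow_le hR 0), sum_inner]
        refine hsum.trans (Finset.sum_congr rfl fun i _ => ?_)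
        exact powSer_inner_cutPow h1 (hq i) k hR hy (v i) h
      · obtain ⟨B, hB⟩ := seqBounded_specSeq hgr k Y
        refine ⟨B * ‖h‖, fun l t ht => ?_⟩
        have h2 := hB 0 t ht
        simp only [if_pos ht.1] at h2
        calc _ ≤ ‖specSeq D k 0 t‖ * ‖mulLp (cutPow (R : ℝ) l) h‖ := norm_inner_le_norm _ _
          _ ≤ B * ((R : ℝ) ^ l * ‖h‖) := mul_le_mul h2 (hcut l) (norm_nonneg _) ((norm_nonneg _).trans h2)
          _ = _ := by ring
      · calc _ ≤ ‖v i‖ * ‖mulLp (cutPow (R : ℝ) s) h‖ := norm_inner_le_norm _ _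
          _ ≤ ‖v i‖ * ((R : ℝ) ^ s * ‖h‖) := by gcongr; exact hcut s
          _ = _ := by ring
      · have h2 := congrFun (picStep_iterate_shift (μ := μ) z l k 0) t
        rw [zero_add] at h2
        rw [← h2, ← (hv _).2 t ht]
        refine picStep_iterate_congr k 0 (fun j hj s _ => ?_) t ht
        exact (inner_specSeq_cutPow k (by omega) hR l s h).symm
    have hs : ∀ᵐ ξ, (∑ i ∈ A, mulLp (m i) (v i) : Lp ℂ 2 (volume : Measure (Bdry n))) ξ = ∑ i ∈ A, mulLp (m i) (v i) ξ := by
      filter_upwards [Lp.coeFn_finsetSum A fun i => mulLp (m i) (v i)] with ξ hξ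
      rw [hξ]; simp
    filter_upwards [hs, coeFn_mulLp (measurable_cutPow (R : ℝ) 0) (abs_cutPow_le hR 0) (specSeq D k 0 y),
      ae_all_iff.2 fun i => coeFn_mulLp (hmm i) (hC i) (v i)] with ξ e1 e2 e3 hξ
    rw [hE, e1, cutPow_of_le hξ] at e2
    simp only [pow_zero, Complex.ofReal_one, one_mul] at e2
    rw [← e2]
    refine Finset.sum_congr rfl fun i _ => ?_
    rw [e3 i]
    simp [hm, cutPow_of_le hξ]
  filter_upwards [ae_all_iff.2 key] with ξ hξ
  obtain ⟨r, hr⟩ := exists_nat_ge (freqSq ξ)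
  exact hξ r hr

end

section

variable {n : ℕ} {D : HalfCoord n → ℝ} {μ : ℝ}

/-- Uniqueness for the iterated weighted Laplacian: a solution of moderate growth that vanishes weakly
at the boundary to an order above `N + μ` is trivial. -/
theorem eq_zero_of_weak_vanishing (hn : 1 ≤ n) (hD : SmoothHalf D) (hgr : ModerateGrowth D) (h0 : 0 < μ) (h1 : μ < 1)
    (N : ℕ) (hk : ∀ p ∈ upperHalf n, (weightedLaplacian (1 - 2 * μ))^[N + 1] D p = 0) {ρ : ℝ} (hρ : N + μ < ρ)
    (ho : ∀ g, IsTest g → testInt D g =O[𝓝[>] 0] fun y : ℝ => y ^ ρ) : ∀ p ∈ upperHalf n, D p = 0 := by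
  have hn0 : Nonempty (Fin n) := ⟨⟨0, hn⟩⟩
  obtain ⟨v, hv⟩ := exists_spec_coef hD hgr h0 h1 (by positivity) hρ hk ho
  have hq := expo_nonneg (μ := μ) h0
  set A := expoAbove μ (N + μ) (N + 1)
  choose a ha _ hae using fun i => exists_solPow_eq h1 (hq i) (N + 1)
  set d : Bdry n → ℝ → ℂ := fun ξ y => ∑ i ∈ A, ((y ^ expo μ i * a i (freqSq ξ * y ^ 2) : ℝ) : ℂ) * v i ξ with hd
  have hde : ∀ y, 0 < y → ∀ᵐ ξ, specSeq D (N + 1) 0 y ξ = d ξ y := fun y hy => by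
    filter_upwards [specSeq_ae_eq h0 h1 hgr hv hy] with ξ hξ
    rw [hξ]
    exact Finset.sum_congr rfl fun i _ => by rw [hae i _ y hy]
  have hdm : Measurable (Function.uncurry d) := by
    refine Finset.measurable_fun_sum A fun i _ => ?_
    refine (Complex.measurable_ofReal.comp ?_).mul ((Lp.stronglyMeasurable (v i)).measurable.comp measurable_fst)
    refine (measurable_snd.pow_const _).mul ((ha i).continuous.measurable.comp ?_)
    exact (continuous_freqSq.measurable.comp measurable_fst).mul (measurable_snd.pow_const 2)
  obtain ⟨C, M, hC, hb⟩ := exists_norm_sliceLp_le hgr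
  set w : ℝ → ENNReal := fun y => ENNReal.ofReal ((1 + y) ^ (-(2 * M + 2 : ℝ))) with hw
  have hwm : Measurable w := by
    exact ENNReal.measurable_ofReal.comp ((measurable_id.const_add 1).pow_const _)
  have hint : ∀ y ∈ Ioi (1 : ℝ), ∫⁻ ξ, ‖d ξ y‖ₑ ^ (2 : ℝ) * w y ≤ ENNReal.ofReal (C ^ 2 * y ^ (-2 : ℝ)) := by
    intro y hy
    have hy1 : 1 < y := hy
    have hy0 : 0 < y := by linarith
    have e1 : ∫⁻ ξ, ‖d ξ y‖ₑ ^ (2 : ℝ) = ENNReal.ofReal (‖specSeq D (N + 1) 0 y‖ ^ 2) := by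
      have e2 : ∫⁻ ξ, ‖d ξ y‖ₑ ^ (2 : ℝ) = ∫⁻ ξ, ‖specSeq D (N + 1) 0 y ξ‖ₑ ^ (2 : ℝ) :=
        lintegral_congr_ae (by filter_upwards [hde y hy0] with ξ hξ; rw [hξ])
      have e3 := eLpNorm_nnreal_pow_eq_lintegral (p := 2) (f := specSeq D (N + 1) 0 y) (μ := volume) two_ne_zero
      rw [e2, ← Real.rpow_two, ← ENNReal.ofReal_rpow_of_nonneg (norm_nonneg _) (by norm_num), Lp.norm_def,
        ENNReal.ofReal_toReal (Lp.eLpNorm_ne_top _)]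
      exact e3.symm
    have hdy : Measurable fun ξ => ‖d ξ y‖ₑ ^ (2 : ℝ) :=
      (hdm.comp (measurable_id.prodMk measurable_const)).enorm.pow_const _
    rw [lintegral_mul_const _ hdy, e1, ← ENNReal.ofReal_mul (by positivity)]
    refine ENNReal.ofReal_le_ofReal ?_
    have h3 : ‖specSeq D (N + 1) 0 y‖ ≤ C * (1 + y) ^ M := by
      refine (norm_mulLp_le (measurable_specMul _ _) (abs_specMul_le _ _) _).trans ?_
      rw [one_mul, Lp.norm_fourier_eq]
      exact hb y hy0
    have h4 : ((1 + y) ^ M) ^ 2 * (1 + y) ^ (-(2 * M + 2 : ℝ)) = (1 + y) ^ (-2 : ℝ) := by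
      rw [← pow_mul, ← Real.rpow_natCast, ← Real.rpow_add (by linarith)]
      congr 1; push_cast; ring
    calc _ ≤ (C * (1 + y) ^ M) ^ 2 * (1 + y) ^ (-(2 * M + 2 : ℝ)) := by gcongr
      _ = C ^ 2 * (1 + y) ^ (-2 : ℝ) := by rw [mul_pow, mul_assoc, h4]
      _ ≤ _ := by
        refine mul_le_mul_of_nonneg_left ?_ (by positivity)
        exact Real.rpow_le_rpow_of_nonpos hy0 (by linarith) (by norm_num)
  have hfin : ∫⁻ ξ, ∫⁻ y in Ioi 1, ‖d ξ y‖ₑ ^ (2 : ℝ) * w y ≠ ⊤ := by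
    rw [lintegral_lintegral_swap ((hdm.enorm.pow_const _).mul (hwm.comp measurable_snd)).aemeasurable]
    refine ne_top_of_le_ne_top ?_ (setLIntegral_mono' measurableSet_Ioi hint)
    exact ((integrableOn_Ioi_rpow_of_lt (by norm_num) one_pos).const_mul (C ^ 2)).lintegral_lt_top.ne
  have hae1 := ae_lt_top ((hdm.enorm.pow_const 2).mul (hwm.comp measurable_snd)).lintegral_prod_right' hfin
  have hvz : ∀ᵐ ξ, ∀ i ∈ A, v i ξ = 0 := by
    have hne : ∀ᵐ ξ : Bdry n, ξ ≠ 0 := by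
      rw [ae_iff]; simp
    filter_upwards [hae1, hne] with ξ hξ hξ0
    have hΛ : 0 < freqSq ξ := by
      have := norm_pos_iff.2 hξ0
      unfold freqSq; positivity
    have key : ∀ L : ℂ →L[ℝ] ℝ, (∀ z, |L z| ≤ ‖z‖) → ∀ i ∈ A, L (v i ξ) = 0 := by
      intro L hL
      refine eq_zero_of_sum_solPow h0 h1 hΛ N (M := 2 * M + 2) (by positivity) ?_
      have e : ∀ y ∈ Ioi (1 : ℝ), (∑ i ∈ A, L (v i ξ) * solPow μ (expo μ i) (N + 1) (freqSq ξ) y) ^ 2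
          * (1 + y) ^ (-(2 * M + 2 : ℝ)) = L (d ξ y) ^ 2 * (1 + y) ^ (-(2 * M + 2 : ℝ)) := fun y hy => by
        have hy0 : 0 < y := zero_lt_one.trans hy
        congr 2
        simp only [hd, map_sum, ← Complex.real_smul, map_smul, smul_eq_mul]
        exact Finset.sum_congr rfl fun i _ => by rw [hae i _ y hy0, mul_comm]
      refine IntegrableOn.congr_fun ?_ (fun y hy => (e y hy).symm) measurableSet_Ioi
      have hm1 : Measurable fun y => L (d ξ y) ^ 2 * (1 + y) ^ (-(2 * M + 2 : ℝ)) :=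
        ((L.measurable.comp (hdm.comp (measurable_const.prodMk measurable_id))).pow_const 2).mul
          ((measurable_id.const_add 1).pow_const _)
      refine ⟨hm1.aestronglyMeasurable, lt_of_le_of_lt (setLIntegral_mono' measurableSet_Ioi fun y hy => ?_) hξ⟩
      have hy1 : 1 < y := hy
      have hp : 0 ≤ (1 + y) ^ (-(2 * M + 2 : ℝ)) := Real.rpow_nonneg (by linarith) _
      simp only [hw, Function.uncurry]
      rw [enorm_mul, Real.enorm_of_nonneg hp]
      refine mul_le_mul' ?_ le_rfl
      rw [enorm_pow]
      simp only [← ofReal_norm, ENNReal.rpow_two]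
      exact pow_le_pow_left' (ENNReal.ofReal_le_ofReal (hL _)) 2
    intro i hi
    exact Complex.ext (key Complex.reCLM (fun z => Complex.abs_re_le_norm z) i hi)
      (key Complex.imCLM (fun z => Complex.abs_im_le_norm z) i hi)
  intro p hp
  have hy := mem_upperHalf.1 hp
  have h5 : 𝓕 (sliceLp D p.2) = 0 := by
    rw [Lp.eq_zero_iff_ae_eq_zero]
    filter_upwards [hde p.2 hy, hvz, coeFn_specSeq D (N + 1) 0 p.2] with ξ e1 e2 e3
    rw [e1, hd] at e3
    simp only at e3
    rw [Finset.sum_eq_zero fun i hi => by rw [e2 i hi, mul_zero]] at e3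
    refine (mul_eq_zero.1 e3.symm).resolve_left ?_
    have := freqSq_nonneg ξ
    rw [specMul, Nat.zero_min, pow_zero]
    exact_mod_cast (by positivity : 0 < 1 / (1 + freqSq ξ) ^ (N + 1)).ne'
  have h6 : sliceLp D p.2 = 0 := by
    rw [← norm_eq_zero, ← Lp.norm_fourier_eq, h5, norm_zero]
  have h7 : (fun x => D (x, p.2)) =ᵐ[volume] fun _ => 0 := by
    have h8 := (Lp.eq_zero_iff_ae_eq_zero).1 h6
    filter_upwards [h8, coeFn_sliceLp hgr hy] with x e1 e2
    rw [e2] at e1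
    simpa using e1
  exact congrFun ((Continuous.ae_eq_iff_eq volume (hD.slice_contDiff hy).continuous continuous_const).1 h7) p.1

end

section

theorem abs_sub_le_of_abs_deriv_le_rpow {f f' : ℝ → ℝ} {a C y z : ℝ} (ha : a ≠ 0) (hy : 0 < y) (hyz : y ≤ z)
    (hf : ∀ t ∈ Icc y z, HasDerivAt f (f' t) t) (hC : ∀ t ∈ Icc y z, |f' t| ≤ C * t ^ (a - 1)) :
    |f z - f y| ≤ C / a * (z ^ a - y ^ a) := by
  have hB : ∀ t ∈ Icc y z, HasDerivAt (fun t => C / a * (t ^ a - y ^ a)) (C * t ^ (a - 1)) t := fun t ht => by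
    refine (((Real.hasDerivAt_rpow_const (Or.inl (hy.trans_le ht.1).ne')).sub_const _).const_mul (C / a)).congr_deriv ?_
    field_simp
  refine image_norm_le_of_norm_deriv_right_le_deriv_boundary' (f := fun t => f t - f y)
    (fun t ht => ((hf t ht).sub_const (f y)).continuousAt.continuousWithinAt)
    (fun t ht => ((hf t (Ico_subset_Icc_self ht)).sub_const (f y)).hasDerivWithinAt) (by simp)
    (fun t ht => (hB t ht).continuousAt.continuousWithinAt)
    (fun t ht => (hB t (Ico_subset_Icc_self ht)).hasDerivWithinAt)
    (fun t ht => hC t (Ico_subset_Icc_self ht)) (right_mem_Icc.2 hyz)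

/-- The decay at `0` gained from the Bessel equation. -/
theorem isBigO_of_besselOp_isBigO {u : ℝ → ℝ} {σ ρ : ℝ} (hu : ContDiffOn ℝ ∞ u (Ioi 0)) (hσ : 0 < σ) (hρ : 0 ≤ ρ)
    (hne : 2 - 2 * σ + ρ ≠ 0) (h0 : Tendsto u (𝓝[>] 0) (𝓝 0))
    (hO : besselOp (1 - 2 * σ) u =O[𝓝[>] 0] fun y : ℝ => y ^ ρ) :
    u =O[𝓝[>] 0] fun y : ℝ => y ^ min (2 * σ) (ρ + 2) := by
  obtain ⟨C, hC0, hC⟩ := hO.exists_nonneg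
  rw [Asymptotics.isBigOWith_iff] at hC
  obtain ⟨z₁, hz₁, hC⟩ := mem_nhdsGT_iff_exists_Ioc_subset.1 hC
  set z := min z₁ 1
  have hz0 : 0 < z := lt_min hz₁ one_pos
  set a := 2 - 2 * σ + ρ with ha
  set r := min (2 * σ) (ρ + 2)
  have hr0 : 0 < r := lt_min (by linarith) (by linarith)
  set w : ℝ → ℝ := fun t => t ^ (1 - 2 * σ) * deriv u t with hw
  have hw' : ∀ t, 0 < t → HasDerivAt w (t ^ (1 - 2 * σ) * besselOp (1 - 2 * σ) u t) t := fun t ht => by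
    refine ((Real.hasDerivAt_rpow_const (p := 1 - 2 * σ) (Or.inl ht.ne')).mul
      (hu.deriv_Ioi.hasDerivAt_Ioi ht)).congr_deriv ?_
    rw [besselOp, Real.rpow_sub_one ht.ne']
    ring
  have hwb : ∀ y ∈ Ioc 0 z, |w z - w y| ≤ C / a * (z ^ a - y ^ a) := fun y hy => by
    refine abs_sub_le_of_abs_deriv_le_rpow hne hy.1 hy.2 (fun t ht => hw' t (hy.1.trans_le ht.1)) fun t ht => ?_
    have ht0 : 0 < t := hy.1.trans_le ht.1
    have h1 : ‖besselOp (1 - 2 * σ) u t‖ ≤ C * ‖t ^ ρ‖ := hC ⟨ht0, ht.2.trans (min_le_left _ _)⟩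
    rw [Real.norm_eq_abs, Real.norm_of_nonneg (by positivity)] at h1
    rw [abs_mul, abs_of_pos (by positivity), show a - 1 = (1 - 2 * σ) + ρ by rw [ha]; ring, Real.rpow_add ht0]
    calc _ ≤ t ^ (1 - 2 * σ) * (C * t ^ ρ) := by gcongr
      _ = _ := by ring
  set K := |w z| + |C / a| * z ^ a + |C / a| with hK
  have hub : ∀ y ∈ Ioc 0 z, |deriv u y| ≤ K * y ^ (r - 1) := fun y hy => by
    have hy0 := hy.1
    have hy1 : y ≤ 1 := hy.2.trans (min_le_right _ _)
    have h1 : |w y| ≤ |w z| + |C / a| * (z ^ a + y ^ a) := by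
      have h2 := hwb y hy
      have h3 : C / a * (z ^ a - y ^ a) ≤ |C / a| * (z ^ a + y ^ a) := by
        refine (le_abs_self _).trans ?_
        rw [abs_mul]
        gcongr
        refine (abs_sub _ _).trans_eq ?_
        rw [abs_of_pos (by positivity), abs_of_pos (by positivity)]
      have h4 := abs_sub_abs_le_abs_sub (w y) (w z)
      rw [abs_sub_comm] at h4
      linarith
    have h5 : deriv u y = y ^ (2 * σ - 1) * w y := by
      simp only [hw]
      rw [← mul_assoc, ← Real.rpow_add hy0]
      simp
    have h6 : y ^ (2 * σ - 1) ≤ y ^ (r - 1) :=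
      Real.rpow_le_rpow_of_exponent_ge hy0 hy1 (by linarith [min_le_left (2 * σ) (ρ + 2)])
    have h7 : y ^ (2 * σ - 1) * y ^ a ≤ y ^ (r - 1) := by
      rw [← Real.rpow_add hy0]
      exact Real.rpow_le_rpow_of_exponent_ge hy0 hy1 (by linarith [min_le_right (2 * σ) (ρ + 2)])
    rw [h5, abs_mul, abs_of_pos (by positivity)]
    calc _ ≤ y ^ (2 * σ - 1) * (|w z| + |C / a| * (z ^ a + y ^ a)) := by gcongr
      _ = (|w z| + |C / a| * z ^ a) * y ^ (2 * σ - 1) + |C / a| * (y ^ (2 * σ - 1) * y ^ a) := by ring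
      _ ≤ (|w z| + |C / a| * z ^ a) * y ^ (r - 1) + |C / a| * y ^ (r - 1) := by gcongr
      _ = _ := by rw [hK]; ring
  refine Asymptotics.IsBigO.of_bound (K / r) ?_
  filter_upwards [Ioc_mem_nhdsGT hz0] with y hy
  rw [Real.norm_of_nonneg (Real.rpow_nonneg hy.1.le _)]
  have h8 : Tendsto (fun s => ‖u y - u s‖) (𝓝[>] 0) (𝓝 ‖u y - 0‖) := (tendsto_const_nhds.sub h0).norm
  rw [sub_zero] at h8
  refine le_of_tendsto h8 ?_
  filter_upwards [Ioc_mem_nhdsGT hy.1] with s hs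
  refine (abs_sub_le_of_abs_deriv_le_rpow (f' := deriv u) hr0.ne' hs.1 hs.2
    (fun t ht => hu.hasDerivAt_Ioi (hs.1.trans_le ht.1))
    fun t ht => hub t ⟨hs.1.trans_le ht.1, ht.2.trans hy.2⟩).trans ?_
  have : 0 ≤ K := by positivity
  have h9 : 0 ≤ s ^ r := Real.rpow_nonneg hs.1.le _
  gcongr
  linarith

variable {n : ℕ} {D : HalfCoord n → ℝ}

/-- Slices that are bounded in `L²` and converge to zero pointwise converge weakly to zero. -/
theorem tendsto_testInt_zero (hD : SmoothHalf D) (hgr : ModerateGrowth D)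
    (h0 : ∀ x, Tendsto (fun y => D (x, y)) (𝓝[>] 0) (𝓝 0)) {g : Bdry n → ℝ} (hg : IsTest g) :
    Tendsto (testInt D g) (𝓝[>] 0) (𝓝 0) := by
  set m : ℝ → Bdry n → ℝ := fun y x => D (x, y) / (1 + |D (x, y)|) * g x with hm
  have hpos : ∀ x y, 0 < 1 + |D (x, y)| := fun x y => by positivity
  have hmg : ∀ y x, |m y x| ≤ |g x| := fun y x => by
    rw [hm, abs_mul, abs_div, abs_of_pos (hpos x y)]
    refine mul_le_of_le_one_left (abs_nonneg _) ((div_le_one (hpos x y)).2 (by linarith))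
  have hmc : ∀ y, 0 < y → Continuous (m y) := fun y hy => by
    have hc := (hD.slice_contDiff hy).continuous
    exact (hc.div (hc.abs.const_add 1) fun x => (hpos x y).ne').mul hg.smooth.continuous
  have hm0 : ∀ x, Tendsto (fun y => m y x) (𝓝[>] 0) (𝓝 0) := fun x => by
    have h1 := ((h0 x).div ((h0 x).abs.const_add 1) (by simp)).mul_const (g x)
    simpa using h1
  have hev : ∀ᶠ y : ℝ in 𝓝[>] 0, 0 < y := self_mem_nhdsWithin
  have hmL : ∀ y, 0 < y → MemLp (m y) 2 volume := fun y hy =>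
    hg.memLp.mono (hmc y hy).aestronglyMeasurable (.of_forall fun x => hmg y x)
  have hgi : Integrable g := hg.smooth.continuous.integrable_of_hasCompactSupport hg.supp
  have t1 : Tendsto (fun y => ∫ x, m y x) (𝓝[>] 0) (𝓝 0) := by
    have := tendsto_integral_filter_of_dominated_convergence (μ := volume) (l := 𝓝[>] (0 : ℝ)) (F := m) (f := fun _ => 0)
      (fun x => |g x|) (hev.mono fun y hy => (hmc y hy).aestronglyMeasurable)
      (.of_forall fun y => .of_forall fun x => hmg y x) hgi.abs
      (.of_forall hm0)
    simpa using this
  have t2 : Tendsto (fun y => (eLpNorm (m y) 2 volume).toReal) (𝓝[>] 0) (𝓝 0) := by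
    have h1 : Tendsto (fun y => ∫ x, ‖m y x‖ ^ (2 : ℝ)) (𝓝[>] 0) (𝓝 0) := by
      have := tendsto_integral_filter_of_dominated_convergence (μ := volume) (l := 𝓝[>] (0 : ℝ))
        (F := fun y x => ‖m y x‖ ^ (2 : ℝ)) (f := fun _ => 0)
        (fun x => ‖g x‖ ^ (2 : ℝ)) (hev.mono fun y hy => by
          exact ((hmc y hy).norm.rpow_const fun _ => Or.inr (by norm_num)).aestronglyMeasurable)
        (.of_forall fun y => .of_forall fun x => by
          rw [Real.norm_of_nonneg (by positivity)]
          exact Real.rpow_le_rpow (norm_nonneg _) (hmg y x) (by norm_num))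
        (by simpa using hg.memLp.integrable_norm_rpow two_ne_zero ENNReal.ofNat_ne_top)
        (.of_forall fun x => by
          have := ((hm0 x).norm).rpow_const (p := 2) (Or.inr (by norm_num))
          simpa using this)
      simpa using this
    have h2 := h1.rpow_const (p := 2⁻¹) (Or.inr (by norm_num))
    rw [Real.zero_rpow (by norm_num)] at h2
    refine h2.congr' (hev.mono fun y hy => ?_)
    simp only
    rw [(hmL y hy).eLpNorm_eq_integral_rpow_norm two_ne_zero ENNReal.ofNat_ne_top,
      ENNReal.toReal_ofReal (by positivity)]
    simp
  obtain ⟨C, N, hC0, hC⟩ := hgr.exists_toReal_le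
  have t3 : Tendsto (fun y => ∫ x, |D (x, y)| * m y x) (𝓝[>] 0) (𝓝 0) := by
    have h1 := t2.const_mul (C * (1 + 1) ^ N)
    rw [mul_zero] at h1
    refine squeeze_zero_norm' ?_ h1
    filter_upwards [Ioc_mem_nhdsGT (zero_lt_one' ℝ)] with y hy
    refine (abs_integral_mul_le (hC y hy.1).1.abs (hmL y hy.1)).trans ?_
    refine mul_le_mul_of_nonneg_right ?_ ENNReal.toReal_nonneg
    rw [eLpNorm_congr_norm_ae (f := |fun x => D (x, y)|) (g := fun x => D (x, y))
      (.of_forall fun x => norm_abs_eq_norm _)]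
    have h3 := hy.1.le
    refine (hC y hy.1).2.trans ?_
    gcongr
    exact hy.2
  have t4 := t1.add t3
  rw [add_zero] at t4
  refine t4.congr' (hev.mono fun y hy => ?_)
  have hi : Integrable fun x => |D (x, y)| * m y x :=
    ((hD.slice_contDiff hy).continuous.abs.mul (hmc y hy)).integrable_of_hasCompactSupport hg.supp.mul_left.mul_left
  rw [← integral_add ((hmc y hy).integrable_of_hasCompactSupport hg.supp.mul_left) hi]
  refine integral_congr_ae (.of_forall fun x => ?_)
  have := (hpos x y).ne'
  simp only [hm]
  field_simp

/-- Uniqueness for the Poisson problem. -/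
theorem eq_of_isPoissonSolution (hn : 1 ≤ n) {f : Bdry n → ℝ} {σ : ℝ} (hσ : 0 < σ) (hσN : ∀ N : ℕ, σ ≠ N)
    {P P' : HalfCoord n → ℝ} (hP : IsPoissonSolution σ f P) (hP' : IsPoissonSolution σ f P') (x : Bdry n) {y : ℝ}
    (hy : 0 < y) : P' (x, y) = P (x, y) := by
  set s := -(((n : ℝ) - 2 * σ) / 2)
  set A : HalfCoord n → ℝ := fun p => p.2 ^ s * P p with hA
  set A' : HalfCoord n → ℝ := fun p => p.2 ^ s * P' p with hA'
  have hAs : SmoothHalf A := smoothHalf_of_isPoissonSolution hP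
  have hAs' : SmoothHalf A' := smoothHalf_of_isPoissonSolution hP'
  set W : HalfCoord n → ℝ := A' + fun p => (-1) * A p with hW
  have hWs : SmoothHalf W := hAs'.add (hAs.const_mul (-1))
  have hWg : ModerateGrowth W := hP'.growth.add (hP.growth.const_mul (-1))
  have hWk : ∀ p ∈ upperHalf n, weightedLaplacian (1 - 2 * σ) W p = 0 := fun p hp => by
    have e1 : weightedLaplacian (1 - 2 * σ) A p = 0 := weightedLaplacian_of_isPoissonSolution hP p hp
    have e2 : weightedLaplacian (1 - 2 * σ) A' p = 0 := weightedLaplacian_of_isPoissonSolution hP' p hp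
    rw [weightedLaplacian_eq_gen] at e1 e2 ⊢
    rw [tangentialOp_lap.gen_add _ hAs' (hAs.const_mul (-1)) hp, Pi.add_apply,
      tangentialOp_lap.gen_const_mul _ (-1) hAs hp, e2]
    simp only [e1]
    simp
  have hW0 : ∀ x, Tendsto (fun y => W (x, y)) (𝓝[>] 0) (𝓝 0) := fun x => by
    have := (hP'.boundary x).add ((hP.boundary x).const_mul (-1))
    rwa [show f x + -1 * f x = 0 by ring] at this
  have hbe : ∀ g, IsTest g → EqOn (besselOp (1 - 2 * σ) (testInt W g)) (testInt W (negLap g)) (Ioi 0) :=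
    fun g hg y hy => by
      have h1 := seqOp_testInt hWs hg (μ := σ) hy
      have h2 : testInt (weightedLaplacian (1 - 2 * σ) W) g y = 0 := by
        rw [testInt_congr (D' := 0) hWk g hy]
        simp [testInt]
      rw [h2] at h1
      exact sub_eq_zero.1 h1
  have hb : ∀ j : ℕ, j ≤ ⌊σ⌋₊ → ∀ g, IsTest g →
      testInt W g =O[𝓝[>] 0] fun y : ℝ => y ^ min (2 * σ) (2 * (j : ℝ) + 2) := by
    intro j
    induction j with
    | zero =>
      intro _ g hg
      have h1 := (tendsto_testInt_zero hWs hWg hW0 hg.negLap).isBigO_one ℝ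
      have h2 := isBigO_of_besselOp_isBigO (contDiffOn_testInt hWs hg) hσ le_rfl
        (fun h => hσN 1 (by push_cast; linarith)) (tendsto_testInt_zero hWs hWg hW0 hg)
        ((h1.congr' (eventually_of_mem self_mem_nhdsWithin fun y hy => (hbe g hg hy).symm)
          (.of_forall fun y => (Real.rpow_zero y).symm)))
      simpa using h2
    | succ j ih =>
      intro hj g hg
      have h1 := ih (by omega) _ hg.negLap
      have h3 : ((j + 1 : ℕ) : ℝ) ≤ σ := (Nat.cast_le.2 hj).trans (Nat.floor_le hσ.le)
      rw [min_eq_right (by push_cast at h3; linarith)] at h1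
      have h2 := isBigO_of_besselOp_isBigO (contDiffOn_testInt hWs hg) hσ (by positivity)
        (fun h => hσN (j + 2) (by push_cast; linarith)) (tendsto_testInt_zero hWs hWg hW0 hg)
        (h1.congr' (eventually_of_mem self_mem_nhdsWithin fun y hy => (hbe g hg hy).symm) EventuallyEq.rfl)
      push_cast
      rwa [mul_add, mul_one]
  have hfl : σ = ⌊σ⌋₊ + Int.fract σ := eq_floor_add_fract hσ
  have hz := eq_zero_of_weak_vanishing hn hWs hWg (fract_pos_of_ne hσ hσN) (Int.fract_lt_one σ) ⌊σ⌋₊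
    (fun p hp => by
      have h1 := tangentialOp_lap.iter_pow_mul_eq_zero (fract_pos_of_ne hσ hσN)
        (Int.fract_lt_one σ) ⌊σ⌋₊ 0 W (Nat.zero_le _) hWs (fun q hq => by
          rw [← weightedLaplacian_eq_gen, show 1 - 2 * Int.fract σ - 2 * ((⌊σ⌋₊ : ℝ) - 2 * (0 : ℕ)) = 1 - 2 * σ by
            push_cast; linarith]
          exact hWk q hq) p hp
      simp only [mul_zero, pow_zero, one_mul] at h1
      exact h1) (ρ := 2 * σ) (by linarith) fun g hg => by
        have h2 := hb _ le_rfl g hg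
        rwa [min_eq_left (by linarith [Nat.lt_floor_add_one σ])] at h2
  have h1 := hz (x, y) (mem_upperHalf.2 hy)
  have h2 : y ^ s * (P' (x, y) - P (x, y)) = 0 := by
    simp only [hW, hA, hA', Pi.add_apply] at h1
    linarith
  exact sub_eq_zero.1 ((mul_eq_zero.1 h2).resolve_left (Real.rpow_pos_of_pos hy s).ne')

end

section

variable {n : ℕ} {γ : ℝ}

/-- The even boundary operators determine the limits that enter their definition. -/
theorem limUnder_eq_of_evenBdryOp_eq {U V : HalfCoord n → ℝ} {p : ℕ}
    (h : ∀ j ≤ p, evenBdryOp γ U j = evenBdryOp γ V j) {j : ℕ} (hj : j ≤ p) (x : Bdry n) :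
    limUnder (𝓝[>] (0 : ℝ)) (fun y => (normalOp (weightExp γ))^[j] U (x, y))
      = limUnder (𝓝[>] (0 : ℝ)) (fun y => (normalOp (weightExp γ))^[j] V (x, y)) := by
  have e := congrFun (h j hj) x
  rw [evenBdryOp.eq_def γ U j, evenBdryOp.eq_def γ V j] at e
  simp only [fun i : Fin j => h (j - (i.1 + 1)) (by omega)] at e
  exact mul_left_cancel₀ (pow_ne_zero j (by norm_num)) (sub_left_injective e)

theorem limUnder_eq_of_oddBdryOp_eq {U V : HalfCoord n → ℝ} {p : ℕ}
    (h : ∀ j < p, oddBdryOp γ U j = oddBdryOp γ V j) {j : ℕ} (hj : j < p) (x : Bdry n) :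
    limUnder (𝓝[>] (0 : ℝ)) (fun y => y ^ weightExp γ * partialY ((normalOp (weightExp γ))^[j] U) (x, y))
      = limUnder (𝓝[>] (0 : ℝ)) (fun y => y ^ weightExp γ * partialY ((normalOp (weightExp γ))^[j] V) (x, y)) := by
  have e := congrFun (h j hj) x
  rw [oddBdryOp.eq_def γ U j, oddBdryOp.eq_def γ V j] at e
  simp only [fun i : Fin j => h (j - (i.1 + 1)) (by omega)] at e
  exact mul_left_cancel₀ (pow_ne_zero (j + 1) (by norm_num)) (sub_left_injective e)

theorem IsSmoothEven.contDiffOn_slice {F : HalfCoord n → ℝ} (hF : IsSmoothEven F) (x : Bdry n) :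
    ContDiffOn ℝ ∞ (fun y => F (x, y)) (Ici 0) :=
  hF.1.comp (contDiff_prodMk_right x).contDiffOn fun _ hy => ⟨mem_univ _, hy⟩

/-- Even functions with the same leading Taylor coefficients agree to high order. -/
theorem IsSmoothEven.exists_bound_sub {F F' : HalfCoord n → ℝ} (hF : IsSmoothEven F) (hF' : IsSmoothEven F')
    {K : Set (Bdry n)} (hK : IsCompact K) {p : ℕ}
    (h : ∀ x, ∀ j < p, iteratedDerivWithin (2 * j) (fun y => F (x, y)) (Ici 0) 0
      = iteratedDerivWithin (2 * j) (fun y => F' (x, y)) (Ici 0) 0) :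
    ∃ C, ∀ x ∈ K, ∀ y ∈ Icc (0 : ℝ) 1, |F (x, y) - F' (x, y)| ≤ C * y ^ (2 * p) := by
  refine exists_bound_of_iteratedDerivWithin_eq_zero hK (2 * p) (hF.1.sub hF'.1) fun x _ k hk => ?_
  have h1 := iteratedDerivWithin_sub (n := k) (f := fun y => F (x, y)) (g := fun y => F' (x, y))
    (mem_Ici.2 (le_refl (0 : ℝ))) (uniqueDiffOn_Ici 0)
    ((hF.contDiffOn_slice x 0 (mem_Ici.2 le_rfl)).of_le (by exact_mod_cast le_top))
    ((hF'.contDiffOn_slice x 0 (mem_Ici.2 le_rfl)).of_le (by exact_mod_cast le_top))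
  refine h1.trans (sub_eq_zero.2 ?_)
  rcases Nat.even_or_odd' k with ⟨j, rfl | rfl⟩
  · exact h x j (by omega)
  · rw [hF.2 x _ ⟨j, rfl⟩, hF'.2 x _ ⟨j, rfl⟩]

/-- Uniqueness for the Dirichlet problem. -/
theorem eq_of_isDirichletSolution (hn : 1 ≤ n) (hγ : 0 < γ) (hγN : ∀ N : ℕ, γ ≠ N) {f φ : ℕ → Bdry n → ℝ}
    {U V : HalfCoord n → ℝ} (hU : IsDirichletSolution γ f φ U) (hV : IsDirichletSolution γ f φ V) (x : Bdry n)
    {y : ℝ} (hy : 0 < y) : U (x, y) = V (x, y) := by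
  obtain ⟨F, G, hF, hG, hUe⟩ := hU.mem
  obtain ⟨F', G', hF', hG', hVe⟩ := hV.mem
  have h0 := fract_pos_of_ne hγ hγN
  have h1 := Int.fract_lt_one γ
  have hfl := eq_floor_add_fract hγ
  set μ := Int.fract γ
  set N := ⌊γ⌋₊
  have hexp : ∀ {F G U : HalfCoord n → ℝ}, IsSmoothEven F → IsSmoothEven G →
      (∀ x y, 0 < y → U (x, y) = F (x, y) + y ^ (2 * μ) * G (x, y)) → ∀ x J, HasExp μ J (fun y => U (x, y))
        (fun i => iteratedDerivWithin (2 * i) (fun y => F (x, y)) (Ici 0) 0 / ((2 * i).factorial : ℝ))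
        (fun i => iteratedDerivWithin (2 * i) (fun y => G (x, y)) (Ici 0) 0 / ((2 * i).factorial : ℝ)) :=
    fun hF hG h x J => (hF.evenExp x J).hasExp h0 (hG.evenExp x J) (h x)
  have hsm : ∀ {F G U : HalfCoord n → ℝ}, IsSmoothEven F → IsSmoothEven G →
      (∀ x y, 0 < y → U (x, y) = F (x, y) + y ^ (2 * μ) * G (x, y)) → SmoothHalf U := fun {F G U} hF hG h => by
    have hs : ∀ {F : HalfCoord n → ℝ}, IsSmoothEven F → SmoothHalf F := fun hF =>
      hF.1.mono fun p hp => ⟨mem_univ _, (mem_upperHalf.1 hp).le⟩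
    exact ((hs hF).add ((hs hG).mul_right (contDiffOn_rpow_Ioi (2 * μ)))).congr
      fun p hp => h p.1 p.2 (mem_upperHalf.1 hp)
  have hfac : ∀ j : ℕ, ((2 * j).factorial : ℝ) ≠ 0 := fun j => by positivity
  have hv : ∀ x, ∀ j < ⌊γ / 2⌋₊ + 1, iteratedDerivWithin (2 * j) (fun y => F (x, y)) (Ici 0) 0
      = iteratedDerivWithin (2 * j) (fun y => F' (x, y)) (Ici 0) 0 := fun x j hj => by
    have e := limUnder_eq_of_evenBdryOp_eq (γ := γ) (U := U) (V := V)
      (fun j hj => (hU.even_data j hj).trans (hV.even_data j hj).symm) (Nat.lt_succ_iff.1 hj) x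
    have t1 := ((hexp hF hG hUe x (0 + 1 + j)).tendsto_normalOp h0).limUnder_eq
    have t2 := ((hexp hF' hG' hVe x (0 + 1 + j)).tendsto_normalOp h0).limUnder_eq
    exact (div_left_inj' (hfac j)).1 (mul_left_cancel₀ (evenFactor_ne_zero h1 j) (t1.symm.trans (e.trans t2)))
  have hw : ∀ x, ∀ j < N - ⌊γ / 2⌋₊, iteratedDerivWithin (2 * j) (fun y => G (x, y)) (Ici 0) 0
      = iteratedDerivWithin (2 * j) (fun y => G' (x, y)) (Ici 0) 0 := fun x j hj => by
    have e := limUnder_eq_of_oddBdryOp_eq (γ := γ) (U := U) (V := V)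
      (fun j hj => (hU.odd_data j hj).trans (hV.odd_data j hj).symm) hj x
    have t1 := ((hexp hF hG hUe x (0 + 1 + j)).tendsto_partialY_normalOp h0 h1).limUnder_eq
    have t2 := ((hexp hF' hG' hVe x (0 + 1 + j)).tendsto_partialY_normalOp h0 h1).limUnder_eq
    exact (div_left_inj' (hfac j)).1 (mul_left_cancel₀ (oddFactor_ne_zero h0 j) (t1.symm.trans (e.trans t2)))
  have hUs := hsm hF hG hUe
  have hVs := hsm hF' hG' hVe
  set D : HalfCoord n → ℝ := U + fun p => (-1) * V p with hD
  have hDs : SmoothHalf D := hUs.add (hVs.const_mul (-1))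
  set ρ := min (2 * ((⌊γ / 2⌋₊ : ℝ) + 1)) (2 * μ + 2 * ((N - ⌊γ / 2⌋₊ : ℕ) : ℝ)) with hρ
  have hργ : N + μ < ρ := by
    refine lt_min ?_ ?_
    · have := Nat.lt_floor_add_one (γ / 2)
      linarith
    · have h2 : N ≤ 2 * (N - ⌊γ / 2⌋₊) := by
        rw [Nat.floor_div_ofNat]
        change N ≤ 2 * (N - N / 2)
        omega
      have h3 : (N : ℝ) ≤ 2 * ((N - ⌊γ / 2⌋₊ : ℕ) : ℝ) := by exact_mod_cast h2
      linarith
  have hz := eq_zero_of_weak_vanishing hn hDs (hU.growth.add (hV.growth.const_mul (-1))) h0 h1 N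
    (fun p hp => by
      have e1 : (weightedLaplacian (1 - 2 * μ))^[N + 1] U p = 0 := hU.eqn p.1 p.2 (mem_upperHalf.1 hp)
      have e2 : (weightedLaplacian (1 - 2 * μ))^[N + 1] V p = 0 := hV.eqn p.1 p.2 (mem_upperHalf.1 hp)
      rw [weightedLaplacian_eq_gen] at e1 e2 ⊢
      rw [tangentialOp_lap.iter_add _ _ hUs (hVs.const_mul (-1)) hp, Pi.add_apply, e1,
        tangentialOp_lap.iter_const_mul _ (-1) _ hVs hp]
      simp only [e2]
      simp) hργ fun g hg => by
    obtain ⟨C, hC⟩ := hF.exists_bound_sub hF' hg.supp.isCompact hv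
    obtain ⟨C', hC'⟩ := hG.exists_bound_sub hG' hg.supp.isCompact hw
    refine Asymptotics.IsBigO.of_bound (∫ x, (|C| + |C'|) * |g x|) ?_
    filter_upwards [Ioc_mem_nhdsGT (zero_lt_one' ℝ)] with y hy
    have hy0 := hy.1
    have hgi : Integrable g := hg.smooth.continuous.integrable_of_hasCompactSupport hg.supp
    rw [Real.norm_of_nonneg (Real.rpow_nonneg hy0.le ρ), ← integral_mul_const]
    refine norm_integral_le_of_norm_le ((hgi.abs.const_mul _).mul_const _) (.of_forall fun x => ?_)
    by_cases hx : x ∈ tsupport g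
    · rw [norm_mul, Real.norm_eq_abs, Real.norm_eq_abs, mul_right_comm]
      refine mul_le_mul_of_nonneg_right ?_ (abs_nonneg _)
      have a1 := hC x hx y ⟨hy0.le, hy.2⟩
      have a2 := hC' x hx y ⟨hy0.le, hy.2⟩
      have b1 : y ^ (2 * (⌊γ / 2⌋₊ + 1)) ≤ y ^ ρ := by
        rw [← Real.rpow_natCast]
        exact Real.rpow_le_rpow_of_exponent_ge hy0 hy.2 ((min_le_left _ _).trans_eq (by push_cast; ring))
      have b2 : y ^ (2 * μ) * y ^ (2 * (N - ⌊γ / 2⌋₊)) ≤ y ^ ρ := by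
        rw [← Real.rpow_natCast, ← Real.rpow_add hy0]
        exact Real.rpow_le_rpow_of_exponent_ge hy0 hy.2 ((min_le_right _ _).trans_eq (by push_cast; ring))
      have e : D (x, y) = (F (x, y) - F' (x, y)) + y ^ (2 * μ) * (G (x, y) - G' (x, y)) := by
        simp only [hD, Pi.add_apply, hUe x y hy0, hVe x y hy0]
        ring
      have hp : 0 < y ^ (2 * μ) := Real.rpow_pos_of_pos hy0 _
      rw [e]
      calc _ ≤ |F (x, y) - F' (x, y)| + y ^ (2 * μ) * |G (x, y) - G' (x, y)| := by
            refine (abs_add_le _ _).trans_eq ?_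
            rw [abs_mul, abs_of_pos hp]
        _ ≤ |C| * y ^ (2 * (⌊γ / 2⌋₊ + 1)) + y ^ (2 * μ) * (|C'| * y ^ (2 * (N - ⌊γ / 2⌋₊))) := by
            gcongr
            · exact a1.trans (by gcongr; exact le_abs_self C)
            · exact a2.trans (by gcongr; exact le_abs_self C')
        _ = |C| * y ^ (2 * (⌊γ / 2⌋₊ + 1)) + |C'| * (y ^ (2 * μ) * y ^ (2 * (N - ⌊γ / 2⌋₊))) := by ring
        _ ≤ |C| * y ^ ρ + |C'| * y ^ ρ := by gcongr
        _ = _ := by ring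
    · simp [image_eq_zero_of_notMem_tsupport hx]
  have h2 := hz (x, y) (mem_upperHalf.2 hy)
  simp only [hD, Pi.add_apply] at h2
  linarith

end

section

theorem MemHs.memLp {n : ℕ} {s : ℝ} {f : Bdry n → ℝ} (h : MemHs s f) : MemLp f 2 volume := by
  obtain ⟨h, -⟩ := h
  simpa using h.re

theorem mainTheorem7 (n : ℕ) (hn : 1 ≤ n) (γ : ℝ) (hγ : 0 < γ) (hγN : ∀ N : ℕ, γ ≠ N)
    (f φ : ℕ → Bdry n → ℝ)
    (hf : ∀ j : ℕ, j ≤ ⌊γ / 2⌋₊ → ContDiff ℝ ∞ (f j) ∧ MemHs (γ - 2 * (j : ℝ)) (f j))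
    (hφ : ∀ j : ℕ, j < ⌊γ⌋₊ - ⌊γ / 2⌋₊ →
      ContDiff ℝ ∞ (φ j) ∧ MemHs ((⌊γ⌋₊ : ℝ) - Int.fract γ - 2 * (j : ℝ)) (φ j)) :
    ∃ (P Q : ℕ → HalfCoord n → ℝ) (V : HalfCoord n → ℝ),
      (∀ j : ℕ, j ≤ ⌊γ / 2⌋₊ → IsPoissonExtension (γ - 2 * (j : ℝ)) (f j) (P j)) ∧
      (∀ j : ℕ, j < ⌊γ⌋₊ - ⌊γ / 2⌋₊ →
        IsPoissonExtension ((⌊γ⌋₊ : ℝ) - Int.fract γ - 2 * (j : ℝ)) (φ j) (Q j)) ∧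
      IsDirichletSolution γ f φ V ∧
      (∀ U : HalfCoord n → ℝ, IsDirichletSolution γ f φ U →
        ∀ (x : Bdry n) (y : ℝ), 0 < y → U (x, y) = V (x, y)) ∧
      ∀ (x : Bdry n) (y : ℝ), 0 < y →
        V (x, y) =
          ∑ j ∈ Finset.range (⌊γ / 2⌋₊ + 1),
            (-1 : ℝ) ^ j * (2 : ℝ) ^ (-(2 * (j : ℤ)))
              * (Real.Gamma (1 - Int.fract γ)
                / ((j.factorial : ℝ) * Real.Gamma (1 + j - Int.fract γ)))
              * (y ^ (-(((n : ℝ) - 2 * γ) / 2)) * P j (x, y))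
          + ∑ j ∈ Finset.range (⌊γ⌋₊ - ⌊γ / 2⌋₊),
            (-1 : ℝ) ^ (j + 1) * (2 : ℝ) ^ (-(2 * (j : ℤ)) - 1)
              * (Real.Gamma (Int.fract γ)
                / ((j.factorial : ℝ) * Real.Gamma (1 + j + Int.fract γ)))
              * (y ^ (-(((n : ℝ) - 2 * γ) / 2)) * Q j (x, y)) := by
  have hf' := fun j hj => And.intro (hf j hj).1 (hf j hj).2.memLp
  have hφ' := fun j hj => And.intro (hφ j hj).1 (hφ j hj).2.memLp
  have hV := isDirichletSolution_dirichletSol hγ hγN hf' hφ'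
  refine ⟨fun j p => p.2 ^ (((n : ℝ) - 2 * (γ - 2 * j)) / 2) * poissonInt (γ - 2 * j) (f j) p,
    fun j p => p.2 ^ (((n : ℝ) - 2 * (⌊γ⌋₊ - Int.fract γ - 2 * j)) / 2)
      * poissonInt (⌊γ⌋₊ - Int.fract γ - 2 * j) (φ j) p,
    dirichletSol γ f φ, fun j hj => ?_, fun j hj => ?_, hV,
    fun U hU x y hy => eq_of_isDirichletSolution hn hγ hγN hU hV x hy, fun x y hy => ?_⟩
  · obtain ⟨h1, h2⟩ := even_index_pos hγ hγN hj
    have hP := isPoissonSolution_poissonInt (hf' j hj).1 h1 h2 (hf' j hj).2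
    exact ⟨hP, fun P' hP' x y hy => eq_of_isPoissonSolution hn h1 h2 hP hP' x hy⟩
  · obtain ⟨h1, h2⟩ := odd_index_pos hγ hγN hj
    have hP := isPoissonSolution_poissonInt (hφ' j hj).1 h1 h2 (hφ' j hj).2
    exact ⟨hP, fun P' hP' x y hy => eq_of_isPoissonSolution hn h1 h2 hP hP' x hy⟩
  · have hfl := eq_floor_add_fract hγ
    rw [dirichletSol]
    refine congrArg₂ (· + ·) (Finset.sum_congr rfl fun j _ => ?_) (Finset.sum_congr rfl fun j _ => ?_)
    · rw [← mul_assoc (y ^ _) (y ^ _), ← Real.rpow_add hy, evenCoef]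
      congr 4
      ring
    · rw [← mul_assoc (y ^ _) (y ^ _), ← Real.rpow_add hy, oddCoef]
      congr 3
      linarith

end

end
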